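/- **Setting.** Let $\widetilde{\mathbb C}_\hbar$ be the real oriented blow-up of $\mathbb C$ at $0$ (pairs of a radius and a direction), with the topology generated by the open sectors $\{|\hbar|<\varepsilon,\ \theta_1<\arg\hbar<\theta_2\}$ (boundary points at $\hbar=0$ included). A *sectoroid* is an open subset $S\subset\widetilde{\mathbb C}_\hbar$; $\mathrm{Cone}(S)$ is the set of $b\in\mathbb C^*$ a positive multiple of which lies in $S$, and $S^\vee=\{a\in\mathbb C:\ \mathrm{Re}(a\bar b)\ge 0\ \ \forall b\in \mathrm{Cone}(S)\}$. Let $M$ be a (Hausdorff, finite-dimensional) complex manifold. On $M\times S$ consider the following sheaves of functions that are holomorphic off $\hbar=0$: - $\mathcal A$: functions having, locally uniformly, an asymptotic expansion $\sum_{j\ge0}a_j(x)\hbar^j$ with holomorphic coefficients $a_j$; - $\mathcal A^{\exp}$: $e^{-r/\hbar}f\in\mathcal A$ for some $r\in S^\vee$, locally; - $\mathcal A^{\mathrm{se}}\subset\mathcal A^{\exp}$: $e^{-c/\hbar}f\in\mathcal A$ for all $c\in S^\vee\setminus\{0\}$; - $\mathcal A^{\mathrm{ce}}\subset\mathcal A^{\exp}$: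 $f$ extends continuously to $\hbar=0$, with $f|_{\hbar=0}$ (locally) a holomorphic function of $x$ alone; - $F^{\le D}$, for a bounded open neighbourhood $D$ of $0\in\mathbb C$: $e^{r/\hbar}f\in\mathcal A$ for all $r\in D\cap S^\vee$. Put $\mathcal O^{\Lambda}_{M\times S}=\varprojlim_D \mathcal A^{\exp}/F^{\le D}$, and let $\mathcal O^{\mathrm{se},\Lambda_0}_{M\times S}$, $\mathcal O^{\mathrm{ce},\Lambda_0}_{M\times S}$ be the subsheaves of rings $\varprojlim_D\mathcal A^{\bullet}/(\mathcal A^\bullet\cap F^{\le D})$, $\bullet=\mathrm{se},\mathrm{ce}$ (quotients and limits are taken as sheaves). Write $\mathcal O^\Lambda_S$ for $\mathcal O^\Lambda_{\mathrm{pt}\times S}$. A *rank-one flat $\hbar$-connection valued in $\mathcal O^{\mathrm{ce},\Lambda_0}_{M\times S}$* is a locally free $\mathcal O^{\mathrm{ce},\Lambda_0}_{M\times S}$-module $\mathcal E$ of rank one with an operator $\nabla$ satisfying $\nabla(\psi s)=\hbar\,d\psi\otimes s+\psi\nabla s$ (where $d$ is the differential along $M$), given in local frames by one-forms with values in $\mathcal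 O^{\mathrm{ce},\Lambda_0}$, and with curvature zero. Its *characteristic variety* $\mathrm{Char}(\mathcal E)\subset T^*M$ consists of the values at $\hbar=0$ of its connection forms in local frames. For a holomorphic function $\alpha$, $\mathcal E^{\alpha/\hbar}$ is $\mathcal O^{\mathrm{se},\Lambda_0}$ with the $\hbar$-connection $\hbar\,d+d\alpha$. The function $\alpha$ is a *primitive* of $\mathrm{Char}(\mathcal E)$ on $U\subset M$ if every point of $\mathrm{Char}(\mathcal E)$ over $U$ lies on the graph of $d\alpha$. A $\mathcal D^{\mathrm{se},\Lambda_0}$-module isomorphism is an isomorphism of sheaves of $\mathcal O^{\mathrm{se},\Lambda_0}$-modules commuting with the $\hbar$-connections. **Theorem.** Let $(\mathcal E,\nabla)$ be a rank-one flat $\hbar$-connection valued in $\mathcal O^{\mathrm{ce},\Lambda_0}_{M\times S}$, let $U\subset M$ be open and simply connected (in particular connected and non-empty), let $x_0\in U$, and let $S'\subset S$ be open (for example $S'=S$). 1. For every initial condition $v$, that is, every section over $S'$ of the restriction of $\mathcal E$ to $\{x_0\}\times S$ with coefficients extended to $\mathcal O^\Lambda_S$ (a section of $\mathcal O^\Lambda_S$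 over $S'$ once a frame at $x_0$ is chosen), there is exactly one section $\psi$ of $\mathcal E\otimes_{\mathcal O^{\mathrm{ce},\Lambda_0}}\mathcal O^{\Lambda}$ over $U\times S'$ with $\nabla\psi=0$ and $\psi|_{x=x_0}=v$. 2. If $\alpha$ is a holomorphic function on $U$ that is a primitive of $\mathrm{Char}(\mathcal E)$ on $U$, and if the restriction of $\mathcal E$ to $\{x_0\}\times S'$ is free of rank one after extension of coefficients to $\mathcal O^{\mathrm{se},\Lambda_0}$ (which holds if $\mathcal E$ is free, and always for a small enough neighbourhood $S'$ of a given point of $S$), then over $U\times S'$ the $\mathcal D^{\mathrm{se},\Lambda_0}$-modules $\mathcal E\otimes_{\mathcal O^{\mathrm{ce},\Lambda_0}}\mathcal O^{\mathrm{se},\Lambda_0}$ and $\mathcal E^{\alpha/\hbar}$ are isomorphic. -/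

import Mathlib

open Set Filter Topology Metric
open scoped Manifold ContDiff
open TopologicalSpace (Opens)
set_option linter.unusedSectionVars false

namespace HbarConn

section Cauchy
theorem cauchy_fderiv_bound {G : Type*} [NormedAddCommGroup G] [NormedSpace ℂ G]
    {h : G → ℂ} {p : G} {ρ C : ℝ} (hρ : 0 < ρ) (hd : DifferentiableOn ℂ h (ball p ρ))
    (hC : ∀ y ∈ ball p ρ, ‖h y‖ ≤ C) : ‖fderiv ℂ h p‖ ≤ 2 * C / ρ := by
  have hC0 : 0 ≤ C := (norm_nonneg _).trans (hC p (mem_ball_self hρ))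
  refine ContinuousLinearMap.opNorm_le_bound _ (by positivity) fun w => ?_
  by_cases hw : w = 0
  · simp [hw]
  have hw' : 0 < ‖w‖ := norm_pos_iff.2 hw
  have hmem : ∀ ζ ∈ closedBall (0:ℂ) (ρ / (2 * ‖w‖)), p + ζ • w ∈ ball p ρ := by
    intro ζ hζ
    rw [mem_closedBall_zero_iff] at hζ
    rw [mem_ball, dist_eq_norm, add_sub_cancel_left, norm_smul]
    calc ‖ζ‖ * ‖w‖ ≤ ρ / (2 * ‖w‖) * ‖w‖ := by gcongr
      _ = ρ / 2 := by field_simp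
      _ < ρ := by linarith
  have hl : ∀ ζ : ℂ, HasDerivAt (fun ζ : ℂ => p + ζ • w) w ζ := fun ζ => by
    simpa using ((hasDerivAt_id ζ).smul_const w).const_add p
  have hdz : ∀ ζ ∈ closedBall (0:ℂ) (ρ / (2 * ‖w‖)),
      HasDerivAt (fun ζ : ℂ => h (p + ζ • w)) (fderiv ℂ h (p + ζ • w) w) ζ := fun ζ hζ =>
    ((hd.differentiableAt (isOpen_ball.mem_nhds (hmem ζ hζ))).hasFDerivAt).comp_hasDerivAt ζ (hl ζ)
  have hr : 0 < ρ / (2 * ‖w‖) := by positivity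
  have key := Complex.norm_deriv_le_of_forall_mem_sphere_norm_le (f := fun ζ : ℂ => h (p + ζ • w))
    (c := 0) (C := C) hr
    (DifferentiableOn.diffContOnCl_ball (U := closedBall 0 (ρ / (2 * ‖w‖)))
      (fun ζ hζ => (hdz ζ hζ).differentiableAt.differentiableWithinAt) subset_rfl)
    (fun ζ hζ => hC _ (hmem ζ (sphere_subset_closedBall hζ)))
  rw [(hdz 0 (mem_closedBall_self hr.le)).deriv] at key
  simp only [zero_smul, add_zero] at key
  refine key.trans (le_of_eq ?_)
  field_simp

theorem differentiableAt_fderiv_apply {G : Type*} [NormedAddCommGroup G] [NormedSpace ℂ G]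
    [FiniteDimensional ℂ G] {h : G → ℂ} {p₀ : G} (hd : ∀ᶠ p in 𝓝 p₀, DifferentiableAt ℂ h p)
    (w : G) : DifferentiableAt ℂ (fun p => fderiv ℂ h p w) p₀ := by
  have : ProperSpace G := FiniteDimensional.proper ℂ G
  borelize G
  obtain ⟨R, hR, hball⟩ := Metric.eventually_nhds_iff_ball.1 hd
  set ρ := R / 4 with hρdef
  have hρ : 0 < ρ := by positivity
  have hdo : ∀ p ∈ closedBall p₀ (3 * ρ), DifferentiableAt ℂ h p := fun p hp =>
    hball p (closedBall_subset_ball (by linarith) hp)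
  obtain ⟨C, hC⟩ := (isCompact_closedBall p₀ (3 * ρ)).exists_bound_of_continuousOn
    (fun p hp => (hdo p hp).continuousAt.continuousWithinAt)
  have hfd : ∀ p ∈ ball p₀ (2 * ρ), ‖fderiv ℂ h p‖ ≤ 2 * C / ρ := by
    intro p hp
    have hsub : ball p ρ ⊆ closedBall p₀ (3 * ρ) :=
      (ball_subset_ball' (by rw [mem_ball] at hp; linarith)).trans ball_subset_closedBall
    exact cauchy_fderiv_bound hρ
      (fun y hy => (hdo y (hsub hy)).differentiableWithinAt) fun y hy => hC y (hsub hy)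
  set r : ℝ := ρ / (‖w‖ + 1) with hrdef
  have hr : 0 < r := by positivity
  have hrw : r * ‖w‖ < ρ := by
    rw [hrdef, div_mul_eq_mul_div, div_lt_iff₀ (by positivity)]
    nlinarith
  have hmem : ∀ p ∈ ball p₀ ρ, ∀ ζ ∈ closedBall (0:ℂ) r, p + ζ • w ∈ ball p₀ (2 * ρ) := by
    intro p hp ζ hζ
    rw [mem_closedBall_zero_iff] at hζ
    rw [mem_ball, dist_eq_norm] at hp ⊢
    calc ‖p + ζ • w - p₀‖ = ‖(p - p₀) + ζ • w‖ := by congr 1; abel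
      _ ≤ ‖p - p₀‖ + ‖ζ‖ * ‖w‖ := by rw [← norm_smul]; exact norm_add_le _ _
      _ ≤ ‖p - p₀‖ + r * ‖w‖ := by gcongr
      _ < 2 * ρ := by linarith
  have hsub2 : ball p₀ (2 * ρ) ⊆ closedBall p₀ (3 * ρ) :=
    (ball_subset_ball (by linarith)).trans ball_subset_closedBall
  have hform : ∀ p ∈ ball p₀ ρ, fderiv ℂ h p w =
      Complex.cderiv r (fun ζ : ℂ => h (p + ζ • w)) 0 := by
    intro p hp
    have hl : ∀ ζ : ℂ, HasDerivAt (fun ζ : ℂ => p + ζ • w) w ζ := fun ζ => by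
      simpa using ((hasDerivAt_id ζ).smul_const w).const_add p
    have hO : IsOpen {ζ : ℂ | p + ζ • w ∈ ball p₀ (2 * ρ)} :=
      isOpen_ball.preimage (by fun_prop)
    have hdz : ∀ ζ ∈ {ζ : ℂ | p + ζ • w ∈ ball p₀ (2 * ρ)},
        HasDerivAt (fun ζ : ℂ => h (p + ζ • w)) (fderiv ℂ h (p + ζ • w) w) ζ := fun ζ hζ =>
      (hdo _ (hsub2 hζ)).hasFDerivAt.comp_hasDerivAt ζ (hl ζ)
    rw [Complex.cderiv_eq_deriv hO
      (fun ζ hζ => (hdz ζ hζ).differentiableAt.differentiableWithinAt) hr (fun ζ hζ => hmem p hp ζ hζ),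
      (hdz 0 (hmem p hp 0 (mem_closedBall_self hr.le))).deriv]
    simp
  have hev : (fun p => fderiv ℂ h p w) =ᶠ[𝓝 p₀]
      fun p => Complex.cderiv r (fun ζ : ℂ => h (p + ζ • w)) 0 := by
    filter_upwards [ball_mem_nhds p₀ hρ] with p hp using hform p hp
  refine DifferentiableAt.congr_of_eventuallyEq ?_ hev
  simp only [Complex.cderiv, circleIntegral]
  have hcm : ∀ θ : ℝ, circleMap 0 r θ ∈ closedBall (0:ℂ) r := fun θ =>
    circleMap_mem_closedBall 0 hr.le θ
  set c : ℝ → ℂ := fun θ => deriv (circleMap 0 r) θ * ((circleMap 0 r θ - 0) ^ 2)⁻¹ with hc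
  have hcc : Continuous c := by
    have h1 : ∀ θ : ℝ, (circleMap 0 r θ - 0) ^ 2 ≠ 0 := fun θ => by
      simp [hr.ne']
    refine Continuous.mul ?_ (Continuous.inv₀ (by fun_prop) h1)
    have h2 : deriv (circleMap 0 r) = fun θ => circleMap 0 r θ * Complex.I := by
      funext θ; simp [deriv_circleMap]
    rw [h2]
    fun_prop
  have hcw : ∀ p ∈ ball p₀ ρ, Continuous fun θ => c θ * h (p + circleMap 0 r θ • w) := by
    intro p hp
    refine hcc.mul (continuous_iff_continuousAt.2 fun θ => ?_)
    exact ContinuousAt.comp (f := fun θ => p + circleMap 0 r θ • w) (g := h)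
      (hdo _ (hsub2 (hmem p hp _ (hcm θ)))).continuousAt (by fun_prop)
  have := intervalIntegral.hasFDerivAt_integral_of_dominated_of_fderiv_le (𝕜 := ℂ)
    (μ := MeasureTheory.volume) (a := 0) (b := 2 * Real.pi)
    (F := fun p θ => c θ * h (p + circleMap 0 r θ • w))
    (F' := fun p θ => c θ • fderiv ℂ h (p + circleMap 0 r θ • w))
    (bound := fun θ => ‖c θ‖ * (2 * C / ρ)) (x₀ := p₀) (s := ball p₀ ρ)
    (ball_mem_nhds p₀ hρ)
    (by filter_upwards [ball_mem_nhds p₀ hρ] with p hp using (hcw p hp).aestronglyMeasurable)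
    ((hcw p₀ (mem_ball_self hρ)).intervalIntegrable _ _)
    (by
      have : SecondCountableTopology (G →L[ℂ] ℂ) := by
        have : ProperSpace (G →L[ℂ] ℂ) := FiniteDimensional.proper ℂ _
        infer_instance
      have hm : Measurable (fderiv ℂ h) := measurable_fderiv ℂ h
      have hm2 : Measurable fun θ : ℝ => fderiv ℂ h (p₀ + circleMap 0 r θ • w) :=
        hm.comp (Continuous.measurable (by fun_prop))
      exact (hcc.aestronglyMeasurable).smul hm2.aestronglyMeasurable)
    (Eventually.of_forall fun θ _ p hp => by
      rw [norm_smul]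
      gcongr
      exact hfd _ (hmem p hp _ (hcm θ)))
    ((by fun_prop : Continuous fun θ => ‖c θ‖ * (2 * C / ρ)).intervalIntegrable _ _)
    (Eventually.of_forall fun θ _ p hp => by
      have h1 := (hdo _ (hsub2 (hmem p hp _ (hcm θ)))).hasFDerivAt
      have h2 : HasFDerivAt (fun p => h (p + circleMap 0 r θ • w))
          (fderiv ℂ h (p + circleMap 0 r θ • w)) p := by
        exact h1.comp p ((hasFDerivAt_id p).add_const (circleMap 0 r θ • w))
      exact h2.const_mul (c θ))
  have h3 := this.differentiableAt.const_mul ((2 * Real.pi * Complex.I : ℂ)⁻¹)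
  refine h3.congr_of_eventuallyEq (Eventually.of_forall fun p => ?_)
  simp only [hc, smul_eq_mul, mul_assoc]

theorem differentiableAt_fderiv {G : Type*} [NormedAddCommGroup G] [NormedSpace ℂ G]
    [FiniteDimensional ℂ G] {h : G → ℂ} {p₀ : G} (hd : ∀ᶠ p in 𝓝 p₀, DifferentiableAt ℂ h p) :
    DifferentiableAt ℂ (fderiv ℂ h) p₀ := by
  have := fun w => differentiableAt_fderiv_apply hd w
  let b := Module.finBasis ℂ G
  have hrep : fderiv ℂ h = fun p => ∑ i, (fderiv ℂ h p (b i)) •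
      (LinearMap.toContinuousLinearMap (b.coord i)) := by
    funext p
    ext w
    conv_lhs => rw [← b.sum_repr w]
    rw [map_sum]
    simp [mul_comm]
  rw [hrep]
  exact DifferentiableAt.fun_sum fun i _ => (this (b i)).smul_const _

end Cauchy

section Blowup

/-- The real oriented blow-up of `ℂ` at `0`: points are pairs of a radius and a direction `u`, with
`z` the underlying complex number. Over `z = 0` all directions `u` occur. -/
structure RealBlowup where
  z : ℂ
  u : Circle
  polar : z = (‖z‖ : ℂ) * (u : ℂ)

/-- Open sectors `{|ħ| < ε, θ₁ < arg ħ < θ₂}`, boundary points at `ħ = 0` included. -/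
def IsOpenSector (T : Set RealBlowup) : Prop :=
  ∃ a b ε : ℝ, a < b ∧ 0 < ε ∧ T = {p | ‖p.z‖ < ε ∧ ∃ t ∈ Ioo a b, p.u = Circle.exp t}

/-- The topology generated by the open sectors; its open sets are the sectoroids. -/
instance : TopologicalSpace RealBlowup := TopologicalSpace.generateFrom {T | IsOpenSector T}

/-- The nonzero `ħ` of which some positive multiple lies in `S`. -/
def cone (S : Set RealBlowup) : Set ℂ :=
  {h | ∃ r : ℝ, 0 < r ∧ ∃ s ∈ S, s.z ≠ 0 ∧ (r : ℂ) * h = s.z}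

/-- The polar dual `{a | Re (a * conj b) ≥ 0 for all b in the cone of S}`. -/
def polarDual (S : Set RealBlowup) : Set ℂ :=
  {a | ∀ b ∈ cone S, 0 ≤ (a * (starRingEnd ℂ) b).re}

theorem RealBlowup.exists_nhd {O : Set RealBlowup} (hO : IsOpen O) {s : RealBlowup} (hs : s ∈ O) :
    ∃ ε η : ℝ, ‖s.z‖ < ε ∧ 0 < η ∧
      ∀ s' : RealBlowup, ‖s'.z‖ < ε → dist s'.u s.u < η → s' ∈ O := by
  induction hO generalizing s with
  | basic T hT =>
    obtain ⟨a, b, ε, -, -, rfl⟩ := hT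
    obtain ⟨h1, t, ht, hu⟩ := hs
    have hop : IsOpen (Circle.exp '' Ioo a b) := isLocalHomeomorph_circleExp.isOpenMap _ isOpen_Ioo
    obtain ⟨η, hη, hsub⟩ := Metric.isOpen_iff.1 hop s.u ⟨t, ht, hu.symm⟩
    refine ⟨ε, η, h1, hη, fun s' h2 h3 => ⟨h2, ?_⟩⟩
    obtain ⟨t', ht', h'⟩ := hsub h3
    exact ⟨t', ht', h'.symm⟩
  | univ => exact ⟨‖s.z‖ + 1, 1, by linarith, one_pos, fun _ _ _ => mem_univ _⟩
  | inter A B _ _ hA hB =>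
    obtain ⟨ε, η, h1, h2, h3⟩ := hA hs.1
    obtain ⟨ε', η', h1', h2', h3'⟩ := hB hs.2
    exact ⟨min ε ε', min η η', lt_min h1 h1', lt_min h2 h2', fun s' k1 k2 =>
      ⟨h3 s' (k1.trans_le (min_le_left _ _)) (k2.trans_le (min_le_left _ _)),
        h3' s' (k1.trans_le (min_le_right _ _)) (k2.trans_le (min_le_right _ _))⟩⟩
  | sUnion 𝒮 _ h =>
    obtain ⟨A, hA, hsA⟩ := hs
    obtain ⟨ε, η, h1, h2, h3⟩ := h A hA hsA
    exact ⟨ε, η, h1, h2, fun s' k1 k2 => ⟨A, hA, h3 s' k1 k2⟩⟩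

theorem RealBlowup.isOpen_lt (ε : ℝ) : IsOpen {s : RealBlowup | ‖s.z‖ < ε} := by
  rcases le_or_gt ε 0 with h | h
  · convert isOpen_empty
    ext s
    simp only [mem_ofPred_eq, mem_empty_iff_false, iff_false, not_lt]
    exact h.trans (norm_nonneg _)
  · refine TopologicalSpace.isOpen_generateFrom_of_mem ⟨-4, 4, ε, by norm_num, h, ?_⟩
    ext s
    simp only [mem_ofPred_eq, iff_self_and]
    intro _
    refine ⟨Complex.arg s.u, ⟨?_, ?_⟩, (Circle.exp_arg s.u).symm⟩
    · linarith [Complex.neg_pi_lt_arg (s.u : ℂ), Real.pi_lt_four]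
    · linarith [Complex.arg_le_pi (s.u : ℂ), Real.pi_lt_four]

theorem RealBlowup.continuous_u : Continuous RealBlowup.u := by
  rw [continuous_def]
  intro O hO
  rw [isOpen_iff_mem_nhds]
  intro s hs
  obtain ⟨t, ht⟩ : ∃ t, Circle.exp t = s.u := ⟨_, Circle.exp_arg s.u⟩
  have hpre : Circle.exp ⁻¹' O ∈ 𝓝 t :=
    (hO.preimage Circle.exp.continuous).mem_nhds (by simpa [ht] using hs)
  obtain ⟨δ, hδ, hsub⟩ := Metric.mem_nhds_iff.1 hpre
  have hopen : IsOpen {p : RealBlowup | ‖p.z‖ < ‖s.z‖ + 1 ∧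
      ∃ t' ∈ Ioo (t - δ) (t + δ), p.u = Circle.exp t'} :=
    TopologicalSpace.isOpen_generateFrom_of_mem
      ⟨t - δ, t + δ, ‖s.z‖ + 1, by linarith, by positivity, rfl⟩
  refine mem_of_superset (hopen.mem_nhds ⟨by linarith, t, ⟨by linarith, by linarith⟩, ht.symm⟩) ?_
  rintro p ⟨-, t', ht', hp⟩
  have : t' ∈ ball t δ := by rwa [Real.ball_eq_Ioo]
  have := hsub this
  simpa [hp] using this

theorem exists_circle_eq {z : ℂ} (hz : z ≠ 0) : ∃ w : Circle, (w : ℂ) = z / (‖z‖ : ℂ) := by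
  refine ⟨Circle.exp (Complex.arg z), ?_⟩
  have h := Complex.norm_mul_exp_arg_mul_I z
  have hn : (‖z‖ : ℂ) ≠ 0 := by simpa using hz
  rw [eq_div_iff hn]
  rw [Circle.coe_exp, mul_comm, h]

theorem RealBlowup.exists_lift {O : Set RealBlowup} (hO : IsOpen O) {s : RealBlowup} (hs : s ∈ O)
    (hz : s.z ≠ 0) : ∀ᶠ z in 𝓝 s.z, z ≠ 0 ∧ ∃ s' ∈ O, s'.z = z := by
  obtain ⟨ε, η, h1, h2, h3⟩ := RealBlowup.exists_nhd hO hs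
  have hu : (s.u : ℂ) = s.z / ‖s.z‖ := by
    have := s.polar
    rw [eq_div_iff (by simpa using hz)]
    rw [mul_comm]; exact this.symm
  have hc : ContinuousAt (fun z : ℂ => z / (‖z‖ : ℂ)) s.z :=
    continuousAt_id.div (by fun_prop) (by simpa using hz)
  have e1 : ∀ᶠ z in 𝓝 s.z, dist (z / (‖z‖ : ℂ)) (s.z / ‖s.z‖) < η :=
    hc.eventually (ball_mem_nhds _ h2)
  have e2 : ∀ᶠ z : ℂ in 𝓝 s.z, ‖z‖ < ε := continuous_norm.continuousAt.eventually (gt_mem_nhds h1)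
  filter_upwards [e1, e2, isOpen_ne.mem_nhds hz] with z k1 k2 k3
  have k3 : z ≠ 0 := k3
  obtain ⟨w, hw⟩ := exists_circle_eq k3
  refine ⟨k3, ⟨z, w, ?_⟩, h3 _ k2 ?_, rfl⟩
  · have : (‖z‖ : ℂ) ≠ 0 := by simpa using k3
    rw [hw]
    field_simp
  · change dist (w : ℂ) (s.u : ℂ) < η
    rwa [hw, hu]

theorem cone_of_mem {S : Set RealBlowup} (hS : IsOpen S) {s : RealBlowup} (hs : s ∈ S) :
    ∃ η : ℝ, 0 < η ∧ ∀ b : ℂ, dist b (s.u : ℂ) < η → b ∈ cone S := by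
  obtain ⟨ε, η, h1, h2, h3⟩ := RealBlowup.exists_nhd hS hs
  have hε : 0 < ε := (norm_nonneg _).trans_lt h1
  have hs0 : (s.u : ℂ) ≠ 0 := Circle.coe_ne_zero _
  have hc : ContinuousAt (fun z : ℂ => z / (‖z‖ : ℂ)) (s.u : ℂ) :=
    continuousAt_id.div (by fun_prop) (by simp)
  have e1 : ∀ᶠ z in 𝓝 (s.u : ℂ), dist (z / (‖z‖ : ℂ)) (s.u : ℂ) < η := by
    have := hc.eventually (ball_mem_nhds _ h2)
    simp only [Circle.norm_coe, Complex.ofReal_one, div_one] at this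
    exact this
  obtain ⟨η', hη', hb⟩ := Metric.eventually_nhds_iff.1 (e1.and (isOpen_ne.mem_nhds hs0))
  refine ⟨η', hη', fun b hbd => ?_⟩
  obtain ⟨k1, k2⟩ := hb hbd
  have k2 : b ≠ 0 := k2
  have hbn : (‖b‖ : ℂ) ≠ 0 := by simpa using k2
  have hn : ‖b / (‖b‖ : ℂ)‖ = 1 := by rw [norm_div]; simp [k2]
  have hbp : 0 < ‖b‖ := norm_pos_iff.2 k2
  have hnorm : ‖((ε / 2 : ℝ) : ℂ) * (b / (‖b‖ : ℂ))‖ = ε / 2 := by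
    rw [norm_mul, hn, mul_one, Complex.norm_real, Real.norm_of_nonneg (by positivity)]
  obtain ⟨w, hw⟩ := exists_circle_eq k2
  refine ⟨ε / 2 / ‖b‖, by positivity, ⟨((ε / 2 : ℝ) : ℂ) * (b / (‖b‖ : ℂ)),
    w, by rw [hnorm, hw]⟩, h3 _ ?_ ?_, ?_, ?_⟩
  · change ‖((ε / 2 : ℝ) : ℂ) * (b / (‖b‖ : ℂ))‖ < ε
    rw [hnorm]; linarith
  · change dist (w : ℂ) (s.u : ℂ) < η
    rwa [hw]
  · change ((ε / 2 : ℝ) : ℂ) * (b / (‖b‖ : ℂ)) ≠ 0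
    rw [← norm_pos_iff, hnorm]; positivity
  · push_cast; ring

theorem polarDual_pos {S : Set RealBlowup} (hS : IsOpen S) {c : ℂ} (hc : c ∈ polarDual S)
    (hc0 : c ≠ 0) {s : RealBlowup} (hs : s ∈ S) :
    0 < (c * (starRingEnd ℂ) (s.u : ℂ)).re := by
  obtain ⟨η, hη, h⟩ := cone_of_mem hS hs
  have hcn : 0 < ‖c‖ := norm_pos_iff.2 hc0
  set τ : ℝ := η / (2 * ‖c‖) with hτ
  have hτ0 : 0 < τ := by positivity
  have := hc (s.u - τ * c) (h _ (by
    rw [dist_eq_norm, sub_sub_cancel_left, norm_neg, norm_mul, Complex.norm_real,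
      Real.norm_of_nonneg hτ0.le, hτ]
    field_simp; linarith))
  have h2 : (c * (starRingEnd ℂ) ((s.u : ℂ) - τ * c)).re =
      (c * (starRingEnd ℂ) (s.u : ℂ)).re - τ * ‖c‖ ^ 2 := by
    rw [map_sub, map_mul, Complex.conj_ofReal, mul_sub, Complex.sub_re,
      show c * ((τ : ℂ) * (starRingEnd ℂ) c) = (τ : ℂ) * (c * (starRingEnd ℂ) c) by ring,
      Complex.mul_conj, ← Complex.ofReal_mul, Complex.ofReal_re, Complex.normSq_eq_norm_sq]
  rw [h2] at this
  have : 0 < τ * ‖c‖ ^ 2 := by positivity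
  linarith

theorem re_div_eq (c : ℂ) (s : RealBlowup) :
    (c / s.z).re = (c * (starRingEnd ℂ) (s.u : ℂ)).re / ‖s.z‖ := by
  by_cases hz : s.z = 0
  · simp [hz]
  have hn : (‖s.z‖ : ℂ) ≠ 0 := by simpa using hz
  have h1 : c / s.z = (((‖s.z‖)⁻¹ : ℝ) : ℂ) * (c * (starRingEnd ℂ) (s.u : ℂ)) := by
    conv_lhs => rw [s.polar]
    rw [← Circle.coe_inv_eq_conj, Circle.coe_inv]
    push_cast
    field_simp
  rw [h1, Complex.re_ofReal_mul]
  field_simp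

theorem polarDual_add {S : Set RealBlowup} {a b : ℂ} (ha : a ∈ polarDual S)
    (hb : b ∈ polarDual S) : a + b ∈ polarDual S := fun c hc => by
  rw [add_mul, Complex.add_re]; exact add_nonneg (ha c hc) (hb c hc)

theorem polarDual_zero {S : Set RealBlowup} : (0 : ℂ) ∈ polarDual S := fun c _ => by simp

theorem polarDual_smul {S : Set RealBlowup} {a : ℂ} (ha : a ∈ polarDual S) {t : ℝ} (ht : 0 ≤ t) :
    (t : ℂ) * a ∈ polarDual S := fun c hc => by
  rw [mul_assoc, Complex.re_ofReal_mul]; exact mul_nonneg ht (ha c hc)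

end Blowup

section Expansion

variable (E : Type*) [NormedAddCommGroup E] [NormedSpace ℂ E] {M : Type*} [TopologicalSpace M]
  [ChartedSpace E M]

/-- Holomorphy of `f (x, ħ)` at the point of `M × ℂ` under `q`. -/
def IsHolAt (f : M × ℂ → ℂ) (q : M × RealBlowup) : Prop :=
  MDifferentiableAt (𝓘(ℂ, E).prod 𝓘(ℂ, ℂ)) 𝓘(ℂ, ℂ) f (q.1, q.2.z)

/-- `f ~ ∑ a_j ħ^j` uniformly on `V`, to all orders. -/
def HasExpansion (V : Set (M × RealBlowup)) (f : M × ℂ → ℂ) (a : ℕ → M → ℂ) : Prop :=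
  ∀ N : ℕ, ∃ C : ℝ, ∀ q ∈ V, q.2.z ≠ 0 →
    ‖f (q.1, q.2.z) - ∑ j ∈ Finset.range N, a j q.1 * q.2.z ^ j‖ ≤ C * ‖q.2.z‖ ^ N

/-- The germ of `f` at `p` is asymptotically expandable: it is holomorphic off `ħ = 0`, and has near
`p` a uniform asymptotic expansion in powers of `ħ` with holomorphic coefficients. This is the sheaf `A`.
Values of `f` at `ħ = 0` play no role. -/
def IsAE (p : M × RealBlowup) (f : M × ℂ → ℂ) : Prop :=
  ∃ V : Set (M × RealBlowup), IsOpen V ∧ p ∈ V ∧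
    (∀ q ∈ V, q.2.z ≠ 0 → IsHolAt E f q) ∧
    ∃ a : ℕ → M → ℂ, (∀ j, ∀ q ∈ V, MDifferentiableAt 𝓘(ℂ, E) 𝓘(ℂ, ℂ) (a j) q.1) ∧
      HasExpansion V f a

/-- The function `e^{r/ħ}`. -/
noncomputable def expFac (r : ℂ) : M × ℂ → ℂ := fun q => Complex.exp (r / q.2)

theorem expFac_add (r r' : ℂ) : (expFac (r + r') : M × ℂ → ℂ) = expFac r * expFac r' := by
  funext q; simp [expFac, add_div, Complex.exp_add]

theorem expFac_zero : (expFac 0 : M × ℂ → ℂ) = 1 := by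
  funext q; simp [expFac]

theorem hasExpansion_iff {V : Set (M × RealBlowup)} {f : M × ℂ → ℂ} {a : ℕ → M → ℂ} :
    HasExpansion V f a ↔ ∀ N : ℕ,
      (fun q : M × RealBlowup => f (q.1, q.2.z) - ∑ j ∈ Finset.range N, a j q.1 * q.2.z ^ j)
        =O[𝓟 {q ∈ V | q.2.z ≠ 0}] fun q => q.2.z ^ N := by
  simp only [HasExpansion, Asymptotics.isBigO_principal, norm_pow]
  refine forall_congr' fun N => exists_congr fun C => ?_
  exact ⟨fun h q hq => h q hq.1 hq.2, fun h q h1 h2 => h q ⟨h1, h2⟩⟩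

variable {E}

theorem IsAE.eventually {p : M × RealBlowup} {f : M × ℂ → ℂ} (h : IsAE E p f) :
    ∀ᶠ q in 𝓝 p, IsAE E q f := by
  obtain ⟨V, hV, hp, h1, h2⟩ := h
  filter_upwards [hV.mem_nhds hp] with q hq using ⟨V, hV, hq, h1, h2⟩

theorem IsAE.hol {p : M × RealBlowup} {f : M × ℂ → ℂ} (h : IsAE E p f) (hz : p.2.z ≠ 0) :
    IsHolAt E f p := by
  obtain ⟨V, _, hp, h1, _⟩ := h
  exact h1 p hp hz

theorem HasExpansion.mono {V V' : Set (M × RealBlowup)} {f : M × ℂ → ℂ} {a : ℕ → M → ℂ}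
    (h : HasExpansion V f a) (hV : V' ⊆ V) : HasExpansion V' f a := fun N => by
  obtain ⟨C, hC⟩ := h N
  exact ⟨C, fun q hq => hC q (hV hq)⟩

theorem isOpen_prod_lt (ε : ℝ) : IsOpen {q : M × RealBlowup | ‖q.2.z‖ < ε} :=
  (RealBlowup.isOpen_lt ε).preimage continuous_snd

/-- The set of pairs close to `q` in `M × ℂ` lifts to any open set containing `q`. -/
theorem exists_lift {V : Set (M × RealBlowup)} (hV : IsOpen V) {q : M × RealBlowup} (hq : q ∈ V)
    (hz : q.2.z ≠ 0) :
    ∀ᶠ r : M × ℂ in 𝓝 (q.1, q.2.z), ∃ q' ∈ V, q'.1 = r.1 ∧ q'.2.z = r.2 ∧ r.2 ≠ 0 := by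
  obtain ⟨A, B, hA, hB, hqA, hqB, hAB⟩ := isOpen_prod_iff.1 hV q.1 q.2 hq
  have h1 := RealBlowup.exists_lift hB hqB hz
  rw [nhds_prod_eq]
  have h0 : ∀ᶠ x in 𝓝 q.1, x ∈ A := hA.mem_nhds hqA
  filter_upwards [h0.prod_inl (𝓝 q.2.z), h1.prod_inr (𝓝 q.1)] with r hr1 hr2
  obtain ⟨hr2, s', hs', hs'z⟩ := hr2
  exact ⟨(r.1, s'), hAB ⟨hr1, hs'⟩, rfl, hs'z, hr2⟩

theorem IsAE.congr {p : M × RealBlowup} {f g : M × ℂ → ℂ} (h : IsAE E p f)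
    (hfg : ∀ᶠ q in 𝓝 p, q.2.z ≠ 0 → g (q.1, q.2.z) = f (q.1, q.2.z)) : IsAE E p g := by
  obtain ⟨V, hV, hp, h1, a, ha, he⟩ := h
  obtain ⟨V', hV's, hV', hpV'⟩ := eventually_nhds_iff.1 hfg
  refine ⟨V ∩ V', hV.inter hV', ⟨hp, hpV'⟩, fun q hq hz => ?_, a, fun j q hq => ha j q hq.1, fun N => ?_⟩
  · refine (h1 q hq.1 hz).congr_of_eventuallyEq ?_
    filter_upwards [exists_lift hV' hq.2 hz] with r hr
    obtain ⟨q', hq', e1, e2, e3⟩ := hr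
    have := hV's q' hq' (e2 ▸ e3)
    rwa [e1, e2] at this
  · obtain ⟨C, hC⟩ := he N
    refine ⟨C, fun q hq hz => ?_⟩
    rw [hV's q hq.2 hz]
    exact hC q hq.1 hz

theorem IsAE.add {p : M × RealBlowup} {f g : M × ℂ → ℂ} (hf : IsAE E p f) (hg : IsAE E p g) :
    IsAE E p (f + g) := by
  obtain ⟨V, hV, hp, h1, a, ha, he⟩ := hf
  obtain ⟨V', hV', hp', h1', a', ha', he'⟩ := hg
  refine ⟨V ∩ V', hV.inter hV', ⟨hp, hp'⟩, fun q hq hz => ?_, fun j => a j + a' j,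
    fun j q hq => (ha j q hq.1).add (ha' j q hq.2), ?_⟩
  · exact MDifferentiableAt.add (h1 q hq.1 hz) (h1' q hq.2 hz)
  · have k1 := hasExpansion_iff.1 (he.mono inter_subset_left (V' := V ∩ V'))
    have k2 := hasExpansion_iff.1 (he'.mono inter_subset_right (V' := V ∩ V'))
    refine hasExpansion_iff.2 fun N => ((k1 N).add (k2 N)).congr_left fun q => ?_
    simp only [Pi.add_apply, add_mul, Finset.sum_add_distrib]
    ring

theorem sum_range_mul_sum_range (N : ℕ) (F : ℕ → ℕ → ℂ) :
    ∑ i ∈ Finset.range N, ∑ j ∈ Finset.range N, F i j =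
      ∑ k ∈ Finset.range N, ∑ x ∈ Finset.HasAntidiagonal.antidiagonal k, F x.1 x.2 +
      ∑ x ∈ (Finset.range N ×ˢ Finset.range N).filter (fun x => N ≤ x.1 + x.2), F x.1 x.2 := by
  rw [← Finset.sum_product']
  rw [← Finset.sum_filter_add_sum_filter_not (Finset.range N ×ˢ Finset.range N)
    (fun x => x.1 + x.2 < N)]
  congr 1
  · rw [← Finset.sum_fiberwise_of_maps_to (t := Finset.range N) (g := fun x => x.1 + x.2)
      (fun x hx => by simpa using (Finset.mem_filter.1 hx).2)]
    refine Finset.sum_congr rfl fun k hk => Finset.sum_congr ?_ fun _ _ => rfl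
    ext x
    simp only [Finset.mem_filter, Finset.mem_product, Finset.mem_range, Finset.HasAntidiagonal.mem_antidiagonal] at *
    omega
  · refine Finset.sum_congr ?_ fun _ _ => rfl
    ext x
    simp

theorem IsAE.mul {p : M × RealBlowup} {f g : M × ℂ → ℂ} (hf : IsAE E p f) (hg : IsAE E p g) :
    IsAE E p (f * g) := by
  obtain ⟨V, hV, hp, h1, a, ha, he⟩ := hf
  obtain ⟨V', hV', hp', h1', b, hb, he'⟩ := hg
  set W : Set (M × RealBlowup) := V ∩ V' ∩ {q | ‖q.2.z‖ < ‖p.2.z‖ + 1} with hW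
  have hWo : IsOpen W := (hV.inter hV').inter (isOpen_prod_lt _)
  refine ⟨W, hWo, ⟨⟨hp, hp'⟩, by simp⟩, fun q hq hz => ?_,
    fun k => ∑ x ∈ Finset.HasAntidiagonal.antidiagonal k, a x.1 * b x.2, fun j q hq => ?_, ?_⟩
  · exact MDifferentiableAt.mul (h1 q hq.1.1 hz) (h1' q hq.1.2 hz)
  · refine MDifferentiableAt.sum fun x _ => MDifferentiableAt.mul (ha _ q hq.1.1) (hb _ q hq.1.2)
  set l := 𝓟 {q ∈ W | q.2.z ≠ 0} with hl
  have k1 := hasExpansion_iff.1 (he.mono (V' := W) fun q hq => hq.1.1)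
  have k2 := hasExpansion_iff.1 (he'.mono (V' := W) fun q hq => hq.1.2)
  have hzO : (fun q : M × RealBlowup => q.2.z) =O[l] fun _ => (1 : ℂ) := by
    refine Asymptotics.isBigO_principal.2 ⟨‖p.2.z‖ + 1, fun q hq => ?_⟩
    simpa using (le_of_lt hq.1.2 : ‖q.2.z‖ ≤ _)
  have coefO : ∀ (f : M × ℂ → ℂ) (a : ℕ → M → ℂ),
      (∀ N : ℕ, (fun q : M × RealBlowup => f (q.1, q.2.z) -
        ∑ j ∈ Finset.range N, a j q.1 * q.2.z ^ j) =O[l] fun q => q.2.z ^ N) →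
      ∀ j, (fun q : M × RealBlowup => a j q.1) =O[l] fun _ => (1 : ℂ) := by
    intro f a k j
    have e1 : (fun q : M × RealBlowup => q.2.z ^ (j + 1)) =O[l] fun q => q.2.z ^ j := by
      simpa [pow_succ] using (Asymptotics.isBigO_refl (fun q : M × RealBlowup => q.2.z ^ j) l).mul hzO
    have e2 := (k j).sub ((k (j + 1)).trans e1)
    have e3 : (fun q : M × RealBlowup => a j q.1 * q.2.z ^ j) =O[l] fun q => q.2.z ^ j := by
      refine e2.congr_left fun q => ?_
      rw [Finset.sum_range_succ]; ring
    have e4 := e3.mul (Asymptotics.isBigO_refl (fun q : M × RealBlowup => (q.2.z ^ j)⁻¹) l)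
    refine e4.congr' ?_ ?_
    · refine eventually_principal.2 fun q hq => ?_
      have : q.2.z ^ j ≠ 0 := pow_ne_zero _ hq.2
      simp only
      field_simp
    · refine eventually_principal.2 fun q hq => ?_
      have : q.2.z ^ j ≠ 0 := pow_ne_zero _ hq.2
      simp only
      field_simp
  have hbO := coefO g b k2
  have haO := coefO f a k1
  have hfO : (fun q : M × RealBlowup => f (q.1, q.2.z)) =O[l] fun _ => (1 : ℂ) := by
    simpa using k1 0
  refine hasExpansion_iff.2 fun N => ?_
  have hQO : (fun q : M × RealBlowup => ∑ j ∈ Finset.range N, b j q.1 * q.2.z ^ j) =O[l]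
      fun _ => (1 : ℂ) := by
    refine Asymptotics.IsBigO.fun_sum fun j _ => ?_
    simpa using (hbO j).mul (hzO.pow j)
  have t1 := hfO.mul (k2 N)
  have t2 := (k1 N).mul hQO
  have t3 : (fun q : M × RealBlowup =>
      ∑ x ∈ (Finset.range N ×ˢ Finset.range N).filter (fun x => N ≤ x.1 + x.2),
        (a x.1 q.1 * q.2.z ^ x.1) * (b x.2 q.1 * q.2.z ^ x.2)) =O[l] fun q => q.2.z ^ N := by
    refine Asymptotics.IsBigO.fun_sum fun x hx => ?_
    have hx' := (Finset.mem_filter.1 hx).2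
    have u1 := ((haO x.1).mul (hbO x.2)).mul (((hzO.pow (x.1 + x.2 - N))).mul
      (Asymptotics.isBigO_refl (fun q : M × RealBlowup => q.2.z ^ N) l))
    refine (u1.congr_left fun q => ?_).congr_right fun q => by simp
    have : q.2.z ^ (x.1 + x.2 - N) * q.2.z ^ N = q.2.z ^ x.1 * q.2.z ^ x.2 := by
      rw [← pow_add, ← pow_add]; congr 1; omega
    rw [this]; ring
  have t := ((t1.congr_right fun q => by simp).add (t2.congr_right fun q => by simp)).add t3
  refine t.congr_left fun q => ?_
  have key := sum_range_mul_sum_range N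
    (fun i j => (a i q.1 * q.2.z ^ i) * (b j q.1 * q.2.z ^ j))
  have key2 : ∀ k ∈ Finset.range N,
      (∑ x ∈ Finset.HasAntidiagonal.antidiagonal k, a x.1 * b x.2) q.1 * q.2.z ^ k =
      ∑ x ∈ Finset.HasAntidiagonal.antidiagonal k, (a x.1 q.1 * q.2.z ^ x.1) * (b x.2 q.1 * q.2.z ^ x.2) := by
    intro k _
    rw [Finset.sum_apply, Finset.sum_mul]
    refine Finset.sum_congr rfl fun x hx => ?_
    rw [← Finset.HasAntidiagonal.mem_antidiagonal.1 hx, pow_add]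
    simp only [Pi.mul_apply]
    ring
  rw [Finset.sum_congr rfl key2]
  rw [← Finset.sum_mul_sum] at key
  simp only [Pi.mul_apply]
  linear_combination -key

theorem IsAE.of_base {p : M × RealBlowup} {f : M → ℂ}
    (hf : ∀ᶠ x in 𝓝 p.1, MDifferentiableAt 𝓘(ℂ, E) 𝓘(ℂ, ℂ) f x) :
    IsAE E p (fun q => f q.1) := by
  have hc : ContinuousAt f p.1 := hf.self_of_nhds.continuousAt
  have hb : ∀ᶠ x in 𝓝 p.1, ‖f x‖ < ‖f p.1‖ + 1 :=
    hc.norm.eventually (gt_mem_nhds (by linarith))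
  obtain ⟨B, hB, hBo, hpB⟩ := eventually_nhds_iff.1 (hf.and hb)
  refine ⟨Prod.fst ⁻¹' B, hBo.preimage continuous_fst, hpB, fun q hq _ => ?_,
    fun j => if j = 0 then f else 0, fun j q hq => ?_, fun N => ?_⟩
  · exact MDifferentiableAt.comp (I' := 𝓘(ℂ, E)) (q.1, q.2.z) (g := f) (f := Prod.fst)
      (hB q.1 hq).1 mdifferentiableAt_fst
  · by_cases hj : j = 0
    · simpa [hj] using (hB q.1 hq).1
    · simp only [hj, if_false]; exact mdifferentiableAt_const (c := (0 : ℂ))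
  · rcases N with _ | N
    · refine ⟨‖f p.1‖ + 1, fun q hq _ => ?_⟩
      simpa using (hB q.1 hq).2.le
    · refine ⟨0, fun q hq _ => ?_⟩
      rw [Finset.sum_range_succ']
      simp

theorem IsAE.const {p : M × RealBlowup} (c : ℂ) : IsAE E p (fun _ : M × ℂ => c) :=
  IsAE.of_base (f := fun _ => c) (Eventually.of_forall fun _ => mdifferentiableAt_const)

theorem IsAE.one {p : M × RealBlowup} : IsAE E p (1 : M × ℂ → ℂ) := IsAE.const 1

theorem IsAE.neg {p : M × RealBlowup} {f : M × ℂ → ℂ} (hf : IsAE E p f) : IsAE E p (-f) := by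
  have := (IsAE.const (E := E) (p := p) (-1)).mul hf
  refine this.congr (Eventually.of_forall fun q _ => by simp)

theorem IsAE.sub {p : M × RealBlowup} {f g : M × ℂ → ℂ} (hf : IsAE E p f) (hg : IsAE E p g) :
    IsAE E p (f - g) := by
  rw [sub_eq_add_neg]; exact hf.add hg.neg

theorem IsAE.hbar {p : M × RealBlowup} : IsAE E p (fun q : M × ℂ => q.2) := by
  refine ⟨{q | ‖q.2.z‖ < ‖p.2.z‖ + 1}, isOpen_prod_lt _, by simp, fun q _ _ => mdifferentiableAt_snd,
    fun j => if j = 1 then 1 else 0, fun j q _ => ?_, fun N => ?_⟩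
  · by_cases hj : j = 1
    · simp only [hj, if_true]; exact mdifferentiableAt_const (c := (1 : ℂ))
    · simp only [hj, if_false]; exact mdifferentiableAt_const (c := (0 : ℂ))
  · rcases N with _ | _ | N
    · exact ⟨‖p.2.z‖ + 1, fun q hq _ => by simpa using (le_of_lt hq : ‖q.2.z‖ ≤ _)⟩
    · exact ⟨1, fun q hq _ => by simp⟩
    · refine ⟨0, fun q _ _ => ?_⟩
      rw [Finset.sum_eq_single 1]
      · simp
      · intro j _ hj; simp [hj]
      · intro h; simp at h

theorem isHolAt_expFac (r : ℂ) {q : M × RealBlowup} (hz : q.2.z ≠ 0) :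
    IsHolAt E (expFac r : M × ℂ → ℂ) q := by
  have h : DifferentiableAt ℂ (fun z : ℂ => Complex.exp (r / z)) q.2.z :=
    ((differentiableAt_const r).div differentiableAt_id hz).cexp
  exact MDifferentiableAt.comp (I' := 𝓘(ℂ, ℂ)) (q.1, q.2.z) (g := fun z : ℂ => Complex.exp (r / z))
    (f := Prod.snd) h.mdifferentiableAt mdifferentiableAt_snd

/-- `e^{-c/ħ}` is rapidly decaying on `S` for a nonzero `c` in the polar dual. -/
theorem IsAE.expFac_neg {S : Set RealBlowup} (hS : IsOpen S) {c : ℂ} (hc : c ∈ polarDual S)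
    {p : M × RealBlowup} (hp : p.2 ∈ S) : IsAE E p (expFac (-c)) := by
  by_cases hc0 : c = 0
  · rw [hc0, neg_zero, expFac_zero]; exact IsAE.one
  have hpos := polarDual_pos hS hc hc0 hp
  set δ := (c * (starRingEnd ℂ) (p.2.u : ℂ)).re / 2 with hδ
  have hδ0 : 0 < δ := by positivity
  have hcont : Continuous fun q : M × RealBlowup => (c * (starRingEnd ℂ) (q.2.u : ℂ)).re := by
    have : Continuous fun q : M × RealBlowup => (q.2.u : ℂ) :=
      continuous_subtype_val.comp (RealBlowup.continuous_u.comp continuous_snd)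
    fun_prop
  refine ⟨{q | δ < (c * (starRingEnd ℂ) (q.2.u : ℂ)).re},
    isOpen_lt continuous_const hcont, ?_, fun q _ hz => isHolAt_expFac _ hz,
    fun _ => 0, fun j q _ => mdifferentiableAt_const (c := (0 : ℂ)), fun N => ?_⟩
  · change δ < _; linarith
  refine ⟨N.factorial / δ ^ N, fun q hq hz => ?_⟩
  have hzp : 0 < ‖q.2.z‖ := norm_pos_iff.2 hz
  have h1 : ‖expFac (-c) (q.1, q.2.z)‖ = Real.exp (-((c / q.2.z).re)) := by
    rw [expFac, Complex.norm_exp, neg_div, Complex.neg_re]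
  have h2 : δ / ‖q.2.z‖ ≤ (c / q.2.z).re := by
    rw [re_div_eq]
    have : δ < (c * (starRingEnd ℂ) (q.2.u : ℂ)).re := hq
    gcongr
  have h3 := Real.pow_div_factorial_le_exp (δ / ‖q.2.z‖) (by positivity) N
  simp only [Pi.zero_apply, zero_mul, Finset.sum_const_zero, sub_zero]
  rw [h1, Real.exp_neg]
  have h4 := h3.trans (Real.exp_le_exp.2 h2)
  calc (Real.exp ((c / q.2.z).re))⁻¹ ≤ ((δ / ‖q.2.z‖) ^ N / N.factorial)⁻¹ := by gcongr
    _ = N.factorial / δ ^ N * ‖q.2.z‖ ^ N := by rw [div_pow]; field_simp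

end Expansion

section Derivation

variable {E : Type*} [NormedAddCommGroup E] [NormedSpace ℂ E] {M : Type*} [TopologicalSpace M]
  [ChartedSpace E M]

/-- The derivative of `f (x, ħ)` in the direction `v`, for fixed `ħ`. -/
noncomputable def dirDeriv (v : Π x : M, TangentSpace 𝓘(ℂ, E) x) (f : M × ℂ → ℂ) : M × ℂ → ℂ :=
  fun q => mfderiv 𝓘(ℂ, E) 𝓘(ℂ, ℂ) (fun y => f (y, q.2)) q.1 (v q.1)

theorem isHolAt_slice {f : M × ℂ → ℂ} {q : M × RealBlowup} (h : IsHolAt E f q) :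
    MDifferentiableAt 𝓘(ℂ, E) 𝓘(ℂ, ℂ) (fun y => f (y, q.2.z)) q.1 :=
  MDifferentiableAt.comp (I' := 𝓘(ℂ, E).prod 𝓘(ℂ, ℂ)) q.1 (g := f) (f := fun y => (y, q.2.z)) h
    (mdifferentiableAt_id.prodMk mdifferentiableAt_const)

variable [IsManifold 𝓘(ℂ, E) ω M]

theorem chart_deriv {x₀ x : M} (hx : x ∈ (chartAt E x₀).source) {g : M → ℂ}
    (hg : MDifferentiableAt 𝓘(ℂ, E) 𝓘(ℂ, ℂ) g x) :
    DifferentiableAt ℂ (g ∘ (chartAt E x₀).symm) (chartAt E x₀ x) ∧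
    ∀ w : TangentSpace 𝓘(ℂ, E) x, mfderiv 𝓘(ℂ, E) 𝓘(ℂ, ℂ) g x w =
      fderiv ℂ (g ∘ (chartAt E x₀).symm) (chartAt E x₀ x)
        (mfderiv 𝓘(ℂ, E) 𝓘(ℂ, E) (chartAt E x₀) x w) := by
  have : IsManifold 𝓘(ℂ, E) 1 M := IsManifold.of_le (n := ω) le_top
  set φ := chartAt E x₀
  have h1 : MDifferentiableAt 𝓘(ℂ, E) 𝓘(ℂ, E) φ.symm (φ x) :=
    mdifferentiableAt_atlas_symm (chart_mem_atlas E x₀) (φ.map_source hx)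
  have h2 : MDifferentiableAt 𝓘(ℂ, E) 𝓘(ℂ, E) φ x :=
    mdifferentiableAt_atlas (chart_mem_atlas E x₀) hx
  have hg' : MDifferentiableAt 𝓘(ℂ, E) 𝓘(ℂ, ℂ) g (φ.symm (φ x)) := by rwa [φ.left_inv hx]
  have h3 : MDifferentiableAt 𝓘(ℂ, E) 𝓘(ℂ, ℂ) (g ∘ φ.symm) (φ x) := hg'.comp _ h1
  refine ⟨h3.differentiableAt, fun w => ?_⟩
  have h4 : g =ᶠ[𝓝 x] (g ∘ φ.symm) ∘ φ := by
    filter_upwards [φ.open_source.mem_nhds hx] with y hy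
    simp [φ.left_inv hy]
  rw [h4.mfderiv_eq, mfderiv_comp x h3 h2, mfderiv_eq_fderiv]
  rfl

theorem chart_joint {x₀ : M} {y : E} (hy : y ∈ (chartAt E x₀).target) {f : M × ℂ → ℂ} {z : ℂ}
    (hf : MDifferentiableAt (𝓘(ℂ, E).prod 𝓘(ℂ, ℂ)) 𝓘(ℂ, ℂ) f ((chartAt E x₀).symm y, z)) :
    DifferentiableAt ℂ (fun q : E × ℂ => f ((chartAt E x₀).symm q.1, q.2)) (y, z) := by
  have : IsManifold 𝓘(ℂ, E) 1 M := IsManifold.of_le (n := ω) le_top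
  have h1 : MDifferentiableAt 𝓘(ℂ, E) 𝓘(ℂ, E) (chartAt E x₀).symm y :=
    mdifferentiableAt_atlas_symm (chart_mem_atlas E x₀) hy
  have h2 : MDifferentiableAt (𝓘(ℂ, E).prod 𝓘(ℂ, ℂ)) (𝓘(ℂ, E).prod 𝓘(ℂ, ℂ))
      (fun q : E × ℂ => ((chartAt E x₀).symm q.1, q.2)) (y, z) :=
    MDifferentiableAt.prodMk
      (MDifferentiableAt.comp (I' := 𝓘(ℂ, E)) (y, z) (g := (chartAt E x₀).symm) (f := Prod.fst)
        h1 mdifferentiableAt_fst)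
      mdifferentiableAt_snd
  have h3 : MDifferentiableAt (𝓘(ℂ, E).prod 𝓘(ℂ, ℂ)) 𝓘(ℂ, ℂ)
      (fun q : E × ℂ => f ((chartAt E x₀).symm q.1, q.2)) (y, z) :=
    MDifferentiableAt.comp (I' := 𝓘(ℂ, E).prod 𝓘(ℂ, ℂ)) (y, z) (g := f) hf h2
  rw [← modelWithCornersSelf_prod, chartedSpaceSelf_prod] at h3
  exact h3.differentiableAt

/-- The chart expression of a holomorphic vector field is holomorphic. -/
theorem chart_field {v : Π x : M, TangentSpace 𝓘(ℂ, E) x} {x₀ : M}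
    (hv : MDifferentiableAt 𝓘(ℂ, E) 𝓘(ℂ, E).tangent
      (fun x => (⟨x, v x⟩ : TangentBundle 𝓘(ℂ, E) M)) x₀) :
    MDifferentiableAt 𝓘(ℂ, E) 𝓘(ℂ, E)
      (fun x => (mfderiv 𝓘(ℂ, E) 𝓘(ℂ, E) (chartAt E x₀) x (v x) : E)) x₀ := by
  have : IsManifold 𝓘(ℂ, E) 1 M := IsManifold.of_le (n := ω) le_top
  have h := (mdifferentiableAt_section (F := E) (E := TangentSpace 𝓘(ℂ, E)) 𝓘(ℂ, E) v).1 hv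
  refine h.congr_of_eventuallyEq ?_
  filter_upwards [(chartAt E x₀).open_source.mem_nhds (mem_chart_source E x₀)] with x hx
  have h2 := TangentBundle.continuousLinearMapAt_trivializationAt (I := 𝓘(ℂ, E)) hx
  set e := trivializationAt E (TangentSpace 𝓘(ℂ, E) : M → Type _) x₀ with he
  have hxe : x ∈ e.baseSet := by simpa [he] using hx
  have h4 : (e.continuousLinearMapAt ℂ x) (v x) = (e ⟨x, v x⟩).2 := by
    rw [Bundle.Trivialization.continuousLinearMapAt_apply, Bundle.Trivialization.linearMapAt_apply,
      if_pos hxe]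
  exact (congrArg (fun T : TangentSpace 𝓘(ℂ, E) x →L[ℂ] E => T (v x)) h2).symm.trans h4

variable [FiniteDimensional ℂ E]

theorem dirDeriv_mdiff {v : Π x : M, TangentSpace 𝓘(ℂ, E) x} {f : M × ℂ → ℂ} {x : M} {z : ℂ}
    (hv : MDifferentiableAt 𝓘(ℂ, E) 𝓘(ℂ, E).tangent
      (fun x => (⟨x, v x⟩ : TangentBundle 𝓘(ℂ, E) M)) x)
    (hf : ∀ᶠ q in 𝓝 (x, z), MDifferentiableAt (𝓘(ℂ, E).prod 𝓘(ℂ, ℂ)) 𝓘(ℂ, ℂ) f q) :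
    MDifferentiableAt (𝓘(ℂ, E).prod 𝓘(ℂ, ℂ)) 𝓘(ℂ, ℂ) (dirDeriv v f) (x, z) := by
  have : IsManifold 𝓘(ℂ, E) 1 M := IsManifold.of_le (n := ω) le_top
  set φ := chartAt E x with hφ
  have hxs : x ∈ φ.source := mem_chart_source E x
  set h : E × ℂ → ℂ := fun q => f (φ.symm q.1, q.2) with hh
  set w : M → E := fun x' => mfderiv 𝓘(ℂ, E) 𝓘(ℂ, E) φ x' (v x') with hw
  have hwd : MDifferentiableAt 𝓘(ℂ, E) 𝓘(ℂ, E) w x := chart_field hv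
  have hφd : MDifferentiableAt 𝓘(ℂ, E) 𝓘(ℂ, E) φ x :=
    mdifferentiableAt_atlas (chart_mem_atlas E x) hxs
  have hcont : ContinuousAt (fun q : E × ℂ => ((φ.symm q.1, q.2) : M × ℂ)) (φ x, z) := by
    refine ContinuousAt.prodMk ?_ continuousAt_snd
    exact ContinuousAt.comp (f := Prod.fst) (x := (φ x, z))
      (φ.continuousAt_symm (φ.map_source hxs)) continuousAt_fst
  have hhd : ∀ᶠ q in 𝓝 (φ x, z), DifferentiableAt ℂ h q := by
    have e1 : ∀ᶠ q : E × ℂ in 𝓝 (φ x, z),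
        MDifferentiableAt (𝓘(ℂ, E).prod 𝓘(ℂ, ℂ)) 𝓘(ℂ, ℂ) f (φ.symm q.1, q.2) := by
      refine hcont.eventually ?_
      simpa [φ.left_inv hxs] using hf
    have e2 : ∀ᶠ q : E × ℂ in 𝓝 (φ x, z), q.1 ∈ φ.target :=
      continuousAt_fst.eventually (φ.open_target.mem_nhds (φ.map_source hxs))
    filter_upwards [e1, e2] with q k1 k2 using chart_joint k2 k1
  have hD : DifferentiableAt ℂ (fderiv ℂ h) (φ x, z) := differentiableAt_fderiv hhd
  have hpair : MDifferentiableAt (𝓘(ℂ, E).prod 𝓘(ℂ, ℂ)) 𝓘(ℂ, E × ℂ)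
      (fun q : M × ℂ => ((φ q.1, q.2) : E × ℂ)) (x, z) := by
    rw [modelWithCornersSelf_prod, ← chartedSpaceSelf_prod]
    exact MDifferentiableAt.prodMk
      (MDifferentiableAt.comp (I' := 𝓘(ℂ, E)) (x, z) (g := φ) (f := Prod.fst) hφd
        mdifferentiableAt_fst) mdifferentiableAt_snd
  have hfd : MDifferentiableAt (𝓘(ℂ, E).prod 𝓘(ℂ, ℂ)) 𝓘(ℂ, E × ℂ →L[ℂ] ℂ)
      (fun q : M × ℂ => fderiv ℂ h (φ q.1, q.2)) (x, z) :=
    MDifferentiableAt.comp (I' := 𝓘(ℂ, E × ℂ)) (x, z) (g := fderiv ℂ h)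
      (f := fun q : M × ℂ => ((φ q.1, q.2) : E × ℂ)) hD.mdifferentiableAt hpair
  have hw2 : MDifferentiableAt (𝓘(ℂ, E).prod 𝓘(ℂ, ℂ)) 𝓘(ℂ, E)
      (fun q : M × ℂ => w q.1) (x, z) :=
    MDifferentiableAt.comp (I' := 𝓘(ℂ, E)) (x, z) (g := w) (f := Prod.fst) hwd
      mdifferentiableAt_fst
  have hw3 : MDifferentiableAt (𝓘(ℂ, E).prod 𝓘(ℂ, ℂ)) 𝓘(ℂ, E × ℂ)
      (fun q : M × ℂ => ((w q.1, 0) : E × ℂ)) (x, z) :=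
    MDifferentiableAt.comp (I' := 𝓘(ℂ, E)) (x, z) (g := fun e : E => ((e, 0) : E × ℂ))
      (f := fun q : M × ℂ => w q.1)
      ((differentiableAt_id.prodMk (differentiableAt_const _)).mdifferentiableAt) hw2
  refine (hfd.clm_apply hw3).congr_of_eventuallyEq ?_
  have e1 : ∀ᶠ q : M × ℂ in 𝓝 (x, z), q.1 ∈ φ.source :=
    continuousAt_fst.eventually (φ.open_source.mem_nhds hxs)
  filter_upwards [hf, e1] with q k1 k2
  have s1 : MDifferentiableAt 𝓘(ℂ, E) 𝓘(ℂ, ℂ) (fun y => f (y, q.2)) q.1 :=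
    MDifferentiableAt.comp (I' := 𝓘(ℂ, E).prod 𝓘(ℂ, ℂ)) q.1 (g := f) (f := fun y => (y, q.2)) k1
      (mdifferentiableAt_id.prodMk mdifferentiableAt_const)
  change mfderiv 𝓘(ℂ, E) 𝓘(ℂ, ℂ) (fun y => f (y, q.2)) q.1 (v q.1) = _
  rw [(chart_deriv k2 s1).2]
  have k3 : DifferentiableAt ℂ h (φ q.1, q.2) :=
    chart_joint (φ.map_source k2) (by simpa [φ, φ.left_inv k2] using k1)
  have k4 : HasFDerivAt (fun y : E => h (y, q.2))
      ((fderiv ℂ h (φ q.1, q.2)).comp (ContinuousLinearMap.inl ℂ E ℂ)) (φ q.1) :=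
    HasFDerivAt.comp (g := h) (f := fun y : E => (y, q.2)) (φ q.1) k3.hasFDerivAt
      (hasFDerivAt_prodMk_left (φ q.1) q.2)
  have k5 : ((fun y => f (y, q.2)) ∘ φ.symm) = fun y : E => h (y, q.2) := rfl
  rw [k5, k4.fderiv]
  rfl

theorem deriv_base_mdiff {v : Π x : M, TangentSpace 𝓘(ℂ, E) x} {a : M → ℂ} {x : M}
    (hv : MDifferentiableAt 𝓘(ℂ, E) 𝓘(ℂ, E).tangent
      (fun x => (⟨x, v x⟩ : TangentBundle 𝓘(ℂ, E) M)) x)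
    (ha : ∀ᶠ x' in 𝓝 x, MDifferentiableAt 𝓘(ℂ, E) 𝓘(ℂ, ℂ) a x') :
    MDifferentiableAt 𝓘(ℂ, E) 𝓘(ℂ, ℂ)
      (fun x' => (mfderiv 𝓘(ℂ, E) 𝓘(ℂ, ℂ) a x' (v x') : ℂ)) x := by
  have h1 : ∀ᶠ q : M × ℂ in 𝓝 (x, 0), MDifferentiableAt (𝓘(ℂ, E).prod 𝓘(ℂ, ℂ)) 𝓘(ℂ, ℂ)
      (fun q : M × ℂ => a q.1) q := by
    have : ∀ᶠ q : M × ℂ in 𝓝 (x, 0), MDifferentiableAt 𝓘(ℂ, E) 𝓘(ℂ, ℂ) a q.1 :=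
      continuousAt_fst.eventually ha
    filter_upwards [this] with q hq
    exact MDifferentiableAt.comp (I' := 𝓘(ℂ, E)) q (g := a) (f := Prod.fst) hq
      mdifferentiableAt_fst
  exact MDifferentiableAt.comp (I' := 𝓘(ℂ, E).prod 𝓘(ℂ, ℂ)) x
    (g := dirDeriv v (fun q : M × ℂ => a q.1)) (f := fun x' : M => (x', (0 : ℂ)))
    (dirDeriv_mdiff hv h1) (mdifferentiableAt_id.prodMk mdifferentiableAt_const)

theorem IsAE.dirDeriv {p : M × RealBlowup} {f : M × ℂ → ℂ} (hf : IsAE E p f)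
    {v : Π x : M, TangentSpace 𝓘(ℂ, E) x}
    (hv : ∀ᶠ x in 𝓝 p.1, MDifferentiableAt 𝓘(ℂ, E) 𝓘(ℂ, E).tangent
      (fun x => (⟨x, v x⟩ : TangentBundle 𝓘(ℂ, E) M)) x) :
    IsAE E p (dirDeriv v f) := by
  have : IsManifold 𝓘(ℂ, E) 1 M := IsManifold.of_le (n := ω) le_top
  obtain ⟨V, hV, hp, h1, a, ha, he⟩ := hf
  obtain ⟨A, B, hA, hB, hpA, hpB, hAB⟩ := isOpen_prod_iff.1 hV p.1 p.2 hp
  set φ := chartAt E p.1 with hφ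
  have hps : p.1 ∈ φ.source := mem_chart_source E p.1
  -- a chart ball of radius `2 ρ` inside `A`
  have e1 : ∀ᶠ y in 𝓝 (φ p.1), y ∈ φ.target ∧ φ.symm y ∈ A := by
    have e0 : ∀ᶠ y in 𝓝 (φ p.1), y ∈ φ.target := φ.open_target.mem_nhds (φ.map_source hps)
    refine e0.and ?_
    refine (φ.continuousAt_symm (φ.map_source hps)).eventually ?_
    rw [φ.left_inv hps]
    exact hA.mem_nhds hpA
  obtain ⟨R, hR, hball⟩ := Metric.eventually_nhds_iff_ball.1 e1
  set ρ := R / 2 with hρ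
  have hρ0 : 0 < ρ := by positivity
  set w : M → E := fun x' => mfderiv 𝓘(ℂ, E) 𝓘(ℂ, E) φ x' (v x') with hw
  have hwd : MDifferentiableAt 𝓘(ℂ, E) 𝓘(ℂ, E) w p.1 := chart_field hv.self_of_nhds
  have e2 : ∀ᶠ x in 𝓝 p.1, ‖w x‖ < ‖w p.1‖ + 1 :=
    hwd.continuousAt.norm.eventually (gt_mem_nhds (by linarith))
  have e3 : ∀ᶠ x in 𝓝 p.1, φ x ∈ ball (φ p.1) ρ :=
    (φ.continuousAt hps).eventually (ball_mem_nhds _ hρ0)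
  have e4 : ∀ᶠ x in 𝓝 p.1, x ∈ φ.source := φ.open_source.mem_nhds hps
  obtain ⟨A', hA', hA'o, hpA'⟩ := eventually_nhds_iff.1 (((hv.and e2).and e3).and e4)
  set W : Set (M × RealBlowup) := V ∩ A' ×ˢ B with hWdef
  have hWo : IsOpen W := hV.inter (hA'o.prod hB)
  have hafst : ∀ j, ∀ q ∈ W, ∀ᶠ x in 𝓝 q.1, MDifferentiableAt 𝓘(ℂ, E) 𝓘(ℂ, ℂ) (a j) x := by
    intro j q hq
    have : ∀ᶠ x in 𝓝 q.1, (x, q.2) ∈ V :=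
      (Continuous.prodMk_left q.2).continuousAt.eventually (hV.mem_nhds hq.1)
    filter_upwards [this] with x hx using ha j _ hx
  refine ⟨W, hWo, ⟨hp, hpA', hpB⟩, fun q hq hz => ?_,
    fun j x => (mfderiv 𝓘(ℂ, E) 𝓘(ℂ, ℂ) (a j) x (v x) : ℂ), fun j q hq => ?_, fun N => ?_⟩
  · refine dirDeriv_mdiff (hA' q.1 hq.2.1).1.1.1 ?_
    filter_upwards [exists_lift hV hq.1 hz] with r hr
    obtain ⟨q', hq', k1, k2, k3⟩ := hr
    have := h1 q' hq' (k2 ▸ k3)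
    rw [IsHolAt, k1, k2] at this
    exact this
  · exact deriv_base_mdiff (hA' q.1 hq.2.1).1.1.1 (hafst j q hq)
  · obtain ⟨C, hC⟩ := he N
    refine ⟨2 * C / ρ * (‖w p.1‖ + 1), fun q hq hz => ?_⟩
    obtain ⟨⟨⟨kv, kw⟩, kb⟩, ks⟩ := hA' q.1 hq.2.1
    -- points of the chart ball around `φ q.1`
    have hmem : ∀ y ∈ ball (φ q.1) ρ, y ∈ φ.target ∧ (φ.symm y, q.2) ∈ V := by
      intro y hy
      have : y ∈ ball (φ p.1) R := by
        rw [mem_ball] at *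
        have := dist_triangle y (φ q.1) (φ p.1)
        linarith
      exact ⟨(hball y this).1, hAB ⟨(hball y this).2, hq.2.2⟩⟩
    set G : M → ℂ := fun x => f (x, q.2.z) - ∑ j ∈ Finset.range N, a j x * q.2.z ^ j with hG
    have hGd : ∀ x, (x, q.2) ∈ V → MDifferentiableAt 𝓘(ℂ, E) 𝓘(ℂ, ℂ) G x := by
      intro x hx
      refine MDifferentiableAt.sub (isHolAt_slice (h1 (x, q.2) hx hz)) ?_
      have : (fun x => ∑ j ∈ Finset.range N, a j x * q.2.z ^ j) =
        ∑ j ∈ Finset.range N, fun x => a j x * q.2.z ^ j := by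
        funext x; simp
      rw [this]
      exact MDifferentiableAt.sum fun j _ =>
        MDifferentiableAt.mul (ha j (x, q.2) hx) (mdifferentiableAt_const (c := q.2.z ^ j))
    have hGb : ∀ y ∈ ball (φ q.1) ρ, ‖(G ∘ φ.symm) y‖ ≤ C * ‖q.2.z‖ ^ N := fun y hy =>
      hC (φ.symm y, q.2) (hmem y hy).2 hz
    have hGdiff : DifferentiableOn ℂ (G ∘ φ.symm) (ball (φ q.1) ρ) := by
      intro y hy
      have k := (chart_deriv (x₀ := p.1) (φ.map_target (hmem y hy).1) (hGd _ (hmem y hy).2)).1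
      rw [← hφ, φ.right_inv (hmem y hy).1] at k
      exact k.differentiableWithinAt
    have hbound := cauchy_fderiv_bound hρ0 hGdiff hGb
    have hGq := chart_deriv (x₀ := p.1) ks (hGd q.1 hq.1)
    let da : ℕ → M → ℂ := fun j x => mfderiv 𝓘(ℂ, E) 𝓘(ℂ, ℂ) (a j) x (v x)
    change ‖HbarConn.dirDeriv v f (q.1, q.2.z) - ∑ j ∈ Finset.range N, da j q.1 * q.2.z ^ j‖ ≤ _
    have hval : HbarConn.dirDeriv v f (q.1, q.2.z) -
        ∑ j ∈ Finset.range N, da j q.1 * q.2.z ^ j =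
        mfderiv 𝓘(ℂ, E) 𝓘(ℂ, ℂ) G q.1 (v q.1) := by
      have hs := chart_deriv (x₀ := p.1) ks (isHolAt_slice (h1 q hq.1 hz))
      have hj := fun j => chart_deriv (x₀ := p.1) ks (ha j q hq.1)
      rw [hGq.2]
      simp only [HbarConn.dirDeriv]
      rw [hs.2]
      simp only [da, (hj _).2]
      have hder : HasFDerivAt (G ∘ φ.symm)
          (fderiv ℂ ((fun y => f (y, q.2.z)) ∘ φ.symm) (φ q.1) -
            ∑ j ∈ Finset.range N, q.2.z ^ j • fderiv ℂ (a j ∘ φ.symm) (φ q.1)) (φ q.1) := by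
        have hsum := HasFDerivAt.fun_sum (u := Finset.range N)
          (fun j _ => ((hj j).1.hasFDerivAt).mul_const (q.2.z ^ j))
        exact hs.1.hasFDerivAt.sub hsum
      rw [hder.fderiv]
      have hlin : ∀ (L : E →L[ℂ] ℂ) (K : ℕ → E →L[ℂ] ℂ) (c : ℕ → ℂ) (y : E),
          L y - ∑ j ∈ Finset.range N, K j y * c j = (L - ∑ j ∈ Finset.range N, c j • K j) y := by
        intro L K c y
        simp [mul_comm]
      exact hlin _ (fun j => fderiv ℂ (a j ∘ φ.symm) (φ q.1)) (fun j => q.2.z ^ j) (w q.1)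
    rw [hval, hGq.2]
    refine (ContinuousLinearMap.le_opNorm _ _).trans ?_
    have hC0 : 0 ≤ C * ‖q.2.z‖ ^ N := (norm_nonneg _).trans (hC q hq.1 hz)
    calc _ ≤ 2 * (C * ‖q.2.z‖ ^ N) / ρ * (‖w p.1‖ + 1) := by
          refine mul_le_mul hbound kw.le (norm_nonneg _) (by positivity)
      _ = _ := by ring

end Derivation

section Growth
variable (E : Type*) [NormedAddCommGroup E] [NormedSpace ℂ E] {M : Type*} [TopologicalSpace M]
  [ChartedSpace E M] (S : Opens RealBlowup)

/-- Exponential growth `A^exp`: `e^{-r/ħ} f ∈ A` for some `r` in the polar dual. -/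
def IsExp (p : M × RealBlowup) (f : M × ℂ → ℂ) : Prop :=
  ∃ r ∈ polarDual (S : Set RealBlowup), IsAE E p (expFac (-r) * f)

/-- Subexponential growth `A^se`: `e^{-c/ħ} f ∈ A` for all nonzero `c` in the polar dual. -/
def IsSe (p : M × RealBlowup) (f : M × ℂ → ℂ) : Prop :=
  IsExp E S p f ∧ ∀ c ∈ polarDual (S : Set RealBlowup), c ≠ 0 → IsAE E p (expFac (-c) * f)

/-- `A^ce`: elements of `A^exp` that extend continuously to `ħ = 0`, with boundary value a
holomorphic function of `x` alone. -/
def IsCe (p : M × RealBlowup) (f : M × ℂ → ℂ) : Prop :=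
  IsExp E S p f ∧ ∃ g : M → ℂ, ∀ᶠ q in 𝓝 p, MDifferentiableAt 𝓘(ℂ, E) 𝓘(ℂ, ℂ) g q.1 ∧
    (q.2.z = 0 → Tendsto (fun q' : M × RealBlowup => f (q'.1, q'.2.z))
      (𝓝[{q' | q'.2.z ≠ 0}] q) (𝓝 (g q.1)))

/-- `F^{≤ D}`: functions with `e^{r/ħ} f ∈ A` for all `r` in the intersection of `D` with the polar dual. -/
def IsFil (D : Set ℂ) (p : M × RealBlowup) (f : M × ℂ → ℂ) : Prop :=
  ∀ r ∈ D ∩ polarDual (S : Set RealBlowup), IsAE E p (expFac r * f)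

variable {E S} {p : M × RealBlowup} {f g : M × ℂ → ℂ}

theorem IsAE.of_expFac_neg {r r' : ℂ} (hp : p.2 ∈ S) (hr' : r' ∈ polarDual (S : Set RealBlowup))
    (h : IsAE E p (expFac (-r) * f)) : IsAE E p (expFac (-(r + r')) * f) := by
  have := (IsAE.expFac_neg (E := E) (M := M) S.2 hr' hp).mul h
  rwa [← mul_assoc, ← expFac_add, show -r' + -r = -(r + r') by ring] at this

theorem IsExp.hol (h : IsExp E S p f) (hz : p.2.z ≠ 0) : IsHolAt E f p := by
  obtain ⟨r, _, h⟩ := h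
  have h1 := MDifferentiableAt.mul (isHolAt_expFac (E := E) (M := M) r hz) (h.hol hz)
  have h2 : expFac r * (expFac (-r) * f) = f := by
    rw [← mul_assoc, ← expFac_add, add_neg_cancel, expFac_zero, one_mul]
  rwa [h2] at h1

theorem IsExp.eventually (h : IsExp E S p f) : ∀ᶠ q in 𝓝 p, IsExp E S q f := by
  obtain ⟨r, hr, h⟩ := h
  filter_upwards [h.eventually] with q hq using ⟨r, hr, hq⟩

theorem IsExp.of_isAE (h : IsAE E p f) : IsExp E S p f :=
  ⟨0, polarDual_zero, by simpa [expFac_zero] using h⟩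

theorem IsExp.add (hp : p.2 ∈ S) (hf : IsExp E S p f) (hg : IsExp E S p g) :
    IsExp E S p (f + g) := by
  obtain ⟨r, hr, hf⟩ := hf
  obtain ⟨r', hr', hg⟩ := hg
  refine ⟨r + r', polarDual_add hr hr', ?_⟩
  rw [mul_add]
  refine (hf.of_expFac_neg hp hr').add ?_
  rw [add_comm r r']
  exact hg.of_expFac_neg hp hr

theorem IsExp.mul (hf : IsExp E S p f) (hg : IsExp E S p g) : IsExp E S p (f * g) := by
  obtain ⟨r, hr, hf⟩ := hf
  obtain ⟨r', hr', hg⟩ := hg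
  refine ⟨r + r', polarDual_add hr hr', ?_⟩
  have := hf.mul hg
  rwa [show expFac (-r) * f * (expFac (-r') * g) = (expFac (-r) * expFac (-r')) * (f * g) by ring,
    ← expFac_add, show -r + -r' = -(r + r') by ring] at this

theorem IsExp.neg (hf : IsExp E S p f) : IsExp E S p (-f) := by
  obtain ⟨r, hr, hf⟩ := hf
  exact ⟨r, hr, by simpa using hf.neg⟩

theorem IsSe.add (hp : p.2 ∈ S) (hf : IsSe E S p f) (hg : IsSe E S p g) : IsSe E S p (f + g) :=
  ⟨hf.1.add hp hg.1, fun c hc h0 => by rw [mul_add]; exact (hf.2 c hc h0).add (hg.2 c hc h0)⟩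

theorem IsSe.neg (hf : IsSe E S p f) : IsSe E S p (-f) :=
  ⟨hf.1.neg, fun c hc h0 => by simpa using (hf.2 c hc h0).neg⟩

theorem IsSe.mul (hf : IsSe E S p f) (hg : IsSe E S p g) : IsSe E S p (f * g) := by
  refine ⟨hf.1.mul hg.1, fun c hc h0 => ?_⟩
  have hc2 : ((1 / 2 : ℝ) : ℂ) * c ∈ polarDual (S : Set RealBlowup) :=
    polarDual_smul hc (by norm_num)
  have h02 : ((1 / 2 : ℝ) : ℂ) * c ≠ 0 := mul_ne_zero (by norm_num) h0
  have := (hf.2 _ hc2 h02).mul (hg.2 _ hc2 h02)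
  rwa [show ∀ a : M × ℂ → ℂ, a * f * (a * g) = (a * a) * (f * g) from fun a => by ring,
    ← expFac_add, show -(((1 / 2 : ℝ) : ℂ) * c) + -(((1 / 2 : ℝ) : ℂ) * c) = -c by
      push_cast; ring] at this

theorem IsSe.of_isAE (hp : p.2 ∈ S) (h : IsAE E p f) : IsSe E S p f :=
  ⟨IsExp.of_isAE h, fun _ hc _ => (IsAE.expFac_neg S.2 hc hp).mul h⟩

theorem IsCe.add (hp : p.2 ∈ S) (hf : IsCe E S p f) (hg : IsCe E S p g) : IsCe E S p (f + g) := by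
  obtain ⟨h1, a, ha⟩ := hf
  obtain ⟨h2, b, hb⟩ := hg
  refine ⟨h1.add hp h2, a + b, ?_⟩
  filter_upwards [ha, hb] with q k1 k2
  exact ⟨k1.1.add k2.1, fun hz => (k1.2 hz).add (k2.2 hz)⟩

theorem IsCe.mul (hf : IsCe E S p f) (hg : IsCe E S p g) : IsCe E S p (f * g) := by
  obtain ⟨h1, a, ha⟩ := hf
  obtain ⟨h2, b, hb⟩ := hg
  refine ⟨h1.mul h2, a * b, ?_⟩
  filter_upwards [ha, hb] with q k1 k2
  exact ⟨k1.1.mul k2.1, fun hz => (k1.2 hz).mul (k2.2 hz)⟩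

theorem IsCe.const (c : ℂ) : IsCe E S p (fun _ => c) :=
  ⟨IsExp.of_isAE (IsAE.const c), fun _ => c, Eventually.of_forall fun _ =>
    ⟨mdifferentiableAt_const, fun _ => tendsto_const_nhds⟩⟩

theorem IsCe.neg (hf : IsCe E S p f) : IsCe E S p (-f) := by
  have := (IsCe.const (E := E) (S := S) (p := p) (-1)).mul hf
  rwa [show (fun _ => (-1 : ℂ)) * f = -f by funext q; simp] at this

theorem IsFil.add {D : Set ℂ} (hf : IsFil E S D p f) (hg : IsFil E S D p g) :
    IsFil E S D p (f + g) := fun r hr => by rw [mul_add]; exact (hf r hr).add (hg r hr)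

theorem IsFil.neg {D : Set ℂ} (hf : IsFil E S D p f) : IsFil E S D p (-f) := fun r hr => by
  simpa using (hf r hr).neg

theorem IsFil.zero {D : Set ℂ} : IsFil E S D p (0 : M × ℂ → ℂ) := fun r _ => by
  rw [mul_zero]; exact IsAE.const 0

/-- A factor of growth `e^{r₀/ħ}` costs a shift of the domain. -/
theorem IsFil.mul {D D' : Set ℂ} {r₀ : ℂ} (hr₀ : r₀ ∈ polarDual (S : Set RealBlowup))
    (hD : ∀ r ∈ D, r + r₀ ∈ D') (hf : IsAE E p (expFac (-r₀) * f)) (hg : IsFil E S D' p g) :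
    IsFil E S D p (f * g) := fun r hr => by
  have := hf.mul (hg (r + r₀) ⟨hD r hr.1, polarDual_add hr.2 hr₀⟩)
  rwa [show expFac (-r₀) * f * (expFac (r + r₀) * g) = (expFac (-r₀) * expFac (r + r₀)) * (f * g)
    by ring, ← expFac_add, show -r₀ + (r + r₀) = r by ring] at this

end Growth

/-- Bounded open neighbourhoods of the origin of `ℂ`. -/
abbrev Dom : Type := {D : Set ℂ // IsOpen D ∧ Bornology.IsBounded D ∧ (0 : ℂ) ∈ D}

noncomputable instance : SemilatticeSup Dom :=
  Subtype.semilatticeSup fun _ _ hx hy => ⟨hx.1.union hy.1, hx.2.1.union hy.2.1, Or.inl hx.2.2⟩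

instance : Nonempty Dom := ⟨⟨ball 0 1, isOpen_ball, isBounded_ball, mem_ball_self one_pos⟩⟩

theorem Dom.shift (D : Dom) (r₀ : ℂ) : ∃ D' : Dom, ∀ r ∈ D.1, r + r₀ ∈ D'.1 := by
  obtain ⟨R, hR⟩ := (isBounded_iff_subset_ball (0 : ℂ)).1 D.2.2.1
  refine ⟨⟨ball 0 (|R| + ‖r₀‖ + 1), isOpen_ball, isBounded_ball, mem_ball_self (by positivity)⟩,
    fun r hr => ?_⟩
  have h1 := hR hr
  rw [mem_ball_zero_iff] at *
  have := norm_add_le r r₀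
  have := le_abs_self R
  linarith

/-- Families of germs: a function near `p`, to be used modulo `F^{≤ D}`, for all `p` and `D`. -/
abbrev Fam (M : Type*) : Type _ := M × RealBlowup → Dom → M × ℂ → ℂ

section Sheaf
variable (E : Type*) [NormedAddCommGroup E] [NormedSpace ℂ E] {M : Type*} [TopologicalSpace M]
  [ChartedSpace E M] (S : Opens RealBlowup)

/-- `F` represents, near `p`, a section of the limit over `D` of the quotient sheaves `A^exp / F^{≤ D}`:
for every `D` and all large `D'`, the germ of `F p D'` represents the section modulo `F^{≤ D}`, compatibly
with the representatives chosen at the neighbouring points `q`. -/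
def IsCoh (F : Fam M) (p : M × RealBlowup) : Prop :=
  (∀ D, IsExp E S p (F p D)) ∧
  ∀ D : Dom, ∀ᶠ D' in atTop, ∀ᶠ q in 𝓝 p, ∀ᶠ D'' in atTop, ∀ᶠ q' in 𝓝 q,
    IsFil E S D.1 q' (F q D'' - F p D')

/-- The section that `F` represents near `p` is zero. -/
def IsNull (F : Fam M) (p : M × RealBlowup) : Prop :=
  ∀ D : Dom, ∀ᶠ D' in atTop, ∀ᶠ q in 𝓝 p, IsFil E S D.1 q (F p D')

variable {E S} {F G : Fam M} {p : M × RealBlowup}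

theorem eventually_mem (hp : p.2 ∈ S) : ∀ᶠ q : M × RealBlowup in 𝓝 p, q.2 ∈ S :=
  continuousAt_snd.eventually (S.2.mem_nhds hp)

theorem IsCoh.growth (hp : p.2 ∈ S) (hF : IsCoh E S F p) :
    ∃ r ∈ polarDual (S : Set RealBlowup),
      (∀ᶠ D' in atTop, ∀ᶠ q in 𝓝 p, IsAE E q (expFac (-r) * F p D')) ∧
      ∀ᶠ q in 𝓝 p, ∀ᶠ D'' in atTop, ∀ᶠ q' in 𝓝 q, IsAE E q' (expFac (-r) * F q D'') := by
  obtain ⟨D₀⟩ : Nonempty Dom := inferInstance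
  obtain ⟨D₁, h1⟩ := (hF.2 D₀).exists
  obtain ⟨r, hr, h2⟩ := hF.1 D₁
  have key : ∀ (q' : M × RealBlowup) (f : M × ℂ → ℂ), q'.2 ∈ S →
      IsAE E q' (expFac (-r) * F p D₁) → IsFil E S D₀.1 q' (f - F p D₁) →
      IsAE E q' (expFac (-r) * f) := by
    intro q' f hq' k1 k2
    have k3 := k2 0 ⟨D₀.2.2.2, polarDual_zero⟩
    rw [expFac_zero, one_mul] at k3
    have := ((IsAE.expFac_neg S.2 hr hq').mul k3).add k1
    rwa [← mul_add, sub_add_cancel] at this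
  refine ⟨r, hr, ?_, ?_⟩
  · filter_upwards [h1.self_of_nhds] with D' k
    filter_upwards [k, h2.eventually, eventually_mem hp] with q k1 k2 k3 using key q _ k3 k2 k1
  · filter_upwards [h1, h2.eventually.eventually_nhds, (eventually_mem hp).eventually_nhds]
      with q k1 k2 k3
    filter_upwards [k1] with D'' k1
    filter_upwards [k1, k2, k3] with q' k1 k2 k3 using key q' _ k3 k2 k1

theorem IsCoh.add (hp : p.2 ∈ S) (hF : IsCoh E S F p) (hG : IsCoh E S G p) :
    IsCoh E S (F + G) p := by
  refine ⟨fun D => (hF.1 D).add hp (hG.1 D), fun D => ?_⟩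
  filter_upwards [hF.2 D, hG.2 D] with D' h1 h2
  filter_upwards [h1, h2] with q h1 h2
  filter_upwards [h1, h2] with D'' h1 h2
  filter_upwards [h1, h2] with q' h1 h2
  have := h1.add h2
  rwa [show F q D'' - F p D' + (G q D'' - G p D') = (F + G) q D'' - (F + G) p D' by
    simp only [Pi.add_apply]; ring] at this

theorem IsCoh.neg (hF : IsCoh E S F p) : IsCoh E S (-F) p := by
  refine ⟨fun D => (hF.1 D).neg, fun D => ?_⟩
  filter_upwards [hF.2 D] with D' h1
  filter_upwards [h1] with q h1
  filter_upwards [h1] with D'' h1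
  filter_upwards [h1] with q' h1
  have := h1.neg
  rwa [show -(F q D'' - F p D') = (-F) q D'' - (-F) p D' by
    simp only [Pi.neg_apply]; ring] at this

theorem IsCoh.mul (hp : p.2 ∈ S) (hF : IsCoh E S F p) (hG : IsCoh E S G p) :
    IsCoh E S (F * G) p := by
  refine ⟨fun D => (hF.1 D).mul (hG.1 D), fun D => ?_⟩
  obtain ⟨r, hr, -, hF2⟩ := hF.growth hp
  obtain ⟨s, hs, hG1, -⟩ := hG.growth hp
  obtain ⟨Dr, hDr⟩ := D.shift r
  obtain ⟨Ds, hDs⟩ := D.shift s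
  filter_upwards [hF.2 Ds, hG.2 Dr, hG1] with D' h1 h2 h3
  filter_upwards [h1, h2, h3.eventually_nhds, hF2] with q h1 h2 h3 h4
  filter_upwards [h1, h2, h4] with D'' h1 h2 h4
  filter_upwards [h1, h2, h3, h4] with q' h1 h2 h3 h4
  have := (IsFil.mul hr hDr h4 h2).add (IsFil.mul hs hDs h3 h1)
  rwa [show F q D'' * (G q D'' - G p D') + G p D' * (F q D'' - F p D') =
    (F * G) q D'' - (F * G) p D' by simp only [Pi.mul_apply]; ring] at this

/-- A single function with values in `A^exp` near `p`, as a constant family. -/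
theorem IsCoh.of_const {f : M × ℂ → ℂ} (hf : IsExp E S p f) : IsCoh E S (fun _ _ => f) p :=
  ⟨fun _ => hf, fun _ => Eventually.of_forall fun _ => Eventually.of_forall fun _ =>
    Eventually.of_forall fun _ => Eventually.of_forall fun _ => by
      rw [sub_self]; exact IsFil.zero⟩

theorem IsNull.mul (hp : p.2 ∈ S) (hF : IsNull E S F p) (hG : IsCoh E S G p) :
    IsNull E S (G * F) p := fun D => by
  obtain ⟨s, hs, hG1, -⟩ := hG.growth hp
  obtain ⟨Ds, hDs⟩ := D.shift s
  filter_upwards [hF Ds, hG1] with D' h1 h2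
  filter_upwards [h1, h2] with q h1 h2 using IsFil.mul hs hDs h2 h1

variable (E S)

/-- Families that represent a section of `O^Λ` over the part of `W` that lies over `S`. -/
def LamFam (W : Opens (M × RealBlowup)) : Subring (Fam M) where
  carrier := {F | ∀ p ∈ W, p.2 ∈ S → IsCoh E S F p}
  zero_mem' _ _ _ := IsCoh.of_const (IsExp.of_isAE (IsAE.const 0))
  one_mem' _ _ _ := IsCoh.of_const (IsExp.of_isAE (IsAE.const 1))
  add_mem' h h' p hp hS := (h p hp hS).add hS (h' p hp hS)
  neg_mem' h p hp hS := (h p hp hS).neg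
  mul_mem' h h' p hp hS := (h p hp hS).mul hS (h' p hp hS)

/-- Families that represent the zero section. -/
def nullIdeal (W : Opens (M × RealBlowup)) : Ideal (LamFam E S W) where
  carrier := {F | ∀ p ∈ W, p.2 ∈ S → IsNull E S F.1 p}
  zero_mem' p _ _ D := Eventually.of_forall fun _ => Eventually.of_forall fun _ => IsFil.zero
  add_mem' {F G} h h' p hp hS D := by
    filter_upwards [h p hp hS D, h' p hp hS D] with D' h1 h2
    filter_upwards [h1, h2] with q h1 h2 using h1.add h2
  smul_mem' G F h p hp hS := (h p hp hS).mul hS (G.2 p hp hS)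

/-- Sections over `W ∩ (M × S)` of `O^Λ = lim_D A^exp / F^{≤ D}` (quotient sheaves, and their limit over
the bounded open neighbourhoods `D` of the origin). -/
abbrev OLam (W : Opens (M × RealBlowup)) : Type _ := LamFam E S W ⧸ nullIdeal E S W

/-- The section represented by a family. -/
def mkLam {W : Opens (M × RealBlowup)} : LamFam E S W →+* OLam E S W :=
  Ideal.Quotient.mk (nullIdeal E S W)

/-- Sections of `O^{se,Λ0} = lim_D A^se / (A^se ∩ F^{≤ D})`, as a subring of `O^Λ`. -/
def Ose (W : Opens (M × RealBlowup)) : Subring (OLam E S W) :=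
  Subring.map (mkLam E S)
    { carrier := {F | ∀ p ∈ W, p.2 ∈ S → ∀ D, ∀ᶠ q in 𝓝 p, IsSe E S q (F.1 p D)}
      zero_mem' := fun p _ hS _ => (eventually_mem hS).mono fun q hq =>
        IsSe.of_isAE hq (IsAE.const 0)
      one_mem' := fun p _ hS _ => (eventually_mem hS).mono fun q hq =>
        IsSe.of_isAE hq (IsAE.const 1)
      add_mem' := fun h h' p hp hS D => by
        filter_upwards [h p hp hS D, h' p hp hS D, eventually_mem hS] with q h1 h2 h3
          using h1.add h3 h2
      neg_mem' := fun h p hp hS D => (h p hp hS D).mono fun q hq => hq.neg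
      mul_mem' := fun h h' p hp hS D => by
        filter_upwards [h p hp hS D, h' p hp hS D] with q h1 h2 using h1.mul h2 }

/-- Sections of `O^{ce,Λ0} = lim_D A^ce / (A^ce ∩ F^{≤ D})`, as a subring of `O^Λ`. -/
def Oce (W : Opens (M × RealBlowup)) : Subring (OLam E S W) :=
  Subring.map (mkLam E S)
    { carrier := {F | ∀ p ∈ W, p.2 ∈ S → ∀ D, ∀ᶠ q in 𝓝 p, IsCe E S q (F.1 p D)}
      zero_mem' := fun p _ hS _ => Eventually.of_forall fun q => IsCe.const 0
      one_mem' := fun p _ hS _ => Eventually.of_forall fun q => IsCe.const 1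
      add_mem' := fun h h' p hp hS D => by
        filter_upwards [h p hp hS D, h' p hp hS D, eventually_mem hS] with q h1 h2 h3
          using h1.add h3 h2
      neg_mem' := fun h p hp hS D => (h p hp hS D).mono fun q hq => hq.neg
      mul_mem' := fun h h' p hp hS D => by
        filter_upwards [h p hp hS D, h' p hp hS D] with q h1 h2 using h1.mul h2 }

variable {E S}

/-- Restriction of sections. -/
def res {W W' : Opens (M × RealBlowup)} (h : W' ≤ W) : OLam E S W →+* OLam E S W' :=
  Ideal.quotientMap (nullIdeal E S W')
    (Subring.inclusion fun F (hF : F ∈ LamFam E S W) p hp hS => hF p (h hp) hS)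
    fun _ hF p hp hS => hF p (h hp) hS

/-- The section of `O^Λ` given by a function with values in `A^exp`. -/
def ofFun {W : Opens (M × RealBlowup)} (f : M × ℂ → ℂ)
    (hf : ∀ p ∈ W, p.2 ∈ S → IsExp E S p f) : OLam E S W :=
  mkLam E S ⟨fun _ _ => f, fun p hp hS => IsCoh.of_const (hf p hp hS)⟩

/-- The section `ħ`. -/
def hbar {W : Opens (M × RealBlowup)} : OLam E S W :=
  ofFun (fun q => q.2) fun _ _ _ => IsExp.of_isAE IsAE.hbar

theorem eventually_base {P : M → Prop} {W : Opens (M × RealBlowup)} (h : ∀ q ∈ W, P q.1)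
    {p : M × RealBlowup} (hp : p ∈ W) : ∀ᶠ x in 𝓝 p.1, P x := by
  have : ∀ᶠ x in 𝓝 p.1, (x, p.2) ∈ W :=
    (Continuous.prodMk_left p.2).continuousAt.eventually (W.2.mem_nhds hp)
  filter_upwards [this] with x hx using h _ hx

/-- A holomorphic function of `x` as a section of `O^Λ`. -/
def ofHol {W : Opens (M × RealBlowup)} (f : M → ℂ)
    (hf : ∀ q ∈ W, MDifferentiableAt 𝓘(ℂ, E) 𝓘(ℂ, ℂ) f q.1) : OLam E S W :=
  ofFun (fun q => f q.1) fun _ hp _ => IsExp.of_isAE (IsAE.of_base (eventually_base hf hp))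

end Sheaf

section Deriv
variable {E : Type*} [NormedAddCommGroup E] [NormedSpace ℂ E] [FiniteDimensional ℂ E]
  {M : Type*} [TopologicalSpace M]
  [ChartedSpace E M] [IsManifold 𝓘(ℂ, E) ω M] {S : Opens RealBlowup}

/-- The vector field `v` is holomorphic on the projection of `W` to `M`. -/
def HolVF (v : Π x : M, TangentSpace 𝓘(ℂ, E) x) (W : Opens (M × RealBlowup)) : Prop :=
  ∀ q ∈ W, MDifferentiableAt 𝓘(ℂ, E) 𝓘(ℂ, E).tangent
    (fun x => (⟨x, v x⟩ : TangentBundle 𝓘(ℂ, E) M)) q.1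

theorem HolVF.mono {v : Π x : M, TangentSpace 𝓘(ℂ, E) x} {W W' : Opens (M × RealBlowup)}
    (h : W' ≤ W) (hv : HolVF v W) : HolVF v W' := fun q hq => hv q (h hq)

theorem dirDeriv_expFac {v : Π x : M, TangentSpace 𝓘(ℂ, E) x} {f : M × ℂ → ℂ} {r : ℂ}
    {q : M × RealBlowup} (h : IsHolAt E f q) :
    dirDeriv v (expFac r * f) (q.1, q.2.z) =
      (expFac r * dirDeriv v f : M × ℂ → ℂ) (q.1, q.2.z) := by
  have := const_smul_mfderiv (isHolAt_slice h) (Complex.exp (r / q.2.z))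
  exact congrArg (fun T : TangentSpace 𝓘(ℂ, E) q.1 →L[ℂ] ℂ => T (v q.1)) this

theorem dirDeriv_sub {v : Π x : M, TangentSpace 𝓘(ℂ, E) x} {f g : M × ℂ → ℂ}
    {q : M × RealBlowup} (hf : IsHolAt E f q) (hg : IsHolAt E g q) :
    dirDeriv v (f - g) (q.1, q.2.z) = (dirDeriv v f - dirDeriv v g) (q.1, q.2.z) := by
  have := mfderiv_sub (isHolAt_slice hf) (isHolAt_slice hg)
  exact congrArg (fun T : TangentSpace 𝓘(ℂ, E) q.1 →L[ℂ] ℂ => T (v q.1)) this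

theorem dirDeriv_add {v : Π x : M, TangentSpace 𝓘(ℂ, E) x} {f g : M × ℂ → ℂ}
    {q : M × RealBlowup} (hf : IsHolAt E f q) (hg : IsHolAt E g q) :
    dirDeriv v (f + g) (q.1, q.2.z) = (dirDeriv v f + dirDeriv v g) (q.1, q.2.z) := by
  have := mfderiv_add (isHolAt_slice hf) (isHolAt_slice hg)
  exact congrArg (fun T : TangentSpace 𝓘(ℂ, E) q.1 →L[ℂ] ℂ => T (v q.1)) this

/-- The holomorphy condition on `v` near a point. -/
def HolNear (v : Π x : M, TangentSpace 𝓘(ℂ, E) x) (x : M) : Prop :=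
  ∀ᶠ y in 𝓝 x, MDifferentiableAt 𝓘(ℂ, E) 𝓘(ℂ, E).tangent
    (fun x => (⟨x, v x⟩ : TangentBundle 𝓘(ℂ, E) M)) y

variable {v : Π x : M, TangentSpace 𝓘(ℂ, E) x} {p : M × RealBlowup} {f g : M × ℂ → ℂ}

theorem HolNear.eventually (hv : HolNear v p.1) : ∀ᶠ q in 𝓝 p, HolNear v q.1 :=
  continuousAt_fst.eventually (Filter.Eventually.eventually_nhds hv)

theorem IsAE.dirDeriv_expFac {r : ℂ} (hv : HolNear v p.1)
    (hf : ∀ᶠ q in 𝓝 p, q.2.z ≠ 0 → IsHolAt E f q) (h : IsAE E p (expFac r * f)) :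
    IsAE E p (expFac r * HbarConn.dirDeriv v f) :=
  (h.dirDeriv hv).congr <| hf.mono fun _ hq hz => (HbarConn.dirDeriv_expFac (hq hz)).symm

theorem IsExp.hol_near (h : IsExp E S p f) : ∀ᶠ q in 𝓝 p, q.2.z ≠ 0 → IsHolAt E f q :=
  h.eventually.mono fun _ hq hz => hq.hol hz

theorem IsExp.dirDeriv (hv : HolNear v p.1) (h : IsExp E S p f) :
    IsExp E S p (dirDeriv v f) := by
  obtain ⟨r, hr, h'⟩ := id h
  exact ⟨r, hr, h'.dirDeriv_expFac hv h.hol_near⟩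

theorem IsSe.dirDeriv (hv : HolNear v p.1) (h : IsSe E S p f) : IsSe E S p (dirDeriv v f) :=
  ⟨h.1.dirDeriv hv, fun c hc h0 => (h.2 c hc h0).dirDeriv_expFac hv h.1.hol_near⟩

theorem IsFil.dirDeriv {D : Dom} (hv : HolNear v p.1)
    (h : IsFil E S D.1 p f) : IsFil E S D.1 p (dirDeriv v f) := fun r hr => by
  have h0 := h 0 ⟨D.2.2.2, polarDual_zero⟩
  rw [expFac_zero, one_mul] at h0
  exact (h r hr).dirDeriv_expFac hv (h0.eventually.mono fun _ hq hz => hq.hol hz)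

theorem IsFil.congr {D : Set ℂ} (h : IsFil E S D p f)
    (hfg : ∀ᶠ q in 𝓝 p, q.2.z ≠ 0 → g (q.1, q.2.z) = f (q.1, q.2.z)) : IsFil E S D p g :=
  fun r hr => (h r hr).congr <| hfg.mono fun q hq hz => by
    simp only [Pi.mul_apply]; rw [hq hz]

theorem mem_eventually {W : Opens (M × RealBlowup)} (hp : p ∈ W) (hS : p.2 ∈ S) :
    ∀ᶠ q in 𝓝 p, q ∈ W ∧ q.2 ∈ S :=
  (show ∀ᶠ q in 𝓝 p, q ∈ W from W.2.mem_nhds hp).and (eventually_mem hS)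

theorem HolVF.near {W : Opens (M × RealBlowup)} (hv : HolVF v W) (hp : p ∈ W) : HolNear v p.1 :=
  eventually_base hv hp

theorem vfDeriv_mem {W : Opens (M × RealBlowup)} (hv : HolVF v W) {F : Fam M}
    (hF : F ∈ LamFam E S W) : (fun p D => dirDeriv v (F p D)) ∈ LamFam E S W := by
  intro p hp hS
  refine ⟨fun D => ((hF p hp hS).1 D).dirDeriv (hv.near hp), fun D => ?_⟩
  filter_upwards [(hF p hp hS).2 D] with D' h1
  filter_upwards [h1, mem_eventually hp hS, ((hF p hp hS).1 D').eventually.eventually_nhds]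
    with q h1 hq hp'
  filter_upwards [h1] with D'' h1
  filter_upwards [h1, (hv.near hq.1).eventually, ((hF q hq.1 hq.2).1 D'').eventually, hp']
    with q' h1 h2 h3 h4
  refine (h1.dirDeriv h2).congr ?_
  filter_upwards [h3.hol_near, h4.hol_near] with y k1 k2 hz
  exact (dirDeriv_sub (k1 hz) (k2 hz)).symm

/-- Differentiation along a holomorphic vector field. -/
noncomputable def vfDeriv {W : Opens (M × RealBlowup)} (v : Π x : M, TangentSpace 𝓘(ℂ, E) x) (hv : HolVF v W)
    (a : OLam E S W) : OLam E S W :=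
  Quotient.map' (s₁ := Submodule.quotientRel _) (s₂ := Submodule.quotientRel _)
    (fun F : LamFam E S W => (⟨fun p D => dirDeriv v (F.1 p D), vfDeriv_mem hv F.2⟩ : LamFam E S W))
    (fun F G h => by
      rw [Submodule.quotientRel_def] at h ⊢
      intro p hp hS D
      filter_upwards [h p hp hS D] with D' h1
      filter_upwards [h1, (hv.near hp).eventually, ((F.2 p hp hS).1 D').eventually,
        ((G.2 p hp hS).1 D').eventually] with q h1 h2 h3 h4
      refine (h1.dirDeriv h2).congr ?_
      filter_upwards [h3.hol_near, h4.hol_near] with y k1 k2 hz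
      exact (dirDeriv_sub (k1 hz) (k2 hz)).symm) a

theorem vfDeriv_mem_Ose {W : Opens (M × RealBlowup)} (hv : HolVF v W)
    {a : OLam E S W} (ha : a ∈ Ose E S W) : vfDeriv v hv a ∈ Ose E S W := by
  obtain ⟨F, hF, rfl⟩ := ha
  refine ⟨⟨fun p D => dirDeriv v (F.1 p D), vfDeriv_mem hv F.2⟩, fun p hp hS D => ?_, rfl⟩
  filter_upwards [hF p hp hS D, (hv.near hp).eventually] with q h1 h2 using h1.dirDeriv h2

theorem ofFun_mem_Ose {W : Opens (M × RealBlowup)} {f : M × ℂ → ℂ}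
    (hf : ∀ p ∈ W, p.2 ∈ S → IsAE E p f) :
    ofFun f (fun p hp hS => IsExp.of_isAE (hf p hp hS)) ∈ Ose E S W := by
  refine ⟨_, fun p hp hS D => ?_, rfl⟩
  filter_upwards [(hf p hp hS).eventually, eventually_mem hS] with q h1 h2 using IsSe.of_isAE h2 h1

end Deriv

/-- The product of an open subset of `M` and an open subset of the real blow-up. -/
def prodOpen {M : Type*} [TopologicalSpace M] (U : Opens M) (S : Opens RealBlowup) :
    Opens (M × RealBlowup) :=
  ⟨(U : Set M) ×ˢ (S : Set RealBlowup), U.2.prod S.2⟩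

section Pull
variable {E : Type*} [NormedAddCommGroup E] [NormedSpace ℂ E] {M : Type*} [TopologicalSpace M]
  [ChartedSpace E M] {S : Opens RealBlowup}

/-- The inclusion of the slice `{x₀} × RealBlowup` in `M × RealBlowup`. -/
def sliceMap (x₀ : M) (p : PUnit.{1} × RealBlowup) : M × RealBlowup := (x₀, p.2)

theorem continuous_sliceMap (x₀ : M) : Continuous (sliceMap x₀) :=
  continuous_const.prodMk continuous_snd

/-- The open subset `{s | (x₀, s) ∈ W}`, as an open subset of a point times the blow-up. -/
def slice (x₀ : M) (W : Opens (M × RealBlowup)) : Opens (PUnit.{1} × RealBlowup) :=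
  Opens.comap ⟨sliceMap x₀, continuous_sliceMap x₀⟩ W

theorem slice_mono (x₀ : M) {W W' : Opens (M × RealBlowup)} (h : W' ≤ W) :
    slice x₀ W' ≤ slice x₀ W := fun _ hp => h hp

/-- Restriction of a function to `x = x₀`. -/
def atPoint (x₀ : M) (f : M × ℂ → ℂ) : PUnit.{1} × ℂ → ℂ := fun q => f (x₀, q.2)

variable {x₀ : M} {p : PUnit.{1} × RealBlowup} {f : M × ℂ → ℂ}

theorem IsAE.atPoint (h : IsAE E (sliceMap x₀ p) f) : IsAE PUnit.{1} p (atPoint x₀ f) := by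
  obtain ⟨V, hV, hp, h1, a, -, he⟩ := h
  refine ⟨sliceMap x₀ ⁻¹' V, hV.preimage (continuous_sliceMap x₀), hp, fun q hq hz => ?_,
    fun j _ => a j x₀, fun j q _ => mdifferentiableAt_const, fun N => ?_⟩
  · exact MDifferentiableAt.comp (I' := 𝓘(ℂ, E).prod 𝓘(ℂ, ℂ)) (q.1, q.2.z) (g := f)
      (f := fun q : PUnit.{1} × ℂ => (x₀, q.2)) (h1 _ hq hz)
      (mdifferentiableAt_const.prodMk mdifferentiableAt_snd)
  · obtain ⟨C, hC⟩ := he N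
    exact ⟨C, fun q hq hz => hC _ hq hz⟩

theorem IsExp.atPoint (h : IsExp E S (sliceMap x₀ p) f) : IsExp PUnit.{1} S p (atPoint x₀ f) := by
  obtain ⟨r, hr, h⟩ := h
  exact ⟨r, hr, h.atPoint⟩

theorem IsFil.atPoint {D : Set ℂ} (h : IsFil E S D (sliceMap x₀ p) f) :
    IsFil PUnit.{1} S D p (atPoint x₀ f) := fun r hr => (h r hr).atPoint

def famAt (x₀ : M) (F : Fam M) : Fam PUnit.{1} := fun p D => atPoint x₀ (F (sliceMap x₀ p) D)

theorem IsCoh.famAt {F : Fam M} (h : IsCoh E S F (sliceMap x₀ p)) :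
    IsCoh PUnit.{1} S (famAt x₀ F) p := by
  refine ⟨fun D => (h.1 D).atPoint, fun D => ?_⟩
  filter_upwards [h.2 D] with D' h1
  filter_upwards [(continuous_sliceMap x₀).continuousAt.eventually h1] with q h1
  filter_upwards [h1] with D'' h1
  filter_upwards [(continuous_sliceMap x₀).continuousAt.eventually h1] with q' h1 using h1.atPoint

theorem IsNull.famAt {F : Fam M} (h : IsNull E S F (sliceMap x₀ p)) :
    IsNull PUnit.{1} S (famAt x₀ F) p := fun D => by
  filter_upwards [h D] with D' h1
  filter_upwards [(continuous_sliceMap x₀).continuousAt.eventually h1] with q h1 using h1.atPoint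

/-- Evaluation at `x = x₀`, with values in the ring of the slice. -/
noncomputable def ev (x₀ : M) {W : Opens (M × RealBlowup)} : OLam E S W →+* OLam PUnit.{1} S (slice x₀ W) :=
  Ideal.quotientMap (nullIdeal PUnit.{1} S (slice x₀ W))
    { toFun := fun F => ⟨famAt x₀ F.1, fun p hp hS => (F.2 (sliceMap x₀ p) hp hS).famAt⟩
      map_one' := rfl
      map_mul' := fun _ _ => rfl
      map_zero' := rfl
      map_add' := fun _ _ => rfl }
    fun _ hF p hp hS => (hF (sliceMap x₀ p) hp hS).famAt

theorem ev_res (x₀ : M) {W W' : Opens (M × RealBlowup)} (h : W' ≤ W) (a : OLam E S W) :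
    ev x₀ (res h a) = res (slice_mono x₀ h) (ev x₀ a) := by
  obtain ⟨F, rfl⟩ := Ideal.Quotient.mk_surjective a
  rfl

end Pull

section Connection
variable (E : Type*) [NormedAddCommGroup E] [NormedSpace ℂ E] [FiniteDimensional ℂ E]
  {M : Type*} [TopologicalSpace M]
  [ChartedSpace E M] [IsManifold 𝓘(ℂ, E) ω M] (S : Opens RealBlowup)

/-- Holomorphic one-forms with values in `O^{ce,Λ0}` over `W`: `O_M`-linear maps from the sheaf of
holomorphic vector fields to `O^{ce,Λ0}`. -/
structure OneForm (W : Opens (M × RealBlowup)) where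
  app : ∀ W' : Opens (M × RealBlowup), W' ≤ W →
    ∀ v : Π x : M, TangentSpace 𝓘(ℂ, E) x, HolVF v W' → OLam E S W'
  mem : ∀ W' h v hv, app W' h v hv ∈ Oce E S W'
  app_add : ∀ W' h v w hv hw hvw,
    app W' h (fun x => v x + w x) hvw = app W' h v hv + app W' h w hw
  app_smul : ∀ W' h (f : M → ℂ) (hf : ∀ q ∈ W', MDifferentiableAt 𝓘(ℂ, E) 𝓘(ℂ, ℂ) f q.1) v hv hfv,
    app W' h (fun x => f x • v x) hfv = ofHol f hf * app W' h v hv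
  app_res : ∀ W' h W'' (h' : W'' ≤ W') v hv,
    app W'' (h'.trans h) v (hv.mono h') = res h' (app W' h v hv)

variable {E S} in
/-- The operator `ħ v + A(v)`. -/
noncomputable def OneForm.nabla {W : Opens (M × RealBlowup)} (A : OneForm E S W)
    {W' : Opens (M × RealBlowup)} (h : W' ≤ W) (v : Π x : M, TangentSpace 𝓘(ℂ, E) x)
    (hv : HolVF v W') (a : OLam E S W') : OLam E S W' :=
  hbar * vfDeriv v hv a + A.app W' h v hv * a

variable (M) in
/-- A rank-one flat `ħ`-connection over `M × S` with values in `O^{ce,Λ0}`: a locally free module of rank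
one with frames `e_i` over an open cover `dom i`, transition functions `e_j = g i j • e_i`, and
`∇ e_i = form i • e_i`, where `∇ (ψ s) = ħ dψ s + ψ ∇ s`. The field `gauge` says that `∇` is well defined on
overlaps, and `flat` that its curvature is zero. -/
structure RankOneConnection where
  ι : Type*
  dom : ι → Opens (M × RealBlowup)
  cover : ∀ p : M × RealBlowup, p.2 ∈ S → ∃ i, p ∈ dom i
  g : ∀ i j, OLam E S (dom i ⊓ dom j)
  g_mem : ∀ i j, g i j ∈ Oce E S (dom i ⊓ dom j)
  g_self : ∀ i, g i i = 1
  cocycle : ∀ i j k,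
    (res inf_le_left (g i j) : OLam E S (dom i ⊓ dom j ⊓ dom k)) *
      res (inf_le_inf_right _ inf_le_right) (g j k) =
      res (inf_le_inf_right _ inf_le_left) (g i k)
  form : ∀ i, OneForm E S (dom i)
  gauge : ∀ i j W' (h : W' ≤ dom i ⊓ dom j) v (hv : HolVF v W'),
    hbar * vfDeriv v hv (res h (g i j)) = res h (g i j) *
      ((form j).app W' (h.trans inf_le_right) v hv - (form i).app W' (h.trans inf_le_left) v hv)
  flat : ∀ i W' (h : W' ≤ dom i) v w u (hv : HolVF v W') (hw : HolVF w W') (hu : HolVF u W'),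
    (∀ q ∈ W', u q.1 = VectorField.mlieBracket 𝓘(ℂ, E) v w q.1) →
    (hbar : OLam E S W') * (vfDeriv v hv ((form i).app W' h w hw) - vfDeriv w hw ((form i).app W' h v hv)) =
      hbar * (form i).app W' h u hu

variable {E S}
namespace RankOneConnection
variable (𝓔 : RankOneConnection E M S)

/-- Sections over `W` of the module with coefficients in `O^Λ`, given by their coordinates
in the frames `e_i`. -/
@[ext]
structure Sec (W : Opens (M × RealBlowup)) where
  comp : ∀ i, OLam E S (W ⊓ 𝓔.dom i)
  compat : ∀ i j, res (inf_le_inf_left W inf_le_left) (comp i) =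
    (res inf_le_right (𝓔.g i j) : OLam E S (W ⊓ (𝓔.dom i ⊓ 𝓔.dom j))) *
      res (inf_le_inf_left W inf_le_right) (comp j)

variable {𝓔} in
/-- The equation `∇ ψ = 0`. -/
def Sec.IsSol {W : Opens (M × RealBlowup)} (ψ : 𝓔.Sec W) : Prop :=
  ∀ i W' (h : W' ≤ W ⊓ 𝓔.dom i) v (hv : HolVF v W'),
    (𝓔.form i).nabla (h.trans inf_le_right) v hv (res h (ψ.comp i)) = 0

/-- Sections over `W ∩ ({x₀} × S)` of the restriction of the module to `{x₀} × S`, with coefficients in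
the sheaf `O^Λ` of the slice: initial conditions at `x₀`. -/
@[ext]
structure Fibre (x₀ : M) (W : Opens (M × RealBlowup)) where
  comp : ∀ i, OLam PUnit.{1} S (slice x₀ (W ⊓ 𝓔.dom i))
  compat : ∀ i j, res (slice_mono x₀ (inf_le_inf_left W inf_le_left)) (comp i) =
    (res (slice_mono x₀ inf_le_right) (ev x₀ (𝓔.g i j)) :
      OLam PUnit.{1} S (slice x₀ (W ⊓ (𝓔.dom i ⊓ 𝓔.dom j)))) *
      res (slice_mono x₀ (inf_le_inf_left W inf_le_right)) (comp j)

variable {𝓔} in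
/-- The value of a section at `x = x₀`. -/
noncomputable def Sec.eval {W : Opens (M × RealBlowup)} (ψ : 𝓔.Sec W) (x₀ : M) : 𝓔.Fibre x₀ W where
  comp i := ev x₀ (ψ.comp i)
  compat i j := by
    have := congrArg (ev x₀) (ψ.compat i j)
    rw [map_mul] at this
    simp only [ev_res] at this
    exact this

variable {𝓔} in
/-- The element generates the fibre freely over `O^{se,Λ0}`: its coordinates are units of that ring. -/
def Fibre.IsFrame {x₀ : M} {W : Opens (M × RealBlowup)} (e : 𝓔.Fibre x₀ W) : Prop :=
  ∀ i, e.comp i ∈ Ose PUnit.{1} S (slice x₀ (W ⊓ 𝓔.dom i)) ∧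
    ∃ b ∈ Ose PUnit.{1} S (slice x₀ (W ⊓ 𝓔.dom i)), e.comp i * b = 1

/-- The section `a` has the boundary value `c` at the point `p` over `ħ = 0`. -/
def HasBdryValue {W : Opens (M × RealBlowup)} (a : OLam E S W) (p : M × RealBlowup) (c : ℂ) :
    Prop :=
  ∃ F : LamFam E S W, mkLam E S F = a ∧ ∀ᶠ D in atTop,
    Tendsto (fun q : M × RealBlowup => F.1 p D (q.1, q.2.z)) (𝓝[{q | q.2.z ≠ 0}] p) (𝓝 c)

/-- The characteristic variety in the cotangent bundle: the values at `ħ = 0` of the connection form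
in local frames. -/
def charVariety : Set (Σ x : M, TangentSpace 𝓘(ℂ, E) x →L[ℂ] ℂ) :=
  {η | ∃ s ∈ S, s.z = 0 ∧ ∃ i, (η.1, s) ∈ 𝓔.dom i ∧
    ∀ W' (h : W' ≤ 𝓔.dom i) v (hv : HolVF v W'), (η.1, s) ∈ W' →
      HasBdryValue ((𝓔.form i).app W' h v hv) (η.1, s) (η.2 (v η.1))}

end RankOneConnection

/-- A function on `M` holomorphic on the base of `W`. -/
def HolOn (α : M → ℂ) (W : Opens (M × RealBlowup)) : Prop :=
  ∀ q ∈ W, MDifferentiableAt 𝓘(ℂ, E) 𝓘(ℂ, ℂ) α q.1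

theorem ofHol_mem_Ose {α : M → ℂ} {W : Opens (M × RealBlowup)} (hα : HolOn (E := E) α W) :
    (ofHol α hα : OLam E S W) ∈ Ose E S W :=
  ofFun_mem_Ose fun _ hp _ => IsAE.of_base (eventually_base hα hp)

theorem hbar_mem_Ose {W : Opens (M × RealBlowup)} : (hbar : OLam E S W) ∈ Ose E S W :=
  ofFun_mem_Ose fun _ _ _ => IsAE.hbar

/-- The `ħ`-connection `ħ d + dα` of `E^{α/ħ}` on `O^{se,Λ0}`. -/
noncomputable def nablaExp {W : Opens (M × RealBlowup)} (α : M → ℂ) (hα : HolOn (E := E) α W)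
    (v : Π x : M, TangentSpace 𝓘(ℂ, E) x) (hv : HolVF v W) (a : Ose E S W) : Ose E S W :=
  ⟨hbar * vfDeriv v hv a.1 + vfDeriv v hv (ofHol α hα) * a.1,
    add_mem (mul_mem hbar_mem_Ose (vfDeriv_mem_Ose hv a.2))
      (mul_mem (vfDeriv_mem_Ose hv (ofHol_mem_Ose hα)) a.2)⟩

theorem res_mem_Ose {W W' : Opens (M × RealBlowup)} (h : W' ≤ W) {a : OLam E S W}
    (ha : a ∈ Ose E S W) : res h a ∈ Ose E S W' := by
  obtain ⟨F, hF, rfl⟩ := ha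
  exact ⟨⟨F.1, fun p hp hS => F.2 p (h hp) hS⟩,
    fun p hp hS D => hF p (h hp) hS D, rfl⟩

/-- Isomorphisms over `W₀` from `E^{α/ħ}`, which is `O^{se,Λ0}` with the `ħ`-connection `ħ d + dα`, to the
module `𝓔` with coefficients extended to `O^{se,Λ0}`: bijective on sections over every open subset of
`W₀`, compatible with restriction, linear over `O^{se,Λ0}` and commuting with the `ħ`-derivations
along holomorphic vector fields, that is, linear over the ring of `ħ`-differential operators. -/
structure ExpIso (𝓔 : RankOneConnection E M S) (α : M → ℂ) (W₀ : Opens (M × RealBlowup))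
    (hα : HolOn (E := E) α W₀) where
  app : ∀ W ≤ W₀, Ose E S W → 𝓔.Sec W
  app_mem : ∀ W h a i, (app W h a).comp i ∈ Ose E S (W ⊓ 𝓔.dom i)
  injective : ∀ W h, Function.Injective (app W h)
  surjective : ∀ W h (ψ : 𝓔.Sec W), (∀ i, ψ.comp i ∈ Ose E S (W ⊓ 𝓔.dom i)) →
    ∃ a, app W h a = ψ
  app_res : ∀ W h W' (h' : W' ≤ W) a i,
    (app W' (h'.trans h) ⟨res h' a.1, res_mem_Ose h' a.2⟩).comp i =
      res (inf_le_inf_right _ h') ((app W h a).comp i)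
  app_add : ∀ W h a b i, (app W h (a + b)).comp i = (app W h a).comp i + (app W h b).comp i
  app_mul : ∀ W h a b i, (app W h (a * b)).comp i = res inf_le_left a.1 * (app W h b).comp i
  app_nabla : ∀ W h v (hv : HolVF v W) a i,
    (app W h (nablaExp α (fun q hq => hα q (h hq)) v hv a)).comp i =
      (𝓔.form i).nabla inf_le_right v (hv.mono inf_le_left) ((app W h a).comp i)

end Connection

end HbarConn

namespace HbarConn

/-! If `0` is the only element of the polar dual of `S`, then `A^exp = A = F^{≤ D}`, all rings `O^Λ`
vanish and both claims are void. Otherwise a nonzero `c` in the dual satisfies `Re (c/ħ) ≥ δ/|ħ|`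
locally, with `δ > 0`, and the sheaves `A^exp`, `A^se`, `F^{≤ D}` can be described by exponential
rates, that is by bounds `f = O(e^{K/|ħ|})` (`Grow`). A section of `O^Λ` is then a function known
locally up to `O(e^{-R/|ħ|})` for each `R` (`Rep`). Equality of sections may be tested at the points
over `ħ = 0` (`eq_of_rep`), and sections are built from compatible sequences of local functions of
increasing precision (`exists_section`).

Part 1. Fix a precision `N`. In a chart, flatness says that representatives of the connection
coefficients form a one-form closed up to `O(e^{-N/|ħ|})`. Having continuous boundary values, they
are bounded, so a quantitative Poincaré lemma (`exists_primitive`) gives a bounded primitive `Φ` up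
to the same order, and `e^{-Φ/ħ}` is a unit of exponential growth that solves the equation to
precision about `N` (`exists_flatUnit`). By Gronwall's inequality the quotient of two such units is
constant along `M` up to a factor `1 + O(e^{-(N-1)/|ħ|})`. Over a fixed direction at `ħ = 0`,
comparing local units therefore gives a locally constant cocycle on `U` with values in the units in
`ħ` modulo such factors (`Gam`). Simple connectedness trivializes it
(`exists_trivialization_of_cocycle`), which gives flat sections of precision `N` normalized at `x₀`
(`Good`).

Normalized flat sections are unique to their precision, hence compatible in the precision, the point
and the direction. After each has been extended from a small sector to a whole neighbourhood of the
given point, up to an exponentially small error (`Grow.exists_extension`), they assemble into an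
invertible exact solution `ε` with value `1` at `x₀` (`exists_isFundamental`). Every section is `ε
w`; it is a solution exactly when `w` is constant along `M`, and such a `w` is determined by its
value at `x₀` (`eq_zero_of_vfDeriv_eq_zero`). Conversely the initial coordinate, pulled back to `U`,
is an admissible `w`. This proves existence and uniqueness where one frame covers the directions at
`x₀`; uniqueness lets these local solutions glue.

Part 2. Subtracting a constant, assume `α(x₀) = 0`. At `ħ = 0` the connection form takes values in
the characteristic variety, so `ħ` times the logarithmic derivative of `e^{α/ħ} ε` along `M` tends
to zero. Gronwall now compares absolute values at neighbouring points up to `e^{o(1/|ħ|)}`. Since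
the function is close to `1` at `x₀`, it and its inverse are subexponential over all of `U`
(`Good.subExp`). For a solution `ψ` whose value at `x₀` is a frame, `χ = e^{α/ħ} ψ` is therefore a
generator over `O^{se,Λ0}`, and `∇ χ = dα χ`; multiplication by `χ` is the isomorphism. -/

instance {E : Type*} [NormedAddCommGroup E] [NormedSpace ℂ E] {M : Type*} [TopologicalSpace M]
    [ChartedSpace E M] {E' : Type*} [NormedAddCommGroup E'] [NormedSpace ℂ E'] {M' : Type*}
    [TopologicalSpace M'] [ChartedSpace E' M'] {S : Opens RealBlowup}
    {W : Opens (M × RealBlowup)} {W' : Opens (M' × RealBlowup)} :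
    CoeFun (OLam E S W →+* OLam E' S W') fun _ => OLam E S W → OLam E' S W' := ⟨DFunLike.coe⟩

end HbarConn

namespace HbarConn

/-! ### Base points over `ħ = 0` in the blow-up. -/

section Basepoint

theorem RealBlowup.ext' {s t : RealBlowup} (hz : s.z = t.z) (hu : s.u = t.u) : s = t := by
  obtain ⟨z, u, h⟩ := s
  obtain ⟨z', u', h'⟩ := t
  dsimp only at hz hu
  subst hz hu
  rfl

/-- The point over `ħ = 0` with the same direction. -/
def RealBlowup.base (s : RealBlowup) : RealBlowup := ⟨0, s.u, by rw [norm_zero, Complex.ofReal_zero, zero_mul]⟩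

@[simp] theorem RealBlowup.base_z (s : RealBlowup) : s.base.z = 0 := rfl

@[simp] theorem RealBlowup.base_u (s : RealBlowup) : s.base.u = s.u := rfl

theorem RealBlowup.base_eq {s : RealBlowup} (h : s.z = 0) : s.base = s :=
  RealBlowup.ext' h.symm rfl

theorem RealBlowup.mem_nhds_sector {s : RealBlowup} {ε η : ℝ} (hε : ‖s.z‖ < ε) (hη : 0 < η) :
    {s' : RealBlowup | ‖s'.z‖ < ε ∧ dist s'.u s.u < η} ∈ 𝓝 s :=
  ((RealBlowup.isOpen_lt ε).inter
    ((isOpen_ball (x := s.u) (ε := η)).preimage RealBlowup.continuous_u)).mem_nhds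
    ⟨hε, mem_ball_self hη⟩

theorem RealBlowup.nhds_basis {s : RealBlowup} {V : Set RealBlowup} (hV : V ∈ 𝓝 s) :
    ∃ ε η : ℝ, ‖s.z‖ < ε ∧ 0 < η ∧ ∀ s', ‖s'.z‖ < ε → dist s'.u s.u < η → s' ∈ V := by
  obtain ⟨O, hOV, hO, hs⟩ := mem_nhds_iff.1 hV
  obtain ⟨ε, η, h1, h2, h3⟩ := RealBlowup.exists_nhd hO hs
  exact ⟨ε, η, h1, h2, fun s' k1 k2 => hOV (h3 s' k1 k2)⟩

theorem RealBlowup.tendsto_base (s : RealBlowup) : Tendsto RealBlowup.base (𝓝 s) (𝓝 s.base) := by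
  intro V hV
  obtain ⟨ε, η, h1, h2, h3⟩ := RealBlowup.nhds_basis hV
  have h4 : ‖s.z‖ < ‖s.z‖ + 1 := by linarith
  rw [mem_map]
  exact mem_of_superset (RealBlowup.mem_nhds_sector h4 h2) fun s' k => h3 _ (by simpa using h1) k.2

/-- Open sectors contain all smaller radii down to `ħ = 0`, so every open set around a point
contains its base point. The topology is thus not Hausdorff, and what holds near a point holds near
the boundary point below it. -/
theorem RealBlowup.nhds_base_le (s : RealBlowup) : 𝓝 s.base ≤ 𝓝 s := by
  intro V hV
  obtain ⟨ε, η, h1, h2, h3⟩ := RealBlowup.nhds_basis hV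
  exact mem_of_superset (RealBlowup.mem_nhds_sector (s := s.base) (ε := ε)
    (by simpa using (norm_nonneg _).trans_lt h1) h2) fun s' k => h3 s' k.1 k.2

theorem RealBlowup.base_mem {O : Set RealBlowup} (hO : IsOpen O) {s : RealBlowup} (hs : s ∈ O) :
    s.base ∈ O :=
  mem_of_mem_nhds (RealBlowup.nhds_base_le s (hO.mem_nhds hs))

variable {M : Type*} [TopologicalSpace M]

/-- The point over `ħ = 0` below a point of `M × RealBlowup`. -/
def basePt (p : M × RealBlowup) : M × RealBlowup := (p.1, p.2.base)

@[simp] theorem basePt_fst (p : M × RealBlowup) : (basePt p).1 = p.1 := rfl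

@[simp] theorem basePt_snd (p : M × RealBlowup) : (basePt p).2 = p.2.base := rfl

theorem basePt_eq {p : M × RealBlowup} (h : p.2.z = 0) : basePt p = p :=
  Prod.ext rfl (RealBlowup.base_eq h)

theorem nhds_basePt_le (p : M × RealBlowup) : 𝓝 (basePt p) ≤ 𝓝 p := by
  obtain ⟨x, s⟩ := p
  rw [basePt, nhds_prod_eq, nhds_prod_eq]
  exact Filter.prod_mono le_rfl (RealBlowup.nhds_base_le s)

theorem tendsto_basePt (p : M × RealBlowup) : Tendsto basePt (𝓝 p) (𝓝 (basePt p)) := by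
  obtain ⟨x, s⟩ := p
  rw [basePt, nhds_prod_eq, nhds_prod_eq]
  exact tendsto_id.prodMap (RealBlowup.tendsto_base s)

theorem basePt_mem {W : Opens (M × RealBlowup)} {p : M × RealBlowup} (hp : p ∈ W) :
    basePt p ∈ W :=
  mem_of_mem_nhds (nhds_basePt_le p (W.2.mem_nhds hp))

theorem base_mem {S : Opens RealBlowup} {s : RealBlowup} (hs : s ∈ S) : s.base ∈ S :=
  RealBlowup.base_mem S.2 hs

/-- The neighbourhood filter of `p` off `ħ = 0`. -/
def pnhds (p : M × RealBlowup) : Filter (M × RealBlowup) := 𝓝[{q | q.2.z ≠ 0}] p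

theorem eventually_pnhds {p : M × RealBlowup} {P : M × RealBlowup → Prop} :
    (∀ᶠ q in pnhds p, P q) ↔ ∀ᶠ q in 𝓝 p, q.2.z ≠ 0 → P q :=
  eventually_nhdsWithin_iff

theorem tendsto_z_pnhds {p : M × RealBlowup} (hp : p.2.z = 0) :
    Tendsto (fun q : M × RealBlowup => ‖q.2.z‖) (pnhds p) (𝓝[>] 0) := by
  rw [tendsto_nhdsWithin_iff]
  refine ⟨?_, eventually_pnhds.2 (Eventually.of_forall fun q hq => norm_pos_iff.2 hq)⟩
  rw [Metric.tendsto_nhds]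
  intro ε hε
  have h : ∀ᶠ q : M × RealBlowup in 𝓝 p, ‖q.2.z‖ < ε :=
    (isOpen_prod_lt ε).mem_nhds (by simpa [hp] using hε)
  exact (h.filter_mono nhdsWithin_le_nhds).mono fun q hq => by simpa using hq

theorem tendsto_exp_pnhds {p : M × RealBlowup} (hp : p.2.z = 0) {K : ℝ} (hK : K < 0) :
    Tendsto (fun q : M × RealBlowup => Real.exp (K / ‖q.2.z‖)) (pnhds p) (𝓝 0) := by
  refine Real.tendsto_exp_atBot.comp ?_
  have h1 := tendsto_inv_nhdsGT_zero.comp (tendsto_z_pnhds hp)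
  simpa [div_eq_mul_inv] using h1.const_mul_atTop_of_neg hK

end Basepoint

/-! ### Exponential rates in place of the growth sheaves. -/

section Growth

variable {E : Type*} [NormedAddCommGroup E] [NormedSpace ℂ E] {M : Type*} [TopologicalSpace M]
  [ChartedSpace E M] {S : Opens RealBlowup}

variable (E) in
/-- `f` is holomorphic near `p` off `ħ = 0` and is there `O (exp (K / |ħ|))`. -/
def Grow (K : ℝ) (p : M × RealBlowup) (f : M × ℂ → ℂ) : Prop :=
  (∀ᶠ q in 𝓝 p, q.2.z ≠ 0 → IsHolAt E f q) ∧
  (fun q : M × RealBlowup => f (q.1, q.2.z)) =O[pnhds p] fun q => Real.exp (K / ‖q.2.z‖)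

variable {K L : ℝ} {p : M × RealBlowup} {f g : M × ℂ → ℂ}

theorem grow_iff : Grow E K p f ↔ ∃ C : ℝ, 0 < C ∧ ∀ᶠ q in 𝓝 p, q.2.z ≠ 0 →
    IsHolAt E f q ∧ ‖f (q.1, q.2.z)‖ ≤ C * Real.exp (K / ‖q.2.z‖) := by
  constructor
  · rintro ⟨h1, h2⟩
    obtain ⟨C, hC, h⟩ := h2.exists_pos
    refine ⟨C, hC, ?_⟩
    filter_upwards [h1, eventually_pnhds.1 h.bound] with q k1 k2 hz
    exact ⟨k1 hz, by simpa using k2 hz⟩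
  · rintro ⟨C, hC, h⟩
    refine ⟨h.mono fun q k hz => (k hz).1, Asymptotics.IsBigO.of_bound C ?_⟩
    exact eventually_pnhds.2 (h.mono fun q k hz => by simpa using (k hz).2)

theorem Grow.mono (h : Grow E K p f) (hKL : K ≤ L) : Grow E L p f :=
  ⟨h.1, h.2.trans <| Asymptotics.IsBigO.of_bound 1 <| Eventually.of_forall fun q => by
    simp only [Real.norm_eq_abs, Real.abs_exp, one_mul, Real.exp_le_exp]
    gcongr⟩

theorem Grow.congr (h : Grow E K p f)
    (hfg : ∀ᶠ q in 𝓝 p, q.2.z ≠ 0 → g (q.1, q.2.z) = f (q.1, q.2.z)) : Grow E K p g := by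
  refine ⟨?_, h.2.congr' ?_ EventuallyEq.rfl⟩
  · obtain ⟨V, hVs, hV, hpV⟩ := eventually_nhds_iff.1 hfg
    filter_upwards [h.1, hV.mem_nhds hpV] with q k1 k2 hz
    refine (k1 hz).congr_of_eventuallyEq ?_
    filter_upwards [exists_lift hV k2 hz] with r hr
    obtain ⟨q', hq', e1, e2, e3⟩ := hr
    have := hVs q' hq' (e2 ▸ e3)
    rwa [e1, e2] at this
  · exact eventually_pnhds.2 (hfg.mono fun q k hz => (k hz).symm)

theorem Grow.add (hf : Grow E K p f) (hg : Grow E K p g) : Grow E K p (f + g) :=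
  ⟨by filter_upwards [hf.1, hg.1] with q h1 h2 hz using MDifferentiableAt.add (h1 hz) (h2 hz),
    hf.2.add hg.2⟩

theorem Grow.mul (hf : Grow E K p f) (hg : Grow E L p g) : Grow E (K + L) p (f * g) := by
  refine ⟨by filter_upwards [hf.1, hg.1] with q h1 h2 hz using MDifferentiableAt.mul (h1 hz) (h2 hz),
    (hf.2.mul hg.2).congr_right fun q => ?_⟩
  rw [← Real.exp_add, add_div]

theorem Grow.mul_le {N : ℝ} (hf : Grow E K p f) (hg : Grow E L p g) (h : K + L ≤ N) :
    Grow E N p (f * g) := (hf.mul hg).mono h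

theorem Grow.zero : Grow E K p (0 : M × ℂ → ℂ) :=
  ⟨Eventually.of_forall fun _ _ => mdifferentiableAt_const (c := (0 : ℂ)),
    Asymptotics.isBigO_zero _ _⟩

theorem Grow.of_bounded (h1 : ∀ᶠ q in 𝓝 p, q.2.z ≠ 0 → IsHolAt E f q)
    (h2 : ∃ C : ℝ, ∀ᶠ q in 𝓝 p, q.2.z ≠ 0 → ‖f (q.1, q.2.z)‖ ≤ C) : Grow E 0 p f := by
  obtain ⟨C, hC⟩ := h2
  refine ⟨h1, Asymptotics.IsBigO.of_bound C (eventually_pnhds.2 (hC.mono fun q k hz => ?_))⟩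
  simpa using k hz

theorem Grow.const (c : ℂ) : Grow E 0 p (fun _ : M × ℂ => c) :=
  Grow.of_bounded (Eventually.of_forall fun _ _ => mdifferentiableAt_const)
    ⟨‖c‖, Eventually.of_forall fun _ _ => le_rfl⟩

theorem Grow.one : Grow E 0 p (1 : M × ℂ → ℂ) := Grow.const 1

theorem Grow.neg (hf : Grow E K p f) : Grow E K p (-f) := by
  have := (Grow.const (E := E) (p := p) (-1)).mul hf
  rw [zero_add] at this
  exact this.congr (Eventually.of_forall fun q _ => by simp)

theorem Grow.sub (hf : Grow E K p f) (hg : Grow E K p g) : Grow E K p (f - g) := by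
  rw [sub_eq_add_neg]; exact hf.add hg.neg

theorem Grow.sub_comm (h : Grow E K p (f - g)) : Grow E K p (g - f) := by
  simpa using h.neg

theorem Grow.trans {k : M × ℂ → ℂ} (h : Grow E K p (f - g)) (h' : Grow E K p (g - k)) :
    Grow E K p (f - k) := by
  simpa using h.add h'

theorem Grow.of_isAE (h : IsAE E p f) : Grow E 0 p f := by
  obtain ⟨V, hV, hp, h1, a, -, he⟩ := h
  obtain ⟨C, hC⟩ := he 0
  have hVp := hV.mem_nhds hp
  exact Grow.of_bounded (by filter_upwards [hVp] with q hq hz using h1 q hq hz)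
    ⟨C, by filter_upwards [hVp] with q hq hz using by simpa using hC q hq hz⟩

theorem Grow.hbar : Grow E 0 p (fun q : M × ℂ => q.2) := Grow.of_isAE IsAE.hbar

theorem Grow.of_base_fun {a : M → ℂ}
    (ha : ∀ᶠ x in 𝓝 p.1, MDifferentiableAt 𝓘(ℂ, E) 𝓘(ℂ, ℂ) a x) :
    Grow E 0 p (fun q => a q.1) := Grow.of_isAE (IsAE.of_base ha)

/-- From `1 + t ≤ e^t` with `t = 1/|ħ|`. Any positive rate would do; the fixed rate `1` is the price
of each later division by `ħ`. -/
theorem Grow.inv_hbar : Grow E 1 p (fun q : M × ℂ => q.2⁻¹) := by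
  refine grow_iff.2 ⟨1, one_pos, Eventually.of_forall fun q hz => ⟨?_, ?_⟩⟩
  · have h : DifferentiableAt ℂ (fun z : ℂ => z⁻¹) q.2.z := differentiableAt_inv hz
    exact MDifferentiableAt.comp (I' := 𝓘(ℂ, ℂ)) (q.1, q.2.z) (g := fun z : ℂ => z⁻¹)
      (f := Prod.snd) h.mdifferentiableAt mdifferentiableAt_snd
  · have := Real.add_one_le_exp (1 / ‖q.2.z‖)
    rw [norm_inv, one_mul, ← one_div]
    linarith

theorem Grow.expFac (r : ℂ) : Grow E ‖r‖ p (expFac r : M × ℂ → ℂ) := by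
  refine grow_iff.2 ⟨1, one_pos, Eventually.of_forall fun q hz => ⟨isHolAt_expFac r hz, ?_⟩⟩
  rw [HbarConn.expFac, Complex.norm_exp, one_mul, Real.exp_le_exp]
  simpa using Complex.re_le_norm (r / q.2.z)

theorem Grow.eventually (h : Grow E K p f) : ∀ᶠ q in 𝓝 p, Grow E K q f := by
  obtain ⟨C, hC, h⟩ := grow_iff.1 h
  filter_upwards [h.eventually_nhds] with q hq using grow_iff.2 ⟨C, hC, hq⟩

theorem Grow.basePt (h : Grow E K p f) : Grow E K (basePt p) f := by
  obtain ⟨C, hC, h⟩ := grow_iff.1 h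
  exact grow_iff.2 ⟨C, hC, h.filter_mono (nhds_basePt_le p)⟩

theorem nhds_basis_prod {V : Set (M × RealBlowup)} (hV : V ∈ 𝓝 p) :
    ∃ A ∈ 𝓝 p.1, ∃ ε η : ℝ, ‖p.2.z‖ < ε ∧ 0 < η ∧
      ∀ x ∈ A, ∀ s : RealBlowup, ‖s.z‖ < ε → dist s.u p.2.u < η → (x, s) ∈ V := by
  obtain ⟨x, s⟩ := p
  obtain ⟨A, hA, B, hB, hAB⟩ := mem_nhds_prod_iff.1 hV
  obtain ⟨ε, η, h1, h2, h3⟩ := RealBlowup.nhds_basis hB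
  exact ⟨A, hA, ε, η, h1, h2, fun y hy s' k1 k2 => hAB ⟨hy, h3 s' k1 k2⟩⟩

theorem mem_nhds_sector_prod {A : Set M} (hA : A ∈ 𝓝 p.1) {ε η : ℝ} (hε : ‖p.2.z‖ < ε)
    (hη : 0 < η) : {q : M × RealBlowup | q.1 ∈ A ∧ ‖q.2.z‖ < ε ∧ dist q.2.u p.2.u < η} ∈ 𝓝 p := by
  have := prod_mem_nhds hA (RealBlowup.mem_nhds_sector hε hη)
  exact mem_of_superset this fun q hq => ⟨hq.1, hq.2⟩

/-- The growth rate is detected at `ħ = 0`. -/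
theorem Grow.of_basePt (h : Grow E L p f) (h0 : Grow E K (HbarConn.basePt p) f) :
    Grow E K p f := by
  obtain ⟨C, hC, h⟩ := grow_iff.1 h
  obtain ⟨C', hC', h0⟩ := grow_iff.1 h0
  obtain ⟨A, hA, ε, η, h1, h2, h3⟩ := nhds_basis_prod h
  obtain ⟨A', hA', ε', η', h1', h2', h3'⟩ := nhds_basis_prod h0
  simp only [basePt_fst, basePt_snd, RealBlowup.base_z, RealBlowup.base_u, norm_zero] at hA' h1' h3'
  set C'' := max C' (C * Real.exp (|L| / ε') * Real.exp (|K| / ε')) with hC''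
  refine grow_iff.2 ⟨C'', lt_max_of_lt_left hC', ?_⟩
  filter_upwards [mem_nhds_sector_prod (inter_mem hA hA') h1 (lt_min h2 h2')] with q hq hz
  obtain ⟨⟨k1, k1'⟩, k2, k3⟩ := hq
  have kk := h3 q.1 k1 q.2 k2 (k3.trans_le (min_le_left _ _)) hz
  refine ⟨kk.1, ?_⟩
  have hz' : 0 < ‖q.2.z‖ := norm_pos_iff.2 hz
  rcases lt_or_ge ‖q.2.z‖ ε' with hlt | hge
  · refine (h3' q.1 k1' q.2 hlt (k3.trans_le (min_le_right _ _)) hz).2.trans ?_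
    gcongr
    exact le_max_left _ _
  -- Here `|ħ| ≥ ε'`, so `e^{L/|ħ|}` is bounded above and `e^{K/|ħ|}` below by constants; the
  -- constant `C''` was chosen to absorb their ratio.
  · refine kk.2.trans ?_
    have e1 : L / ‖q.2.z‖ ≤ |L| / ε' := by
      refine (div_le_div_of_nonneg_right (le_abs_self L) hz'.le).trans ?_
      gcongr
    have e2 : -(|K| / ε') ≤ K / ‖q.2.z‖ := by
      have : |K| / ‖q.2.z‖ ≤ |K| / ε' := by gcongr
      have h5 : -(|K| / ‖q.2.z‖) ≤ K / ‖q.2.z‖ := by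
        rw [← neg_div]; gcongr; exact neg_abs_le K
      linarith
    have e3 : Real.exp (L / ‖q.2.z‖) ≤
        Real.exp (|L| / ε') * Real.exp (|K| / ε') * Real.exp (K / ‖q.2.z‖) := by
      rw [← Real.exp_add, ← Real.exp_add, Real.exp_le_exp]; linarith
    calc C * Real.exp (L / ‖q.2.z‖) ≤
        C * (Real.exp (|L| / ε') * Real.exp (|K| / ε') * Real.exp (K / ‖q.2.z‖)) := by gcongr
      _ = C * Real.exp (|L| / ε') * Real.exp (|K| / ε') * Real.exp (K / ‖q.2.z‖) := by ring
      _ ≤ _ := by gcongr; exact le_max_right _ _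

/-- Exponentially decaying functions have a trivial asymptotic expansion. -/
theorem Grow.isAE (h : Grow E K p f) (hK : K < 0) : IsAE E p f := by
  obtain ⟨C, hC, h⟩ := grow_iff.1 h
  obtain ⟨V, hVs, hV, hpV⟩ := eventually_nhds_iff.1 h
  refine ⟨V, hV, hpV, fun q hq hz => (hVs q hq hz).1, fun _ => 0,
    fun j q _ => mdifferentiableAt_const (c := (0 : ℂ)), fun N => ?_⟩
  have hK' : 0 < -K := by linarith
  refine ⟨C * (N.factorial / (-K) ^ N), fun q hq hz => ?_⟩
  have hz' : 0 < ‖q.2.z‖ := norm_pos_iff.2 hz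
  have h3 := Real.pow_div_factorial_le_exp ((-K) / ‖q.2.z‖) (by positivity) N
  simp only [Pi.zero_apply, zero_mul, Finset.sum_const_zero, sub_zero]
  refine (hVs q hq hz).2.trans ?_
  rw [mul_assoc]
  gcongr
  rw [show K / ‖q.2.z‖ = -((-K) / ‖q.2.z‖) by ring, Real.exp_neg]
  calc (Real.exp ((-K) / ‖q.2.z‖))⁻¹ ≤ (((-K) / ‖q.2.z‖) ^ N / N.factorial)⁻¹ := by gcongr
    _ = N.factorial / (-K) ^ N * ‖q.2.z‖ ^ N := by rw [div_pow]; field_simp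

/-- Direction-dependent bound for `e^{r/ħ}`. -/
theorem Grow.expFac_of_re {r : ℂ} (h : (r * (starRingEnd ℂ) (p.2.u : ℂ)).re < K) :
    Grow E K p (HbarConn.expFac r : M × ℂ → ℂ) := by
  refine grow_iff.2 ⟨1, one_pos, ?_⟩
  have hcont : Continuous fun q : M × RealBlowup => (r * (starRingEnd ℂ) (q.2.u : ℂ)).re := by
    have : Continuous fun q : M × RealBlowup => (q.2.u : ℂ) :=
      continuous_subtype_val.comp (RealBlowup.continuous_u.comp continuous_snd)
    fun_prop
  filter_upwards [(isOpen_lt hcont continuous_const).mem_nhds h] with q hq hz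
  refine ⟨isHolAt_expFac r hz, ?_⟩
  have hq : (r * (starRingEnd ℂ) (q.2.u : ℂ)).re < K := hq
  rw [HbarConn.expFac, Complex.norm_exp, one_mul, Real.exp_le_exp, re_div_eq]
  gcongr

/-- The polar dual of `S` has a nonzero element. Otherwise the sheaf `O^Λ` is zero. -/
class DualNontrivial (S : Opens RealBlowup) : Prop where
  exists_ne : ∃ c ∈ polarDual (S : Set RealBlowup), c ≠ 0

/-- One direction is `|e^{r/ħ}| ≤ e^{|r|/|ħ|}`. For the other, `polarDual_pos` gives a `c` in the
dual with `Re (c ū) > 0` in the direction `u` of `p`, so that a large multiple `t c` outweighs any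
rate `K`, and an exponentially decaying function has the zero expansion. -/
theorem isExp_iff [hD : DualNontrivial S] (hp : p.2 ∈ S) :
    IsExp E S p f ↔ ∃ K, Grow E K p f := by
  constructor
  · rintro ⟨r, hr, h⟩
    have h1 := (Grow.expFac (E := E) (p := p) r).mul (Grow.of_isAE h)
    rw [← mul_assoc, ← expFac_add, add_neg_cancel, expFac_zero, one_mul] at h1
    exact ⟨_, h1⟩
  · rintro ⟨K, h⟩
    obtain ⟨c, hc, hc0⟩ := hD.exists_ne
    have hpos := polarDual_pos S.2 hc hc0 hp
    set δ := (c * (starRingEnd ℂ) (p.2.u : ℂ)).re with hδ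
    set t : ℝ := (|K| + 2) / δ with ht
    have ht0 : 0 ≤ t := by positivity
    refine ⟨t * c, polarDual_smul hc ht0, ?_⟩
    have h1 : Grow E (-(|K| + 1)) p (expFac (-((t : ℂ) * c)) : M × ℂ → ℂ) := by
      refine Grow.expFac_of_re ?_
      rw [neg_mul, Complex.neg_re, mul_assoc, Complex.re_ofReal_mul, ← hδ, ht]
      rw [div_mul_cancel₀ _ hpos.ne']
      linarith
    exact (h1.mul_le h (N := -1) (by linarith [le_abs_self K])).isAE (by norm_num)

/-- For `|r| < R` the product with `e^{r/ħ}` still decays exponentially, hence has the zero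
expansion. -/
theorem Grow.isFil {D : Set ℂ} {R : ℝ} (h : Grow E (-R) p f) (hD : D ⊆ ball 0 R) :
    IsFil E S D p f := by
  intro r hr
  have hr' := hD hr.1
  rw [mem_ball_zero_iff] at hr'
  exact ((Grow.expFac (E := E) (p := p) r).mul h).isAE (by linarith)

/-- Converse to `Grow.isFil`: it suffices to test a single `r = t c` in the dual with `Re (r ū) > R`
in the direction of `p`. That inequality is open in the direction, so one ball containing `r` serves
all nearby points. -/
theorem exists_dom_grow [hD : DualNontrivial S] (hp : p.2 ∈ S) (R : ℝ) :
    ∃ D : Dom, ∀ᶠ q in 𝓝 p, ∀ D' : Dom, D ≤ D' → ∀ f : M × ℂ → ℂ, IsFil E S D'.1 q f →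
      Grow E (-R) q f := by
  obtain ⟨c, hc, hc0⟩ := hD.exists_ne
  have hpos := polarDual_pos S.2 hc hc0 hp
  set δ := (c * (starRingEnd ℂ) (p.2.u : ℂ)).re with hδ
  set t : ℝ := (2 * |R| + 2) / δ with ht
  have ht0 : 0 ≤ t := by positivity
  set r : ℂ := t * c with hr
  have hcont : Continuous fun q : M × RealBlowup => ((-r) * (starRingEnd ℂ) (q.2.u : ℂ)).re := by
    have : Continuous fun q : M × RealBlowup => (q.2.u : ℂ) :=
      continuous_subtype_val.comp (RealBlowup.continuous_u.comp continuous_snd)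
    fun_prop
  have hlt : ((-r) * (starRingEnd ℂ) (p.2.u : ℂ)).re < -R := by
    rw [neg_mul, Complex.neg_re, hr, mul_assoc, Complex.re_ofReal_mul, ← hδ, ht]
    rw [div_mul_cancel₀ _ hpos.ne']
    have := le_abs_self R
    have := abs_nonneg R
    linarith
  refine ⟨⟨ball 0 (‖r‖ + 1), isOpen_ball, isBounded_ball, mem_ball_self (by positivity)⟩, ?_⟩
  filter_upwards [(isOpen_lt hcont continuous_const).mem_nhds hlt] with q hq D' hD' f hf
  have hq : ((-r) * (starRingEnd ℂ) (q.2.u : ℂ)).re < -R := hq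
  have h1 := hf r ⟨hD' (show r ∈ ball (0 : ℂ) (‖r‖ + 1) by rw [mem_ball_zero_iff]; linarith),
    polarDual_smul hc ht0⟩
  have h2 := (Grow.expFac_of_re (E := E) (p := q) hq).mul (Grow.of_isAE h1)
  rwa [← mul_assoc, ← expFac_add, neg_add_cancel, expFac_zero, one_mul, add_zero] at h2

theorem Dom.eventually_subset_ball (D : Dom) : ∃ R : ℝ, D.1 ⊆ ball 0 R :=
  (isBounded_iff_subset_ball (0 : ℂ)).1 D.2.2.1

/-- The subexponential functions in terms of growth. -/
theorem isSe_iff [hD : DualNontrivial S] (hp : p.2 ∈ S) :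
    IsSe E S p f ↔ ∀ ε > 0, Grow E ε p f := by
  constructor
  · rintro ⟨h, h'⟩ ε hε
    obtain ⟨c, hc, hc0⟩ := hD.exists_ne
    have hcn : 0 < ‖c‖ := norm_pos_iff.2 hc0
    set t : ℝ := ε / ‖c‖ with ht
    have ht0 : 0 < t := by positivity
    have h1 := h' (t * c) (polarDual_smul hc ht0.le)
      (mul_ne_zero (by exact_mod_cast ht0.ne') hc0)
    have h2 := (Grow.expFac (E := E) (p := p) ((t : ℂ) * c)).mul (Grow.of_isAE h1)
    rw [← mul_assoc, ← expFac_add, add_neg_cancel, expFac_zero, one_mul] at h2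
    refine h2.mono (le_of_eq ?_)
    rw [norm_mul, Complex.norm_real, Real.norm_of_nonneg ht0.le, ht]
    field_simp; simp
  · intro h
    refine ⟨(isExp_iff hp).2 ⟨1, h 1 one_pos⟩, fun c hc hc0 => ?_⟩
    have hpos := polarDual_pos S.2 hc hc0 hp
    set δ := (c * (starRingEnd ℂ) (p.2.u : ℂ)).re with hδ
    have h1 : Grow E (-(δ / 2)) p (HbarConn.expFac (-c) : M × ℂ → ℂ) := by
      refine Grow.expFac_of_re ?_
      rw [neg_mul, Complex.neg_re, ← hδ]; linarith
    exact (h1.mul (h (δ / 4) (by positivity))).isAE (by linarith)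

end Growth

/-! ### Derivatives along `M` of functions of exponential growth. -/

section GrowthDerivative

variable {E : Type*} [NormedAddCommGroup E] [NormedSpace ℂ E] [FiniteDimensional ℂ E]
  {M : Type*} [TopologicalSpace M] [ChartedSpace E M] [IsManifold 𝓘(ℂ, E) ω M]
  {K : ℝ} {p : M × RealBlowup} {f g : M × ℂ → ℂ} {v : Π x : M, TangentSpace 𝓘(ℂ, E) x}

/-- Twist by `e^{-r/ħ}` with `r = t u`, where `u` is the direction of `p` and `K < t < L`. The
product decays exponentially and so lies in `A`, which is stable under derivations; the factor does
not depend on `x` and can be removed afterwards. Directions near `u` vary, which is why an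
arbitrarily small part of the rate is lost. -/
theorem Grow.dirDeriv (hv : HolNear v p.1) (h : Grow E K p f) {L : ℝ} (hL : K < L) :
    Grow E L p (HbarConn.dirDeriv v f) := by
  set u : ℂ := (p.2.u : ℂ) with hu
  have hre : ∀ t : ℝ, ((t : ℂ) * u * (starRingEnd ℂ) u).re = t := fun t => by
    rw [mul_assoc, Complex.mul_conj, Complex.normSq_eq_norm_sq, hu, Circle.norm_coe]
    simp
  set t : ℝ := (K + L) / 2 with ht
  set r : ℂ := (t : ℂ) * u with hr
  set η : ℝ := (L - K) / 4 with hη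
  have h1 : Grow E (-t + η) p (HbarConn.expFac (-r) : M × ℂ → ℂ) :=
    Grow.expFac_of_re (by rw [neg_mul, Complex.neg_re, hre]; linarith)
  have h2 : IsAE E p (HbarConn.expFac (-r) * f) := (h1.mul h).isAE (by linarith)
  have h3 := h2.dirDeriv_expFac hv h.1
  have h4 : Grow E L p (HbarConn.expFac r : M × ℂ → ℂ) :=
    Grow.expFac_of_re (by rw [hre]; linarith)
  have h5 := h4.mul (Grow.of_isAE h3)
  rwa [← mul_assoc, ← expFac_add, add_neg_cancel, expFac_zero, one_mul, add_zero] at h5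

theorem dirDeriv_mul {q : M × RealBlowup} (hf : IsHolAt E f q) (hg : IsHolAt E g q) :
    dirDeriv v (f * g) (q.1, q.2.z) =
      (dirDeriv v f * g + f * dirDeriv v g) (q.1, q.2.z) := by
  have := ((isHolAt_slice hf).hasMFDerivAt.mul (isHolAt_slice hg).hasMFDerivAt).mfderiv
  have h2 := congrArg (fun T : TangentSpace 𝓘(ℂ, E) q.1 →L[ℂ] ℂ => T (v q.1)) this
  refine h2.trans ?_
  change f (q.1, q.2.z) * dirDeriv v g (q.1, q.2.z) + g (q.1, q.2.z) * dirDeriv v f (q.1, q.2.z) =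
    dirDeriv v f (q.1, q.2.z) * g (q.1, q.2.z) + f (q.1, q.2.z) * dirDeriv v g (q.1, q.2.z)
  ring

theorem dirDeriv_comp {F F' : ℂ → ℂ → ℂ} {q : M × RealBlowup} (hf : IsHolAt E f q)
    (hF : HasDerivAt (fun w => F w q.2.z) (F' (f (q.1, q.2.z)) q.2.z) (f (q.1, q.2.z))) :
    dirDeriv v (fun r => F (f r) r.2) (q.1, q.2.z) =
      F' (f (q.1, q.2.z)) q.2.z * dirDeriv v f (q.1, q.2.z) := by
  have h1 := (isHolAt_slice hf).hasMFDerivAt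
  have h2 := hF.hasFDerivAt.hasMFDerivAt
  have h3 := HasMFDerivAt.comp (g := fun w => F w q.2.z) (f := fun y => f (y, q.2.z)) q.1 h2 h1
  have h4 := congrArg (fun T : TangentSpace 𝓘(ℂ, E) q.1 →L[ℂ] ℂ => T (v q.1)) h3.mfderiv
  refine h4.trans ?_
  rw [mul_comm]
  rfl

theorem dirDeriv_snd (c : ℂ → ℂ) (q : M × ℂ) :
    dirDeriv v (fun r => c r.2) q = 0 := by
  have := mfderiv_const (I := 𝓘(ℂ, E)) (I' := 𝓘(ℂ, ℂ)) (x := q.1) (c := c q.2)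
  exact congrArg (fun T : TangentSpace 𝓘(ℂ, E) q.1 →L[ℂ] ℂ => T (v q.1)) this

end GrowthDerivative

end HbarConn

namespace HbarConn

/-! ### Sections of `O^Λ` through local representatives of finite precision. -/

section Rep

variable {E : Type*} [NormedAddCommGroup E] [NormedSpace ℂ E] {M : Type*} [TopologicalSpace M]
  [ChartedSpace E M] {S : Opens RealBlowup} {W W' : Opens (M × RealBlowup)}
  {R R' K L N : ℝ} {p : M × RealBlowup} {f g : M × ℂ → ℂ} {a b : OLam E S W}

/-- By `exists_dom_grow` and `Grow.isFil`, the filtrations by domains `D` and by decay rates `R` are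
cofinal in each other. The innermost quantifier over points `q'` disappears because a growth bound
at `q` already holds near `q`. -/
theorem isCoh_iff [DualNontrivial S] {F : Fam M} (hp : p.2 ∈ S) :
    IsCoh E S F p ↔ (∀ D, ∃ K, Grow E K p (F p D)) ∧
      ∀ R : ℝ, ∀ᶠ D' in atTop, ∀ᶠ q in 𝓝 p, ∀ᶠ D'' in atTop, Grow E (-R) q (F q D'' - F p D') := by
  refine and_congr (forall_congr' fun D => isExp_iff hp) ⟨fun h R => ?_, fun h D => ?_⟩
  · obtain ⟨D, hD⟩ := exists_dom_grow (E := E) hp R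
    filter_upwards [h D] with D' h
    filter_upwards [h, hD] with q h k
    filter_upwards [h] with D'' h using k D le_rfl _ h.self_of_nhds
  · obtain ⟨R, hR⟩ := D.eventually_subset_ball
    filter_upwards [h R] with D' h
    filter_upwards [h] with q h
    filter_upwards [h] with D'' h
    filter_upwards [h.eventually] with q' h using h.isFil hR

theorem isNull_iff [DualNontrivial S] {F : Fam M} (hp : p.2 ∈ S) :
    IsNull E S F p ↔ ∀ R : ℝ, ∀ᶠ D' in atTop, Grow E (-R) p (F p D') := by
  refine ⟨fun h R => ?_, fun h D => ?_⟩
  · obtain ⟨D, hD⟩ := exists_dom_grow (E := E) hp R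
    filter_upwards [h D] with D' h using hD.self_of_nhds D le_rfl _ h.self_of_nhds
  · obtain ⟨R, hR⟩ := D.eventually_subset_ball
    filter_upwards [h R] with D' h
    filter_upwards [h.eventually] with q' h using h.isFil hR

/-- Near `p`, the function `f` represents the section `a` up to `O (exp (-R / |ħ|))`. -/
def Rep (R : ℝ) (p : M × RealBlowup) (a : OLam E S W) (f : M × ℂ → ℂ) : Prop :=
  ∃ F : LamFam E S W, mkLam E S F = a ∧ ∀ᶠ D in atTop, Grow E (-R) p (F.1 p D - f)

theorem Rep.mono (h : Rep R p a f) (hR : R' ≤ R) : Rep R' p a f := by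
  obtain ⟨F, hF, h⟩ := h
  exact ⟨F, hF, h.mono fun D h => h.mono (by linarith)⟩

theorem Rep.of_grow (h : Rep R p a f) (hg : Grow E (-R) p (f - g)) : Rep R p a g := by
  obtain ⟨F, hF, h⟩ := h
  exact ⟨F, hF, h.mono fun D h => h.trans hg⟩

theorem Rep.congr (h : Rep R p a f)
    (hfg : ∀ᶠ q in 𝓝 p, q.2.z ≠ 0 → g (q.1, q.2.z) = f (q.1, q.2.z)) : Rep R p a g :=
  h.of_grow (Grow.zero.congr (hfg.mono fun q h hz => by simp [h hz]))

theorem mkLam_surjective (a : OLam E S W) : ∃ F, mkLam E S F = a :=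
  Ideal.Quotient.mk_surjective a

section Dual
variable [DualNontrivial S]

/-- Two families of the same section differ by a null family, so a representative may be tested on
any of them. -/
theorem rep_mk {F : LamFam E S W} (hp : p ∈ W) (hS : p.2 ∈ S) :
    Rep R p (mkLam E S F) f ↔ ∀ᶠ D in atTop, Grow E (-R) p (F.1 p D - f) := by
  refine ⟨fun ⟨G, hG, h⟩ => ?_, fun h => ⟨F, rfl, h⟩⟩
  have h1 : F - G ∈ nullIdeal E S W := Ideal.Quotient.eq.1 hG.symm
  filter_upwards [h, (isNull_iff hS).1 (h1 p hp hS) R] with D k1 k2 using k2.trans k1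

theorem exists_rep (a : OLam E S W) (hp : p ∈ W) (hS : p.2 ∈ S) (R : ℝ) : ∃ f, Rep R p a f := by
  obtain ⟨F, rfl⟩ := mkLam_surjective a
  obtain ⟨D', h⟩ := (((isCoh_iff hS).1 (F.2 p hp hS)).2 R).exists
  exact ⟨F.1 p D', F, rfl, h.self_of_nhds⟩

theorem Rep.exists_grow (h : Rep R p a f) (hp : p ∈ W) (hS : p.2 ∈ S) : ∃ K, Grow E K p f := by
  obtain ⟨F, rfl, h⟩ := h
  obtain ⟨D, h⟩ := h.exists
  obtain ⟨K, hK⟩ := ((isCoh_iff hS).1 (F.2 p hp hS)).1 D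
  refine ⟨max K (-R), ?_⟩
  simpa using (hK.mono (le_max_left K (-R))).sub (h.mono (le_max_right K (-R)))

theorem Rep.sub_grow (h : Rep R p a f) (h' : Rep R p a g) (hp : p ∈ W) (hS : p.2 ∈ S) :
    Grow E (-R) p (f - g) := by
  obtain ⟨F, rfl⟩ := mkLam_surjective a
  obtain ⟨D, k, k'⟩ := (((rep_mk hp hS).1 h).and ((rep_mk hp hS).1 h')).exists
  exact k.sub_comm.trans k'

/-- Coherence of the family compares its members at `q` with its members at `p`, and those are close
to `f`. -/
theorem Rep.eventually (h : Rep R p a f) (hp : p ∈ W) (hS : p.2 ∈ S) :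
    ∀ᶠ q in 𝓝 p, Rep R q a f := by
  obtain ⟨F, rfl, h⟩ := h
  obtain ⟨D', h, h'⟩ := (h.and (((isCoh_iff hS).1 (F.2 p hp hS)).2 R)).exists
  filter_upwards [h', h.eventually] with q k k'
  exact ⟨F, rfl, k.mono fun D'' k => k.trans k'⟩

theorem Rep.basePt (h : Rep R p a f) (hp : p ∈ W) (hS : p.2 ∈ S) :
    Rep R (HbarConn.basePt p) a f :=
  ((h.eventually hp hS).filter_mono (nhds_basePt_le p)).self_of_nhds

/-- Sections are determined by their representatives over `ħ = 0`. -/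
theorem eq_of_rep (h : ∀ p ∈ W, p.2 ∈ S → p.2.z = 0 → ∀ R : ℝ, ∃ f, Rep R p a f ∧ Rep R p b f) :
    a = b := by
  obtain ⟨F, hF⟩ := mkLam_surjective a
  obtain ⟨G, hG⟩ := mkLam_surjective b
  rw [← hF, ← hG]
  refine Ideal.Quotient.eq.2 fun p hp hS => (isNull_iff hS).2 fun R => ?_
  obtain ⟨f, hf⟩ := exists_rep a hp hS R
  obtain ⟨g, hg⟩ := exists_rep b hp hS R
  obtain ⟨K, hK⟩ := hf.exists_grow hp hS
  obtain ⟨L, hL⟩ := hg.exists_grow hp hS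
  have hp' := basePt_mem hp
  have hS' := base_mem hS
  obtain ⟨k, k1, k2⟩ := h _ hp' hS' rfl R
  -- The hypothesis only speaks of `ħ = 0`; since `f` and `g` represent their sections at the base
  -- point too, their difference is small there, and its rate at `p` is the rate at the base point.
  have hfg : Grow E (-R) p (f - g) := Grow.of_basePt (L := max K L)
    ((hK.mono (le_max_left _ _)).sub (hL.mono (le_max_right _ _)))
    (((hf.basePt hp hS).sub_grow k1 hp' hS').trans
      (k2.sub_grow (hg.basePt hp hS) hp' hS'))
  rw [← hF] at hf
  rw [← hG] at hg
  filter_upwards [(rep_mk hp hS).1 hf, (rep_mk hp hS).1 hg] with D k k'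
  exact (k.trans hfg).trans k'.sub_comm

theorem Rep.add (hf : Rep R p a f) (hg : Rep R p b g) : Rep R p (a + b) (f + g) := by
  obtain ⟨F, rfl, hF⟩ := hf
  obtain ⟨G, rfl, hG⟩ := hg
  refine ⟨F + G, map_add _ _ _, ?_⟩
  filter_upwards [hF, hG] with D h h'
  have := h.add h'
  rwa [show F.1 p D - f + (G.1 p D - g) = (F + G).1 p D - (f + g) from by
    change _ = F.1 p D + G.1 p D - (f + g); ring] at this

theorem Rep.neg (hf : Rep R p a f) : Rep R p (-a) (-f) := by
  obtain ⟨F, rfl, hF⟩ := hf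
  refine ⟨-F, map_neg _ _, ?_⟩
  filter_upwards [hF] with D h
  have := h.neg
  rwa [show -(F.1 p D - f) = (-F).1 p D - -f from by
    change _ = -(F.1 p D) - -f; ring] at this

theorem Rep.sub (hf : Rep R p a f) (hg : Rep R p b g) : Rep R p (a - b) (f - g) := by
  rw [sub_eq_add_neg, sub_eq_add_neg]; exact hf.add hg.neg

/-- Expand the error as `(F - f)(G - g) + (F - f) g + f (G - g)`: its terms have the rates `-(R +
R')`, `L - R` and `K - R'`. The growth of each factor is lost from the precision of the other. -/
theorem Rep.mul (hf : Rep R p a f) (hg : Rep R' p b g) (hK : Grow E K p f) (hL : Grow E L p g)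
    (h1 : N + L ≤ R) (h2 : N + K ≤ R') (h3 : N ≤ R + R') : Rep N p (a * b) (f * g) := by
  obtain ⟨F, rfl, hF⟩ := hf
  obtain ⟨G, rfl, hG⟩ := hg
  refine ⟨F * G, map_mul _ _ _, ?_⟩
  filter_upwards [hF, hG] with D h h'
  have := ((h.mul_le h' (N := -N) (by linarith)).add (h.mul_le hL (N := -N) (by linarith))).add
    (hK.mul_le h' (N := -N) (by linarith))
  rwa [show (F.1 p D - f) * (G.1 p D - g) + (F.1 p D - f) * g + f * (G.1 p D - g) =
    (F * G).1 p D - f * g from by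
    change _ = F.1 p D * G.1 p D - f * g; ring] at this

theorem rep_ofFun {hf : ∀ p ∈ W, p.2 ∈ S → IsExp E S p f} :
    Rep R p (ofFun f hf : OLam E S W) f :=
  ⟨_, rfl, Eventually.of_forall fun D => by
    rw [show (fun _ _ => f : Fam M) p D - f = 0 from sub_self f]; exact Grow.zero⟩

theorem rep_hbar : Rep R p (HbarConn.hbar : OLam E S W) (fun q => q.2) := rep_ofFun

theorem rep_ofHol {α : M → ℂ}
    {hα : ∀ q ∈ W, MDifferentiableAt 𝓘(ℂ, E) 𝓘(ℂ, ℂ) α q.1} :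
    Rep R p (ofHol α hα : OLam E S W) (fun q => α q.1) := rep_ofFun

theorem rep_zero : Rep R p (0 : OLam E S W) 0 :=
  ⟨0, map_zero _, Eventually.of_forall fun D => by
    rw [show (0 : LamFam E S W).1 p D - 0 = 0 from sub_self 0]; exact Grow.zero⟩

theorem rep_one : Rep R p (1 : OLam E S W) 1 :=
  ⟨1, map_one _, Eventually.of_forall fun D => by
    rw [show (1 : LamFam E S W).1 p D - 1 = 0 from sub_self 1]; exact Grow.zero⟩

theorem Rep.res (h : W' ≤ W) (hf : Rep R p a f) : Rep R p (res h a) f := by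
  obtain ⟨F, rfl, hF⟩ := hf
  exact ⟨_, rfl, hF⟩

theorem rep_res (h : W' ≤ W) (hp : p ∈ W') (hS : p.2 ∈ S) :
    Rep R p (res h a) f ↔ Rep R p a f := by
  refine ⟨fun hf => ?_, Rep.res h⟩
  obtain ⟨g, hg⟩ := exists_rep a (h hp) hS R
  exact hg.of_grow ((hg.res h).sub_grow hf hp hS)

theorem exists_rep_of_mem_Oce (ha : a ∈ Oce E S W) (hp : p ∈ W) (hS : p.2 ∈ S) (R : ℝ) :
    ∃ f, Rep R p a f ∧ ∀ᶠ q in 𝓝 p, IsCe E S q f := by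
  obtain ⟨F, hF, rfl⟩ := ha
  obtain ⟨D', h⟩ := (((isCoh_iff hS).1 (F.2 p hp hS)).2 R).exists
  exact ⟨F.1 p D', ⟨F, rfl, h.self_of_nhds⟩, hF p hp hS D'⟩

/-- The integer part of the diameter turns the directed set of domains into a precision tending to
infinity: a domain that contains both `0` and `n` has diameter at least `n`. -/
theorem exists_le_dom (n : ℕ) : ∀ᶠ D : Dom in atTop, n ≤ ⌊diam D.1⌋₊ := by
  filter_upwards [eventually_ge_atTop (⟨ball 0 (n + 1), isOpen_ball, isBounded_ball,
    mem_ball_self (by positivity)⟩ : Dom)] with D hD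
  refine Nat.le_floor ?_
  have h1 : ((n : ℂ)) ∈ D.1 := hD (show (n : ℂ) ∈ ball (0 : ℂ) (n + 1) by simp)
  simpa using dist_le_diam_of_mem D.2.2.1 h1 D.2.2.2

/-- Construction of a section from local representatives. -/
theorem exists_section (f : M × RealBlowup → ℕ → M × ℂ → ℂ)
    (h1 : ∀ p ∈ W, p.2 ∈ S → ∀ n, ∃ K, Grow E K p (f p n))
    (h2 : ∀ p ∈ W, p.2 ∈ S → ∀ n : ℕ, ∀ᶠ q in 𝓝 p, ∀ m, n ≤ m →
      Grow E (-n) (basePt q) (f q m - f p n)) :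
    ∃ a : OLam E S W, ∀ p ∈ W, p.2 ∈ S → ∀ n : ℕ, Rep n p a (f p n) := by
  -- Compatibility is only assumed over `ħ = 0`; as all functions are defined and of finite growth
  -- near `q` itself, `Grow.of_basePt` carries it to `q`.
  have h2' : ∀ p ∈ W, p.2 ∈ S → ∀ n : ℕ, ∀ᶠ q in 𝓝 p, ∀ m, n ≤ m →
      Grow E (-n) q (f q m - f p n) := by
    intro p hp hS n
    obtain ⟨K, hK⟩ := h1 p hp hS n
    filter_upwards [h2 p hp hS n, mem_eventually hp hS, hK.eventually] with q k1 k2 k3 m hm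
    obtain ⟨L, hL⟩ := h1 q k2.1 k2.2 m
    exact Grow.of_basePt ((hL.mono (le_max_right K L)).sub (k3.mono (le_max_left K L))) (k1 m hm)
  -- Modulo `F^{≤ D}` the local function whose precision is the integer part of the diameter of `D`
  -- is used.
  set F : Fam M := fun p D => f p ⌊diam D.1⌋₊ with hF
  have hmem : F ∈ LamFam E S W := by
    intro p hp hS
    refine (isCoh_iff hS).2 ⟨fun D => h1 p hp hS _, fun R => ?_⟩
    filter_upwards [exists_le_dom ⌈R⌉₊] with D' hD'
    filter_upwards [h2' p hp hS ⌊diam D'.1⌋₊] with q hq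
    filter_upwards [exists_le_dom ⌊diam D'.1⌋₊] with D'' hD''
    refine (hq _ hD'').mono (neg_le_neg ?_)
    exact (Nat.le_ceil R).trans (by exact_mod_cast hD')
  refine ⟨mkLam E S ⟨F, hmem⟩, fun p hp hS n => ⟨_, rfl, ?_⟩⟩
  filter_upwards [exists_le_dom n] with D hD using (h2' p hp hS n).self_of_nhds _ hD

/-- Sections of `O^Λ` glue. -/
theorem exists_glue {κ : Type*} (V : κ → Opens (M × RealBlowup)) (hV : ∀ k, V k ≤ W)
    (hcov : ∀ p ∈ W, p.2 ∈ S → ∃ k, p ∈ V k) (s : ∀ k, OLam E S (V k))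
    (hs : ∀ k l, (res inf_le_left (s k) : OLam E S (V k ⊓ V l)) = res inf_le_right (s l)) :
    ∃ a : OLam E S W, ∀ k, res (hV k) a = s k := by
  rcases isEmpty_or_nonempty κ with _ | _
  · exact ⟨0, fun k => isEmptyElim k⟩
  have key : ∀ p, p ∈ W ∧ p.2 ∈ S → ∃ k, p ∈ V k := fun p hp => hcov p hp.1 hp.2
  choose! k hk using key
  have key2 : ∀ p, p ∈ W ∧ p.2 ∈ S → ∀ n : ℕ, ∃ f, Rep n p (s (k p)) f := fun p hp n =>
    exists_rep _ (hk p hp) hp.2 n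
  choose! f hf using key2
  have agree : ∀ (k l) (p : M × RealBlowup) (R : ℝ) (g), p ∈ V k → p ∈ V l → p.2 ∈ S →
      Rep R p (s k) g → Rep R p (s l) g := by
    intro k l p R g h1 h2 hS h
    have := h.res (inf_le_left : V k ⊓ V l ≤ V k)
    rw [hs k l] at this
    exact (rep_res (inf_le_right : V k ⊓ V l ≤ V l) ⟨h1, h2⟩ hS).1 this
  obtain ⟨a, ha⟩ := exists_section (E := E) (S := S) (W := W) f
    (fun p hp hS n => (hf p ⟨hp, hS⟩ n).exists_grow (hk p ⟨hp, hS⟩) hS) (by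
      intro p hp hS n
      filter_upwards [mem_eventually hp hS, mem_eventually (hk p ⟨hp, hS⟩) hS,
        (hf p ⟨hp, hS⟩ n).eventually (hk p ⟨hp, hS⟩) hS] with q k1 k2 k3 m hm
      have h1 := agree _ _ q _ _ (hk q k1) k2.1 k1.2 (hf q k1 m)
      exact ((h1.mono (by exact_mod_cast hm)).sub_grow k3 k2.1 k1.2).basePt)
  refine ⟨a, fun l => eq_of_rep fun p hp hS _ R => ?_⟩
  have hp' := hV l hp
  refine ⟨f p ⌈R⌉₊, ?_, ?_⟩
  · exact ((ha p hp' hS ⌈R⌉₊).mono (Nat.le_ceil R)).res _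
  · exact (agree _ _ p _ _ (hk p ⟨hp', hS⟩) hp hS (hf p ⟨hp', hS⟩ ⌈R⌉₊)).mono (Nat.le_ceil R)

/-- Precision `0` suffices: a bounded error does not affect subexponential growth. In particular,
the function `f` may depend on `ε`. -/
theorem mem_Ose_iff : a ∈ Ose E S W ↔
    ∀ p ∈ W, p.2 ∈ S → ∀ ε > 0, ∃ f, Rep 0 p a f ∧ Grow E ε p f := by
  constructor
  · rintro ⟨F, hF, rfl⟩ p hp hS ε hε
    obtain ⟨D', h⟩ := (((isCoh_iff hS).1 (F.2 p hp hS)).2 0).exists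
    exact ⟨F.1 p D', ⟨F, rfl, h.self_of_nhds⟩, (isSe_iff hS).1 (hF p hp hS D').self_of_nhds ε hε⟩
  · intro h
    obtain ⟨F, rfl⟩ := mkLam_surjective a
    have key : ∀ p, p ∈ W ∧ p.2 ∈ S → ∃ D₁ : Dom, ∀ D, D₁ ≤ D → Rep 0 p (mkLam E S F) (F.1 p D) := by
      rintro p ⟨hp, hS⟩
      obtain ⟨D₁, h1⟩ := eventually_atTop.1 (((isCoh_iff hS).1 (F.2 p hp hS)).2 0)
      exact ⟨D₁, fun D hD => ⟨F, rfl, (h1 D hD).self_of_nhds⟩⟩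
    choose! D₁ hD₁ using key
    -- Membership asks every member of the family to be subexponential, also for small `D`, where
    -- `F` is arbitrary. Enlarging `D` by `D₁ p` makes every member a representative of precision
    -- `0` without changing the section.
    set G : Fam M := fun p D => F.1 p (D ⊔ D₁ p) with hG
    have hev : ∀ p, ∀ᶠ D in atTop, G p D = F.1 p D := fun p => by
      filter_upwards [eventually_ge_atTop (D₁ p)] with D hD
      simp only [hG, sup_eq_left.2 hD]
    have hmem : G ∈ LamFam E S W := by
      intro p hp hS
      have h1 := (isCoh_iff hS).1 (F.2 p hp hS)
      refine (isCoh_iff hS).2 ⟨fun D => h1.1 _, fun R => ?_⟩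
      filter_upwards [h1.2 R, hev p] with D' k1 k2
      filter_upwards [k1] with q k1
      filter_upwards [k1, hev q] with D'' k1 k3
      rwa [k2, k3]
    refine ⟨⟨G, hmem⟩, fun p hp hS D => ?_, ?_⟩
    · filter_upwards [(hD₁ p ⟨hp, hS⟩ (D ⊔ D₁ p) le_sup_right).eventually hp hS,
        mem_eventually hp hS] with q k1 k2
      refine (isSe_iff k2.2).2 fun ε hε => ?_
      obtain ⟨f, hf, hf'⟩ := h q k2.1 k2.2 ε hε
      have := (k1.sub_grow hf k2.1 k2.2).mono (show -(0 : ℝ) ≤ ε by linarith)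
      simpa using this.add hf'
    · refine eq_of_rep fun p hp hS _ R => ?_
      obtain ⟨f, hf⟩ := exists_rep (mkLam E S F) hp hS R
      refine ⟨f, (rep_mk hp hS).2 ?_, hf⟩
      filter_upwards [(rep_mk hp hS).1 hf, hev p] with D k1 k2
      rwa [k2]

/-- All representatives of a section have the same growth. -/
theorem exists_growth (a : OLam E S W) (hp : p ∈ W) (hS : p.2 ∈ S) :
    ∃ K : ℝ, 0 ≤ K ∧ ∀ R : ℝ, 0 ≤ R → ∀ f, Rep R p a f → Grow E K p f := by
  obtain ⟨g, hg⟩ := exists_rep a hp hS 0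
  obtain ⟨K, hK⟩ := hg.exists_grow hp hS
  refine ⟨max K 0, le_max_right _ _, fun R hR f hf => ?_⟩
  have := ((hf.mono hR).sub_grow hg hp hS).mono (show -(0 : ℝ) ≤ max K 0 by simp)
  simpa using this.add (hK.mono (le_max_left _ _))

end Dual

/-- When the polar dual is `{0}`, the conditions defining `A^exp` and `F^{≤ D}` both reduce to
membership in `A`, so all quotients vanish. -/
theorem Subsingleton.OLam (h : ¬ DualNontrivial S) (W : Opens (M × RealBlowup)) :
    Subsingleton (OLam E S W) := by
  have h0 : ∀ c ∈ polarDual (S : Set RealBlowup), c = 0 := by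
    intro c hc
    by_contra hc0
    exact h ⟨c, hc, hc0⟩
  have hnull : ∀ F : LamFam E S W, F ∈ nullIdeal E S W := by
    intro F p hp hS D
    refine Eventually.of_forall fun D' => ?_
    filter_upwards [((F.2 p hp hS).1 D').eventually] with q hq r hr
    rw [h0 r hr.2]
    obtain ⟨r', hr', hq⟩ := hq
    rw [h0 r' hr', neg_zero] at hq
    exact hq
  refine ⟨fun a b => ?_⟩
  obtain ⟨F, rfl⟩ := mkLam_surjective a
  obtain ⟨G, rfl⟩ := mkLam_surjective b
  exact Ideal.Quotient.eq.2 (hnull _)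

end Rep

/-! ### Derivations of `O^Λ` along vector fields. -/

section RepDeriv

variable {E : Type*} [NormedAddCommGroup E] [NormedSpace ℂ E] [FiniteDimensional ℂ E]
  {M : Type*} [TopologicalSpace M] [ChartedSpace E M] [IsManifold 𝓘(ℂ, E) ω M]
  {S : Opens RealBlowup} [DualNontrivial S] {W W' : Opens (M × RealBlowup)}
  {R R' K L N : ℝ} {p : M × RealBlowup} {f g : M × ℂ → ℂ} {a b : OLam E S W}
  {v : Π x : M, TangentSpace 𝓘(ℂ, E) x}

theorem Rep.vfDeriv (hf : Rep R p a f) (hv : HolVF v W) (hp : p ∈ W) (hS : p.2 ∈ S)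
    (hR : R' < R) : Rep R' p (vfDeriv v hv a) (dirDeriv v f) := by
  obtain ⟨K, hK⟩ := hf.exists_grow hp hS
  obtain ⟨F, rfl, hF⟩ := hf
  refine ⟨⟨fun p D => dirDeriv v (F.1 p D), vfDeriv_mem hv F.2⟩, rfl, ?_⟩
  filter_upwards [hF] with D h
  obtain ⟨L, hL⟩ := ((isCoh_iff hS).1 (F.2 p hp hS)).1 D
  refine (h.dirDeriv (hv.near hp) (neg_lt_neg hR)).congr ?_
  filter_upwards [hK.1, hL.1] with q k1 k2 hz
  exact (dirDeriv_sub (k2 hz) (k1 hz)).symm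

theorem vfDeriv_res (hv : HolVF v W) (h : W' ≤ W) (a : OLam E S W) :
    vfDeriv v (hv.mono h) (res h a) = res h (vfDeriv v hv a) := by
  obtain ⟨F, rfl⟩ := mkLam_surjective a
  rfl

theorem vfDeriv_add (hv : HolVF v W) (a b : OLam E S W) :
    vfDeriv v hv (a + b) = vfDeriv v hv a + vfDeriv v hv b := by
  refine eq_of_rep fun p hp hS _ R => ?_
  obtain ⟨f, hf⟩ := exists_rep a hp hS (R + 1)
  obtain ⟨g, hg⟩ := exists_rep b hp hS (R + 1)
  obtain ⟨K, hK⟩ := hf.exists_grow hp hS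
  obtain ⟨L, hL⟩ := hg.exists_grow hp hS
  refine ⟨dirDeriv v (f + g), (hf.add hg).vfDeriv hv hp hS (by linarith), ?_⟩
  refine ((hf.vfDeriv hv hp hS (R' := R) (by linarith)).add
    (hg.vfDeriv hv hp hS (by linarith))).congr ?_
  filter_upwards [hK.1, hL.1] with q k1 k2 hz using dirDeriv_add (k1 hz) (k2 hz)

theorem vfDeriv_mul (hv : HolVF v W) (a b : OLam E S W) :
    vfDeriv v hv (a * b) = vfDeriv v hv a * b + a * vfDeriv v hv b := by
  refine eq_of_rep fun p hp hS _ R => ?_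
  obtain ⟨K, hK0, hK⟩ := exists_growth a hp hS
  obtain ⟨L, hL0, hL⟩ := exists_growth b hp hS
  -- Enough precision for the products, which lose `K` or `L`, and for the small losses of the
  -- derivatives.
  set N : ℝ := |R| + K + L + 2 with hN
  have hRa := le_abs_self R
  have hR0 := abs_nonneg R
  obtain ⟨f, hf⟩ := exists_rep a hp hS N
  obtain ⟨g, hg⟩ := exists_rep b hp hS N
  have hKf := hK N (by positivity) f hf
  have hLg := hL N (by positivity) g hg
  have hn := hv.near hp
  have hf' := hf.vfDeriv hv hp hS (R' := N - 1) (by linarith)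
  have hg' := hg.vfDeriv hv hp hS (R' := N - 1) (by linarith)
  have hKf' := hKf.dirDeriv hn (L := K + 1) (by linarith)
  have hLg' := hLg.dirDeriv hn (L := L + 1) (by linarith)
  refine ⟨dirDeriv v (f * g), (hf.mul hg hKf hLg (N := R + 1) (by linarith) (by linarith)
    (by linarith)).vfDeriv hv hp hS (by linarith), ?_⟩
  refine ((hf'.mul hg hKf' hLg (N := R) (by linarith) (by linarith) (by linarith)).add
    (hf.mul hg' hKf hLg' (by linarith) (by linarith) (by linarith))).congr ?_
  filter_upwards [hKf.1, hLg.1] with q k1 k2 hz using dirDeriv_mul (k1 hz) (k2 hz)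

end RepDeriv

/-! ### Restriction to `x = x₀` and pullback of functions of `ħ`. -/

section Slices

variable {E : Type*} [NormedAddCommGroup E] [NormedSpace ℂ E] {M : Type*} [TopologicalSpace M]
  [ChartedSpace E M] {S : Opens RealBlowup} {W : Opens (M × RealBlowup)}
  {R K : ℝ} {f : M × ℂ → ℂ} {x₀ : M} {p : PUnit.{1} × RealBlowup}

theorem Grow.atPoint (h : Grow E K (sliceMap x₀ p) f) : Grow PUnit.{1} K p (atPoint x₀ f) := by
  obtain ⟨C, hC, h⟩ := grow_iff.1 h
  refine grow_iff.2 ⟨C, hC, ?_⟩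
  filter_upwards [(continuous_sliceMap x₀).continuousAt.eventually h] with q h hz
  refine ⟨?_, (h hz).2⟩
  exact MDifferentiableAt.comp (I' := 𝓘(ℂ, E).prod 𝓘(ℂ, ℂ)) (q.1, q.2.z) (g := f)
    (f := fun q : PUnit.{1} × ℂ => (x₀, q.2)) (h hz).1
    (mdifferentiableAt_const.prodMk mdifferentiableAt_snd)

theorem Rep.ev {a : OLam E S W} (h : Rep R (sliceMap x₀ p) a f) :
    Rep R p (ev x₀ a) (HbarConn.atPoint x₀ f) := by
  obtain ⟨F, rfl, hF⟩ := h
  exact ⟨_, rfl, hF.mono fun D h => h.atPoint⟩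

/-- A function of `ħ` alone, as a function on `M × ℂ`. -/
def ofPoint (f : PUnit.{1} × ℂ → ℂ) : M × ℂ → ℂ := fun q => f (PUnit.unit, q.2)

theorem Grow.ofPoint {f : PUnit.{1} × ℂ → ℂ} {x : M} {s : RealBlowup}
    (h : Grow PUnit.{1} K (PUnit.unit, s) f) : Grow E K (x, s) (ofPoint f : M × ℂ → ℂ) := by
  obtain ⟨C, hC, h⟩ := grow_iff.1 h
  refine grow_iff.2 ⟨C, hC, ?_⟩
  have hc : Continuous fun q : M × RealBlowup => (PUnit.unit.{1}, q.2) := by fun_prop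
  filter_upwards [(hc.tendsto (x, s)).eventually h] with q h hz
  refine ⟨?_, (h hz).2⟩
  exact MDifferentiableAt.comp (I' := 𝓘(ℂ, PUnit.{1}).prod 𝓘(ℂ, ℂ)) (q.1, q.2.z) (g := f)
    (f := fun q : M × ℂ => (PUnit.unit.{1}, q.2)) (h hz).1
    (mdifferentiableAt_const.prodMk mdifferentiableAt_snd)

/-- Pullback of sections along the projection to the blow-up. -/
theorem exists_pullback [DualNontrivial S] {V : Opens (PUnit.{1} × RealBlowup)}
    (hV : ∀ q ∈ W, (PUnit.unit, q.2) ∈ V) (a : OLam PUnit.{1} S V) :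
    ∃ b : OLam E S W, ∀ p ∈ W, p.2 ∈ S → ∀ R f, Rep R (PUnit.unit, p.2) a f →
      Rep R p b (ofPoint f) := by
  have key : ∀ p : M × RealBlowup, p ∈ W ∧ p.2 ∈ S → ∀ n : ℕ, ∃ f,
      Rep n (PUnit.unit.{1}, p.2) a f := fun p hp n => exists_rep a (hV p hp.1) hp.2 n
  choose! f hf using key
  have hc : Continuous fun q : M × RealBlowup => (PUnit.unit.{1}, q.2) := by fun_prop
  obtain ⟨b, hb⟩ := exists_section (E := E) (S := S) (W := W) (fun p n => ofPoint (f p n))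
    (fun p hp hS n => by
      obtain ⟨K, hK⟩ := (hf p ⟨hp, hS⟩ n).exists_grow (hV p hp) hS
      exact ⟨K, hK.ofPoint⟩)
    (fun p hp hS n => by
      filter_upwards [mem_eventually hp hS, (hc.tendsto p).eventually
        ((hf p ⟨hp, hS⟩ n).eventually (hV p hp) hS)] with q k1 k2 m hm
      have h1 := (((hf q k1 m).mono (by exact_mod_cast hm)).sub_grow k2 (hV q k1.1) k1.2).basePt
      exact h1.ofPoint (x := q.1))
  refine ⟨b, fun p hp hS R g hg => ?_⟩
  refine ((hb p hp hS ⌈R⌉₊).mono (Nat.le_ceil R)).of_grow ?_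
  exact (((hf p ⟨hp, hS⟩ ⌈R⌉₊).mono (Nat.le_ceil R)).sub_grow hg (hV p hp) hS).ofPoint (x := p.1)

end Slices

end HbarConn

/-! ### Coordinate vector fields of a chart. -/

namespace HbarConn
variable {E : Type*} [NormedAddCommGroup E] [NormedSpace ℂ E] [FiniteDimensional ℂ E]
  {M : Type*} [TopologicalSpace M] [ChartedSpace E M] [IsManifold 𝓘(ℂ, E) ω M]

/-- The constant vector field on the model space. -/
def constField (e : E) : Π y : E, TangentSpace 𝓘(ℂ, E) y := fun _ => e

/-- The coordinate vector field in the direction `e` in the preferred chart at `x`. -/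
noncomputable def coordField (x : M) (e : E) : Π y : M, TangentSpace 𝓘(ℂ, E) y :=
  VectorField.mpullback 𝓘(ℂ, E) 𝓘(ℂ, E) (chartAt E x) (constField e)

theorem mfderiv_chart_invertible {x y : M} (hy : y ∈ (chartAt E x).source) :
    (mfderiv 𝓘(ℂ, E) 𝓘(ℂ, E) (chartAt E x) y).IsInvertible := by
  have : IsManifold 𝓘(ℂ, E) 1 M := IsManifold.of_le (n := ω) le_top
  exact ⟨(mdifferentiable_chart (I := 𝓘(ℂ, E)) x).mfderiv hy, rfl⟩

theorem mfderiv_chart_coordField {x y : M} (hy : y ∈ (chartAt E x).source) (e : E) :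
    mfderiv 𝓘(ℂ, E) 𝓘(ℂ, E) (chartAt E x) y (coordField x e y) = constField e (chartAt E x y) := by
  obtain ⟨L, hL⟩ := mfderiv_chart_invertible hy
  rw [coordField, VectorField.mpullback_apply, ← hL, ContinuousLinearMap.inverse_equiv]
  exact L.apply_symm_apply _

theorem contMDiffAt_chart' {x y : M} (hy : y ∈ (chartAt E x).source) :
    ContMDiffAt 𝓘(ℂ, E) 𝓘(ℂ, E) ω (chartAt E x) y :=
  contMDiffOn_chart.contMDiffAt ((chartAt E x).open_source.mem_nhds hy)

theorem mdifferentiable_constField (e y : E) :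
    MDifferentiableAt 𝓘(ℂ, E) 𝓘(ℂ, E).tangent
      (fun x => (⟨x, constField e x⟩ : TangentBundle 𝓘(ℂ, E) E)) y := by
  rw [mdifferentiableAt_section]
  simp only [trivializationAt_model_space_apply]
  exact mdifferentiableAt_const (c := e)

theorem mdifferentiable_coordField {x y : M} (hy : y ∈ (chartAt E x).source) (e : E) :
    MDifferentiableAt 𝓘(ℂ, E) 𝓘(ℂ, E).tangent
      (fun z => (⟨z, coordField x e z⟩ : TangentBundle 𝓘(ℂ, E) M)) y := by
  have : IsManifold 𝓘(ℂ, E) 2 M := IsManifold.of_le (n := ω) le_top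
  have : IsManifold 𝓘(ℂ, E) 1 M := IsManifold.of_le (n := ω) le_top
  have : CompleteSpace E := FiniteDimensional.complete ℂ E
  exact MDifferentiableAt.mpullback_vectorField (n := ω) (mdifferentiable_constField e _)
    (contMDiffAt_chart' hy) (mfderiv_chart_invertible hy) le_top

/-- Pullback by the chart commutes with brackets, and constant fields commute. With these fields the
flatness condition has no bracket term and says that the coefficients are closed. -/
theorem mlieBracket_coordField {x y : M} (hy : y ∈ (chartAt E x).source) (e e' : E) :
    VectorField.mlieBracket 𝓘(ℂ, E) (coordField x e) (coordField x e') y = 0 := by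
  have : IsManifold 𝓘(ℂ, E) (minSmoothness ℂ 3) M := IsManifold.of_le (n := ω) le_top
  have : CompleteSpace E := FiniteDimensional.complete ℂ E
  have := VectorField.mpullback_mlieBracket (n := ω) (mdifferentiable_constField e (chartAt E x y))
    (mdifferentiable_constField e' (chartAt E x y)) (contMDiffAt_chart' hy) le_top
  refine this.symm.trans ?_
  have h : VectorField.mlieBracket 𝓘(ℂ, E) (constField e) (constField e') = 0 := by
    rw [← VectorField.mlieBracketWithin_univ, VectorField.mlieBracketWithin_eq_lieBracketWithin]
    funext z
    have h1 : ∀ e : E, fderivWithin ℂ (fun _ : E => e) univ z = 0 := fun e => by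
      rw [fderivWithin_univ]; exact fderiv_const_apply e
    change fderivWithin ℂ (fun _ : E => e') univ z e - fderivWithin ℂ (fun _ : E => e) univ z e' =
      (0 : E)
    rw [h1, h1]
    exact sub_self (0 : E)
  rw [h, VectorField.mpullback_zero]
  rfl

theorem dirDeriv_coordField {x y : M} (hy : y ∈ (chartAt E x).source) {f : M × ℂ → ℂ} {z : ℂ}
    (hf : MDifferentiableAt 𝓘(ℂ, E) 𝓘(ℂ, ℂ) (fun y' => f (y', z)) y) (e : E) :
    dirDeriv (coordField x e) f (y, z) =
      fderiv ℂ (fun y' => f ((chartAt E x).symm y', z)) (chartAt E x y) e := by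
  refine ((chart_deriv hy hf).2 _).trans ?_
  rw [mfderiv_chart_coordField hy]
  rfl

theorem dirDeriv_sum {ι : Type*} (t : Finset ι) (c : ι → M → ℂ)
    (w : ι → Π x : M, TangentSpace 𝓘(ℂ, E) x) (f : M × ℂ → ℂ) (q : M × ℂ) :
    dirDeriv (fun x => ∑ k ∈ t, c k x • w k x) f q = ∑ k ∈ t, c k q.1 * dirDeriv (w k) f q := by
  rw [dirDeriv, map_sum]
  refine Finset.sum_congr rfl fun k _ => ?_
  rw [map_smul]
  rfl

theorem dirDeriv_congr_field {v w : Π x : M, TangentSpace 𝓘(ℂ, E) x} {f : M × ℂ → ℂ} {q : M × ℂ}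
    (h : v q.1 = w q.1) : dirDeriv v f q = dirDeriv w f q := by
  rw [dirDeriv, dirDeriv, h]

/-- The coefficients of a vector field in the preferred chart at `x`. -/
noncomputable def fieldCoeff (x : M) (v : Π y : M, TangentSpace 𝓘(ℂ, E) y)
    (k : Fin (Module.finrank ℂ E)) (y : M) : ℂ :=
  (Module.finBasis ℂ E).coord k (mfderiv 𝓘(ℂ, E) 𝓘(ℂ, E) (chartAt E x) y (v y))

/-- The coordinate fields along a basis of the model space. -/
noncomputable abbrev basisField (x : M) (k : Fin (Module.finrank ℂ E)) :
    Π y : M, TangentSpace 𝓘(ℂ, E) y := coordField x (Module.finBasis ℂ E k)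

theorem field_eq_sum {x y : M} (hy : y ∈ (chartAt E x).source)
    (v : Π y : M, TangentSpace 𝓘(ℂ, E) y) :
    v y = ∑ k, fieldCoeff x v k y • basisField x k y := by
  have : IsManifold 𝓘(ℂ, E) 1 M := IsManifold.of_le (n := ω) le_top
  refine ((mdifferentiable_chart (I := 𝓘(ℂ, E)) x).mfderiv_bijective hy).1 ?_
  rw [map_sum]
  have h : ∀ k, mfderiv 𝓘(ℂ, E) 𝓘(ℂ, E) (chartAt E x) y (fieldCoeff x v k y • basisField x k y) =
      (fieldCoeff x v k y • Module.finBasis ℂ E k : E) := fun k => by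
    rw [map_smul, mfderiv_chart_coordField hy]
    rfl
  rw [Finset.sum_congr rfl fun k _ => h k]
  exact ((Module.finBasis ℂ E).sum_repr _).symm

/-- The coefficient is the derivative of a holomorphic coordinate function along the field, to which
`deriv_base_mdiff` applies. -/
theorem mdifferentiableAt_fieldCoeff {x y : M} (hy : y ∈ (chartAt E x).source)
    {v : Π y : M, TangentSpace 𝓘(ℂ, E) y}
    (hv : MDifferentiableAt 𝓘(ℂ, E) 𝓘(ℂ, E).tangent
      (fun x => (⟨x, v x⟩ : TangentBundle 𝓘(ℂ, E) M)) y) (k : Fin (Module.finrank ℂ E)) :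
    MDifferentiableAt 𝓘(ℂ, E) 𝓘(ℂ, ℂ) (fieldCoeff x v k) y := by
  have : IsManifold 𝓘(ℂ, E) 1 M := IsManifold.of_le (n := ω) le_top
  set l : E →L[ℂ] ℂ := LinearMap.toContinuousLinearMap ((Module.finBasis ℂ E).coord k)
  have hl : ∀ z ∈ (chartAt E x).source, HasMFDerivAt 𝓘(ℂ, E) 𝓘(ℂ, ℂ) (l ∘ chartAt E x) z
      (l.comp (mfderiv 𝓘(ℂ, E) 𝓘(ℂ, E) (chartAt E x) z)) := fun z hz =>
    HasMFDerivAt.comp z l.hasMFDerivAt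
      (mdifferentiableAt_atlas (chart_mem_atlas E x) hz).hasMFDerivAt
  have hs := (chartAt E x).open_source.mem_nhds hy
  refine (deriv_base_mdiff hv (a := l ∘ chartAt E x) ?_).congr_of_eventuallyEq ?_
  · filter_upwards [hs] with z hz using (hl z hz).mdifferentiableAt
  · filter_upwards [hs] with z hz
    rw [(hl z hz).mfderiv]
    rfl

theorem exists_chart_ball {p : M × RealBlowup} {V : Set (M × RealBlowup)} (hV : V ∈ 𝓝 p) :
    ∃ ρ : ℝ, 0 < ρ ∧ ball (chartAt E p.1 p.1) ρ ⊆ (chartAt E p.1).target ∧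
      ∃ T : Set RealBlowup, IsOpen T ∧ p.2 ∈ T ∧
        ∀ y ∈ ball (chartAt E p.1 p.1) ρ, ∀ s ∈ T, ((chartAt E p.1).symm y, s) ∈ V := by
  obtain ⟨x, s⟩ := p
  obtain ⟨A, hA, B, hB, hAB⟩ := mem_nhds_prod_iff.1 hV
  obtain ⟨T, hTB, hT, hs⟩ := mem_nhds_iff.1 hB
  set φ := chartAt E x with hφ
  have hxs : x ∈ φ.source := mem_chart_source E x
  have e1 : ∀ᶠ y in 𝓝 (φ x), φ.symm y ∈ A := by
    refine (φ.continuousAt_symm (φ.map_source hxs)).eventually ?_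
    rw [φ.left_inv hxs]
    exact hA
  have e2 : ∀ᶠ y in 𝓝 (φ x), y ∈ φ.target := φ.open_target.mem_nhds (φ.map_source hxs)
  obtain ⟨ρ, hρ, hb⟩ := Metric.eventually_nhds_iff_ball.1 (e1.and e2)
  exact ⟨ρ, hρ, fun y hy => (hb y hy).2, T, hT, hs, fun y hy s' hs' => hAB ⟨(hb y hy).1, hTB hs'⟩⟩

end HbarConn

namespace HbarConn

/-! ### Gronwall's inequality and a quantitative Poincaré lemma on convex sets. -/

section Analysis

variable {E : Type*} [NormedAddCommGroup E] [NormedSpace ℂ E]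

/-- Gronwall on the segment from `y` to `y'`, for the increment `f(t) = h(y + t d) - h(y)`: it
starts at `0` and satisfies `|f'| ≤ K |f| + K |h(y)|`. The estimate is relative to the size of `h`,
so quotients of units are compared without taking logarithms. -/
theorem norm_sub_le_of_norm_fderiv_le_mul {B : Set E} (hB : Convex ℝ B) {h : E → ℂ} {κ : ℝ}
    (hκ : 0 ≤ κ) (hd : ∀ y ∈ B, DifferentiableAt ℂ h y)
    (hb : ∀ y ∈ B, ‖fderiv ℂ h y‖ ≤ κ * ‖h y‖) {y y' : E} (hy : y ∈ B) (hy' : y' ∈ B) :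
    ‖h y' - h y‖ ≤ (Real.exp (κ * ‖y' - y‖) - 1) * ‖h y‖ := by
  set d := y' - y with hd'
  set K := κ * ‖d‖ with hK
  have hK0 : 0 ≤ K := by positivity
  have hmem : ∀ t ∈ Icc (0 : ℝ) 1, y + t • d ∈ B := fun t ht => by
    have := hB.add_smul_sub_mem hy hy' ht
    exact this
  set f : ℝ → ℂ := fun t => h (y + t • d) - h y with hf
  set f' : ℝ → ℂ := fun t => fderiv ℂ h (y + t • d) d with hf'
  have hder : ∀ t ∈ Icc (0 : ℝ) 1, HasDerivAt f (f' t) t := fun t ht => by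
    have h1 : HasDerivAt (fun t : ℝ => y + t • d) d t := by
      simpa using ((hasDerivAt_id t).smul_const d).const_add y
    have h2 := ((hd _ (hmem t ht)).hasFDerivAt.restrictScalars ℝ).comp_hasDerivAt t h1
    exact h2.sub_const _
  have hbound : ∀ t ∈ Ico (0 : ℝ) 1, ‖f' t‖ ≤ K * ‖f t‖ + K * ‖h y‖ := fun t ht => by
    have h1 := hb _ (hmem t (Ico_subset_Icc_self ht))
    calc ‖f' t‖ ≤ ‖fderiv ℂ h (y + t • d)‖ * ‖d‖ := ContinuousLinearMap.le_opNorm _ _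
      _ ≤ κ * ‖h (y + t • d)‖ * ‖d‖ := by gcongr
      _ = K * ‖h (y + t • d)‖ := by rw [hK]; ring
      _ ≤ K * (‖f t‖ + ‖h y‖) := by
          gcongr
          simpa [hf] using norm_add_le (f t) (h y)
      _ = _ := by ring
  have key := norm_le_gronwallBound_of_norm_deriv_right_le (f := f) (f' := f') (δ := 0) (K := K)
    (ε := K * ‖h y‖) (a := 0) (b := 1)
    (fun t ht => (hder t ht).continuousAt.continuousWithinAt)
    (fun t ht => (hder t (Ico_subset_Icc_self ht)).hasDerivWithinAt) (by simp [hf]) hbound 1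
    (right_mem_Icc.2 zero_le_one)
  have h1 : f 1 = h y' - h y := by simp [hf, hd']
  rw [h1] at key
  refine key.trans ?_
  by_cases h0 : K = 0
  · simp [gronwallBound_K0, h0]
  · rw [gronwallBound_of_K_ne_0 h0]
    simp only [zero_mul, zero_add, sub_zero, mul_one]
    rw [mul_div_cancel_left₀ _ h0, mul_comm]

theorem exp_sub_one_le {t T : ℝ} (ht : 0 ≤ t) (hT : t ≤ T) : Real.exp t - 1 ≤ t * Real.exp T := by
  have h1 := Real.add_one_le_exp (-t)
  have h2 : Real.exp (-t) * Real.exp t = 1 := by rw [← Real.exp_add]; simp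
  have h3 : Real.exp t ≤ Real.exp T := Real.exp_le_exp.2 hT
  nlinarith [Real.exp_pos t]

variable [FiniteDimensional ℂ E]

variable (E) in
theorem exists_norm_le_basis : ∃ C : ℝ, 0 < C ∧ ∀ (L : E →L[ℂ] ℂ) (m : ℝ), 0 ≤ m →
    (∀ k, ‖L (Module.finBasis ℂ E k)‖ ≤ m) → ‖L‖ ≤ C * m := by
  obtain ⟨C, hC, h⟩ := (Module.finBasis ℂ E).exists_opNorm_le (F := ℂ)
  exact ⟨C, hC, fun L m hm hL => h hm hL⟩

/-- The primitive of a one-form with a parameter, along rays from `c`. -/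
noncomputable def rayIntegral (c : E) (w : E × ℂ → E →L[ℂ] ℂ) (q : E × ℂ) : ℂ :=
  ∫ t : ℝ in 0..1, w (c + (t : ℂ) • (q.1 - c), q.2) (q.1 - c)

section Ray

variable {c : E} {ρ : ℝ} {O : Set ℂ} {w : E × ℂ → E →L[ℂ] ℂ}

theorem ray_mem {y : E} (hy : y ∈ ball c ρ) {t : ℝ} (ht : t ∈ Icc (0 : ℝ) 1) :
    c + (t : ℂ) • (y - c) ∈ ball c ρ := by
  rw [mem_ball, dist_eq_norm] at *
  rw [add_sub_cancel_left, norm_smul, Complex.norm_real, Real.norm_of_nonneg ht.1]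
  nlinarith [ht.2, norm_nonneg (y - c)]

theorem norm_rayIntegral_le {C : ℝ} {y : E} {z : ℂ} (hy : y ∈ ball c ρ)
    (hC : ∀ y' ∈ ball c ρ, ‖w (y', z)‖ ≤ C) : ‖rayIntegral c w (y, z)‖ ≤ C * ρ := by
  have hρ : 0 < ρ := pos_of_mem_ball hy
  have hC0 : 0 ≤ C := (norm_nonneg _).trans (hC c (mem_ball_self hρ))
  have := intervalIntegral.norm_integral_le_of_norm_le_const (a := 0) (b := 1) (C := C * ρ)
    (f := fun t : ℝ => w (c + (t : ℂ) • (y - c), z) (y - c)) (fun t ht => by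
      rw [uIoc_of_le zero_le_one] at ht
      refine (ContinuousLinearMap.le_opNorm _ _).trans ?_
      gcongr
      · exact hC _ (ray_mem hy (Ioc_subset_Icc_self ht))
      · rw [mem_ball, dist_eq_norm] at hy; exact hy.le)
  simpa [rayIntegral] using this

/-- Differentiation under the integral sign. The domination comes from compactness of `[0,1]` times
a small closed ball around `(y, z)`, all of whose rays stay in the domain. -/
theorem hasFDerivAt_rayIntegral (hO : IsOpen O)
    (hw : ∀ q ∈ ball c ρ ×ˢ O, DifferentiableAt ℂ w q)
    (hw' : ContinuousOn (fderiv ℂ w) (ball c ρ ×ˢ O)) {y : E} {z : ℂ} (hy : y ∈ ball c ρ)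
    (hz : z ∈ O) :
    DifferentiableAt ℂ (rayIntegral c w) (y, z) ∧
    ∀ e : E, fderiv ℂ (rayIntegral c w) (y, z) (e, 0) =
      ∫ t : ℝ in 0..1, (w (c + (t : ℂ) • (y - c), z) e +
        fderiv ℂ w (c + (t : ℂ) • (y - c), z) ((t : ℂ) • e, 0) (y - c)) := by
  have : ProperSpace E := FiniteDimensional.proper ℂ E
  have hΩ : IsOpen (ball c ρ ×ˢ O) := isOpen_ball.prod hO
  have hq : ((y, z) : E × ℂ) ∈ ball c ρ ×ˢ O := ⟨hy, hz⟩
  obtain ⟨r, hr, hrs⟩ := Metric.nhds_basis_closedBall.mem_iff.1 (hΩ.mem_nhds hq)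
  set γ : ℝ → E × ℂ → E × ℂ := fun t q => (c + (t : ℂ) • (q.1 - c), q.2) with hγ
  have hγc : Continuous fun p : ℝ × (E × ℂ) => γ p.1 p.2 := by
    simp only [hγ]
    fun_prop
  have hγm : ∀ t ∈ Icc (0 : ℝ) 1, ∀ q ∈ ball c ρ ×ˢ O, γ t q ∈ ball c ρ ×ˢ O :=
    fun t ht q hq => ⟨ray_mem hq.1 ht, hq.2⟩
  set Λ : ℝ → E × ℂ →L[ℂ] E × ℂ := fun t =>
    ((t : ℂ) • ContinuousLinearMap.fst ℂ E ℂ).prod (ContinuousLinearMap.snd ℂ E ℂ) with hΛ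
  have hγd : ∀ t q, HasFDerivAt (γ t) (Λ t) q := fun t q => by
    have h1 : HasFDerivAt (fun q : E × ℂ => c + (t : ℂ) • (q.1 - c))
        ((t : ℂ) • ContinuousLinearMap.fst ℂ E ℂ) q :=
      ((hasFDerivAt_fst.sub_const c).const_smul (t : ℂ)).const_add c
    exact h1.prodMk hasFDerivAt_snd
  set H : E × ℂ → ℝ → ℂ := fun q t => w (γ t q) (q.1 - c) with hH
  set H' : E × ℂ → ℝ → (E × ℂ →L[ℂ] ℂ) := fun q t =>
    (w (γ t q)).comp (ContinuousLinearMap.fst ℂ E ℂ) +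
      ((fderiv ℂ w (γ t q)).comp (Λ t)).flip (q.1 - c) with hH'
  have hHd : ∀ t ∈ Icc (0 : ℝ) 1, ∀ q ∈ ball c ρ ×ˢ O,
      HasFDerivAt (fun q => H q t) (H' q t) q := fun t ht q hq =>
    ((hw _ (hγm t ht q hq)).hasFDerivAt.comp q (hγd t q)).clm_apply
      (hasFDerivAt_fst.sub_const c)
  have hwc : ContinuousOn w (ball c ρ ×ˢ O) := fun q hq => (hw q hq).continuousAt.continuousWithinAt
  have hcomp : ContinuousOn (fun p : ℝ × (E × ℂ) => w (γ p.1 p.2))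
      (Icc (0 : ℝ) 1 ×ˢ (ball c ρ ×ˢ O)) :=
    hwc.comp hγc.continuousOn fun p hp => hγm p.1 hp.1 p.2 hp.2
  have hcomp' : ContinuousOn (fun p : ℝ × (E × ℂ) => fderiv ℂ w (γ p.1 p.2))
      (Icc (0 : ℝ) 1 ×ˢ (ball c ρ ×ˢ O)) :=
    hw'.comp hγc.continuousOn fun p hp => hγm p.1 hp.1 p.2 hp.2
  have hΛc : Continuous Λ := by
    have h1 : Λ = fun t : ℝ => (t : ℂ) • (ContinuousLinearMap.inl ℂ E ℂ).comp
        (ContinuousLinearMap.fst ℂ E ℂ) + (ContinuousLinearMap.inr ℂ E ℂ).comp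
        (ContinuousLinearMap.snd ℂ E ℂ) := by
      funext t
      ext q <;> simp [hΛ]
    rw [h1]
    fun_prop
  have hHc : ContinuousOn (fun p : ℝ × (E × ℂ) => H p.2 p.1)
      (Icc (0 : ℝ) 1 ×ˢ (ball c ρ ×ˢ O)) :=
    hcomp.clm_apply (by fun_prop)
  have hflip : Continuous fun L : E × ℂ →L[ℂ] E →L[ℂ] ℂ => L.flip :=
    (ContinuousLinearMap.flipₗᵢ ℂ (E × ℂ) E ℂ).continuous
  have hH'c : ContinuousOn (fun p : ℝ × (E × ℂ) => H' p.2 p.1)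
      (Icc (0 : ℝ) 1 ×ˢ (ball c ρ ×ˢ O)) := by
    refine (hcomp.clm_comp continuousOn_const).add (ContinuousOn.clm_apply ?_ (by fun_prop))
    exact hflip.comp_continuousOn (hcomp'.clm_comp (hΛc.comp continuous_fst).continuousOn)
  obtain ⟨C, hC⟩ := (isCompact_Icc.prod (isCompact_closedBall ((y, z) : E × ℂ) r)
    ).exists_bound_of_continuousOn (hH'c.mono (prod_mono_right hrs))
  have hslice : ∀ q ∈ ball c ρ ×ˢ O, ContinuousOn (fun t => H q t) (Icc (0 : ℝ) 1) := fun q hq =>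
    hHc.comp (f := fun t : ℝ => (t, q)) (by fun_prop) fun t ht => ⟨ht, hq⟩
  have hslice' : ContinuousOn (fun t => H' (y, z) t) (Icc (0 : ℝ) 1) :=
    hH'c.comp (f := fun t : ℝ => (t, (y, z))) (by fun_prop) fun t ht => ⟨ht, hq⟩
  have hint' : IntervalIntegrable (fun t => H' (y, z) t) MeasureTheory.volume 0 1 :=
    ContinuousOn.intervalIntegrable (by rwa [uIcc_of_le zero_le_one])
  have hsub : Ioc (0 : ℝ) 1 ⊆ Icc 0 1 := Ioc_subset_Icc_self
  have main := intervalIntegral.hasFDerivAt_integral_of_dominated_of_fderiv_le (𝕜 := ℂ)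
    (μ := MeasureTheory.volume) (a := 0) (b := 1) (F := H) (F' := H') (bound := fun _ => C)
    (x₀ := (y, z)) (s := ball (y, z) r) (ball_mem_nhds _ hr)
    (by
      filter_upwards [ball_mem_nhds ((y, z) : E × ℂ) hr] with q hq
      rw [uIoc_of_le zero_le_one]
      exact ((hslice q (hrs (ball_subset_closedBall hq))).mono hsub).aestronglyMeasurable
        measurableSet_Ioc)
    (ContinuousOn.intervalIntegrable (by rw [uIcc_of_le zero_le_one]; exact hslice _ hq))
    (by
      rw [uIoc_of_le zero_le_one]
      exact (hslice'.mono hsub).aestronglyMeasurable measurableSet_Ioc)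
    (Eventually.of_forall fun t ht q hq => by
      rw [uIoc_of_le zero_le_one] at ht
      exact hC (t, q) ⟨hsub ht, ball_subset_closedBall hq⟩)
    (by simp)
    (Eventually.of_forall fun t ht q hq => by
      rw [uIoc_of_le zero_le_one] at ht
      exact hHd t (hsub ht) q (hrs (ball_subset_closedBall hq)))
  have heq : rayIntegral c w = fun q => ∫ t : ℝ in 0..1, H q t := rfl
  rw [← heq] at main
  refine ⟨main.differentiableAt, fun e => ?_⟩
  rw [main.fderiv, ContinuousLinearMap.intervalIntegral_apply hint']
  refine intervalIntegral.integral_congr fun t _ => ?_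
  simp [hH', hΛ, hγ]

/-- The usual proof of the Poincaré lemma, keeping the failure of closedness: the integrals for the
derivative and for `w(y) e` differ by the integral of `t (dw(e)(y - c) - dw(y - c)(e))`. -/
theorem norm_fderiv_rayIntegral_sub_le (hO : IsOpen O)
    (hw : ∀ q ∈ ball c ρ ×ˢ O, DifferentiableAt ℂ w q)
    (hw' : ContinuousOn (fderiv ℂ w) (ball c ρ ×ˢ O)) {y : E} {z : ℂ} (hy : y ∈ ball c ρ)
    (hz : z ∈ O) {δ : ℝ} (hδ : ∀ y' ∈ ball c ρ, ∀ e e' : E,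
      ‖fderiv ℂ w (y', z) (e, 0) e' - fderiv ℂ w (y', z) (e', 0) e‖ ≤ δ * ‖e‖ * ‖e'‖) (e : E) :
    ‖fderiv ℂ (rayIntegral c w) (y, z) (e, 0) - w (y, z) e‖ ≤ δ * ‖e‖ * ρ := by
  rw [(hasFDerivAt_rayIntegral hO hw hw' hy hz).2 e]
  set γ : ℝ → E × ℂ := fun t => (c + (t : ℂ) • (y - c), z) with hγ
  have hγm : ∀ t ∈ Icc (0 : ℝ) 1, γ t ∈ ball c ρ ×ˢ O := fun t ht => ⟨ray_mem hy ht, hz⟩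
  have hγc : Continuous γ := by simp only [hγ]; fun_prop
  have hγd : ∀ t : ℝ, HasDerivAt γ ((y - c, 0) : E × ℂ) t := fun t => by
    have h1 : HasDerivAt (fun t : ℝ => c + (t : ℂ) • (y - c)) (y - c) t := by
      simpa using ((Complex.ofRealCLM.hasDerivAt (x := t)).smul_const (y - c)).const_add c
    exact h1.prodMk (hasDerivAt_const t z)
  have hwγ : ContinuousOn (fun t => w (γ t)) (Icc (0 : ℝ) 1) := fun t ht =>
    ((hw _ (hγm t ht)).continuousAt.comp hγc.continuousAt).continuousWithinAt
  have hw'γ : ContinuousOn (fun t => fderiv ℂ w (γ t)) (Icc (0 : ℝ) 1) :=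
    hw'.comp hγc.continuousOn hγm
  -- The integrand is the derivative of `t w(γ t) e`, which vanishes at `t = 0`.
  have hftc : ∫ t : ℝ in 0..1, (w (γ t) e + (t : ℂ) * fderiv ℂ w (γ t) (y - c, 0) e) =
      w (y, z) e := by
    have h1 : ∀ t ∈ uIcc (0 : ℝ) 1, HasDerivAt (fun t : ℝ => (t : ℂ) * w (γ t) e)
        (w (γ t) e + (t : ℂ) * fderiv ℂ w (γ t) (y - c, 0) e) t := fun t ht => by
      rw [uIcc_of_le zero_le_one] at ht
      have h2 := ((hw _ (hγm t ht)).hasFDerivAt.restrictScalars ℝ).comp_hasDerivAt t (hγd t)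
      have h3 : HasDerivAt (fun t : ℝ => w (γ t) e) (fderiv ℂ w (γ t) (y - c, 0) e) t :=
        HasFDerivAt.comp_hasDerivAt (f := fun t : ℝ => w (γ t)) t
          (((ContinuousLinearMap.apply ℂ ℂ e).restrictScalars ℝ).hasFDerivAt (x := w (γ t))) h2
      have := (Complex.ofRealCLM.hasDerivAt (x := t)).fun_mul h3
      simpa only [Complex.ofRealCLM_apply, Complex.ofReal_one, one_mul] using this
    rw [intervalIntegral.integral_eq_sub_of_hasDerivAt h1]
    · simp [hγ]
    · refine ContinuousOn.intervalIntegrable ?_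
      rw [uIcc_of_le zero_le_one]
      exact (hwγ.clm_apply continuousOn_const).add (Complex.continuous_ofReal.continuousOn.mul
        ((hw'γ.clm_apply continuousOn_const).clm_apply continuousOn_const))
  rw [← hftc, ← intervalIntegral.integral_sub]
  rotate_left
  · refine ContinuousOn.intervalIntegrable ?_
    rw [uIcc_of_le zero_le_one]
    exact (hwγ.clm_apply continuousOn_const).add
      ((hw'γ.clm_apply (by fun_prop)).clm_apply continuousOn_const)
  · refine ContinuousOn.intervalIntegrable ?_
    rw [uIcc_of_le zero_le_one]
    exact (hwγ.clm_apply continuousOn_const).add (Complex.continuous_ofReal.continuousOn.mul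
        ((hw'γ.clm_apply continuousOn_const).clm_apply continuousOn_const))
  have hyc : ‖y - c‖ ≤ ρ := by rw [mem_ball, dist_eq_norm] at hy; exact hy.le
  have hδ0 : 0 ≤ δ * ‖e‖ * ‖y - c‖ := (norm_nonneg _).trans (hδ y hy e (y - c))
  have := intervalIntegral.norm_integral_le_of_norm_le_const (a := 0) (b := 1)
    (C := δ * ‖e‖ * ‖y - c‖)
    (f := fun t : ℝ => w (γ t) e + fderiv ℂ w (γ t) ((t : ℂ) • e, 0) (y - c) -
      (w (γ t) e + (t : ℂ) * fderiv ℂ w (γ t) (y - c, 0) e)) (fun t ht => by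
      rw [uIoc_of_le zero_le_one] at ht
      have ht' := Ioc_subset_Icc_self ht
      have h1 : (((t : ℂ) • e, 0) : E × ℂ) = (t : ℂ) • (e, 0) := by simp
      rw [add_sub_add_left_eq_sub, h1, map_smul, smul_apply, smul_eq_mul,
        ← mul_sub, norm_mul, Complex.norm_real, Real.norm_of_nonneg ht'.1]
      have := hδ _ (hγm t ht').1 e (y - c)
      calc t * _ ≤ 1 * (δ * ‖e‖ * ‖y - c‖) :=
            mul_le_mul ht'.2 this (norm_nonneg _) zero_le_one
        _ = _ := one_mul _)
  refine this.trans ?_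
  rw [sub_zero, abs_one, mul_one]
  -- No sign of `δ` is assumed; that `δ ‖e‖` is nonnegative has to be read off from `hδ`, and at `y
  -- = c` only the pair `(e, e)` is useful for this.
  rcases eq_or_ne (‖y - c‖) 0 with h0 | h0
  · rw [h0, mul_zero]
    by_cases he : ‖e‖ = 0
    · simp [he]
    have hρ : 0 < ρ := pos_of_mem_ball hy
    have := (norm_nonneg _).trans (hδ y hy e e)
    have hepos : 0 < ‖e‖ := lt_of_le_of_ne (norm_nonneg _) (Ne.symm he)
    have : 0 ≤ δ * ‖e‖ := nonneg_of_mul_nonneg_left this hepos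
    positivity
  · have hpos : 0 < ‖y - c‖ := lt_of_le_of_ne (norm_nonneg _) (Ne.symm h0)
    have : 0 ≤ δ * ‖e‖ := nonneg_of_mul_nonneg_left hδ0 hpos
    gcongr

end Ray

end Analysis

end HbarConn

namespace HbarConn

/-! ### Connection forms in coordinates. -/

section Forms

variable {E : Type*} [NormedAddCommGroup E] [NormedSpace ℂ E] [FiniteDimensional ℂ E]
  {M : Type*} [TopologicalSpace M] [ChartedSpace E M] [IsManifold 𝓘(ℂ, E) ω M]
  {S : Opens RealBlowup} {W W' : Opens (M × RealBlowup)}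
  {R R' K L N : ℝ} {p : M × RealBlowup} {f g : M × ℂ → ℂ} {a b : OLam E S W}

theorem OneForm.app_zero (A : OneForm E S W) (h : W' ≤ W)
    (hv : HolVF (fun _ => 0 : Π x : M, TangentSpace 𝓘(ℂ, E) x) W') :
    A.app W' h (fun _ => 0) hv = 0 := by
  have h1 := A.app_add W' h (fun _ => 0) (fun _ => 0) hv hv (by simpa using hv)
  have h2 : (fun x => (fun _ => 0 : Π x : M, TangentSpace 𝓘(ℂ, E) x) x +
      (fun _ => 0 : Π x : M, TangentSpace 𝓘(ℂ, E) x) x) = fun _ => 0 := by funext x; simp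
  simp only [h2] at h1
  simpa using h1

theorem HolVF.smul {c : M → ℂ} {v : Π x : M, TangentSpace 𝓘(ℂ, E) x}
    (hc : ∀ q ∈ W, MDifferentiableAt 𝓘(ℂ, E) 𝓘(ℂ, ℂ) c q.1) (hv : HolVF v W) :
    HolVF (fun x => c x • v x) W := fun q hq =>
  (hc q hq).smul_section (hv q hq)

theorem HolVF.sum {κ : Type*} (t : Finset κ) {v : κ → Π x : M, TangentSpace 𝓘(ℂ, E) x}
    (hv : ∀ k, HolVF (v k) W) : HolVF (fun x => ∑ k ∈ t, v k x) W := fun q hq =>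
  MDifferentiableAt.sum_section fun k _ => hv k q hq

/-- The part of `W` over the source of the preferred chart at `x`. -/
def chartPart (W : Opens (M × RealBlowup)) (x : M) : Opens (M × RealBlowup) :=
  W ⊓ ⟨(chartAt E x).source ×ˢ univ, (chartAt E x).open_source.prod isOpen_univ⟩

theorem chartPart_le {x : M} : chartPart (E := E) W x ≤ W := inf_le_left

theorem mem_chartPart {x : M} (hp : p ∈ W) (hx : p.1 ∈ (chartAt E x).source) :
    p ∈ chartPart (E := E) W x := ⟨hp, hx, mem_univ _⟩

theorem holVF_basisField {x : M} (k : Fin (Module.finrank ℂ E)) :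
    HolVF (basisField x k) (chartPart (E := E) W x) := fun _ hq =>
  mdifferentiable_coordField hq.2.1 _

/-- The component of the one-form along the coordinate `k` of the preferred chart at `x`. -/
noncomputable def OneForm.coord (A : OneForm E S W) (x : M) (k : Fin (Module.finrank ℂ E)) :
    OLam E S (chartPart (E := E) W x) :=
  A.app _ chartPart_le (basisField x k) (holVF_basisField k)

variable [DualNontrivial S]

/-- A limit at the boundary point `p` bounds the function near `p` off `ħ = 0`. -/
theorem IsCe.grow (h : IsCe E S p f) (hp : p.2 ∈ S) (hz : p.2.z = 0) : Grow E 0 p f := by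
  obtain ⟨K, hK⟩ := (isExp_iff hp).1 h.1
  obtain ⟨-, c, hc⟩ := h
  have hlim := hc.self_of_nhds.2 hz
  refine Grow.of_bounded (hK.1) ⟨‖c p.1‖ + 1, ?_⟩
  have := hlim.norm.eventually (gt_mem_nhds (lt_add_one _))
  filter_upwards [eventually_pnhds.1 this] with q hq hz using (hq hz).le

/-- Some representative is in `A^ce`, hence bounded, and all others differ from it by `O(1)`. This
boundedness is why solutions `e^{-Φ/ħ}` grow at most exponentially. -/
theorem Rep.grow_zero_of_mem_Oce (ha : a ∈ Oce E S W) (hf : Rep R p a f) (hR : 0 ≤ R)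
    (hp : p ∈ W) (hS : p.2 ∈ S) (hz : p.2.z = 0) : Grow E 0 p f := by
  obtain ⟨f₀, h0, h1⟩ := exists_rep_of_mem_Oce ha hp hS R
  have h2 := (h1.self_of_nhds.grow hS hz)
  have h3 := (hf.sub_grow h0 hp hS).mono (L := 0) (by linarith)
  simpa using h3.add h2

theorem ofHol_eq_one {f : M → ℂ} (hf : ∀ q ∈ W, MDifferentiableAt 𝓘(ℂ, E) 𝓘(ℂ, ℂ) f q.1)
    (h1 : ∀ q ∈ W, f q.1 = 1) : (ofHol f hf : OLam E S W) = 1 := by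
  refine eq_of_rep fun p hp hS hz R => ⟨1, ?_, rep_one⟩
  refine (rep_ofHol (R := R)).congr ?_
  filter_upwards [W.2.mem_nhds hp] with q hq _ using (h1 q hq).symm

/-- A form is defined on globally given fields, of which only the values over `W'` should matter.
Linearity over functions holomorphic over `W'` proves this: multiplication by a function equal to
`1` there and `0` elsewhere makes the two fields literally equal. -/
theorem OneForm.app_congr (A : OneForm E S W) (h : W' ≤ W) {v w : Π x : M, TangentSpace 𝓘(ℂ, E) x}
    (hv : HolVF v W') (hw : HolVF w W') (hvw : ∀ q ∈ W', v q.1 = w q.1) :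
    A.app W' h v hv = A.app W' h w hw := by
  classical
  set P : Set M := Prod.fst '' (W' : Set (M × RealBlowup)) with hP
  have hPo : IsOpen P := isOpenMap_fst _ W'.2
  -- The projection `P` of `W'` is open, so this indicator is holomorphic where it has to be; no
  -- regularity is required off `P`.
  set f : M → ℂ := fun x => if x ∈ P then 1 else 0 with hf
  have hf1 : ∀ q ∈ W', f q.1 = 1 := fun q hq => if_pos ⟨q, hq, rfl⟩
  have hfe : ∀ q ∈ W', f =ᶠ[𝓝 q.1] fun _ => 1 := fun q hq => by
    filter_upwards [hPo.mem_nhds ⟨q, hq, rfl⟩] with x hx using if_pos hx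
  have hfd : ∀ q ∈ W', MDifferentiableAt 𝓘(ℂ, E) 𝓘(ℂ, ℂ) f q.1 := fun q hq =>
    (mdifferentiableAt_const (c := (1 : ℂ))).congr_of_eventuallyEq (hfe q hq)
  have hs : ∀ u : Π x : M, TangentSpace 𝓘(ℂ, E) x, HolVF u W' → HolVF (fun x => f x • u x) W' :=
    fun u hu q hq => (hu q hq).congr_of_eventuallyEq <| by
      filter_upwards [hPo.mem_nhds ⟨q, hq, rfl⟩] with x hx
      simp [hf, hx]
  have key : ∀ (u : Π x : M, TangentSpace 𝓘(ℂ, E) x) (hu : HolVF u W'),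
      A.app W' h (fun x => f x • u x) (hs u hu) = A.app W' h u hu := fun u hu => by
    rw [A.app_smul W' h f hfd u hu, ofHol_eq_one hfd hf1, one_mul]
  rw [← key v hv, ← key w hw]
  congr 1
  funext x
  by_cases hx : x ∈ P
  · obtain ⟨q, hq, rfl⟩ := hx
    rw [hvw q hq]
  · simp [hf, hx]

theorem OneForm.rep_app_sum (A : OneForm E S W) (h : W' ≤ W) {κ : Type*} (t : Finset κ)
    {c : κ → M → ℂ} {w : κ → Π x : M, TangentSpace 𝓘(ℂ, E) x} {F : κ → M × ℂ → ℂ}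
    (hc : ∀ k, ∀ q ∈ W', MDifferentiableAt 𝓘(ℂ, E) 𝓘(ℂ, ℂ) (c k) q.1) (hw : ∀ k, HolVF (w k) W')
    (hp : p ∈ W') (hS : p.2 ∈ S) (hF : ∀ k, Rep N p (A.app W' h (w k) (hw k)) (F k))
    (hsum : HolVF (fun x => ∑ k ∈ t, c k x • w k x) W') :
    Rep N p (A.app W' h (fun x => ∑ k ∈ t, c k x • w k x) hsum)
      (fun r => ∑ k ∈ t, c k r.1 * F k r) := by
  classical
  induction t using Finset.induction_on with
  | empty =>
    simp only [Finset.sum_empty] at hsum ⊢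
    rw [A.app_zero h hsum]
    exact rep_zero
  | insert k t hk ih =>
    have h1 : HolVF (fun x => ∑ k ∈ t, c k x • w k x) W' :=
      HolVF.sum t fun k => HolVF.smul (hc k) (hw k)
    have h2 : HolVF (fun x => c k x • w k x + ∑ k ∈ t, c k x • w k x) W' := by
      simpa only [Finset.sum_insert hk] using hsum
    simp only [Finset.sum_insert hk] at hsum ⊢
    rw [A.app_add W' h (fun x => c k x • w k x) (fun x => ∑ k ∈ t, c k x • w k x)
      (HolVF.smul (hc k) (hw k)) h1 hsum, A.app_smul W' h (c k) (hc k) (w k) (hw k)]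
    obtain ⟨L, hL⟩ := (hF k).exists_grow hp hS
    have hck : Grow E 0 p (fun q => c k q.1) :=
      Grow.of_base_fun (eventually_base (hc k) hp)
    -- A holomorphic coefficient represents itself exactly, so its precision can be chosen large
    -- enough to outweigh the growth `L`.
    have h3 := (rep_ofHol (S := S) (hα := hc k) (p := p) (R := |N| + |N + L|)).mul (hF k) hck hL
      (N := N) (by have := le_abs_self (N + L); have := abs_nonneg N; linarith) (by simp)
      (by have := neg_le_abs N; have := abs_nonneg (N + L); linarith [le_abs_self N, abs_nonneg N])
    exact h3.add (ih h1)

theorem OneForm.rep_of_coord (A : OneForm E S W) {x : M} {F : Fin (Module.finrank ℂ E) → M × ℂ → ℂ}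
    (hx : p.1 ∈ (chartAt E x).source) (h : W' ≤ W) (hp : p ∈ W') (hS : p.2 ∈ S)
    (hF : ∀ k, Rep N p (A.coord x k) (F k)) (v : Π x : M, TangentSpace 𝓘(ℂ, E) x)
    (hv : HolVF v W') :
    Rep N p (A.app W' h v hv) (fun r => ∑ k, fieldCoeff x v k r.1 * F k r) := by
  have hle : chartPart (E := E) W' x ≤ chartPart (E := E) W x := inf_le_inf_right _ h
  have hp' : p ∈ chartPart (E := E) W' x := mem_chartPart hp hx
  rw [← rep_res chartPart_le hp' hS, ← A.app_res W' h _ chartPart_le v hv]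
  have hc : ∀ k, ∀ q ∈ chartPart (E := E) W' x,
      MDifferentiableAt 𝓘(ℂ, E) 𝓘(ℂ, ℂ) (fieldCoeff x v k) q.1 := fun k q hq =>
    mdifferentiableAt_fieldCoeff hq.2.1 (hv q hq.1) k
  have hb : ∀ k, HolVF (basisField x k) (chartPart (E := E) W' x) := fun k => holVF_basisField k
  have hsum : HolVF (fun y => ∑ k, fieldCoeff x v k y • basisField x k y)
      (chartPart (E := E) W' x) := HolVF.sum _ fun k => HolVF.smul (hc k) (hb k)
  rw [A.app_congr (chartPart_le.trans h) (hv.mono chartPart_le) hsum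
    fun q hq => field_eq_sum hq.2.1 v]
  refine A.rep_app_sum (chartPart_le.trans h) Finset.univ hc hb hp' hS (fun k => ?_) hsum
  have := A.app_res _ chartPart_le _ hle (basisField x k) (holVF_basisField k)
  change A.app _ (chartPart_le.trans h) (basisField x k) (hb k) = res hle (A.coord x k) at this
  rw [this]
  exact (hF k).res hle

theorem OneForm.coord_mem (A : OneForm E S W) (x : M) (k : Fin (Module.finrank ℂ E)) :
    A.coord x k ∈ Oce E S _ := A.mem _ _ _ _

/-- `-ħ v(e) / e`. -/
noncomputable def logD (v : Π x : M, TangentSpace 𝓘(ℂ, E) x) (e : M × ℂ → ℂ) : M × ℂ → ℂ :=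
  fun r => -(r.2 * dirDeriv v e r * (e r)⁻¹)

/-- Both `v ↦ A(v)` and `v ↦ -ħ v(e)/e` are linear over functions of `x`, so it is enough to compare
them on the coordinate fields. -/
theorem OneForm.rep_logD_of_coord (A : OneForm E S W) {x : M} {e : M × ℂ → ℂ}
    (hx : p.1 ∈ (chartAt E x).source) (h : W' ≤ W) (hp : p ∈ W') (hS : p.2 ∈ S)
    (hF : ∀ k, Rep N p (A.coord x k) (logD (basisField x k) e))
    (v : Π x : M, TangentSpace 𝓘(ℂ, E) x) (hv : HolVF v W') :
    Rep N p (A.app W' h v hv) (logD v e) := by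
  refine (A.rep_of_coord hx h hp hS hF v hv).congr ?_
  have : ∀ᶠ q : M × RealBlowup in 𝓝 p, q.1 ∈ (chartAt E x).source :=
    continuous_fst.continuousAt.eventually ((chartAt E x).open_source.mem_nhds hx)
  filter_upwards [this] with q hq _
  simp only [logD]
  rw [dirDeriv_congr_field (w := fun y => ∑ k, fieldCoeff x v k y • basisField x k y)
    (field_eq_sum hq v), dirDeriv_sum, Finset.mul_sum, Finset.sum_mul, ← Finset.sum_neg_distrib]
  exact Finset.sum_congr rfl fun k _ => by ring

end Forms

end HbarConn

namespace HbarConn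

/-! ### Units of exponential growth modulo exponentially small factors. -/

section UnitGerm

variable {E : Type*} [NormedAddCommGroup E] [NormedSpace ℂ E]
  {M : Type*} [TopologicalSpace M] [ChartedSpace E M] {S : Opens RealBlowup}
  {R R' K L N : ℝ} {p : M × RealBlowup} {f g f' g' k : M × ℂ → ℂ}

variable (E) in
/-- `f` is near `p` a nonvanishing function such that `f` and `f⁻¹` grow at most exponentially. -/
def UnitGerm (p : M × RealBlowup) (f : M × ℂ → ℂ) : Prop :=
  (∃ K, 0 ≤ K ∧ Grow E K p f ∧ Grow E K p f⁻¹) ∧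
    ∀ᶠ q in 𝓝 p, q.2.z ≠ 0 → f (q.1, q.2.z) ≠ 0

theorem UnitGerm.mk' (hf : Grow E K p f) (hf' : Grow E L p f⁻¹)
    (h0 : ∀ᶠ q in 𝓝 p, q.2.z ≠ 0 → f (q.1, q.2.z) ≠ 0) : UnitGerm E p f :=
  ⟨⟨max 0 (max K L), le_max_left _ _, hf.mono (by simp), hf'.mono (by simp)⟩, h0⟩

theorem UnitGerm.mul (hf : UnitGerm E p f) (hg : UnitGerm E p g) : UnitGerm E p (f * g) := by
  obtain ⟨⟨K, -, h1, h2⟩, h3⟩ := hf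
  obtain ⟨⟨L, -, h1', h2'⟩, h3'⟩ := hg
  refine UnitGerm.mk' (h1.mul h1') (K := K + L) (L := K + L) ?_ ?_
  · rw [mul_inv]; exact h2.mul h2'
  · filter_upwards [h3, h3'] with q k1 k2 hz using mul_ne_zero (k1 hz) (k2 hz)

theorem UnitGerm.inv (hf : UnitGerm E p f) : UnitGerm E p f⁻¹ := by
  obtain ⟨⟨K, -, h1, h2⟩, h3⟩ := hf
  exact UnitGerm.mk' h2 (by rwa [inv_inv]) (h3.mono fun q hq hz => inv_ne_zero (hq hz))

theorem UnitGerm.one : UnitGerm E p (1 : M × ℂ → ℂ) :=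
  UnitGerm.mk' Grow.one (by rw [inv_one]; exact Grow.one)
    (Eventually.of_forall fun _ _ => one_ne_zero)

theorem UnitGerm.eventually (hf : UnitGerm E p f) : ∀ᶠ q in 𝓝 p, UnitGerm E q f := by
  obtain ⟨⟨K, -, h1, h2⟩, h3⟩ := hf
  filter_upwards [h1.eventually, h2.eventually, h3.eventually_nhds] with q k1 k2 k3
    using UnitGerm.mk' k1 k2 k3

theorem UnitGerm.mul_inv_cancel (hf : UnitGerm E p f) :
    ∀ᶠ q in 𝓝 p, q.2.z ≠ 0 → (f * f⁻¹) (q.1, q.2.z) = 1 := by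
  filter_upwards [hf.2] with q hq hz
  simp [hq hz]

variable (E) in
/-- `f - 1` is `O (exp (-N / |ħ|))` near `p`. -/
def NearOne (N : ℝ) (p : M × RealBlowup) (f : M × ℂ → ℂ) : Prop := Grow E (-N) p (f - 1)

/-- Over `ħ = 0` the error `e^{-N/|ħ|}` tends to zero and is eventually below `1/2`. At a point with
`ħ ≠ 0` the growth bound alone would give no such smallness. -/
theorem NearOne.bounds (h : NearOne E N p f) (hN : 0 < N) (hz : p.2.z = 0) :
    ∀ᶠ q in 𝓝 p, q.2.z ≠ 0 → 1 / 2 ≤ ‖f (q.1, q.2.z)‖ := by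
  obtain ⟨C, hC, h1⟩ := grow_iff.1 h
  have h2 := (tendsto_exp_pnhds hz (neg_neg_of_pos hN)).const_mul C
  rw [mul_zero] at h2
  have h3 := h2.eventually (gt_mem_nhds (one_half_pos (α := ℝ)))
  filter_upwards [h1, eventually_pnhds.1 h3] with q k1 k2 hz'
  have k3 := (k1 hz').2
  have k4 := k2 hz'
  have k5 := norm_sub_norm_le (1 : ℂ) (1 - f (q.1, q.2.z))
  have k6 : ‖1 - f (q.1, q.2.z)‖ < 1 / 2 := by
    rw [norm_sub_rev]
    exact k3.trans_lt k4
  rw [sub_sub_cancel, norm_one] at k5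
  linarith

theorem NearOne.inv_grow (h : NearOne E N p f) (hN : 0 < N) (hz : p.2.z = 0) :
    Grow E 0 p f⁻¹ := by
  have hb := h.bounds hN hz
  refine Grow.of_bounded ?_ ⟨2, ?_⟩
  · filter_upwards [hb.eventually_nhds, h.1] with q k1 k2 hq
    have h1 : IsHolAt E f q := by
      have := (k2 hq).add (mdifferentiableAt_const (c := (1 : ℂ)))
      refine this.congr_of_eventuallyEq (Eventually.of_forall fun r => ?_)
      simp
    have h2 : f (q.1, q.2.z) ≠ 0 := fun h0 => by
      have := k1.self_of_nhds hq
      rw [h0, norm_zero] at this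
      norm_num at this
    have h3 : MDifferentiableAt 𝓘(ℂ, ℂ) 𝓘(ℂ, ℂ) (fun w : ℂ => w⁻¹) (f (q.1, q.2.z)) :=
      (differentiableAt_inv h2).mdifferentiableAt
    exact h3.comp (q.1, q.2.z) h1
  · filter_upwards [hb] with q k1 hq
    rw [Pi.inv_apply, norm_inv]
    exact inv_le_of_inv_le₀ (by norm_num) (by simpa using k1 hq)

theorem NearOne.grow (h : NearOne E N p f) (hN : 0 ≤ N) : Grow E 0 p f := by
  simpa using (Grow.mono h (L := 0) (by linarith)).add Grow.one

theorem NearOne.unitGerm (h : NearOne E N p f) (hN : 0 < N) (hz : p.2.z = 0) : UnitGerm E p f :=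
  UnitGerm.mk' (h.grow hN.le) (h.inv_grow hN hz) <| by
    filter_upwards [h.bounds hN hz] with q hq hq0 h0
    have := hq hq0
    rw [h0, norm_zero] at this
    norm_num at this

theorem NearOne.inv (h : NearOne E N p f) (hN : 0 < N) (hz : p.2.z = 0) : NearOne E N p f⁻¹ := by
  have h1 := (h.neg).mul_le (h.inv_grow hN hz) (N := -N) (by simp)
  refine h1.congr ?_
  filter_upwards [(h.unitGerm hN hz).2] with q hq hq0
  have := hq hq0
  simp only [Pi.sub_apply, Pi.inv_apply, Pi.one_apply, Pi.mul_apply, Pi.neg_apply]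
  field_simp
  ring

theorem NearOne.mul (h : NearOne E N p f) (h' : NearOne E N p g) (hN : 0 ≤ N) :
    NearOne E N p (f * g) := by
  have h1 := (h.mul_le h' (N := -N) (by linarith)).add (h.add h')
  refine h1.congr (Eventually.of_forall fun q _ => ?_)
  simp only [Pi.sub_apply, Pi.one_apply, Pi.mul_apply, Pi.add_apply]
  ring

theorem NearOne.one : NearOne E N p (1 : M × ℂ → ℂ) := by
  rw [NearOne, sub_self]; exact Grow.zero

theorem NearOne.congr (h : NearOne E N p f)
    (hfg : ∀ᶠ q in 𝓝 p, q.2.z ≠ 0 → g (q.1, q.2.z) = f (q.1, q.2.z)) : NearOne E N p g :=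
  Grow.congr h <| by
    filter_upwards [hfg] with q hq hz
    simp [hq hz]

theorem NearOne.mono (h : NearOne E N p f) (hL : L ≤ N) : NearOne E L p f :=
  Grow.mono h (by linarith)

variable (E) in
/-- The functions agree near `p` up to the factor `1 + O (exp (-N / |ħ|))`. -/
def Close (N : ℝ) (p : M × RealBlowup) (f g : M × ℂ → ℂ) : Prop := NearOne E N p (f * g⁻¹)

theorem Close.refl (hf : UnitGerm E p f) : Close E N p f f :=
  NearOne.one.congr hf.mul_inv_cancel

theorem Close.symm (h : Close E N p f g) (hN : 0 < N) (hz : p.2.z = 0) : Close E N p g f := by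
  refine (NearOne.inv h hN hz).congr (Eventually.of_forall fun q _ => ?_)
  simp

theorem Close.trans (h : Close E N p f g) (h' : Close E N p g k) (hg : UnitGerm E p g)
    (hN : 0 ≤ N) : Close E N p f k := by
  refine (NearOne.mul h h' hN).congr ?_
  filter_upwards [hg.2] with q hq hz
  have := hq hz
  simp only [Pi.inv_apply, Pi.mul_apply]
  field_simp

theorem Close.mul (h : Close E N p f g) (h' : Close E N p f' g') (hN : 0 ≤ N) :
    Close E N p (f * f') (g * g') := by
  refine (NearOne.mul h h' hN).congr (Eventually.of_forall fun q _ => ?_)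
  simp only [Pi.inv_apply, Pi.mul_apply, mul_inv]
  ring

theorem Close.mono (h : Close E N p f g) (hL : L ≤ N) : Close E L p f g := NearOne.mono h hL

theorem Close.eventually (h : Close E N p f g) : ∀ᶠ q in 𝓝 p, Close E N q f g := Grow.eventually h

theorem Close.congr (h : Close E N p f g)
    (hf : ∀ᶠ q in 𝓝 p, q.2.z ≠ 0 → f' (q.1, q.2.z) = f (q.1, q.2.z))
    (hg : ∀ᶠ q in 𝓝 p, q.2.z ≠ 0 → g' (q.1, q.2.z) = g (q.1, q.2.z)) : Close E N p f' g' :=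
  NearOne.congr h <| by
    filter_upwards [hf, hg] with q h1 h2 hz
    simp [h1 hz, h2 hz]

/-- Since `f/g - 1 = (f - g)/g`, passing from additive to multiplicative precision loses the rate of
`g⁻¹`; `Close.sub_grow` goes back, at the cost of the rate of `g`. -/
theorem Close.of_sub_grow (hg : UnitGerm E p g) (hK : Grow E K p g⁻¹)
    (h : Grow E (-L) p (f - g)) (hN : N + K ≤ L) : Close E N p f g := by
  refine (h.mul_le hK (N := -N) (by linarith)).congr ?_
  filter_upwards [hg.2] with q hq hz
  have := hq hz
  simp only [Pi.inv_apply, Pi.mul_apply, Pi.sub_apply, Pi.one_apply]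
  field_simp

theorem Close.sub_grow (h : Close E N p f g) (hg : UnitGerm E p g) (hK : Grow E K p g)
    (hL : L + K ≤ N) : Grow E (-L) p (f - g) := by
  refine (Grow.mul_le h hK (N := -L) (by linarith)).congr ?_
  filter_upwards [hg.2] with q hq hz
  have := hq hz
  simp only [Pi.inv_apply, Pi.mul_apply, Pi.sub_apply, Pi.one_apply]
  field_simp

theorem NearOne.atPoint {x : M} {s : RealBlowup} (h : NearOne E N (x, s) f) :
    NearOne PUnit.{1} N (PUnit.unit, s) (atPoint x f) :=
  Grow.atPoint (p := (PUnit.unit, s)) (x₀ := x) h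

theorem Close.atPoint {x : M} {s : RealBlowup} (h : Close E N (x, s) f g) :
    Close PUnit.{1} N (PUnit.unit, s) (atPoint x f) (atPoint x g) := NearOne.atPoint h

theorem UnitGerm.atPoint {x : M} {s : RealBlowup} (h : UnitGerm E (x, s) f) :
    UnitGerm PUnit.{1} (PUnit.unit, s) (atPoint x f) := by
  obtain ⟨⟨K, -, h1, h2⟩, h3⟩ := h
  refine UnitGerm.mk' (Grow.atPoint (p := (PUnit.unit, s)) (x₀ := x) h1)
    (Grow.atPoint (p := (PUnit.unit, s)) (x₀ := x) h2) ?_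
  exact ((continuous_sliceMap x).continuousAt (x := (PUnit.unit, s))).eventually
    (p := fun q => q.2.z ≠ 0 → f (q.1, q.2.z) ≠ 0) h3

theorem UnitGerm.ofPoint {u : PUnit.{1} × ℂ → ℂ} {x : M} {s : RealBlowup}
    (h : UnitGerm PUnit.{1} (PUnit.unit, s) u) : UnitGerm E (x, s) (ofPoint u : M × ℂ → ℂ) := by
  obtain ⟨⟨K, -, h1, h2⟩, h3⟩ := h
  refine UnitGerm.mk' h1.ofPoint (h2.ofPoint : Grow E K (x, s) (HbarConn.ofPoint u⁻¹)) ?_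
  have hc : Continuous fun q : M × RealBlowup => ((PUnit.unit, q.2) : PUnit.{1} × RealBlowup) := by
    fun_prop
  exact (hc.continuousAt (x := (x, s))).eventually
    (p := fun q => q.2.z ≠ 0 → u (q.1, q.2.z) ≠ 0) h3

end UnitGerm

/-! ### The logarithmic derivative `logD`. -/

section LogD

variable {E : Type*} [NormedAddCommGroup E] [NormedSpace ℂ E] [FiniteDimensional ℂ E]
  {M : Type*} [TopologicalSpace M] [ChartedSpace E M] [IsManifold 𝓘(ℂ, E) ω M]
  {S : Opens RealBlowup} {K L N : ℝ} {p : M × RealBlowup} {e f : M × ℂ → ℂ}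
  {v : Π x : M, TangentSpace 𝓘(ℂ, E) x}

theorem UnitGerm.isHolAt (h : UnitGerm E p e) : ∀ᶠ q in 𝓝 p, q.2.z ≠ 0 → IsHolAt E e q := by
  obtain ⟨⟨K, -, h1, h2⟩, h3⟩ := h
  exact h1.1

theorem logD_mul (he : UnitGerm E p e) (hf : UnitGerm E p f) :
    ∀ᶠ q in 𝓝 p, q.2.z ≠ 0 →
      logD v (e * f) (q.1, q.2.z) = (logD v e + logD v f) (q.1, q.2.z) := by
  filter_upwards [he.2, hf.2, he.isHolAt, hf.isHolAt] with q h1 h2 h3 h4 hz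
  have k1 := h1 hz
  have k2 := h2 hz
  simp only [logD, Pi.add_apply]
  rw [dirDeriv_mul (h3 hz) (h4 hz)]
  simp only [Pi.mul_apply, Pi.add_apply]
  field_simp
  ring

theorem logD_inv (he : UnitGerm E p e) :
    ∀ᶠ q in 𝓝 p, q.2.z ≠ 0 → logD v e⁻¹ (q.1, q.2.z) = (-logD v e) (q.1, q.2.z) := by
  filter_upwards [he.2, he.isHolAt] with q h1 h3 hz
  have k1 := h1 hz
  have k2 := dirDeriv_comp (v := v) (F := fun w _ => w⁻¹) (F' := fun w _ => -(w ^ 2)⁻¹) (h3 hz)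
    (hasDerivAt_inv k1)
  have k3 : dirDeriv v e⁻¹ (q.1, q.2.z) = _ := k2
  simp only [logD, Pi.neg_apply]
  rw [k3]
  simp only [Pi.inv_apply]
  field_simp

theorem logD_ofPoint (u : PUnit.{1} × ℂ → ℂ) : logD v (ofPoint u : M × ℂ → ℂ) = 0 := by
  funext q
  have := dirDeriv_snd (v := v) (fun z => u (PUnit.unit, z)) q
  simp only [logD]
  rw [show dirDeriv v (ofPoint u) q = 0 from this]
  simp

end LogD

/-! ### Chart balls and Gronwall's inequality on them. -/

section Gronwall

variable {E : Type*} [NormedAddCommGroup E] [NormedSpace ℂ E] [FiniteDimensional ℂ E]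
  {M : Type*} [TopologicalSpace M] [ChartedSpace E M] [IsManifold 𝓘(ℂ, E) ω M]

variable (E) in
/-- A constant that bounds the norm of a linear form by its values on the standard basis. -/
noncomputable def basisConst : ℝ := (exists_norm_le_basis E).choose

theorem basisConst_pos : 0 < basisConst E := (exists_norm_le_basis E).choose_spec.1

theorem norm_le_basisConst (L : E →L[ℂ] ℂ) {m : ℝ} (hm : 0 ≤ m)
    (h : ∀ k, ‖L (Module.finBasis ℂ E k)‖ ≤ m) : ‖L‖ ≤ basisConst E * m :=
  (exists_norm_le_basis E).choose_spec.2 L m hm h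

variable (E) in
/-- The ball of radius `r` about `x` in the preferred chart at `x`. -/
def chartBall (x : M) (r : ℝ) : Set M :=
  {y | y ∈ (chartAt E x).source ∧ chartAt E x y ∈ ball (chartAt E x x) r}

theorem isOpen_chartBall (x : M) (r : ℝ) : IsOpen (chartBall E x r) :=
  (chartAt E x).isOpen_inter_preimage isOpen_ball

theorem chartBall_eq {x : M} {r : ℝ} (hr : ball (chartAt E x x) r ⊆ (chartAt E x).target) :
    chartBall E x r = (chartAt E x).symm '' ball (chartAt E x x) r :=
  ((chartAt E x).symm_image_eq_source_inter_preimage hr).symm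

theorem isPreconnected_chartBall {x : M} {r : ℝ}
    (hr : ball (chartAt E x x) r ⊆ (chartAt E x).target) : IsPreconnected (chartBall E x r) := by
  rw [chartBall_eq hr]
  have : Convex ℝ (ball (chartAt E x x) r) := convex_ball _ _
  exact this.isPreconnected.image _ ((chartAt E x).continuousOn_symm.mono hr)

theorem mem_chartBall (x : M) {r : ℝ} (hr : 0 < r) : x ∈ chartBall E x r :=
  ⟨mem_chart_source E x, mem_ball_self hr⟩

theorem exists_chartBall {p : M × RealBlowup} {V : Set (M × RealBlowup)} (hV : V ∈ 𝓝 p) {r₀ : ℝ}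
    (hr₀ : 0 < r₀) :
    ∃ r : ℝ, 0 < r ∧ r ≤ r₀ ∧ ball (chartAt E p.1 p.1) r ⊆ (chartAt E p.1).target ∧
      ∃ T : Set RealBlowup, IsOpen T ∧ p.2 ∈ T ∧ ∀ y ∈ chartBall E p.1 r, ∀ s ∈ T, (y, s) ∈ V := by
  obtain ⟨ρ, hρ, h1, T, hT, hpT, h2⟩ := exists_chart_ball (E := E) hV
  refine ⟨min ρ r₀, lt_min hρ hr₀, min_le_right _ _, (ball_subset_ball (min_le_left _ _)).trans h1,
    T, hT, hpT, fun y hy s hs => ?_⟩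
  have := h2 _ (ball_subset_ball (min_le_left _ _) hy.2) s hs
  rwa [(chartAt E p.1).left_inv hy.1] at this

theorem gronwall_chartBall {x : M} {r κ : ℝ} {ρ : M × ℂ → ℂ} {z : ℂ}
    (hr : ball (chartAt E x x) r ⊆ (chartAt E x).target) (hκ : 0 ≤ κ)
    (hd : ∀ y ∈ chartBall E x r, MDifferentiableAt 𝓘(ℂ, E) 𝓘(ℂ, ℂ) (fun y => ρ (y, z)) y)
    (hb : ∀ y ∈ chartBall E x r, ∀ k, ‖dirDeriv (basisField (E := E) x k) ρ (y, z)‖ ≤ κ * ‖ρ (y, z)‖)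
    {y y' : M} (hy : y ∈ chartBall E x r) (hy' : y' ∈ chartBall E x r) :
    ‖ρ (y', z) - ρ (y, z)‖ ≤ (Real.exp (basisConst E * κ * (2 * r)) - 1) * ‖ρ (y, z)‖ := by
  set φ := chartAt E x with hφ
  set h : E → ℂ := fun w => ρ (φ.symm w, z) with hh
  have hmem : ∀ w ∈ ball (φ x) r, φ.symm w ∈ chartBall E x r := fun w hw =>
    ⟨φ.map_target (hr hw), by rw [φ.right_inv (hr hw)]; exact hw⟩
  have h1 : ∀ w ∈ ball (φ x) r, DifferentiableAt ℂ h w := fun w hw => by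
    have hw' := hmem w hw
    have := (chart_deriv (E := E) (x₀ := x) hw'.1 (hd _ hw')).1
    rwa [φ.right_inv (hr hw)] at this
  have h2 : ∀ w ∈ ball (φ x) r, ‖fderiv ℂ h w‖ ≤ basisConst E * κ * ‖h w‖ := fun w hw => by
    have hw' := hmem w hw
    rw [mul_assoc]
    refine norm_le_basisConst _ (by positivity) fun k => ?_
    have h3 := dirDeriv_coordField (E := E) hw'.1 (hd _ hw') (Module.finBasis ℂ E k)
    have h4 := hb _ hw' k
    rw [h3, ← hφ, φ.right_inv (hr hw)] at h4
    exact h4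
  have hconv : Convex ℝ (ball (φ x) r) := convex_ball _ _
  have key := norm_sub_le_of_norm_fderiv_le_mul hconv
    (mul_nonneg basisConst_pos.le hκ) h1 h2 hy.2 hy'.2
  have i1 : φ.symm (φ y) = y := φ.left_inv hy.1
  have i2 : φ.symm (φ y') = y' := φ.left_inv hy'.1
  change ‖ρ (φ.symm (φ y'), z) - ρ (φ.symm (φ y), z)‖ ≤
    (Real.exp (basisConst E * κ * ‖φ y' - φ y‖) - 1) * ‖ρ (φ.symm (φ y), z)‖ at key
  rw [i1, i2] at key
  refine key.trans ?_
  gcongr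
  · exact mul_nonneg basisConst_pos.le hκ
  · have k1 := hy.2
    have k2 := hy'.2
    rw [mem_ball] at k1 k2
    rw [← dist_eq_norm]
    have := dist_triangle_right (φ y') (φ y) (φ x)
    linarith

end Gronwall

end HbarConn

namespace HbarConn

/-! ### Approximate primitives of approximately closed forms depending on `ħ`. -/

section Primitive

variable {E : Type*} [NormedAddCommGroup E] [NormedSpace ℂ E] [FiniteDimensional ℂ E]
  {M : Type*} [TopologicalSpace M] [ChartedSpace E M] [IsManifold 𝓘(ℂ, E) ω M]
  {S : Opens RealBlowup} {W : Opens (M × RealBlowup)}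
  {R K L N : ℝ} {p : M × RealBlowup}

theorem exists_uniform_grow {κ : Type*} [Fintype κ] {F : κ → M × ℂ → ℂ}
    (h : ∀ k, Grow E K p (F k)) : ∃ C : ℝ, 0 < C ∧ ∀ᶠ q in 𝓝 p, q.2.z ≠ 0 → ∀ k,
      IsHolAt E (F k) q ∧ ‖F k (q.1, q.2.z)‖ ≤ C * Real.exp (K / ‖q.2.z‖) := by
  choose C hC hF using fun k => grow_iff.1 (h k)
  refine ⟨∑ k, C k + 1, by have := Finset.sum_nonneg fun k (_ : k ∈ Finset.univ) => (hC k).le;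
                           linarith, ?_⟩
  filter_upwards [eventually_all.2 hF] with q hq hz k
  refine ⟨(hq k hz).1, (hq k hz).2.trans ?_⟩
  gcongr
  have := Finset.single_le_sum (fun k _ => (hC k).le) (Finset.mem_univ k)
  linarith

/-- The nonzero values of `ħ` on a set of points of the blow-up. -/
def zSet (T : Set RealBlowup) : Set ℂ := {z | z ≠ 0 ∧ ∃ s ∈ T, s.z = z}

theorem isOpen_zSet {T : Set RealBlowup} (hT : IsOpen T) : IsOpen (zSet T) := by
  rw [isOpen_iff_mem_nhds]
  rintro z ⟨hz, s, hs, rfl⟩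
  exact RealBlowup.exists_lift hT hs hz

/-- The bound on a basis is applied to `B - B.flip` once in each argument, whence the two factors
`basisConst E`. -/
theorem norm_bilin_sub_le {B : E →L[ℂ] E →L[ℂ] ℂ} {δ : ℝ} (hδ : 0 ≤ δ)
    (h : ∀ k l, ‖B (Module.finBasis ℂ E k) (Module.finBasis ℂ E l) -
      B (Module.finBasis ℂ E l) (Module.finBasis ℂ E k)‖ ≤ δ) (e e' : E) :
    ‖B e e' - B e' e‖ ≤ (basisConst E * (basisConst E * δ)) * ‖e‖ * ‖e'‖ := by
  have h1 : ∀ l, ‖(B - B.flip) (Module.finBasis ℂ E l)‖ ≤ basisConst E * δ := fun l =>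
    norm_le_basisConst _ hδ fun k => h l k
  have hb := (basisConst_pos (E := E)).le
  have h2 : ‖((B - B.flip) : E →L[ℂ] E →L[ℂ] ℂ).flip e'‖ ≤
      basisConst E * (basisConst E * δ * ‖e'‖) :=
    norm_le_basisConst _ (by positivity) fun l =>
      (((B - B.flip) (Module.finBasis ℂ E l)).le_opNorm e').trans
        (mul_le_mul_of_nonneg_right (h1 l) (norm_nonneg _))
  have h3 := (((B - B.flip) : E →L[ℂ] E →L[ℂ] ℂ).flip e').le_opNorm e
  have h4 : (((B - B.flip) : E →L[ℂ] E →L[ℂ] ℂ).flip e') e = B e e' - B e' e := by simp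
  rw [h4] at h3
  refine h3.trans ((mul_le_mul_of_nonneg_right h2 (norm_nonneg _)).trans (le_of_eq (by ring)))

/-- Functions of `(x, ħ)` with closed differential up to `O (exp (K / |ħ|))` have a bounded
primitive up to that order. -/
theorem exists_primitive {F : Fin (Module.finrank ℂ E) → M × ℂ → ℂ} (hF : ∀ k, Grow E 0 p (F k))
    (hD : ∀ k l, Grow E K p (dirDeriv (basisField p.1 k) (F l) - dirDeriv (basisField p.1 l) (F k))) :
    ∃ Φ : M × ℂ → ℂ, Grow E 0 p Φ ∧ ∀ k, Grow E K p (dirDeriv (basisField p.1 k) Φ - F k) := by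
  obtain ⟨C, hC, h1⟩ := exists_uniform_grow hF
  obtain ⟨C', hC', h2⟩ := exists_uniform_grow (κ := Fin _ × Fin _) (fun k => hD k.1 k.2)
  obtain ⟨r, hr, hr1, hball, T, hT, hpT, hV⟩ := exists_chartBall (E := E) (h1.and h2) one_pos
  set φ := chartAt E p.1 with hφ
  set O := zSet T with hO
  have hOo : IsOpen O := isOpen_zSet hT
  have hmem : ∀ w ∈ ball (φ p.1) r, φ.symm w ∈ chartBall E p.1 r := fun w hw =>
    ⟨φ.map_target (hball hw), by rw [← hφ, φ.right_inv (hball hw)]; exact hw⟩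
  have hF' : ∀ w ∈ ball (φ p.1) r, ∀ z ∈ O, ∀ k,
      MDifferentiableAt (𝓘(ℂ, E).prod 𝓘(ℂ, ℂ)) 𝓘(ℂ, ℂ) (F k) (φ.symm w, z) ∧
      ‖F k (φ.symm w, z)‖ ≤ C := by
    rintro w hw z ⟨hz, s, hs, rfl⟩ k
    have := (hV _ (hmem w hw) s hs).1 hz k
    exact ⟨this.1, by simpa using this.2⟩
  have hD' : ∀ w ∈ ball (φ p.1) r, ∀ z ∈ O, ∀ k l,
      ‖dirDeriv (basisField p.1 k) (F l) (φ.symm w, z) -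
        dirDeriv (basisField p.1 l) (F k) (φ.symm w, z)‖ ≤ C' * Real.exp (K / ‖z‖) := by
    rintro w hw z ⟨hz, s, hs, rfl⟩ k l
    exact ((hV _ (hmem w hw) s hs).2 hz (k, l)).2
  set H : Fin (Module.finrank ℂ E) → E × ℂ → ℂ := fun k q => F k (φ.symm q.1, q.2) with hH
  have hHd : ∀ k, ∀ q ∈ ball (φ p.1) r ×ˢ O, DifferentiableAt ℂ (H k) q := fun k q hq =>
    chart_joint (hball hq.1) (hF' q.1 hq.1 q.2 hq.2 k).1
  have hopen : IsOpen (ball (φ p.1) r ×ˢ O) := isOpen_ball.prod hOo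
  have hHc : ∀ k, ContinuousOn (fderiv ℂ (H k)) (ball (φ p.1) r ×ˢ O) := fun k q hq =>
    (differentiableAt_fderiv (by
      filter_upwards [hopen.mem_nhds hq] with q' hq' using
        hHd k q' hq')).continuousAt.continuousWithinAt
  let c : Fin (Module.finrank ℂ E) → E →L[ℂ] ℂ := fun k =>
    LinearMap.toContinuousLinearMap ((Module.finBasis ℂ E).coord k)
  have hcb : ∀ k l, c k (Module.finBasis ℂ E l) = if l = k then 1 else 0 := fun k l => by
    simp [c, Finsupp.single_apply]
  -- The form whose coefficients in the chart are the `F k`. At fixed `ħ` its failure to be closed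
  -- is controlled by `hD`, so the ray integral from the centre of the ball is a primitive up to
  -- `e^{K/|ħ|}`.
  set w : E × ℂ → E →L[ℂ] ℂ := fun q => ∑ k, H k q • c k with hw
  have hwb : ∀ q l, w q (Module.finBasis ℂ E l) = H l q := fun q l => by
    simp [hw, hcb]
  have hwd : ∀ q ∈ ball (φ p.1) r ×ˢ O,
      HasFDerivAt w (∑ k, (fderiv ℂ (H k) q).smulRight (c k)) q := fun q hq =>
    HasFDerivAt.fun_sum fun k _ => (hHd k q hq).hasFDerivAt.smul_const (c k)
  have hwc : ContinuousOn (fderiv ℂ w) (ball (φ p.1) r ×ˢ O) := by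
    have : ContinuousOn (fun q => ∑ k, (fderiv ℂ (H k) q).smulRight (c k))
        (ball (φ p.1) r ×ˢ O) := by
      have hgrp : IsTopologicalAddGroup (E × ℂ →L[ℂ] E →L[ℂ] ℂ) := inferInstance
      have hadd := hgrp.toContinuousAdd
      refine continuousOn_finsetSum _ fun k _ => ?_
      exact ((ContinuousLinearMap.smulRightL ℂ (E × ℂ) (E →L[ℂ] ℂ)).flip (c k)).continuous.comp_continuousOn (hHc k)
    exact this.congr fun q hq => (hwd q hq).fderiv
  have hslice : ∀ y ∈ ball (φ p.1) r, ∀ z ∈ O, ∀ k l,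
      fderiv ℂ (H k) (y, z) (Module.finBasis ℂ E l, 0) =
        dirDeriv (basisField p.1 l) (F k) (φ.symm y, z) := fun y hy z hz k l => by
    have h3 := hmem y hy
    have h4 : MDifferentiableAt 𝓘(ℂ, E) 𝓘(ℂ, ℂ) (fun y' => F k (y', z)) (φ.symm y) :=
      MDifferentiableAt.comp (I' := 𝓘(ℂ, E).prod 𝓘(ℂ, ℂ)) (φ.symm y) (g := F k)
        (f := fun y => (y, z)) (hF' y hy z hz k).1
        (mdifferentiableAt_id.prodMk mdifferentiableAt_const)
    have h5 := dirDeriv_coordField (E := E) h3.1 h4 (Module.finBasis ℂ E l)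
    refine Eq.trans ?_ h5.symm
    rw [← hφ, φ.right_inv (hball hy)]
    have h6 : HasFDerivAt (fun y' : E => H k (y', z))
        ((fderiv ℂ (H k) (y, z)).comp (ContinuousLinearMap.inl ℂ E ℂ)) y :=
      (hHd k (y, z) ⟨hy, hz⟩).hasFDerivAt.comp (f := fun y' : E => (y', z)) y
        (hasFDerivAt_prodMk_left y z)
    have h7 : (fun y' => F k (φ.symm y', z)) = fun y' : E => H k (y', z) := rfl
    rw [h7, h6.fderiv]
    rfl
  have hclosed : ∀ z ∈ O, ∀ y ∈ ball (φ p.1) r, ∀ e e' : E,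
      ‖fderiv ℂ w (y, z) (e, 0) e' - fderiv ℂ w (y, z) (e', 0) e‖ ≤
        (basisConst E * (basisConst E * (C' * Real.exp (K / ‖z‖)))) * ‖e‖ * ‖e'‖ := by
    intro z hz y hy
    refine norm_bilin_sub_le (B := (fderiv ℂ w (y, z)).comp (ContinuousLinearMap.inl ℂ E ℂ))
      (by positivity) fun k l => ?_
    have h3 : ∀ k l, fderiv ℂ w (y, z) (Module.finBasis ℂ E k, 0) (Module.finBasis ℂ E l) =
        dirDeriv (basisField p.1 k) (F l) (φ.symm y, z) := fun k l => by
      rw [(hwd (y, z) ⟨hy, hz⟩).fderiv, ← hslice y hy z hz]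
      simp [hcb]
    change ‖fderiv ℂ w (y, z) (Module.finBasis ℂ E k, 0) (Module.finBasis ℂ E l) -
      fderiv ℂ w (y, z) (Module.finBasis ℂ E l, 0) (Module.finBasis ℂ E k)‖ ≤ _
    rw [h3, h3]
    exact hD' y hy z hz k l
  set Φ : M × ℂ → ℂ := fun q => rayIntegral (φ p.1) w (φ q.1, q.2) with hΦ
  have hwd' : ∀ q ∈ ball (φ p.1) r ×ˢ O, DifferentiableAt ℂ w q := fun q hq =>
    (hwd q hq).differentiableAt
  have hnear : ∀ᶠ q : M × RealBlowup in 𝓝 p, q.1 ∈ chartBall E p.1 r ∧ q.2 ∈ T := by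
    have h3 : ∀ᶠ q : M × RealBlowup in 𝓝 p, q.1 ∈ chartBall E p.1 r :=
      continuous_fst.continuousAt.eventually
        ((isOpen_chartBall p.1 r).mem_nhds (mem_chartBall p.1 hr))
    exact h3.and (continuous_snd.continuousAt.eventually (hT.mem_nhds hpT))
  have hΦhol : ∀ q : M × RealBlowup, q.1 ∈ chartBall E p.1 r → q.2 ∈ T → q.2.z ≠ 0 →
      IsHolAt E Φ q := fun q h3 h4 h5 => by
    have k1 := (hasFDerivAt_rayIntegral hOo hwd' hwc h3.2 (z := q.2.z) ⟨h5, q.2, h4, rfl⟩).1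
    have k2 : MDifferentiableAt 𝓘(ℂ, E) 𝓘(ℂ, E) φ q.1 :=
      (contMDiffAt_chart' h3.1).mdifferentiableAt (by simp)
    have k3 : MDifferentiableAt (𝓘(ℂ, E).prod 𝓘(ℂ, ℂ)) 𝓘(ℂ, E × ℂ)
        (fun r : M × ℂ => (φ r.1, r.2)) (q.1, q.2.z) := by
      rw [modelWithCornersSelf_prod, ← chartedSpaceSelf_prod]
      exact (MDifferentiableAt.comp (I' := 𝓘(ℂ, E)) (q.1, q.2.z) (g := φ) (f := Prod.fst) k2
        mdifferentiableAt_fst).prodMk mdifferentiableAt_snd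
    exact MDifferentiableAt.comp (I' := 𝓘(ℂ, E × ℂ)) (q.1, q.2.z)
      (g := rayIntegral (φ p.1) w) (f := fun r : M × ℂ => (φ r.1, r.2)) k1.mdifferentiableAt k3
  have hΦg : Grow E 0 p Φ := by
    refine Grow.of_bounded ?_ ⟨basisConst E * C * r, ?_⟩
    · filter_upwards [hnear] with q hq hz using hΦhol q hq.1 hq.2 hz
    · filter_upwards [hnear] with q hq hz
      refine norm_rayIntegral_le hq.1.2 fun y hy => ?_
      refine norm_le_basisConst _ hC.le fun k => ?_
      rw [hwb]
      exact (hF' y hy _ ⟨hz, q.2, hq.2, rfl⟩ k).2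
  refine ⟨Φ, hΦg, fun k => ?_⟩
  have hnb : HolNear (basisField p.1 k) p.1 := by
    filter_upwards [(chartAt E p.1).open_source.mem_nhds (mem_chart_source E p.1)] with y hy
      using mdifferentiable_coordField hy _
  have hhol := ((hΦg.dirDeriv hnb zero_lt_one).sub ((hF k).mono zero_le_one)).1
  refine grow_iff.2 ⟨basisConst E * (basisConst E * C') * ‖Module.finBasis ℂ E k‖ * r + 1,
    by have := basisConst_pos (E := E); positivity, ?_⟩
  filter_upwards [hnear, hhol] with q hq hq' hz
  refine ⟨hq' hz, ?_⟩
  have hzO : q.2.z ∈ O := ⟨hz, q.2, hq.2, rfl⟩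
  have k1 := dirDeriv_coordField (E := E) hq.1.1 (isHolAt_slice (hΦhol q hq.1 hq.2 hz))
    (Module.finBasis ℂ E k)
  have k2 : fderiv ℂ (fun y' => Φ (φ.symm y', q.2.z)) (φ q.1) (Module.finBasis ℂ E k) =
      fderiv ℂ (rayIntegral (φ p.1) w) (φ q.1, q.2.z) (Module.finBasis ℂ E k, 0) := by
    have h6 : HasFDerivAt (fun y' : E => rayIntegral (φ p.1) w (y', q.2.z))
        ((fderiv ℂ (rayIntegral (φ p.1) w) (φ q.1, q.2.z)).comp (ContinuousLinearMap.inl ℂ E ℂ))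
        (φ q.1) :=
      (hasFDerivAt_rayIntegral hOo hwd' hwc hq.1.2 hzO).1.hasFDerivAt.comp
        (f := fun y' : E => (y', q.2.z)) (φ q.1) (hasFDerivAt_prodMk_left _ _)
    have h7 : (fun y' => Φ (φ.symm y', q.2.z)) =ᶠ[𝓝 (φ q.1)]
        fun y' : E => rayIntegral (φ p.1) w (y', q.2.z) := by
      filter_upwards [isOpen_ball.mem_nhds hq.1.2] with y hy
      simp only [hΦ]
      rw [φ.right_inv (hball hy)]
    rw [h7.fderiv_eq, h6.fderiv]
    rfl
  have k3 : F k (q.1, q.2.z) = w (φ q.1, q.2.z) (Module.finBasis ℂ E k) := by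
    rw [hwb, hH]
    simp only
    rw [φ.left_inv hq.1.1]
  rw [Pi.sub_apply, k1, ← hφ, k2, k3]
  refine (norm_fderiv_rayIntegral_sub_le hOo hwd' hwc hq.1.2 hzO (hclosed _ hzO) _).trans ?_
  have : 0 < Real.exp (K / ‖q.2.z‖) := Real.exp_pos _
  nlinarith

end Primitive

end HbarConn

namespace HbarConn

/-! ### Approximately flat units and their rigidity. -/

section FlatUnit

variable {E : Type*} [NormedAddCommGroup E] [NormedSpace ℂ E] [FiniteDimensional ℂ E]
  {M : Type*} [TopologicalSpace M] [ChartedSpace E M] [IsManifold 𝓘(ℂ, E) ω M]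
  {S : Opens RealBlowup} {W W' : Opens (M × RealBlowup)}
  {R K L N : ℝ} {p : M × RealBlowup} {e e' : M × ℂ → ℂ} {A : OneForm E S W}

/-- Near `p`, `e` is a unit with `ħ de + A e = 0` up to `O (exp (-N / |ħ|))`. -/
structure FlatUnit (A : OneForm E S W) (N : ℝ) (p : M × RealBlowup) (e : M × ℂ → ℂ) : Prop where
  unit : UnitGerm E p e
  rep : ∀ W' (h : W' ≤ W) v hv, p ∈ W' → Rep N p (A.app W' h v hv) (logD v e)

theorem holNear_basisField {x y : M} (hy : y ∈ (chartAt E x).source)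
    (k : Fin (Module.finrank ℂ E)) : HolNear (basisField (E := E) x k) y := by
  filter_upwards [(chartAt E x).open_source.mem_nhds hy] with y hy
    using mdifferentiable_coordField hy _

theorem eventually_source (p : M × RealBlowup) :
    ∀ᶠ q : M × RealBlowup in 𝓝 p, q.1 ∈ (chartAt E p.1).source :=
  continuous_fst.continuousAt.eventually
    ((chartAt E p.1).open_source.mem_nhds (mem_chart_source E p.1))

theorem FlatUnit.mono (h : FlatUnit A N p e) (hL : L ≤ N) : FlatUnit A L p e :=
  ⟨h.unit, fun W' hW v hv hp => (h.rep W' hW v hv hp).mono hL⟩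

variable [DualNontrivial S]

theorem FlatUnit.of_coord (hu : UnitGerm E p e) {x : M} (hx : p.1 ∈ (chartAt E x).source)
    (hS : p.2 ∈ S)
    (h : ∀ k, Rep N p (A.coord x k) (logD (basisField (E := E) x k) e)) : FlatUnit A N p e :=
  ⟨hu, fun _ hW v hv hp => A.rep_logD_of_coord hx hW hp hS h v hv⟩

theorem FlatUnit.coord (h : FlatUnit A N p e) (hp : p ∈ W) {x : M}
    (hx : p.1 ∈ (chartAt E x).source) (k : Fin (Module.finrank ℂ E)) :
    Rep N p (A.coord x k) (logD (basisField x k) e) :=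
  h.rep _ _ _ _ (mem_chartPart hp hx)

theorem FlatUnit.eventually (h : FlatUnit A N p e) (hp : p ∈ W) (hS : p.2 ∈ S) :
    ∀ᶠ q in 𝓝 p, FlatUnit A N q e := by
  have hx := mem_chart_source E p.1
  have h1 : ∀ᶠ q in 𝓝 p, ∀ k, Rep N q (A.coord p.1 k) (logD (basisField (E := E) p.1 k) e) :=
    eventually_all.2 fun k => (h.coord hp hx k).eventually (mem_chartPart hp hx) hS
  filter_upwards [h1, h.unit.eventually, eventually_source (E := E) p, eventually_mem hS] with q k1 k2 k3 k4
  exact FlatUnit.of_coord (x := p.1) k2 k3 k4 k1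

theorem FlatUnit.mul_ofPoint (h : FlatUnit A N p e) {u : PUnit.{1} × ℂ → ℂ}
    (hu : UnitGerm PUnit.{1} (PUnit.unit, p.2) u) : FlatUnit A N p (e * ofPoint u) := by
  refine ⟨h.unit.mul hu.ofPoint, fun W' hW v hv hp => (h.rep W' hW v hv hp).congr ?_⟩
  filter_upwards [logD_mul (v := v) h.unit hu.ofPoint] with q hq hz
  rw [hq hz, logD_ofPoint, add_zero]

/-- On commuting coordinate fields flatness says that the coefficients are closed. Their
representatives are then closed to finite precision and have a bounded approximate primitive `Φ`;
for `e = e^{-Φ/ħ}` the logarithmic derivative `-ħ v(e)/e` is `v(Φ)`. The initial precision `N + 3`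
pays for the derivatives and one division by `ħ`. -/
theorem exists_flatUnit (hflat : ∀ W' (h : W' ≤ W) v w u (hv : HolVF v W') (hw : HolVF w W')
      (hu : HolVF u W'), (∀ q ∈ W', u q.1 = VectorField.mlieBracket 𝓘(ℂ, E) v w q.1) →
      (hbar : OLam E S W') * (vfDeriv v hv (A.app W' h w hw) - vfDeriv w hw (A.app W' h v hv)) =
        hbar * A.app W' h u hu)
    (hp : p ∈ W) (hS : p.2 ∈ S) (hz : p.2.z = 0) (hN : 0 ≤ N) : ∃ e, FlatUnit A N p e := by
  have hx := mem_chart_source E p.1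
  have hp' : p ∈ chartPart (E := E) W p.1 := mem_chartPart hp hx
  choose f hf using fun k => exists_rep (A.coord p.1 k) hp' hS (N + 3)
  have hf0 : ∀ k, Grow E 0 p (f k) := fun k =>
    (hf k).grow_zero_of_mem_Oce (A.coord_mem _ _) (by linarith) hp' hS hz
  have hD : ∀ k l, Grow E (-(N + 1)) p
      (dirDeriv (basisField p.1 k) (f l) - dirDeriv (basisField p.1 l) (f k)) := fun k l => by
    have hzero : HolVF (fun _ => 0 : Π x : M, TangentSpace 𝓘(ℂ, E) x)
        (chartPart (E := E) W p.1) := by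
      have := HolVF.smul (W := chartPart (E := E) W p.1) (c := fun _ => 0)
        (fun q _ => mdifferentiableAt_const) (holVF_basisField (x := p.1) k)
      simpa using this
    have h1 := hflat _ chartPart_le (basisField p.1 k) (basisField p.1 l) (fun _ => 0)
      (holVF_basisField k) (holVF_basisField l) hzero
      fun q hq => (mlieBracket_coordField hq.2.1 _ _).symm
    rw [A.app_zero, mul_zero] at h1
    have h2 := ((hf l).vfDeriv (holVF_basisField k) hp' hS (R' := N + 2) (by linarith)).sub
      ((hf k).vfDeriv (holVF_basisField l) hp' hS (R' := N + 2) (by linarith))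
    have h3 : Grow E 1 p
        (dirDeriv (basisField p.1 k) (f l) - dirDeriv (basisField p.1 l) (f k)) :=
      ((hf0 l).dirDeriv (holNear_basisField hx k) zero_lt_one).sub
        ((hf0 k).dirDeriv (holNear_basisField hx l) zero_lt_one)
    have h4 := (rep_hbar (S := S) (W := chartPart (E := E) W p.1) (p := p) (R := N + 3)).mul h2
      Grow.hbar h3 (N := N + 2) (by linarith) (by linarith) (by linarith)
    have h5 := h4.sub_grow (R := N + 2) (g := 0) (by
      change Rep _ p (hbar * (vfDeriv _ _ (A.app _ _ _ _) - vfDeriv _ _ (A.app _ _ _ _))) _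
      exact h1 ▸ rep_zero) hp' hS
    -- The curvature identity carries a factor `ħ`; removing it costs one unit of precision.
    refine (Grow.inv_hbar.mul_le h5 (N := -(N + 1)) (by linarith)).congr
      (Eventually.of_forall fun q hq => ?_)
    simp only [Pi.mul_apply, Pi.sub_apply, sub_zero]
    field_simp
  obtain ⟨Φ, hΦ, hΦ'⟩ := exists_primitive hf0 hD
  -- Boundedness of `Φ` by `C` gives the growth rate `C` for `e` and for its inverse.
  set e : M × ℂ → ℂ := fun q => Complex.exp (-Φ q / q.2) with he
  obtain ⟨C, hC, hΦC⟩ := grow_iff.1 hΦ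
  have hexp : ∀ σ : ℂ, ‖σ‖ = 1 → Grow E C p (fun q => Complex.exp (σ * Φ q / q.2)) := fun σ hσ => by
    refine grow_iff.2 ⟨1, one_pos, ?_⟩
    filter_upwards [hΦC] with q hq hz
    obtain ⟨h1, h2⟩ := hq hz
    refine ⟨?_, ?_⟩
    · have h3 : MDifferentiableAt (𝓘(ℂ, E).prod 𝓘(ℂ, ℂ)) 𝓘(ℂ, ℂ)
          (fun q : M × ℂ => q.2⁻¹) (q.1, q.2.z) :=
        MDifferentiableAt.comp (I' := 𝓘(ℂ, ℂ)) (q.1, q.2.z) (g := fun z : ℂ => z⁻¹)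
          (f := Prod.snd) (differentiableAt_inv hz).mdifferentiableAt mdifferentiableAt_snd
      have h4 := (mdifferentiableAt_const (c := σ)).mul (MDifferentiableAt.mul h1 h3)
      have h5 := MDifferentiableAt.comp (I' := 𝓘(ℂ, ℂ)) (q.1, q.2.z) (g := Complex.exp)
        Complex.differentiable_exp.differentiableAt.mdifferentiableAt h4
      refine h5.congr_of_eventuallyEq (Eventually.of_forall fun r => ?_)
      simp [div_eq_mul_inv, mul_assoc]
    · rw [Complex.norm_exp, one_mul]
      refine Real.exp_le_exp.2 ((Complex.re_le_norm _).trans ?_)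
      rw [norm_div, norm_mul, hσ, one_mul]
      gcongr
      simpa using h2
  have hunit : UnitGerm E p e := by
    refine UnitGerm.mk' (K := C) (L := C) ?_ ?_ (Eventually.of_forall fun q _ =>
      Complex.exp_ne_zero _)
    · exact (hexp (-1) (by simp)).congr (Eventually.of_forall fun q _ => by simp [he])
    · refine (hexp 1 (by simp)).congr (Eventually.of_forall fun q _ => ?_)
      simp [he, ← Complex.exp_neg, neg_div]
  refine ⟨e, FlatUnit.of_coord hunit hx hS fun k => ?_⟩
  have h1 : Rep N p (A.coord p.1 k) (dirDeriv (basisField (E := E) p.1 k) Φ) :=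
    ((hf k).mono (by linarith)).of_grow (((hΦ' k).mono (by linarith)).sub_comm)
  refine h1.congr ?_
  filter_upwards [hΦ.1] with q hq hz
  have h2 := dirDeriv_comp (v := basisField p.1 k) (F := fun w z => Complex.exp (-w / z))
    (F' := fun w z => Complex.exp (-w / z) * (-1 / z)) (hq hz)
    (((hasDerivAt_id _).fun_neg.div_const q.2.z).cexp)
  have h3 : dirDeriv (basisField p.1 k) e (q.1, q.2.z) = _ := h2
  simp only [logD]
  rw [h3]
  have h4 : e (q.1, q.2.z) = Complex.exp (-Φ (q.1, q.2.z) / q.2.z) := rfl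
  have h5 := Complex.exp_ne_zero (-Φ (q.1, q.2.z) / q.2.z)
  rw [h4]
  field_simp

/-- The quotient of two flat units is nearly constant along `M`. -/
theorem FlatUnit.exists_ratio_bound (h : FlatUnit A N p e) (h' : FlatUnit A N p e') (hp : p ∈ W)
    (hS : p.2 ∈ S) (hN : 1 ≤ N) {V : Set (M × RealBlowup)} (hV : V ∈ 𝓝 p) :
    ∃ r C : ℝ, 0 < r ∧ 0 < C ∧ ball (chartAt E p.1 p.1) r ⊆ (chartAt E p.1).target ∧
      ∃ T : Set RealBlowup, IsOpen T ∧ p.2 ∈ T ∧ (∀ y ∈ chartBall E p.1 r, ∀ s ∈ T, (y, s) ∈ V) ∧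
      ∀ y ∈ chartBall E p.1 r, ∀ y' ∈ chartBall E p.1 r, ∀ s ∈ T, s.z ≠ 0 →
        ‖(e * e'⁻¹) (y', s.z) - (e * e'⁻¹) (y, s.z)‖ ≤
          C * Real.exp (-(N - 1) / ‖s.z‖) * ‖(e * e'⁻¹) (y, s.z)‖ := by
  have hx := mem_chart_source E p.1
  set ρ := e * e'⁻¹ with hρ
  have hρu : UnitGerm E p ρ := h.unit.mul h'.unit.inv
  -- `logD` of the quotient is the difference of two representatives of the same coefficient of `A`.
  have h1 : ∀ k, Grow E (-N) p (logD (basisField p.1 k) ρ) := fun k => by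
    have h2 := (h.coord hp hx k).sub_grow (h'.coord hp hx k) (mem_chartPart hp hx) hS
    refine h2.congr ?_
    filter_upwards [logD_mul (v := basisField p.1 k) h.unit h'.unit.inv,
      logD_inv (v := basisField p.1 k) h'.unit] with q k1 k2 hz
    rw [k1 hz, Pi.add_apply, k2 hz]
    simp [sub_eq_add_neg]
  obtain ⟨C, hC, h2⟩ := exists_uniform_grow h1
  have h3 : ∀ᶠ q in 𝓝 p, q.2.z ≠ 0 → IsHolAt E ρ q ∧ ∀ k,
      ‖dirDeriv (basisField (E := E) p.1 k) ρ (q.1, q.2.z)‖ ≤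
        C * Real.exp (-(N - 1) / ‖q.2.z‖) * ‖ρ (q.1, q.2.z)‖ := by
    filter_upwards [h2, hρu.2, hρu.isHolAt] with q k1 k2 k3 hz
    refine ⟨k3 hz, fun k => ?_⟩
    have k4 := (k1 hz k).2
    have k5 : 0 < ‖ρ (q.1, q.2.z)‖ := norm_pos_iff.2 (k2 hz)
    have k6 : 0 < ‖q.2.z‖ := norm_pos_iff.2 hz
    -- Passing from `logD` to the derivative divides by `ħ`; this is the loss from `N` to `N - 1`.
    have k7 : ‖q.2.z‖⁻¹ ≤ Real.exp (1 / ‖q.2.z‖) := by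
      have := Real.add_one_le_exp (1 / ‖q.2.z‖)
      rw [one_div] at *
      linarith
    simp only [logD, norm_neg, norm_mul, norm_inv] at k4
    have k8 : Real.exp (-(N - 1) / ‖q.2.z‖) = Real.exp (1 / ‖q.2.z‖) * Real.exp (-N / ‖q.2.z‖) := by
      rw [← Real.exp_add]; congr 1; ring
    rw [k8]
    have k9 : ‖dirDeriv (basisField p.1 k) ρ (q.1, q.2.z)‖ ≤
        ‖q.2.z‖⁻¹ * (C * Real.exp (-N / ‖q.2.z‖)) * ‖ρ (q.1, q.2.z)‖ := by
      rw [← div_le_iff₀ k5, inv_mul_eq_div, le_div_iff₀ k6]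
      refine le_trans (le_of_eq ?_) k4
      field_simp
    refine k9.trans ?_
    have : ‖q.2.z‖⁻¹ * (C * Real.exp (-N / ‖q.2.z‖)) ≤
        Real.exp (1 / ‖q.2.z‖) * (C * Real.exp (-N / ‖q.2.z‖)) := by gcongr
    calc _ ≤ _ := mul_le_mul_of_nonneg_right this (norm_nonneg _)
      _ = _ := by ring
  obtain ⟨r, hr, hr1, hball, T, hT, hpT, hVT⟩ :=
    exists_chartBall (E := E) (inter_mem hV h3) one_pos
  have hb := basisConst_pos (E := E)
  refine ⟨r, basisConst E * C * (2 * r) * Real.exp (basisConst E * C * (2 * r)), hr,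
    by positivity, hball, T, hT, hpT, fun y hy s hs => (hVT y hy s hs).1, fun y hy y' hy' s hs hz => ?_⟩
  -- The Gronwall constant is itself exponentially small, so `e^{cκ} - 1` is of the order of `κ`;
  -- the remaining exponential is bounded because `N ≥ 1`.
  have h4 := gronwall_chartBall (ρ := ρ) (z := s.z) (κ := C * Real.exp (-(N - 1) / ‖s.z‖))
    hball (by positivity)
    (fun y hy => isHolAt_slice (q := (y, s)) ((hVT y hy s hs).2 hz).1)
    (fun y hy => ((hVT y hy s hs).2 hz).2) hy hy'
  refine h4.trans ?_
  have h5 : Real.exp (-(N - 1) / ‖s.z‖) ≤ 1 := by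
    rw [Real.exp_le_one_iff]
    exact div_nonpos_of_nonpos_of_nonneg (by linarith) (norm_nonneg _)
  have h6 := exp_sub_one_le (t := basisConst E * (C * Real.exp (-(N - 1) / ‖s.z‖)) * (2 * r))
    (T := basisConst E * C * (2 * r)) (by positivity) (by
      calc _ ≤ basisConst E * (C * 1) * (2 * r) := by gcongr
        _ = _ := by ring)
  calc _ ≤ _ := mul_le_mul_of_nonneg_right h6 (norm_nonneg _)
    _ = _ := by ring

/-- The quotient of two flat units has equivalent values at nearby points. -/
theorem FlatUnit.exists_close_atPoint (h : FlatUnit A N p e) (h' : FlatUnit A N p e')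
    (hp : p ∈ W) (hS : p.2 ∈ S) (hN : 1 ≤ N) {V : Set (M × RealBlowup)} (hV : V ∈ 𝓝 p) :
    ∃ B : Set M, IsOpen B ∧ IsPreconnected B ∧ p.1 ∈ B ∧ ∃ T : Set RealBlowup, IsOpen T ∧ p.2 ∈ T ∧
      (∀ y ∈ B, ∀ s ∈ T, (y, s) ∈ V) ∧
      ∀ y ∈ B, ∀ y' ∈ B, ∀ s ∈ T,
        Close PUnit.{1} (N - 1) (PUnit.unit, s) (atPoint y' (e * e'⁻¹)) (atPoint y (e * e'⁻¹)) := by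
  have hu := (h.unit.mul h'.unit.inv).eventually
  obtain ⟨r, C, hr, hC, hball, T, hT, hpT, hVT, hb⟩ :=
    h.exists_ratio_bound h' hp hS hN (inter_mem hV hu)
  refine ⟨chartBall E p.1 r, isOpen_chartBall _ _, isPreconnected_chartBall hball,
    mem_chartBall _ hr, T, hT, hpT, fun y hy s hs => (hVT y hy s hs).1, fun y hy y' hy' s hs => ?_⟩
  have u1 := UnitGerm.atPoint (hVT y hy s hs).2
  have u2 := UnitGerm.atPoint (hVT y' hy' s hs).2
  obtain ⟨K, hK⟩ : ∃ K, Grow PUnit.{1} K (PUnit.unit, s)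
      (atPoint y' (e * e'⁻¹) * (atPoint y (e * e'⁻¹))⁻¹ - 1) := by
    obtain ⟨⟨K, -, h1, h2⟩, h3⟩ := u2.mul u1.inv
    obtain ⟨⟨L, -, h1', h2'⟩, h3'⟩ := UnitGerm.one (E := PUnit.{1}) (p := (PUnit.unit, s))
    exact ⟨max K L, (h1.mono (le_max_left _ _)).sub (h1'.mono (le_max_right _ _))⟩
  refine grow_iff.2 ⟨C, hC, ?_⟩
  have hT' : ∀ᶠ q : PUnit.{1} × RealBlowup in 𝓝 (PUnit.unit, s), q.2 ∈ T :=
    continuous_snd.continuousAt.eventually (hT.mem_nhds hs)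
  filter_upwards [hK.1, hT', u1.2] with q k1 k2 k3 hz
  refine ⟨k1 hz, ?_⟩
  have k4 := hb y hy y' hy' q.2 k2 hz
  have k5 := k3 hz
  have k6 : (e * e'⁻¹) (y, q.2.z) ≠ 0 := k5
  have k7 : (atPoint y' (e * e'⁻¹) * (atPoint y (e * e'⁻¹))⁻¹ - 1) (q.1, q.2.z) =
    ((e * e'⁻¹) (y', q.2.z) - (e * e'⁻¹) (y, q.2.z)) / (e * e'⁻¹) (y, q.2.z) := by
    rw [sub_div, div_self k6]
    rfl
  rw [k7, norm_div, div_le_iff₀ (norm_pos_iff.2 k6)]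
  exact k4

/-- Flat units that are equivalent at a point of `M` are equivalent near it. -/
theorem FlatUnit.close_of_atPoint (h : FlatUnit A N p e) (h' : FlatUnit A N p e') (hp : p ∈ W)
    (hS : p.2 ∈ S) (hN : 1 ≤ N) (hL : 0 < L) (hLN : L ≤ N - 1)
    (hc : Close PUnit.{1} L (PUnit.unit, p.2) (atPoint p.1 e) (atPoint p.1 e')) :
    Close E L p e e' := by
  obtain ⟨r, C, hr, hC, hball, T, hT, hpT, hVT, hb⟩ :=
    h.exists_ratio_bound h' hp hS hN univ_mem
  obtain ⟨C', hC', h1⟩ := grow_iff.1 hc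
  have h2 := NearOne.grow hc hL.le
  obtain ⟨C'', hC'', h3⟩ := grow_iff.1 h2
  have hhol : ∀ᶠ q in 𝓝 p, q.2.z ≠ 0 → IsHolAt E (e * e'⁻¹ - 1) q := by
    obtain ⟨⟨K, hK, h1, h2⟩, h3⟩ := h.unit.mul h'.unit.inv
    exact (h1.sub ((Grow.one (E := E) (p := p)).mono hK)).1
  have hc : Continuous fun q : M × RealBlowup => ((PUnit.unit, q.2) : PUnit.{1} × RealBlowup) := by
    fun_prop
  have h1' := (hc.continuousAt (x := p)).eventually h1
  have h3' := (hc.continuousAt (x := p)).eventually h3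
  have hB : ∀ᶠ q : M × RealBlowup in 𝓝 p, q.1 ∈ chartBall E p.1 r :=
    continuous_fst.continuousAt.eventually
      ((isOpen_chartBall p.1 r).mem_nhds (mem_chartBall p.1 hr))
  have hT' : ∀ᶠ q : M × RealBlowup in 𝓝 p, q.2 ∈ T :=
    continuous_snd.continuousAt.eventually (hT.mem_nhds hpT)
  refine grow_iff.2 ⟨C * C'' + C', by positivity, ?_⟩
  filter_upwards [h1', h3', hB, hT', hhol] with q k1 k2 k3 k4 k5 hz'
  refine ⟨k5 hz', ?_⟩
  have m1 := (k1 hz').2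
  have m2 := (k2 hz').2
  have m3 := hb p.1 (mem_chartBall p.1 hr) q.1 k3 q.2 k4 hz'
  change ‖(e * e'⁻¹) (p.1, q.2.z) - 1‖ ≤ _ at m1
  change ‖(e * e'⁻¹) (p.1, q.2.z)‖ ≤ _ at m2
  simp only [zero_div, Real.exp_zero, mul_one] at m2
  have m4 : Real.exp (-(N - 1) / ‖q.2.z‖) ≤ Real.exp (-L / ‖q.2.z‖) := by
    gcongr
  calc ‖(e * e'⁻¹ - 1) (q.1, q.2.z)‖ = ‖((e * e'⁻¹) (q.1, q.2.z) - (e * e'⁻¹) (p.1, q.2.z)) +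
        ((e * e'⁻¹) (p.1, q.2.z) - 1)‖ := by
          rw [Pi.sub_apply, Pi.one_apply, sub_add_sub_cancel]
    _ ≤ _ := norm_add_le _ _
    _ ≤ C * Real.exp (-(N - 1) / ‖q.2.z‖) * ‖(e * e'⁻¹) (p.1, q.2.z)‖ +
        C' * Real.exp (-L / ‖q.2.z‖) := add_le_add m3 m1
    _ ≤ C * Real.exp (-L / ‖q.2.z‖) * C'' + C' * Real.exp (-L / ‖q.2.z‖) := by gcongr
    _ = _ := by ring

end FlatUnit

/-! ### Change of frame. -/

section Transition

variable {E : Type*} [NormedAddCommGroup E] [NormedSpace ℂ E] [FiniteDimensional ℂ E]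
  {M : Type*} [TopologicalSpace M] [ChartedSpace E M] [IsManifold 𝓘(ℂ, E) ω M]
  {S : Opens RealBlowup} {R K L N : ℝ} {p : M × RealBlowup} {a b e : M × ℂ → ℂ}
  {𝓔 : RankOneConnection E M S} {i j k : 𝓔.ι} [DualNontrivial S]

theorem rep_g_grow (hi : p ∈ 𝓔.dom i) (hj : p ∈ 𝓔.dom j) (hS : p.2 ∈ S) (hz : p.2.z = 0)
    (hR : 0 ≤ R) (h : Rep R p (𝓔.g i j) a) : Grow E 0 p a :=
  h.grow_zero_of_mem_Oce (𝓔.g_mem i j) hR ⟨hi, hj⟩ hS hz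

theorem rep_g_mul (hi : p ∈ 𝓔.dom i) (hj : p ∈ 𝓔.dom j) (hk : p ∈ 𝓔.dom k) (hS : p.2 ∈ S)
    (hz : p.2.z = 0) (hR : 0 ≤ R) (ha : Rep R p (𝓔.g i j) a) (hb : Rep R p (𝓔.g j k) b) :
    Rep R p (𝓔.g i k) (a * b) := by
  have h1 := (ha.res (inf_le_left (b := 𝓔.dom k))).mul
    (hb.res (inf_le_inf_right (𝓔.dom k) (inf_le_right (a := 𝓔.dom i) (b := 𝓔.dom j))))
    (rep_g_grow hi hj hS hz hR ha) (rep_g_grow hj hk hS hz hR hb)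
    (N := R) (by simp) (by simp) (by linarith)
  rw [𝓔.cocycle i j k] at h1
  exact (rep_res (W' := 𝓔.dom i ⊓ 𝓔.dom j ⊓ 𝓔.dom k) (inf_le_inf_right _ inf_le_left) (Opens.mem_inf.2 ⟨Opens.mem_inf.2 ⟨hi, hj⟩, hk⟩) hS).1 h1

/-- The cocycle condition gives `g i j * g j i = g i i = 1`. Representatives of both are bounded
over `ħ = 0`, so up to a factor close to `1` each is a bounded inverse of the other. -/
theorem rep_g_unit (hi : p ∈ 𝓔.dom i) (hj : p ∈ 𝓔.dom j) (hS : p.2 ∈ S) (hz : p.2.z = 0)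
    (hR : 0 < R) (h : Rep R p (𝓔.g i j) a) : UnitGerm E p a ∧ Grow E 0 p a⁻¹ := by
  obtain ⟨b, hb⟩ := exists_rep (𝓔.g j i) ⟨hj, hi⟩ hS R
  have h1 := rep_g_mul hi hj hi hS hz hR.le h hb
  rw [𝓔.g_self] at h1
  have h2 : NearOne E R p (a * b) := h1.sub_grow rep_one ⟨hi, hi⟩ hS
  have h3 := h2.unitGerm hR hz
  have h4 := h2.inv_grow hR hz
  have ha := rep_g_grow hi hj hS hz hR.le h
  have hb' := rep_g_grow hj hi hS hz hR.le hb
  have h5 : ∀ᶠ q in 𝓝 p, q.2.z ≠ 0 → a (q.1, q.2.z) ≠ 0 := by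
    filter_upwards [h3.2] with q hq hz
    exact left_ne_zero_of_mul (hq hz)
  have h6 : Grow E 0 p a⁻¹ := by
    refine (hb'.mul_le h4 (N := 0) (by simp)).congr ?_
    filter_upwards [h3.2] with q hq hz
    have k1 := left_ne_zero_of_mul (hq hz)
    have k2 := right_ne_zero_of_mul (hq hz)
    simp only [Pi.mul_apply, Pi.inv_apply]
    field_simp
  exact ⟨UnitGerm.mk' ha h6 h5, h6⟩

theorem rep_g_close (hi : p ∈ 𝓔.dom i) (hj : p ∈ 𝓔.dom j) (hS : p.2 ∈ S) (hz : p.2.z = 0)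
    (hR : 0 < R) (ha : Rep R p (𝓔.g i j) a) (hb : Rep R p (𝓔.g i j) b) : Close E R p a b := by
  obtain ⟨h1, h2⟩ := rep_g_unit hi hj hS hz hR hb
  exact Close.of_sub_grow h1 h2 (ha.sub_grow hb ⟨hi, hj⟩ hS) (by simp)

/-- Divided by `g i j`, the gauge identity reads `A_i = A_j - ħ dg/g`, that is `A_i = A_j + logD g`,
and `logD` is additive on products. -/
theorem FlatUnit.transition (h : FlatUnit (𝓔.form j) N p e) (hi : p ∈ 𝓔.dom i)
    (hj : p ∈ 𝓔.dom j) (hS : p.2 ∈ S) (hz : p.2.z = 0) (hN : 0 ≤ N)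
    (ha : Rep (N + 3) p (𝓔.g i j) a) : FlatUnit (𝓔.form i) N p (a * e) := by
  obtain ⟨hau, hai⟩ := rep_g_unit hi hj hS hz (by linarith) ha
  have ha0 := rep_g_grow hi hj hS hz (by linarith) ha
  obtain ⟨b, hb⟩ := exists_rep (𝓔.g j i) ⟨hj, hi⟩ hS (N + 3)
  have hb0 := rep_g_grow hj hi hS hz (by linarith) hb
  have hab : Rep (N + 3) p (𝓔.g i i) (b * a) := by
    rw [mul_comm]
    exact rep_g_mul hi hj hi hS hz (by linarith) ha hb
  rw [𝓔.g_self] at hab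
  have hba : NearOne E (N + 3) p (b * a) := hab.sub_grow rep_one ⟨hi, hi⟩ hS
  refine FlatUnit.of_coord (hau.mul h.unit) (mem_chart_source E p.1) hS fun l => ?_
  set W := chartPart (E := E) (𝓔.dom i ⊓ 𝓔.dom j) p.1 with hW
  have hp : p ∈ W := mem_chartPart ⟨hi, hj⟩ (mem_chart_source E p.1)
  set v := basisField (E := E) p.1 l with hv
  have hvW : HolVF v W := holVF_basisField l
  have hvn : HolNear v p.1 := hvW.near hp
  have hle : W ≤ 𝓔.dom i ⊓ 𝓔.dom j := chartPart_le
  have hg := 𝓔.gauge i j W hle v hvW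
  have r1 : Rep N p ((𝓔.form j).app W (hle.trans inf_le_right) v hvW) (logD v e) :=
    h.rep _ _ _ _ hp
  have r2 : Rep (N + 3) p (res hle (𝓔.g i j) : OLam E S W) a := ha.res hle
  have r3 : Rep (N + 2) p (vfDeriv v hvW (res hle (𝓔.g i j))) (dirDeriv v a) :=
    r2.vfDeriv hvW hp hS (by linarith)
  have hda : Grow E 1 p (dirDeriv v a) := ha0.dirDeriv hvn zero_lt_one
  have r4 : Rep (N + 1) p ((hbar : OLam E S W) * vfDeriv v hvW (res hle (𝓔.g i j)))
      ((fun q => q.2) * dirDeriv v a) :=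
    (rep_hbar (R := N + 3)).mul r3 Grow.hbar hda (by linarith) (by linarith) (by linarith)
  have hzda : Grow E 1 p ((fun q : M × ℂ => q.2) * dirDeriv v a) :=
    Grow.hbar.mul_le hda (by simp)
  -- the component of the form in the frame `i`
  obtain ⟨f, hf⟩ := exists_rep ((𝓔.form i).app W (hle.trans inf_le_left) v hvW) hp hS (N + 3)
  have hf0 : Grow E 0 p f := hf.grow_zero_of_mem_Oce ((𝓔.form i).mem _ _ _ _) (by linarith) hp hS hz
  obtain ⟨f', hf'⟩ := exists_rep ((𝓔.form j).app W (hle.trans inf_le_right) v hvW) hp hS (N + 3)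
  have hf0' : Grow E 0 p f' :=
    hf'.grow_zero_of_mem_Oce ((𝓔.form j).mem _ _ _ _) (by linarith) hp hS hz
  have r5 : Rep (N + 3) p (res hle (𝓔.g i j) *
      ((𝓔.form j).app W (hle.trans inf_le_right) v hvW -
        (𝓔.form i).app W (hle.trans inf_le_left) v hvW)) (a * (f' - f)) :=
    r2.mul (hf'.sub hf) ha0 (hf0'.sub hf0) (by simp) (by simp) (by linarith)
  rw [← hg] at r5
  have g1 : Grow E (-(N + 1)) p (a * (f' - f) - (fun q => q.2) * dirDeriv v a) :=
    (r5.mono (by linarith)).sub_grow r4 hp hS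
  have g2 : Grow E (-N) p (f' - logD v e) := (hf'.mono (by linarith)).sub_grow r1 hp hS
  have r6 : Rep N p ((𝓔.form i).app W (hle.trans inf_le_left) v hvW) (logD v (a * e)) := by
    refine (hf.mono (by linarith)).of_grow ?_
    have g3 := ((g1.mul_le hai (N := -N) (by linarith)).sub g2).neg
    refine g3.congr ?_
    filter_upwards [logD_mul (v := v) hau h.unit, hau.2] with q k1 k2 hq
    have k3 := k2 hq
    rw [Pi.sub_apply, k1 hq]
    simp only [Pi.neg_apply, Pi.sub_apply, Pi.mul_apply, Pi.inv_apply, Pi.add_apply, logD]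
    field_simp
    ring
  have hle2 : W ≤ chartPart (E := E) (𝓔.dom i) p.1 := inf_le_inf_right _ inf_le_left
  have := (𝓔.form i).app_res _ chartPart_le _ hle2 (basisField p.1 l) (holVF_basisField l)
  rw [← rep_res hle2 hp hS, OneForm.coord, ← this]
  exact r6

end Transition

end HbarConn

namespace HbarConn

/-! ### Locally constant cocycles on simply connected spaces. -/

section Monodromy

/-- A locally constant cocycle with values in a monoid, on a simply connected space, is trivial. -/
theorem exists_trivialization_of_cocycle {X : Type*} [TopologicalSpace X] [SimplyConnectedSpace X]
    [LocallyPathConnectedSpace X] {Γ : Type*} [Monoid Γ] (B : X → Set X)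
    (hB : ∀ x, IsOpen (B x)) (hx : ∀ x, x ∈ B x) (c : X → X → X → Γ)
    (c_self : ∀ x, ∀ y ∈ B x, c x x y = 1)
    (c_mul : ∀ x x' x'' y, y ∈ B x → y ∈ B x' → y ∈ B x'' → c x x' y * c x' x'' y = c x x'' y)
    (c_const : ∀ x x' y, y ∈ B x → y ∈ B x' → ∀ᶠ y' in 𝓝 y, c x x' y' = c x x' y)
    (x₀ : X) (g₀ : Γ) :
    ∃ h : X → Γ, h x₀ = g₀ ∧ ∀ x, ∀ᶠ x' in 𝓝 x, h x' = c x' x x' * h x := by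
  -- With the discrete topology the fibre bundle defined by the cocycle is a covering. A monoid
  -- suffices: `c_mul` and `c_self` already make the transition maps invertible.
  let _ : TopologicalSpace Γ := ⊥
  have : DiscreteTopology Γ := ⟨rfl⟩
  let Z : FiberBundleCore X X Γ :=
    { baseSet := B
      isOpen_baseSet := hB
      indexAt := id
      mem_baseSet_at := hx
      coordChange := fun i j y v => c j i y * v
      coordChange_self := fun i y hy v => by rw [c_self i y hy, one_mul]
      continuousOn_coordChange := fun i j => by
        rintro ⟨y, v⟩ ⟨⟨hi, hj⟩, -⟩
        have h1 : Filter.EventuallyEq (𝓝 (y, v)) (fun p : X × Γ => c j i p.1 * p.2)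
            fun p => c j i y * p.2 := by
          have := (continuous_fst.continuousAt (x := (y, v))).eventually (c_const j i y hj hi)
          filter_upwards [this] with p hp
          rw [hp]
        have h2 : ContinuousAt (fun p : X × Γ => c j i y * p.2) (y, v) :=
          (continuous_of_discreteTopology (f := fun w : Γ => c j i y * w)).continuousAt.comp
            continuous_snd.continuousAt
        exact (h2.congr h1.symm).continuousWithinAt
      coordChange_comp := fun i j k y hy v => by
        rw [← mul_assoc, c_mul k j i y hy.2 hy.1.2 hy.1.1] }
  have hcov : IsCoveringMap (Z.proj) := FiberBundle.isCoveringMap (F := Γ) (E := Z.Fiber)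
  -- Simple connectedness enters here: the identity lifts to a section through the chosen point. In
  -- each local trivialization the section is locally constant, and this is the relation on `h`.
  obtain ⟨σ, ⟨h0, hσ⟩, -⟩ := hcov.existsUnique_continuousMap_lifts (ContinuousMap.id X) x₀
    (⟨x₀, g₀⟩ : Z.TotalSpace) rfl
  have hp : ∀ x, (σ x).proj = x := fun x => congrFun hσ x
  let val : Z.TotalSpace → Γ := fun t => t.snd
  have key : ∀ x, ∀ᶠ x' in 𝓝 x, c x (σ x').proj (σ x').proj * val (σ x') =
      c x (σ x).proj (σ x).proj * val (σ x) := by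
    intro x
    have hs : σ x ∈ (Z.localTriv x).source := by
      rw [Z.mem_localTriv_source]
      change (σ x).proj ∈ B x
      rw [hp]
      exact hx x
    have h1 : ContinuousAt (fun x' => (Z.localTriv x (σ x')).2) x :=
      continuous_snd.continuousAt.comp
        (((Z.localTriv x).continuousAt hs).comp σ.continuous.continuousAt)
    have h2 := h1.eventually ((isOpen_discrete {(Z.localTriv x (σ x)).2}).mem_nhds rfl)
    filter_upwards [h2] with x' hx'
    exact hx'
  refine ⟨fun x => val (σ x), congrArg val h0, fun x => ?_⟩
  filter_upwards [key x, (hB x).mem_nhds (hx x)] with x' h1 h2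
  rw [hp, hp] at h1
  rw [c_self x x (hx x), one_mul] at h1
  rw [← h1, ← mul_assoc, c_mul x' x x' x' (hx x') h2 (hx x'), c_self x' x' (hx x'), one_mul]

end Monodromy

/-! ### Classes of units in `ħ` to a given precision. -/

section Gam

variable {N L : ℝ} {s : RealBlowup} {u v : PUnit.{1} × ℂ → ℂ}

/-- Units of exponential growth in `ħ`. -/
def unitGerms (s : RealBlowup) : Submonoid (PUnit.{1} × ℂ → ℂ) where
  carrier := {u | UnitGerm PUnit.{1} (PUnit.unit, s) u}
  one_mem' := UnitGerm.one
  mul_mem' := UnitGerm.mul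

/-- Equality up to a factor `1 + O (exp (-N / |ħ|))`. -/
def closeCon (hN : 0 < N) (hz : s.z = 0) : Con (unitGerms s) where
  r u v := Close PUnit.{1} N (PUnit.unit, s) u.1 v.1
  iseqv :=
    { refl := fun u => Close.refl u.2
      symm := fun h => h.symm hN hz
      trans := fun {_ v _} h h' => h.trans h' v.2 hN.le }
  mul' h h' := h.mul h' hN.le

/-- The monoid of units of exponential growth near `s`, up to factors `1 + O (exp (-N / |ħ|))`. -/
abbrev Gam (N : ℝ) (s : RealBlowup) : Type :=
  (conGen fun u v : unitGerms s => Close PUnit.{1} N (PUnit.unit, s) u.1 v.1).Quotient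

open Classical in
/-- The class of a unit. -/
noncomputable def toGam (N : ℝ) (s : RealBlowup) (u : PUnit.{1} × ℂ → ℂ) : Gam N s :=
  if h : u ∈ unitGerms s then ((⟨u, h⟩ : unitGerms s) : Gam N s) else 1

theorem toGam_of_unit (hu : UnitGerm PUnit.{1} (PUnit.unit, s) u) :
    toGam N s u = ((⟨u, hu⟩ : unitGerms s) : Gam N s) :=
  dif_pos (show u ∈ unitGerms s from hu)

theorem toGam_mul (hu : UnitGerm PUnit.{1} (PUnit.unit, s) u)
    (hv : UnitGerm PUnit.{1} (PUnit.unit, s) v) :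
    toGam N s (u * v) = toGam N s u * toGam N s v := by
  rw [toGam_of_unit hu, toGam_of_unit hv, toGam_of_unit (hu.mul hv)]
  rfl

theorem toGam_one : toGam N s 1 = 1 := by
  rw [toGam_of_unit UnitGerm.one]
  rfl

/-- For `N > 0` over `ħ = 0` closeness is already a congruence, so generating one adds nothing.
Using the generated congruence in the definition keeps these two conditions out of the type. -/
theorem toGam_eq_iff (hN : 0 < N) (hz : s.z = 0) (hu : UnitGerm PUnit.{1} (PUnit.unit, s) u)
    (hv : UnitGerm PUnit.{1} (PUnit.unit, s) v) :
    toGam N s u = toGam N s v ↔ Close PUnit.{1} N (PUnit.unit, s) u v := by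
  rw [toGam_of_unit hu, toGam_of_unit hv]
  refine (Con.eq _).trans ?_
  have := Con.conGen_of_con (closeCon hN hz)
  exact Iff.of_eq (congrArg (fun c : Con (unitGerms s) => c ⟨u, hu⟩ ⟨v, hv⟩) this)

theorem toGam_inv_mul (hN : 0 < N) (hz : s.z = 0) (hu : UnitGerm PUnit.{1} (PUnit.unit, s) u) :
    toGam N s u⁻¹ * toGam N s u = 1 := by
  rw [← toGam_mul hu.inv hu, ← toGam_one, toGam_eq_iff hN hz (hu.inv.mul hu) UnitGerm.one]
  refine (Close.refl UnitGerm.one).congr ?_ (Eventually.of_forall fun _ _ => rfl)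
  filter_upwards [hu.mul_inv_cancel] with q hq hz
  rw [mul_comm]
  exact hq hz

theorem exists_toGam_eq (γ : Gam N s) :
    ∃ u, UnitGerm PUnit.{1} (PUnit.unit, s) u ∧ toGam N s u = γ := by
  obtain ⟨u, rfl⟩ := Quotient.exists_rep γ
  exact ⟨u.1, u.2, toGam_of_unit u.2⟩

/-- A class to lower precision. -/
noncomputable def Gam.lower (L : ℝ) (γ : Gam N s) : Gam L s := toGam L s (exists_toGam_eq γ).choose

/-- The chosen unit does not matter, because closeness to precision `N` implies closeness to
precision `L`. -/
theorem Gam.lower_toGam (hL : 0 < L) (hLN : L ≤ N) (hz : s.z = 0)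
    (hu : UnitGerm PUnit.{1} (PUnit.unit, s) u) : Gam.lower L (toGam N s u) = toGam L s u := by
  obtain ⟨h1, h2⟩ := (exists_toGam_eq (toGam N s u)).choose_spec
  rw [toGam_eq_iff (hL.trans_le hLN) hz h1 hu] at h2
  exact (toGam_eq_iff hL hz h1 hu).2 (h2.mono hLN)

end Gam

end HbarConn

namespace HbarConn

/-! ### Flat families of classes over a fixed direction at `ħ = 0`. -/

section FlatFamily

variable {E : Type*} [NormedAddCommGroup E] [NormedSpace ℂ E] [FiniteDimensional ℂ E]
  {M : Type*} [TopologicalSpace M] [ChartedSpace E M] [IsManifold 𝓘(ℂ, E) ω M]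
  {S : Opens RealBlowup} [DualNontrivial S] {𝓔 : RankOneConnection E M S} {i j k : 𝓔.ι}
  {N R L : ℝ} {s : RealBlowup} {x y : M} {a e e' : M × ℂ → ℂ}

theorem eventually_slice {p : M × RealBlowup} {P : M × RealBlowup → Prop} (h : ∀ᶠ q in 𝓝 p, P q) :
    ∀ᶠ y in 𝓝 p.1, P (y, p.2) := by
  have hc : Continuous fun y : M => (y, p.2) := by fun_prop
  exact (hc.continuousAt (x := p.1)).eventually h

theorem eventually_point {p : M × RealBlowup} {P : M × RealBlowup → Prop} (h : ∀ᶠ q in 𝓝 p, P q) :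
    ∀ᶠ σ in 𝓝 p.2, P (p.1, σ) := by
  have hc : Continuous fun σ : RealBlowup => (p.1, σ) := by fun_prop
  exact (hc.continuousAt (x := p.2)).eventually h

/-- The class at `(y, s)` of the transition function. -/
noncomputable def gamG (𝓔 : RankOneConnection E M S) (N : ℝ) (s : RealBlowup) (y : M)
    (i j : 𝓔.ι) : Gam N s :=
  open Classical in
  toGam N s (atPoint y (if h : ∃ a, Rep N (y, s) (𝓔.g i j) a then h.choose else 1))

/-- Two representatives of a transition function are multiplicatively close with no loss, since its
inverse is bounded. -/
theorem gamG_eq (hN : 0 < N) (hz : s.z = 0) (hs : s ∈ S) (hi : (y, s) ∈ 𝓔.dom i)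
    (hj : (y, s) ∈ 𝓔.dom j) (hR : N ≤ R) (ha : Rep R (y, s) (𝓔.g i j) a) :
    gamG 𝓔 N s y i j = toGam N s (atPoint y a) := by
  have hex : ∃ a, Rep N (y, s) (𝓔.g i j) a := ⟨a, ha.mono hR⟩
  rw [gamG, dif_pos hex]
  have h1 := rep_g_close hi hj hs hz hN hex.choose_spec (ha.mono hR)
  exact (toGam_eq_iff hN hz (rep_g_unit hi hj hs hz hN hex.choose_spec).1.atPoint
    (rep_g_unit hi hj hs hz hN (ha.mono hR)).1.atPoint).2 h1.atPoint

theorem gamG_mul (hN : 0 < N) (hz : s.z = 0) (hs : s ∈ S) (hi : (y, s) ∈ 𝓔.dom i)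
    (hj : (y, s) ∈ 𝓔.dom j) (hk : (y, s) ∈ 𝓔.dom k) :
    gamG 𝓔 N s y i j * gamG 𝓔 N s y j k = gamG 𝓔 N s y i k := by
  obtain ⟨a, ha⟩ := exists_rep (𝓔.g i j) ⟨hi, hj⟩ hs N
  obtain ⟨b, hb⟩ := exists_rep (𝓔.g j k) ⟨hj, hk⟩ hs N
  have h1 := rep_g_mul hi hj hk hs hz hN.le ha hb
  rw [gamG_eq hN hz hs hi hj le_rfl ha, gamG_eq hN hz hs hj hk le_rfl hb,
    gamG_eq hN hz hs hi hk le_rfl h1, ← toGam_mul (rep_g_unit hi hj hs hz hN ha).1.atPoint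
    (rep_g_unit hj hk hs hz hN hb).1.atPoint]
  rfl

theorem gamG_self (hN : 0 < N) (hz : s.z = 0) (hs : s ∈ S) (hi : (y, s) ∈ 𝓔.dom i) :
    gamG 𝓔 N s y i i = 1 := by
  rw [gamG_eq hN hz hs hi hi le_rfl (a := 1) (by rw [𝓔.g_self]; exact rep_one)]
  exact toGam_one

theorem gamG_symm_mul (hN : 0 < N) (hz : s.z = 0) (hs : s ∈ S) (hi : (y, s) ∈ 𝓔.dom i)
    (hj : (y, s) ∈ 𝓔.dom j) : gamG 𝓔 N s y i j * gamG 𝓔 N s y j i = 1 := by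
  rw [gamG_mul hN hz hs hi hj hi, gamG_self hN hz hs hi]

/-- A frame at the point. -/
noncomputable def frameIdx (𝓔 : RankOneConnection E M S) (p : M × RealBlowup) (i : 𝓔.ι) : 𝓔.ι :=
  open Classical in if h : p.2 ∈ S then (𝓔.cover p h).choose else i

theorem mem_frameIdx {p : M × RealBlowup} (h : p.2 ∈ S) : p ∈ 𝓔.dom (frameIdx 𝓔 p i) := by
  rw [frameIdx, dif_pos h]
  exact (𝓔.cover p h).choose_spec

theorem frameIdx_eq {p : M × RealBlowup} (h : p.2 ∈ S) : frameIdx 𝓔 p i = frameIdx 𝓔 p j := by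
  rw [frameIdx, dif_pos h, frameIdx, dif_pos h]

/-- The class at `(y, s)` of the local section with coordinate `u` in the frame `i`. -/
noncomputable def secClass (𝓔 : RankOneConnection E M S) (N : ℝ) (s : RealBlowup) (y : M)
    (i : 𝓔.ι) (u : M × ℂ → ℂ) : Gam N s :=
  gamG 𝓔 N s y (frameIdx 𝓔 (y, s) i) i * toGam N s (atPoint y u)

theorem secClass_eq_iff (hN : 0 < N) (hz : s.z = 0) (hs : s ∈ S) (hi : (y, s) ∈ 𝓔.dom i)
    (he : UnitGerm E (y, s) e) (he' : UnitGerm E (y, s) e') :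
    secClass 𝓔 N s y i e = secClass 𝓔 N s y i e' ↔
      Close PUnit.{1} N (PUnit.unit, s) (atPoint y e) (atPoint y e') := by
  rw [← toGam_eq_iff hN hz he.atPoint he'.atPoint]
  refine ⟨fun h => ?_, fun h => by rw [secClass, secClass, h]⟩
  have := congrArg (gamG 𝓔 N s y i (frameIdx 𝓔 (y, s) i) * ·) h
  simpa only [secClass, ← mul_assoc, gamG_symm_mul hN hz hs hi (mem_frameIdx hs), one_mul] using this

/-- Classes are expressed in one reference frame at each point, so by the cocycle relation they do
not depend on the frame in which the coordinate is given. -/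
theorem secClass_transition (hN : 0 < N) (hz : s.z = 0) (hs : s ∈ S) (hi : (y, s) ∈ 𝓔.dom i)
    (hj : (y, s) ∈ 𝓔.dom j) (hR : N ≤ R) (ha : Rep R (y, s) (𝓔.g i j) a)
    (he : UnitGerm E (y, s) e) : secClass 𝓔 N s y i (a * e) = secClass 𝓔 N s y j e := by
  have hau := (rep_g_unit hi hj hs hz (hN.trans_le hR) ha).1
  have h1 : toGam N s (atPoint y (a * e)) = gamG 𝓔 N s y i j * toGam N s (atPoint y e) := by
    rw [gamG_eq hN hz hs hi hj hR ha]
    exact toGam_mul hau.atPoint he.atPoint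
  rw [secClass, secClass, h1, ← mul_assoc, gamG_mul hN hz hs (mem_frameIdx hs) hi hj,
    frameIdx_eq (i := i) (j := j) hs]

theorem secClass_mul_ofPoint {u : PUnit.{1} × ℂ → ℂ} (he : UnitGerm E (y, s) e)
    (hu : UnitGerm PUnit.{1} (PUnit.unit, s) u) :
    secClass 𝓔 N s y i (e * ofPoint u) = secClass 𝓔 N s y i e * toGam N s u := by
  rw [secClass, secClass, mul_assoc, ← toGam_mul he.atPoint hu]
  rfl

/-- The family of classes `τ` is that of a flat section near `x`. -/
def FlatAt (𝓔 : RankOneConnection E M S) (N : ℝ) (s : RealBlowup) (τ : M → Gam N s) (x : M) : Prop :=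
  ∃ i, (x, s) ∈ 𝓔.dom i ∧ ∃ e, FlatUnit (𝓔.form i) (N + 1) (x, s) e ∧
    ∀ᶠ y in 𝓝 x, τ y = secClass 𝓔 N s y i e

variable {τ τ' : M → Gam N s}

theorem FlatAt.exists_frame (h : FlatAt 𝓔 N s τ x) (hN : 0 < N) (hz : s.z = 0) (hs : s ∈ S)
    (hj : (x, s) ∈ 𝓔.dom j) : ∃ e, FlatUnit (𝓔.form j) (N + 1) (x, s) e ∧
      ∀ᶠ y in 𝓝 x, τ y = secClass 𝓔 N s y j e := by
  obtain ⟨i, hi, e, he, hτ⟩ := h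
  obtain ⟨a, ha⟩ := exists_rep (𝓔.g j i) ⟨hj, hi⟩ hs (N + 1 + 3)
  refine ⟨a * e, he.transition hj hi hs hz (by linarith) ha, ?_⟩
  filter_upwards [hτ, eventually_slice (ha.eventually (p := (x, s)) ⟨hj, hi⟩ hs),
    eventually_slice ((𝓔.dom i).2.mem_nhds hi), eventually_slice ((𝓔.dom j).2.mem_nhds hj),
    eventually_slice he.unit.eventually] with y h1 h2 h3 h4 h5
  rw [h1]
  exact (secClass_transition hN hz hs h4 h3 (by linarith) h2 h5).symm

theorem NearOne.of_close {u v : PUnit.{1} × ℂ → ℂ} {q : PUnit.{1} × RealBlowup}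
    (h : Close PUnit.{1} N q u v)
    (hv : NearOne PUnit.{1} N q v) (hN : 0 < N) (hz : q.2.z = 0) : NearOne PUnit.{1} N q u := by
  refine (NearOne.mul h hv hN.le).congr ?_
  filter_upwards [(hv.unitGerm hN hz).2] with q hq hz
  have := hq hz
  simp only [Pi.mul_apply, Pi.inv_apply]
  field_simp

/-- Two flat families in a fixed frame that agree at a point agree nearby. -/
theorem FlatUnit.exists_secClass_eq_iff (h : FlatUnit (𝓔.form i) (N + 1) (x, s) e)
    (h' : FlatUnit (𝓔.form i) (N + 1) (x, s) e') (hN : 0 < N) (hz : s.z = 0) (hs : s ∈ S)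
    (hi : (x, s) ∈ 𝓔.dom i) :
    ∀ᶠ y in 𝓝 x, (secClass 𝓔 N s x i e = secClass 𝓔 N s x i e' ↔
      secClass 𝓔 N s y i e = secClass 𝓔 N s y i e') := by
  -- Comparing values at nearby points loses one unit, which is why flat units of precision `N + 1`
  -- accompany classes of precision `N`.
  obtain ⟨B, hB, -, hxB, T, hT, hsT, hBT, hc⟩ := h.exists_close_atPoint h' hi hs (by linarith)
    (inter_mem ((𝓔.dom i).2.mem_nhds hi) (inter_mem h.unit.eventually h'.unit.eventually))
  filter_upwards [hB.mem_nhds hxB] with y hy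
  obtain ⟨d1, u1, u1'⟩ := hBT x hxB s hsT
  obtain ⟨d2, u2, u2'⟩ := hBT y hy s hsT
  rw [secClass_eq_iff hN hz hs d1 u1 u1', secClass_eq_iff hN hz hs d2 u2 u2']
  have c1 := hc x hxB y hy s hsT
  have c2 := hc y hy x hxB s hsT
  rw [add_sub_cancel_right] at c1 c2
  exact ⟨fun k => NearOne.of_close c1 k hN hz, fun k => NearOne.of_close c2 k hN hz⟩

theorem FlatAt.eventually_eq_iff (h : FlatAt 𝓔 N s τ x) (h' : FlatAt 𝓔 N s τ' x) (hN : 0 < N)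
    (hz : s.z = 0) (hs : s ∈ S) : ∀ᶠ y in 𝓝 x, (τ x = τ' x ↔ τ y = τ' y) := by
  obtain ⟨i, hi, e, he, hτ⟩ := h
  obtain ⟨e', he', hτ'⟩ := h'.exists_frame hN hz hs hi
  filter_upwards [hτ, hτ', he.exists_secClass_eq_iff he' hN hz hs hi] with y h1 h2 h3
  rw [h1, h2, hτ.self_of_nhds, hτ'.self_of_nhds]
  exact h3

/-- Agreement of two flat families is both an open and a closed condition on the point, by
`FlatAt.eventually_eq_iff`. -/
theorem FlatAt.eq_iff_of_isPreconnected {B : Set M} (hB : IsPreconnected B)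
    (h : ∀ x ∈ B, FlatAt 𝓔 N s τ x) (h' : ∀ x ∈ B, FlatAt 𝓔 N s τ' x) (hN : 0 < N)
    (hz : s.z = 0) (hs : s ∈ S) (hx : x ∈ B) (hy : y ∈ B) : τ x = τ' x ↔ τ y = τ' y :=
  hB.induction₂ (fun x y => (τ x = τ' x ↔ τ y = τ' y))
    (fun x hx => ((h x hx).eventually_eq_iff (h' x hx) hN hz hs).filter_mono nhdsWithin_le_nhds)
    (fun _ _ _ _ _ _ h1 h2 => h1.trans h2) (fun _ _ _ _ h1 => h1.symm) hx hy

theorem FlatUnit.flatAt (h : FlatUnit (𝓔.form i) (N + 1) (x, s) e) (hi : (x, s) ∈ 𝓔.dom i) :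
    FlatAt 𝓔 N s (fun y => secClass 𝓔 N s y i e) x :=
  ⟨i, hi, e, h, Eventually.of_forall fun _ => rfl⟩

theorem FlatAt.lower {τ : M → Gam N s} (h : FlatAt 𝓔 N s τ x) (hL : 0 < L) (hLN : L ≤ N)
    (hz : s.z = 0) (hs : s ∈ S) : FlatAt 𝓔 L s (fun y => Gam.lower L (τ y)) x ∧
    ∀ i, (x, s) ∈ 𝓔.dom i → ∀ e, UnitGerm E (x, s) e → τ x = secClass 𝓔 N s x i e →
      Gam.lower L (τ x) = secClass 𝓔 L s x i e := by
  have key : ∀ i y, (y, s) ∈ 𝓔.dom i → ∀ e, UnitGerm E (y, s) e →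
      Gam.lower L (secClass 𝓔 N s y i e) = secClass 𝓔 L s y i e := by
    intro i y hi e he
    have hf := mem_frameIdx (𝓔 := 𝓔) (i := i) (p := (y, s)) hs
    obtain ⟨a, ha⟩ := exists_rep (𝓔.g (frameIdx 𝓔 (y, s) i) i) ⟨hf, hi⟩ hs N
    have hau := (rep_g_unit hf hi hs hz (hL.trans_le hLN) ha).1
    rw [secClass, secClass, gamG_eq (hL.trans_le hLN) hz hs hf hi le_rfl ha,
      gamG_eq hL hz hs hf hi hLN ha, ← toGam_mul hau.atPoint he.atPoint,
      ← toGam_mul hau.atPoint he.atPoint, Gam.lower_toGam hL hLN hz (hau.atPoint.mul he.atPoint)]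
  refine ⟨?_, fun i hi e he h => by rw [h, key i x hi e he]⟩
  obtain ⟨i, hi, e, he, hτ⟩ := h
  refine ⟨i, hi, e, he.mono (by linarith), ?_⟩
  filter_upwards [hτ, eventually_slice ((𝓔.dom i).2.mem_nhds hi),
    eventually_slice he.unit.eventually] with y h1 h2 h3
  rw [h1, key i y h2 e h3]

variable (𝓔) in
/-- Over a simply connected open set there are flat families with arbitrary values at a point. -/
theorem exists_flatAt (U : Opens M) [SimplyConnectedSpace U] (hN : 0 < N) (hz : s.z = 0)
    (hs : s ∈ S) {x₀ : M} (hx₀ : x₀ ∈ U) (g₀ : Gam N s) :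
    ∃ τ : M → Gam N s, (∀ x ∈ U, FlatAt 𝓔 N s τ x) ∧ τ x₀ = g₀ := by
  classical
  have : LocallyPathConnectedSpace M := ChartedSpace.locallyPathConnectedSpace E M
  have : LocallyPathConnectedSpace U := U.2.locallyPathConnectedSpace
  obtain ⟨i₀, -⟩ := 𝓔.cover (x₀, s) hs
  set ix : M → 𝓔.ι := fun x => frameIdx 𝓔 (x, s) i₀ with hix
  have hmem : ∀ x, (x, s) ∈ 𝓔.dom (ix x) := fun x => mem_frameIdx hs
  have hixe : ∀ x i, frameIdx 𝓔 (x, s) i = ix x := fun x i => frameIdx_eq hs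
  choose e he using fun x : M => exists_flatUnit (N := N + 1) (𝓔.flat (ix x)) (hmem x) hs hz
    (by linarith)
  set B : U → Set U := fun x =>
    interior {y | (y.1, s) ∈ 𝓔.dom (ix x) ∧ FlatUnit (𝓔.form (ix x)) (N + 1) (y.1, s) (e x)} with hB
  have hBm : ∀ x, ∀ y ∈ B x,
      (y.1, s) ∈ 𝓔.dom (ix x) ∧ FlatUnit (𝓔.form (ix x)) (N + 1) (y.1, s) (e x) := fun x y hy => by
    have h1 : B x ⊆ {y | (y.1, s) ∈ 𝓔.dom (ix x) ∧
      FlatUnit (𝓔.form (ix x)) (N + 1) (y.1, s) (e x)} := interior_subset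
    exact h1 hy
  -- The ratio of the local flat units chosen at `x'` and `x`, both seen in the frame at `x`, as a
  -- class at the point `y`.
  set c : U → U → U → Gam N s := fun x x' y =>
    toGam N s (atPoint y.1 (e x)⁻¹) * gamG 𝓔 N s y (ix x) (ix x') * toGam N s (atPoint y.1 (e x'))
    with hc
  have inv_mul : ∀ x, ∀ y ∈ B x,
      toGam N s (atPoint y.1 (e x)⁻¹) * toGam N s (atPoint y.1 (e x)) = 1 := fun x y hy =>
    toGam_inv_mul hN hz (hBm x y hy).2.unit.atPoint
  obtain ⟨h, h0, hh⟩ := exists_trivialization_of_cocycle B (fun x => isOpen_interior)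
    (fun x => by
      rw [hB, mem_interior_iff_mem_nhds]
      have h1 := eventually_slice (((𝓔.dom (ix x)).2.mem_nhds (hmem x)))
      have h2 := eventually_slice ((he x).eventually (hmem x) hs)
      exact continuous_subtype_val.continuousAt.eventually (h1.and h2)) c
    (fun x y hy => by
      rw [hc]
      simp only
      rw [gamG_self hN hz hs (hBm x y hy).1, mul_one, inv_mul x y hy])
    (fun x x' x'' y hy hy' hy'' => by
      rw [hc]
      simp only
      rw [← gamG_mul hN hz hs (hBm x y hy).1 (hBm x' y hy').1 (hBm x'' y hy'').1]
      have := inv_mul x' y hy'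
      calc _ = toGam N s (atPoint y.1 (e x)⁻¹) * gamG 𝓔 N s y (ix x) (ix x') *
            (toGam N s (atPoint y.1 (e x')⁻¹) * toGam N s (atPoint y.1 (e x'))) *
            gamG 𝓔 N s y (ix x') (ix x'') * toGam N s (atPoint y.1 (e x'')) := by
              simp only [mul_comm, mul_left_comm]
        _ = _ := by rw [this, mul_one]; simp only [mul_assoc])
    (fun x x' y hy hy' => by
      obtain ⟨d1, f1⟩ := hBm x y hy
      obtain ⟨d2, f2⟩ := hBm x' y hy'
      obtain ⟨a, ha⟩ := exists_rep (𝓔.g (ix x) (ix x')) ⟨d1, d2⟩ hs (N + 1 + 3)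
      have hau := (rep_g_unit d1 d2 hs hz (by linarith) ha).1
      -- Moved to the frame at `x`, the unit of `x'` is again flat; the quotient of the two flat
      -- units of the same form has a locally constant class.
      have f3 := f2.transition d1 d2 hs hz (by linarith) ha
      obtain ⟨B', hB', -, hyB', T, hT, hsT, hBT, hcl⟩ := f3.exists_close_atPoint f1 d1 hs
        (by linarith) (inter_mem (inter_mem ((𝓔.dom (ix x)).2.mem_nhds d1)
          ((𝓔.dom (ix x')).2.mem_nhds d2)) (inter_mem (inter_mem f1.unit.eventually
          f2.unit.eventually) (inter_mem hau.eventually (ha.eventually (p := (y.1, s)) ⟨d1, d2⟩ hs))))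
      have hform : ∀ w ∈ B', gamG 𝓔 N s w (ix x) (ix x') = toGam N s (atPoint w a) ∧
          UnitGerm E (w, s) (e x) ∧ UnitGerm E (w, s) (e x') ∧ UnitGerm E (w, s) a := fun w hw => by
        obtain ⟨⟨k1, k2⟩, ⟨k3, k4⟩, k5, k6⟩ := hBT w hw s hsT
        exact ⟨gamG_eq hN hz hs k1 k2 (by linarith) k6, k3, k4, k5⟩
      have hform2 : ∀ w ∈ B', toGam N s (atPoint w (e x)⁻¹) * gamG 𝓔 N s w (ix x) (ix x') *
          toGam N s (atPoint w (e x')) = toGam N s (atPoint w (a * e x' * (e x)⁻¹)) := fun w hw => by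
        obtain ⟨k1, k2, k3, k4⟩ := hform w hw
        rw [k1]
        have m1 : atPoint w (a * e x' * (e x)⁻¹) =
          atPoint w (e x)⁻¹ * atPoint w a * atPoint w (e x') := by
            funext q
            simp only [atPoint, Pi.mul_apply, Pi.inv_apply]
            ring
        rw [m1, toGam_mul (k2.inv.atPoint.mul k4.atPoint) k3.atPoint,
          toGam_mul k2.inv.atPoint k4.atPoint]
      have hev : ∀ᶠ y' : U in 𝓝 y, y'.1 ∈ B' :=
        continuous_subtype_val.continuousAt.eventually (hB'.mem_nhds hyB')
      filter_upwards [hev] with y' hy'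
      rw [hc]
      simp only
      rw [hform2 _ hy', hform2 _ hyB']
      have u1 : ∀ w ∈ B', UnitGerm E (w, s) (a * e x' * (e x)⁻¹) := fun w hw => by
        obtain ⟨k1, k2, k3, k4⟩ := hform w hw
        exact (k4.mul k3).mul k2.inv
      rw [toGam_eq_iff hN hz (u1 _ hy').atPoint (u1 _ hyB').atPoint]
      have := hcl y.1 hyB' y'.1 hy' s hsT
      rwa [add_sub_cancel_right] at this)
    -- The family will be `h` times the class of the local unit, so `g₀` is divided by the class of
    -- that unit at `x₀`.
    ⟨x₀, hx₀⟩ (toGam N s (atPoint x₀ (e x₀)⁻¹) * g₀)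
  set τ : M → Gam N s := fun y => if hy : y ∈ U then
    secClass 𝓔 N s y (ix y) (e y) * h ⟨y, hy⟩ else 1 with hτ
  have hsec : ∀ y, secClass 𝓔 N s y (ix y) (e y) = toGam N s (atPoint y (e y)) := fun y => by
    rw [secClass, hixe, gamG_self hN hz hs (hmem y), one_mul]
  have hinv : ∀ y, toGam N s (atPoint y (e y)) * toGam N s (atPoint y (e y)⁻¹) = 1 := fun y => by
    rw [mul_comm]
    exact toGam_inv_mul hN hz (he y).unit.atPoint
  refine ⟨τ, fun x hx => ?_, ?_⟩
  · obtain ⟨η, hη, hηx⟩ := exists_toGam_eq (h ⟨x, hx⟩)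
    refine ⟨ix x, hmem x, e x * ofPoint η, (he x).mul_ofPoint hη, ?_⟩
    have h1 := hh ⟨x, hx⟩
    rw [nhds_subtype_eq_comap, eventually_comap] at h1
    filter_upwards [h1, U.2.mem_nhds hx, eventually_slice (he x).unit.eventually,
      eventually_slice ((𝓔.dom (ix x)).2.mem_nhds (hmem x))] with y k1 k2 k3 k4
    have k5 := k1 ⟨y, k2⟩ rfl
    rw [hτ]
    simp only
    rw [dif_pos (show y ∈ U from k2), k5, secClass_mul_ofPoint k3 hη, hηx, hsec, hc]
    simp only
    rw [secClass, hixe, ← mul_assoc, ← mul_assoc, ← mul_assoc, hinv, one_mul]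
  · rw [hτ]
    simp only
    rw [dif_pos hx₀, h0, hsec, ← mul_assoc, hinv, one_mul]

end FlatFamily

end HbarConn

namespace HbarConn

/-! ### Normalized flat coordinates: uniqueness and openness. -/

section Good

variable {E : Type*} [NormedAddCommGroup E] [NormedSpace ℂ E] [FiniteDimensional ℂ E]
  {M : Type*} [TopologicalSpace M] [ChartedSpace E M] [IsManifold 𝓘(ℂ, E) ω M]
  {S : Opens RealBlowup} [DualNontrivial S] {𝓔 : RankOneConnection E M S} {i j k i₀ : 𝓔.ι}
  {N R L K : ℝ} {s : RealBlowup} {x y x₀ : M} {p : M × RealBlowup} {a e e' : M × ℂ → ℂ}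
  {U : Opens M}

variable (𝓔) in
/-- A flat family over `U` with value `1` at `x₀` in the frame `i₀`. -/
structure NormFlat (U : Opens M) (x₀ : M) (i₀ : 𝓔.ι) (N : ℝ) (s : RealBlowup) (τ : M → Gam N s) :
    Prop where
  flat : ∀ y ∈ U, FlatAt 𝓔 N s τ y
  norm : τ x₀ = secClass 𝓔 N s x₀ i₀ 1

variable (𝓔) in
/-- Near `p`, the function `e` is to precision `N` the coordinate in the frame `i` of the flat section
over `U` that has value `1` at `x₀` in the frame `i₀`. -/
def Good (U : Opens M) (x₀ : M) (i₀ : 𝓔.ι) (N : ℝ) (p : M × RealBlowup) (i : 𝓔.ι)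
    (e : M × ℂ → ℂ) : Prop :=
  FlatUnit (𝓔.form i) (N + 1) p e ∧
    ∃ τ, NormFlat 𝓔 U x₀ i₀ N p.2 τ ∧ τ p.1 = secClass 𝓔 N p.2 p.1 i e

theorem NormFlat.eq_of_mem {τ τ' : M → Gam N s} (h : NormFlat 𝓔 U x₀ i₀ N s τ)
    (h' : NormFlat 𝓔 U x₀ i₀ N s τ') (hU : IsPreconnected (U : Set M)) (hx₀ : x₀ ∈ U)
    (hN : 0 < N) (hz : s.z = 0) (hs : s ∈ S) (hx : x ∈ U) : τ x = τ' x :=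
  (FlatAt.eq_iff_of_isPreconnected hU h.flat h'.flat hN hz hs hx₀ hx).1 (h.norm.trans h'.norm.symm)

/-- In a common frame, equality of classes is a growth bound near `s`, and such a bound persists for
nearby directions. -/
theorem secClass_eq_eventually (hN : 0 < N) (hz : s.z = 0) (hs : s ∈ S) (hj : (y, s) ∈ 𝓔.dom j)
    (hk : (y, s) ∈ 𝓔.dom k) (he : UnitGerm E (y, s) e) (he' : UnitGerm E (y, s) e')
    (h : secClass 𝓔 N s y j e = secClass 𝓔 N s y k e') :
    ∀ᶠ σ in 𝓝 s, σ.z = 0 → secClass 𝓔 N σ y j e = secClass 𝓔 N σ y k e' := by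
  obtain ⟨a, ha⟩ := exists_rep (𝓔.g j k) ⟨hj, hk⟩ hs N
  have hau := (rep_g_unit hj hk hs hz hN ha).1
  rw [← secClass_transition hN hz hs hj hk le_rfl ha he',
    secClass_eq_iff hN hz hs hj he (hau.mul he')] at h
  have h1 := eventually_point h.eventually
  filter_upwards [h1, S.2.mem_nhds hs, eventually_point ((𝓔.dom j).2.mem_nhds hj),
    eventually_point ((𝓔.dom k).2.mem_nhds hk), eventually_point he.eventually,
    eventually_point he'.eventually, eventually_point hau.eventually,
    eventually_point (ha.eventually (p := (y, s)) ⟨hj, hk⟩ hs)] with σ h1 h2 h3 h4 h5 h6 h7 h8 hσ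
  rw [← secClass_transition hN hσ h2 h3 h4 le_rfl h8 h6,
    secClass_eq_iff hN hσ h2 h3 h5 (h7.mul h6)]
  exact h1

/-- On a chart ball, which is connected, a flat family agrees with the one defined by `e` either
everywhere or nowhere. The point is that one ball and one set `T` of directions serve all `σ`. -/
theorem FlatUnit.exists_normFlat_iff (h : FlatUnit (𝓔.form j) (N + 1) (x, s) e) (hN : 0 < N)
    (hs : s ∈ S) (hj : (x, s) ∈ 𝓔.dom j) (hx : x ∈ U) :
    ∃ B : Set M, IsOpen B ∧ x ∈ B ∧ B ⊆ U ∧ ∃ T : Set RealBlowup, IsOpen T ∧ s ∈ T ∧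
      (∀ y ∈ B, ∀ σ ∈ T, (y, σ) ∈ 𝓔.dom j ∧ FlatUnit (𝓔.form j) (N + 1) (y, σ) e) ∧
      ∀ y ∈ B, ∀ y' ∈ B, ∀ σ ∈ T, σ.z = 0 → ∀ τ, NormFlat 𝓔 U x₀ i₀ N σ τ →
        (τ y = secClass 𝓔 N σ y j e ↔ τ y' = secClass 𝓔 N σ y' j e) := by
  have hU : ∀ᶠ q : M × RealBlowup in 𝓝 (x, s), q.1 ∈ U :=
    continuous_fst.continuousAt.eventually (U.2.mem_nhds hx)
  obtain ⟨r, hr, -, hball, T, hT, hsT, hV⟩ := exists_chartBall (E := E)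
    (inter_mem (inter_mem ((𝓔.dom j).2.mem_nhds hj) (h.eventually hj hs))
      (inter_mem (eventually_mem (p := (x, s)) hs) hU)) one_pos
  refine ⟨chartBall E x r, isOpen_chartBall _ _, mem_chartBall _ hr,
    fun y hy => (hV y hy s hsT).2.2, T, hT, hsT, fun y hy σ hσ => (hV y hy σ hσ).1,
    fun y hy y' hy' σ hσ hz τ hτ => ?_⟩
  exact FlatAt.eq_iff_of_isPreconnected (isPreconnected_chartBall hball)
    (fun w hw => hτ.flat w (hV w hw σ hσ).2.2)
    (fun w hw => (hV w hw σ hσ).1.2.flatAt (hV w hw σ hσ).1.1) hN hz (hV y hy σ hσ).2.1 hy hy'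

/-- The families for different directions are constructed independently; this shows that they vary
consistently. At `x₀` it is the normalization, which has the same expression for all directions, and
`FlatUnit.exists_normFlat_iff` transports it across the connected set `U`. -/
theorem NormFlat.eventually_eq {τ : M → Gam N s} (h : NormFlat 𝓔 U x₀ i₀ N s τ)
    (hU : IsPreconnected (U : Set M)) (hx₀ : x₀ ∈ U) (hi₀ : (x₀, s) ∈ 𝓔.dom i₀)
    (hN : 0 < N) (hz : s.z = 0) (hs : s ∈ S) (hx : x ∈ U) (hj : (x, s) ∈ 𝓔.dom j)
    (he : UnitGerm E (x, s) e) (hτ : τ x = secClass 𝓔 N s x j e) :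
    ∀ᶠ σ in 𝓝 s, σ.z = 0 → ∀ τ', NormFlat 𝓔 U x₀ i₀ N σ τ' → τ' x = secClass 𝓔 N σ x j e := by
  set Q : M → Prop := fun x => ∀ j e, (x, s) ∈ 𝓔.dom j → UnitGerm E (x, s) e →
    τ x = secClass 𝓔 N s x j e → ∀ᶠ σ in 𝓝 s, σ.z = 0 → ∀ τ', NormFlat 𝓔 U x₀ i₀ N σ τ' →
      τ' x = secClass 𝓔 N σ x j e with hQ
  -- It is enough to know the claim for one frame and one unit at each point.
  have indep : ∀ y k e', (y, s) ∈ 𝓔.dom k → UnitGerm E (y, s) e' → τ y = secClass 𝓔 N s y k e' →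
      (∀ᶠ σ in 𝓝 s, σ.z = 0 → ∀ τ', NormFlat 𝓔 U x₀ i₀ N σ τ' → τ' y = secClass 𝓔 N σ y k e') →
      Q y := by
    intro y k e' hk he' hτ' hev j e hj he hτ
    filter_upwards [hev, secClass_eq_eventually hN hz hs hj hk he he' (hτ.symm.trans hτ')]
      with σ h1 h2 hσ τ' h'
    rw [h1 hσ τ' h', h2 hσ]
  have h0 : Q x₀ := indep x₀ i₀ 1 hi₀ UnitGerm.one h.norm
    (Eventually.of_forall fun σ _ τ' h' => h'.norm)
  refine (hU.induction₂ (fun x y => (Q x ↔ Q y)) (fun x hx => ?_)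
    (fun _ _ _ _ _ _ h1 h2 => h1.trans h2) (fun _ _ _ _ h1 => h1.symm) hx₀ hx).1 h0 j e hj he hτ
  obtain ⟨k, hk, e', he', hτ'⟩ := h.flat x hx
  obtain ⟨B, hB, hxB, hBU, T, hT, hsT, hBT, hiff⟩ :=
    he'.exists_normFlat_iff (x₀ := x₀) (i₀ := i₀) hN hs hk hx
  refine Filter.Eventually.filter_mono nhdsWithin_le_nhds ?_
  filter_upwards [hB.mem_nhds hxB, hτ'] with y hy hτy
  have hτx := hτ'.self_of_nhds
  have hyk := hBT y hy s hsT
  constructor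
  · intro hq
    refine indep y k e' hyk.1 hyk.2.unit hτy ?_
    filter_upwards [hq k e' hk he'.unit hτx, hT.mem_nhds hsT] with σ h1 h2 hσ τ' h'
    exact (hiff x hxB y hy σ h2 hσ τ' h').1 (h1 hσ τ' h')
  · intro hq
    refine indep x k e' hk he'.unit hτx ?_
    filter_upwards [hq k e' hyk.1 hyk.2.unit hτy, hT.mem_nhds hsT] with σ h1 h2 hσ τ' h'
    exact (hiff x hxB y hy σ h2 hσ τ' h').2 (h1 hσ τ' h')

theorem exists_normFlat [SimplyConnectedSpace U] (hN : 0 < N) (hz : s.z = 0) (hs : s ∈ S)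
    (hx₀ : x₀ ∈ U) : ∃ τ, NormFlat 𝓔 U x₀ i₀ N s τ := by
  obtain ⟨τ, h1, h2⟩ := exists_flatAt 𝓔 U hN hz hs hx₀ (secClass 𝓔 N s x₀ i₀ 1)
  exact ⟨τ, h1, h2⟩

theorem isPreconnected_of_simplyConnected (U : Opens M) [SimplyConnectedSpace U] :
    IsPreconnected (U : Set M) :=
  isPreconnected_iff_preconnectedSpace.2 inferInstance

theorem exists_good [SimplyConnectedSpace U] (hN : 0 < N) (hz : p.2.z = 0) (hs : p.2 ∈ S)
    (hx₀ : x₀ ∈ U) (hx : p.1 ∈ U) (hi : p ∈ 𝓔.dom i) : ∃ e, Good 𝓔 U x₀ i₀ N p i e := by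
  obtain ⟨τ, hτ⟩ := exists_normFlat (𝓔 := 𝓔) (i₀ := i₀) hN hz hs hx₀
  obtain ⟨e, he, h⟩ := (hτ.flat p.1 hx).exists_frame hN hz hs hi
  exact ⟨e, he, τ, hτ, h.self_of_nhds⟩

/-- Consistency in the direction at the fixed point `x` comes from `NormFlat.eventually_eq`; the
step from `x` to nearby points is `FlatUnit.exists_normFlat_iff`. -/
theorem Good.eventually [SimplyConnectedSpace U] (h : Good 𝓔 U x₀ i₀ N p i e) (hN : 0 < N)
    (hz : p.2.z = 0) (hs : p.2 ∈ S) (hx₀ : x₀ ∈ U) (hi₀ : (x₀, p.2) ∈ 𝓔.dom i₀) (hx : p.1 ∈ U)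
    (hi : p ∈ 𝓔.dom i) : ∀ᶠ q in 𝓝 p, q.2.z = 0 → Good 𝓔 U x₀ i₀ N q i e := by
  obtain ⟨x, s⟩ := p
  obtain ⟨he, τ, hτ, hτx⟩ := h
  have h1 := hτ.eventually_eq (isPreconnected_of_simplyConnected U) hx₀ hi₀ hN hz hs hx hi
    he.unit hτx
  obtain ⟨B, hB, hxB, hBU, T, hT, hsT, hBT, hiff⟩ :=
    he.exists_normFlat_iff (x₀ := x₀) (i₀ := i₀) hN hs hi hx
  have e1 : ∀ᶠ q : M × RealBlowup in 𝓝 (x, s), q.1 ∈ B :=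
    continuous_fst.continuousAt.eventually (hB.mem_nhds hxB)
  have e2 : ∀ᶠ q : M × RealBlowup in 𝓝 (x, s), q.2 ∈ T :=
    continuous_snd.continuousAt.eventually (hT.mem_nhds hsT)
  have e3 := (continuous_snd.continuousAt (x := (x, s))).eventually h1
  filter_upwards [e1, e2, e3, eventually_mem (p := (x, s)) hs] with q k1 k2 k3 k4 hq
  obtain ⟨τ', hτ'⟩ := exists_normFlat (𝓔 := 𝓔) (i₀ := i₀) hN hq k4 hx₀
  exact ⟨(hBT q.1 k1 q.2 k2).2, τ', hτ',
    (hiff x hxB q.1 k1 q.2 k2 hq τ' hτ').1 (k3 hq τ' hτ')⟩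

/-- Two families normalized alike coincide on `U`, so the units have close values at the point of
`M` under `p`, and flatness spreads this to a neighbourhood. -/
theorem Good.close (h : Good 𝓔 U x₀ i₀ N p i e) (h' : Good 𝓔 U x₀ i₀ N p i e') (hN : 0 < N)
    (hz : p.2.z = 0) (hs : p.2 ∈ S) (hU : IsPreconnected (U : Set M)) (hx₀ : x₀ ∈ U)
    (hx : p.1 ∈ U) (hi : p ∈ 𝓔.dom i) : Close E N p e e' := by
  obtain ⟨he, τ, hτ, hτx⟩ := h
  obtain ⟨he', τ', hτ', hτx'⟩ := h'
  have h1 := hτ.eq_of_mem hτ' hU hx₀ hN hz hs hx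
  rw [hτx, hτx', secClass_eq_iff hN hz hs hi he.unit he'.unit] at h1
  exact he.close_of_atPoint he' hi hs (by linarith) hN (by linarith) h1

theorem Good.mono (h : Good 𝓔 U x₀ i₀ N p i e) (hL : 0 < L) (hLN : L ≤ N) (hz : p.2.z = 0)
    (hs : p.2 ∈ S) (hx₀ : x₀ ∈ U) (hx : p.1 ∈ U) (hi₀ : (x₀, p.2) ∈ 𝓔.dom i₀)
    (hi : p ∈ 𝓔.dom i) : Good 𝓔 U x₀ i₀ L p i e := by
  obtain ⟨he, τ, hτ, hτx⟩ := h
  exact ⟨he.mono (by linarith), fun y => Gam.lower L (τ y),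
    ⟨fun y hy => ((hτ.flat y hy).lower hL hLN hz hs).1,
      ((hτ.flat x₀ hx₀).lower hL hLN hz hs).2 i₀ hi₀ 1 UnitGerm.one hτ.norm⟩,
    ((hτ.flat p.1 hx).lower hL hLN hz hs).2 i hi e he.unit hτx⟩

theorem Good.transition (h : Good 𝓔 U x₀ i₀ N p j e) (hN : 0 < N) (hz : p.2.z = 0)
    (hs : p.2 ∈ S) (hi : p ∈ 𝓔.dom i) (hj : p ∈ 𝓔.dom j) (ha : Rep (N + 4) p (𝓔.g i j) a) :
    Good 𝓔 U x₀ i₀ N p i (a * e) := by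
  obtain ⟨he, τ, hτ, hτx⟩ := h
  refine ⟨he.transition hi hj hs hz (by linarith) (ha.mono (by linarith)), τ, hτ, ?_⟩
  rw [hτx]
  exact (secClass_transition hN hz hs hi hj (R := N + 4) (by linarith) ha he.unit).symm

theorem Good.close_one {s : RealBlowup} (h : Good 𝓔 U x₀ i₀ N (x₀, s) i₀ e) (hN : 0 < N)
    (hz : s.z = 0) (hs : s ∈ S) (hi₀ : (x₀, s) ∈ 𝓔.dom i₀) :
    Close PUnit.{1} N (PUnit.unit, s) (atPoint x₀ e) 1 := by
  obtain ⟨he, τ, hτ, hτx⟩ := h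
  have h1 := hτx.symm.trans hτ.norm
  exact (secClass_eq_iff hN hz hs hi₀ he.unit UnitGerm.one).1 h1

end Good

end HbarConn

namespace HbarConn

/-! ### Extending a germ at `ħ = 0` to a given sector. -/

section Extension

/-- A relative perturbation by `κ` at most halves the modulus, and moves the point away from the
positive axis by at most `2‖δ‖ ≤ 2κt`. -/
theorem cone_perturb {t κ : ℝ} {δ : ℂ} (ht : 0 < t) (hκ : κ ≤ 1 / 2) (hδ : ‖δ‖ ≤ κ * t) :
    t / 2 ≤ ‖(t : ℂ) + δ‖ ∧ ‖(t : ℂ) + δ - (‖(t : ℂ) + δ‖ : ℝ)‖ ≤ 4 * κ * ‖(t : ℂ) + δ‖ := by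
  have h1 : ‖(t : ℂ)‖ = t := by rw [Complex.norm_real, Real.norm_of_nonneg ht.le]
  have h2 : t - ‖δ‖ ≤ ‖(t : ℂ) + δ‖ := by
    have := norm_sub_le_norm_add (t : ℂ) δ
    rwa [h1] at this
  have h3 : t / 2 ≤ ‖(t : ℂ) + δ‖ := by nlinarith
  refine ⟨h3, ?_⟩
  have h4 : |t - ‖(t : ℂ) + δ‖| ≤ ‖δ‖ := by
    have := abs_norm_sub_norm_le (t : ℂ) ((t : ℂ) + δ)
    rw [h1] at this
    simpa using this
  have h5 : (t : ℂ) + δ - (‖(t : ℂ) + δ‖ : ℝ) = δ + ((t - ‖(t : ℂ) + δ‖ : ℝ) : ℂ) := by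
    push_cast; ring
  have hκ0 : 0 ≤ κ := by
    have := norm_nonneg δ
    by_contra h
    push Not at h
    nlinarith
  rw [h5]
  refine (norm_add_le _ _).trans ?_
  rw [Complex.norm_real, Real.norm_eq_abs]
  nlinarith

/-- A perturbation of the identity by an exponentially small function that maps a large sector at infinity
into a small one. -/
theorem exists_sector_map {B X κ : ℝ} (hB : 0 < B) (hX : 0 < X) (hκ : 0 < κ) (hκ' : κ ≤ 1 / 2) :
    ∃ A η : ℝ, 0 < A ∧ 0 < η ∧ η ≤ κ ∧ ∀ w : ℂ, w ≠ 0 → ‖w - ‖w‖‖ ≤ η * ‖w‖ →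
      X < ‖w + A * Complex.exp (-B * w)‖ ∧
      ‖w + A * Complex.exp (-B * w) - (‖w + A * Complex.exp (-B * w)‖ : ℝ)‖ ≤
        4 * κ * ‖w + A * Complex.exp (-B * w)‖ := by
  -- So large that `A e^{-B|w|} ≥ 2X + 1` when `|w| ≤ 2X + 1`; for larger `|w|` the term `w` alone
  -- is far enough out.
  set A := (2 * X + 1) * Real.exp (B * (2 * X + 1)) with hA
  have hA0 : 0 < A := by positivity
  have hAB : 0 < 1 + A * B := by positivity
  refine ⟨A, κ / (1 + A * B), hA0, by positivity, ?_, fun w hw hwη => ?_⟩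
  · exact div_le_self hκ.le (by nlinarith [mul_pos hA0 hB])
  -- On the cone of opening `η`, replacing `w` by `|w|` in the exponential changes the result by at
  -- most `AB` times the deviation `w - |w|`, so the total deviation grows by the factor `1 + AB`.
  set η := κ / (1 + A * B) with hη
  have hη0 : 0 < η := by positivity
  have hη1 : η ≤ 1 := (div_le_self hκ.le (by nlinarith [mul_pos hA0 hB])).trans (by linarith)
  have hη' : η * (1 + A * B) = κ := by rw [hη]; field_simp
  have hwpos : 0 < ‖w‖ := norm_pos_iff.2 hw
  set δ := w - ‖w‖ with hδ
  set t := ‖w‖ + A * Real.exp (-B * ‖w‖) with ht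
  have ht0 : 0 < t := by positivity
  set δ' := δ + A * Real.exp (-B * ‖w‖) * (Complex.exp (-B * δ) - 1) with hδ'
  have hν : w + A * Complex.exp (-B * w) = (t : ℂ) + δ' := by
    have : Complex.exp (-B * w) = Real.exp (-B * ‖w‖) * Complex.exp (-B * δ) := by
      rw [Complex.ofReal_exp, ← Complex.exp_add]
      congr 1
      push_cast [hδ]
      ring
    rw [this, hδ', ht]
    push_cast [hδ]
    ring
  have hbound : ‖δ'‖ ≤ κ * t := by
    have h1 : ‖Complex.exp (-B * δ) - 1‖ ≤ B * ‖δ‖ * Real.exp (B * ‖δ‖) := by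
      have h2 := norm_sub_le_of_norm_fderiv_le_mul (E := ℂ) (h := Complex.exp) (κ := 1) convex_univ
        zero_le_one (fun y _ => Complex.differentiable_exp.differentiableAt) (fun y _ => by
          rw [one_mul]
          refine ContinuousLinearMap.opNorm_le_bound _ (norm_nonneg _) fun v => ?_
          rw [(Complex.hasDerivAt_exp y).hasFDerivAt.fderiv]
          simp [mul_comm]) (mem_univ (0 : ℂ)) (mem_univ (-B * δ))
      simp only [Complex.exp_zero, norm_one, mul_one, sub_zero, one_mul, norm_mul, norm_neg,
        Complex.norm_real, Real.norm_of_nonneg hB.le] at h2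
      exact h2.trans (exp_sub_one_le (by positivity) le_rfl)
    have h2 : ‖δ'‖ ≤ ‖δ‖ + A * Real.exp (-B * ‖w‖) * (B * ‖δ‖ * Real.exp (B * ‖δ‖)) := by
      refine (norm_add_le _ _).trans ?_
      rw [norm_mul, norm_mul, Complex.norm_real, Complex.norm_real, Real.norm_of_nonneg hA0.le,
        Real.norm_of_nonneg (Real.exp_pos _).le]
      gcongr
    have h3 : Real.exp (-B * ‖w‖) * Real.exp (B * ‖δ‖) ≤ 1 := by
      rw [← Real.exp_add, Real.exp_le_one_iff]
      have : ‖δ‖ ≤ ‖w‖ := hwη.trans (mul_le_of_le_one_left hwpos.le hη1)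
      nlinarith
    have h4 : A * Real.exp (-B * ‖w‖) * (B * ‖δ‖ * Real.exp (B * ‖δ‖)) ≤ A * B * ‖δ‖ := by
      calc _ = A * B * ‖δ‖ * (Real.exp (-B * ‖w‖) * Real.exp (B * ‖δ‖)) := by ring
        _ ≤ A * B * ‖δ‖ * 1 := by gcongr
        _ = _ := mul_one _
    have h5 : ‖w‖ ≤ t := by rw [ht]; linarith [mul_pos hA0 (Real.exp_pos (-B * ‖w‖))]
    calc ‖δ'‖ ≤ ‖δ‖ * (1 + A * B) := by linarith
      _ ≤ η * ‖w‖ * (1 + A * B) := by gcongr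
      _ = κ * ‖w‖ := by rw [← hη']; ring
      _ ≤ κ * t := by gcongr
  obtain ⟨k1, k2⟩ := cone_perturb ht0 hκ' hbound
  rw [hν]
  refine ⟨?_, k2⟩
  have htX : 2 * X < t := by
    rcases le_total (2 * X + 1) ‖w‖ with h | h
    · rw [ht]
      linarith [mul_pos hA0 (Real.exp_pos (-B * ‖w‖))]
    · have h6 : (2 * X + 1) ≤ A * Real.exp (-B * ‖w‖) := by
        rw [hA, mul_assoc, ← Real.exp_add]
        refine le_mul_of_one_le_right (by positivity) (Real.one_le_exp ?_)
        nlinarith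
      rw [ht]
      linarith
  linarith

variable {E : Type*} [NormedAddCommGroup E] [NormedSpace ℂ E] {M : Type*} [TopologicalSpace M]
  [ChartedSpace E M] {K R : ℝ} {p : M × RealBlowup} {f : M × ℂ → ℂ}

/-- Translates sectors around the direction of `s` into cones around the positive axis for the
coordinate `u/ħ`, which is large when `ħ` is small. -/
theorem dist_u_eq {s s' : RealBlowup} (hz : s'.z ≠ 0) :
    dist s'.u s.u * ‖(s.u : ℂ) / s'.z‖ = ‖(s.u : ℂ) / s'.z - ‖(s.u : ℂ) / s'.z‖‖ := by
  have hu : ‖(s.u : ℂ)‖ = 1 := Circle.norm_coe _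
  have hu' : ‖(s'.u : ℂ)‖ = 1 := Circle.norm_coe _
  have hn : (‖s'.z‖ : ℂ) ≠ 0 := by simpa using hz
  have hn' : ‖s'.z‖ ≠ 0 := by simpa using hz
  have hne' : (s'.u : ℂ) ≠ 0 := Circle.coe_ne_zero _
  have h1 : dist s'.u s.u = ‖(s'.u : ℂ) - s.u‖ := dist_eq_norm (s'.u : ℂ) (s.u : ℂ)
  have h2 : ‖(s.u : ℂ) / s'.z‖ = 1 / ‖s'.z‖ := by rw [norm_div, hu]
  have h3 : (s.u : ℂ) / s'.z - ‖(s.u : ℂ) / s'.z‖ = (s.u - s'.u) / (‖s'.z‖ * s'.u) := by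
    rw [h2]
    have : s'.z = (‖s'.z‖ : ℂ) * s'.u := s'.polar
    push_cast
    rw [sub_div]
    congr 1
    · rw [← this]
    · field_simp
  rw [h3, h1, h2, norm_div, norm_mul, hu', norm_sub_rev]
  simp
  ring

theorem exists_blowup_point {s : RealBlowup} {ν : ℂ} (hν : ν ≠ 0) {η : ℝ}
    (h : ‖ν - ‖ν‖‖ < η * ‖ν‖) :
    ∃ s' : RealBlowup, s'.z = s.u / ν ∧ dist s'.u s.u < η := by
  have hu0 : (s.u : ℂ) ≠ 0 := Circle.coe_ne_zero _
  have hz : (s.u : ℂ) / ν ≠ 0 := div_ne_zero hu0 hν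
  obtain ⟨w, hw⟩ := exists_circle_eq hz
  have hn : (‖(s.u : ℂ) / ν‖ : ℂ) ≠ 0 := by simpa using hz
  refine ⟨⟨s.u / ν, w, by rw [hw]; field_simp⟩, rfl, ?_⟩
  have h1 := dist_u_eq (s := s) (s' := ⟨s.u / ν, w, by rw [hw]; field_simp⟩) hz
  have h2 : (s.u : ℂ) / (s.u / ν) = ν := by field_simp
  simp only [h2] at h1
  rw [← h1] at h
  exact lt_of_mul_lt_mul_right h (norm_nonneg _)

/-- A function near the point over `ħ = 0` below `p` is, up to exponentially small functions, the
restriction of a function near `p`. -/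
theorem Grow.exists_extension (h : Grow E K (HbarConn.basePt p) f) (R : ℝ) :
    ∃ g, (∃ L, Grow E L p g) ∧ Grow E (-R) (HbarConn.basePt p) (f - g) := by
  wlog hK : 0 ≤ K generalizing K
  · exact this (h.mono (le_max_right 0 K)) (le_max_left _ _)
  obtain ⟨x, s⟩ := p
  obtain ⟨C, hC, h1⟩ := grow_iff.1 h
  obtain ⟨V, hV, ε, η₁, hε, hη₁, hVε⟩ := nhds_basis_prod h1
  simp only [basePt_fst, basePt_snd, RealBlowup.base_z, norm_zero, RealBlowup.base_u] at hV hε hVε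
  have hu0 : (s.u : ℂ) ≠ 0 := Circle.coe_ne_zero _
  have hu1 : ‖(s.u : ℂ)‖ = 1 := Circle.norm_coe _
  -- the estimate in terms of `ν = u / ħ`
  have hest : ∀ y ∈ V, ∀ ν : ℂ, ε⁻¹ < ‖ν‖ → ‖ν - ‖ν‖‖ < η₁ * ‖ν‖ →
      MDifferentiableAt (𝓘(ℂ, E).prod 𝓘(ℂ, ℂ)) 𝓘(ℂ, ℂ) f (y, s.u / ν) ∧
      ‖f (y, s.u / ν)‖ ≤ C * Real.exp (K * ‖ν‖) := fun y hy ν hν1 hν2 => by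
    have hν0 : ν ≠ 0 := norm_pos_iff.1 ((inv_pos.2 hε).trans hν1)
    obtain ⟨s', hs', hd⟩ := exists_blowup_point (s := s) hν0 hν2
    have hzn : ‖s'.z‖ = ‖ν‖⁻¹ := by rw [hs', norm_div, hu1, one_div]
    have := hVε y hy s' (by rw [hzn]; exact inv_lt_of_inv_lt₀ hε hν1) hd
      (by rw [hs']; exact div_ne_zero hu0 hν0)
    rw [IsHolAt, hzn, div_inv_eq_mul, hs'] at this
    exact this
  set κ := min (1 / 2) (η₁ / 8) with hκ
  have hκ0 : 0 < κ := by positivity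
  have hκ1 : κ ≤ 1 / 2 := min_le_left _ _
  have hκ2 : 4 * κ < η₁ := by
    have := min_le_right (1 / 2) (η₁ / 8)
    linarith
  -- In the cone `Re w ≥ |w|/2`, so the perturbation is `O(e^{-B|w|/2})`; with this `B` it decays at
  -- rate `R` even against the growth `K` of `f`.
  set B := 2 * (K + |R|) + 1 with hB
  have hB0 : 0 < B := by positivity
  obtain ⟨A, η, hA, hη, hηκ, hmap⟩ := exists_sector_map hB0 (inv_pos.2 hε) hκ0 hκ1
  set ν : ℂ → ℂ := fun w => w + A * Complex.exp (-B * w) with hνdef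
  -- The map `w ↦ ν w` sends the whole cone into the part near infinity where `f` is known, yet
  -- differs from the identity only by an exponentially small amount as `ħ` tends to `0`.
  set g : M × ℂ → ℂ := fun q => f (q.1, s.u / ν (s.u / q.2)) with hg
  have hw : ∀ s' : RealBlowup, s'.z ≠ 0 → dist s'.u s.u < η →
      (s.u : ℂ) / s'.z ≠ 0 ∧ ‖(s.u : ℂ) / s'.z‖ = 1 / ‖s'.z‖ ∧
      ‖(s.u : ℂ) / s'.z - ‖(s.u : ℂ) / s'.z‖‖ ≤ η * ‖(s.u : ℂ) / s'.z‖ := fun s' hz hd => by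
    refine ⟨div_ne_zero hu0 hz, by rw [norm_div, hu1], ?_⟩
    rw [← dist_u_eq hz]
    gcongr
  have hre : ∀ w : ℂ, ‖w - ‖w‖‖ ≤ η * ‖w‖ → ‖w‖ / 2 ≤ w.re := fun w hw => by
    have h2 := (Complex.abs_re_le_norm (w - ‖w‖)).trans hw
    rw [Complex.sub_re, Complex.ofReal_re] at h2
    have h3 := (abs_le.1 h2).1
    have := norm_nonneg w
    nlinarith
  have hexp : ∀ w : ℂ, ‖w - ‖w‖‖ ≤ η * ‖w‖ →
      ‖(A : ℂ) * Complex.exp (-B * w)‖ ≤ A * Real.exp (-B * (‖w‖ / 2)) := fun w hw => by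
    rw [norm_mul, Complex.norm_real, Real.norm_of_nonneg hA.le, Complex.norm_exp]
    gcongr
    have := hre w hw
    simp only [Complex.mul_re, Complex.neg_re, Complex.ofReal_re, Complex.neg_im, Complex.ofReal_im,
      neg_zero, zero_mul, sub_zero]
    nlinarith
  have hnear : ∀ (ε' : ℝ) (p' : M × RealBlowup), p'.1 = x → p'.2.u = s.u → ‖p'.2.z‖ < ε' →
      ∀ᶠ q in 𝓝 p', q.1 ∈ V ∧ ‖q.2.z‖ < ε' ∧ dist q.2.u s.u < η := fun ε' p' h1 h2 h3 => by
    rw [← h2]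
    exact mem_nhds_sector_prod (by rwa [h1]) h3 hη
  have hgp : Grow E K (x, s) g := by
    refine grow_iff.2 ⟨C * Real.exp (K * A), by positivity, ?_⟩
    filter_upwards [hnear (‖s.z‖ + 1) (x, s) rfl rfl (by simp)] with q ⟨hq1, hq2, hq3⟩ hz
    obtain ⟨w0, wn, wc⟩ := hw q.2 hz hq3
    obtain ⟨m1, m2⟩ := hmap _ w0 wc
    have hν0 : ν (s.u / q.2.z) ≠ 0 := norm_pos_iff.1 ((inv_pos.2 hε).trans m1)
    have hνpos : 0 < ‖ν (s.u / q.2.z)‖ := norm_pos_iff.2 hν0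
    obtain ⟨e1, e2⟩ := hest q.1 hq1 (ν (s.u / q.2.z)) m1
      (m2.trans_lt (mul_lt_mul_of_pos_right hκ2 hνpos))
    refine ⟨?_, ?_⟩
    · have d1 : DifferentiableAt ℂ (fun z : ℂ => (s.u : ℂ) / z) q.2.z :=
        (differentiableAt_const _).div differentiableAt_id hz
      have d2 : DifferentiableAt ℂ (fun z : ℂ => ν (s.u / z)) q.2.z :=
        d1.add (((d1.const_mul (-B : ℂ)).cexp).const_mul (A : ℂ))
      have d3 : DifferentiableAt ℂ (fun z : ℂ => (s.u : ℂ) / ν (s.u / z)) q.2.z :=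
        (differentiableAt_const _).div d2 hν0
      have d4 : MDifferentiableAt (𝓘(ℂ, E).prod 𝓘(ℂ, ℂ)) (𝓘(ℂ, E).prod 𝓘(ℂ, ℂ))
          (fun r : M × ℂ => (r.1, (s.u : ℂ) / ν (s.u / r.2))) (q.1, q.2.z) :=
        mdifferentiableAt_fst.prodMk (MDifferentiableAt.comp (I' := 𝓘(ℂ, ℂ)) (q.1, q.2.z)
          (g := fun z : ℂ => (s.u : ℂ) / ν (s.u / z)) (f := Prod.snd) d3.mdifferentiableAt
          mdifferentiableAt_snd)
      exact MDifferentiableAt.comp (I' := 𝓘(ℂ, E).prod 𝓘(ℂ, ℂ)) (q.1, q.2.z) (g := f)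
        (f := fun r : M × ℂ => (r.1, (s.u : ℂ) / ν (s.u / r.2))) e1 d4
    · refine e2.trans ?_
      rw [mul_assoc, ← Real.exp_add]
      have h2 : ‖ν (s.u / q.2.z)‖ ≤ 1 / ‖q.2.z‖ + A := by
        refine (norm_add_le _ _).trans ?_
        rw [wn]
        gcongr
        refine (hexp _ wc).trans (mul_le_of_le_one_right hA.le (Real.exp_le_one_iff.2 ?_))
        have := norm_nonneg ((s.u : ℂ) / q.2.z)
        nlinarith
      gcongr
      calc K * ‖ν (s.u / q.2.z)‖ ≤ K * (1 / ‖q.2.z‖ + A) := by gcongr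
        _ = _ := by ring
  refine ⟨g, ⟨K, hgp⟩, ?_⟩
  have hhol : ∀ᶠ q in 𝓝 (HbarConn.basePt (x, s)), q.2.z ≠ 0 → IsHolAt E (f - g) q :=
    (h.sub hgp.basePt).1
  -- a small sector around `ħ = 0`
  set X := max (max (ε⁻¹ + 3) (4 / κ)) (2 * A + 2) with hX
  have hXpos : 0 < X := by positivity
  refine grow_iff.2 ⟨2 * (C * Real.exp (2 * K)) * A, by positivity, ?_⟩
  have hball : ∀ y ∈ V, ∀ w : ℂ, X < ‖w‖ → ‖w - ‖w‖‖ ≤ κ / 2 * ‖w‖ → ∀ ξ ∈ ball w 2,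
      DifferentiableAt ℂ (fun ξ => f (y, s.u / ξ)) ξ ∧
      ‖f (y, s.u / ξ)‖ ≤ C * Real.exp (2 * K) * Real.exp (K * ‖w‖) := by
    intro y hy w hwX hwc ξ hξ
    have hξ' : ‖ξ - w‖ < 2 := by rwa [mem_ball, dist_eq_norm] at hξ
    have hw0 : 0 < ‖w‖ := hXpos.trans hwX
    have b1 : ε⁻¹ + 3 ≤ X := (le_max_left _ _).trans (le_max_left _ _)
    have b2 : 4 / κ ≤ X := (le_max_right _ _).trans (le_max_left _ _)
    have b3 : 4 ≤ κ * ‖w‖ := by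
      rw [div_le_iff₀ hκ0] at b2
      nlinarith
    have hδ : ‖ξ - ‖w‖‖ ≤ κ * ‖w‖ := by
      have := norm_sub_le_norm_sub_add_norm_sub ξ w (‖w‖ : ℂ)
      linarith
    have hsplit : ξ = (‖w‖ : ℂ) + (ξ - ‖w‖) := by ring
    obtain ⟨c1, c2⟩ := cone_perturb hw0 hκ1 hδ
    rw [← hsplit] at c1 c2
    have hξpos : 0 < ‖ξ‖ := by linarith
    have b4 : ‖w‖ - 2 < ‖ξ‖ := by
      have := norm_sub_norm_le w ξ
      rw [norm_sub_rev] at this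
      linarith
    have b5 : ‖ξ‖ ≤ ‖w‖ + 2 := by
      have := norm_sub_norm_le ξ w
      linarith
    obtain ⟨e1, e2⟩ := hest y hy ξ (by linarith)
      (c2.trans_lt (mul_lt_mul_of_pos_right hκ2 hξpos))
    refine ⟨?_, e2.trans ?_⟩
    · have d1 : DifferentiableAt ℂ (fun ξ : ℂ => (s.u : ℂ) / ξ) ξ :=
        (differentiableAt_const _).div differentiableAt_id (norm_pos_iff.1 hξpos)
      have d2 : MDifferentiableAt 𝓘(ℂ, ℂ) 𝓘(ℂ, ℂ) (fun ξ : ℂ => f (y, s.u / ξ)) ξ :=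
        MDifferentiableAt.comp (I' := 𝓘(ℂ, E).prod 𝓘(ℂ, ℂ)) ξ (g := f)
          (f := fun ξ : ℂ => (y, (s.u : ℂ) / ξ)) e1
          (mdifferentiableAt_const.prodMk d1.mdifferentiableAt)
      exact d2.differentiableAt
    · rw [mul_assoc, ← Real.exp_add]
      gcongr
      nlinarith
  have hsmall := hnear (min (1 / X) 1) (HbarConn.basePt (x, s)) rfl rfl (by simp [hXpos])
  have hang : ∀ᶠ q : M × RealBlowup in 𝓝 (HbarConn.basePt (x, s)), dist q.2.u s.u < κ / 2 := by
    have := mem_nhds_sector_prod (p := HbarConn.basePt (x, s)) (A := univ) univ_mem (ε := 1) (η := κ / 2)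
      (by simp) (by positivity)
    filter_upwards [this] with q hq using hq.2.2
  filter_upwards [hsmall, hang, hhol] with q ⟨hq1, hq2, hq3⟩ hq4 hq5 hz
  refine ⟨hq5 hz, ?_⟩
  obtain ⟨w0, wn, wc⟩ := hw q.2 hz hq3
  set w := (s.u : ℂ) / q.2.z with hwdef
  have hzpos : 0 < ‖q.2.z‖ := norm_pos_iff.2 hz
  have hwX : X < ‖w‖ := by
    rw [wn, lt_div_iff₀ hzpos]
    have := hq2.trans_le (min_le_left _ _)
    rwa [lt_div_iff₀ hXpos, mul_comm] at this
  have wc' : ‖w - ‖w‖‖ ≤ κ / 2 * ‖w‖ := by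
    rw [hwdef, ← dist_u_eq hz]
    gcongr
  have hb := hball q.1 hq1 w hwX wc'
  have hνw := hexp w wc
  have hνw1 : ‖ν w - w‖ ≤ A * Real.exp (-B * (‖w‖ / 2)) := by
    simpa [hνdef] using hνw
  have hX2 : 2 * A + 2 ≤ X := le_max_right _ _
  have hνlt : ‖ν w - w‖ < 1 := by
    refine hνw1.trans_lt ?_
    have i1 := Real.add_one_le_exp (B * (‖w‖ / 2))
    have i2 : Real.exp (-B * (‖w‖ / 2)) * Real.exp (B * (‖w‖ / 2)) = 1 := by
      rw [← Real.exp_add]; simp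
    have i3 : A < Real.exp (B * (‖w‖ / 2)) := by
      have hB1 : 1 ≤ B := by
        have := abs_nonneg R
        rw [hB]; linarith
      nlinarith
    have i4 := Real.exp_pos (-B * (‖w‖ / 2))
    nlinarith
  -- Cauchy's estimate on unit discs, followed by the mean value inequality between `w` and `ν w`,
  -- bounds `f - g` by the growth of `f` times `|ν w - w|`.
  have hfd : ∀ ξ ∈ ball w 1, ‖fderiv ℂ (fun ξ => f (q.1, s.u / ξ)) ξ‖ ≤
      2 * (C * Real.exp (2 * K) * Real.exp (K * ‖w‖)) / 1 := fun ξ hξ => by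
    have hsub : ball ξ 1 ⊆ ball w 2 := ball_subset_ball' (by rw [mem_ball] at hξ; linarith)
    exact cauchy_fderiv_bound one_pos
      (fun y hy => (hb y (hsub hy)).1.differentiableWithinAt) fun y hy => (hb y (hsub hy)).2
  have hmv := (convex_ball w 1).norm_image_sub_le_of_norm_fderiv_le (𝕜 := ℂ)
    (f := fun ξ => f (q.1, s.u / ξ)) (x := ν w) (y := w)
    (fun ξ hξ => (hb ξ (ball_subset_ball one_le_two hξ)).1) hfd
    (by rwa [mem_ball, dist_eq_norm]) (mem_ball_self one_pos)
  have hfw : (f - g) (q.1, q.2.z) = f (q.1, s.u / w) - f (q.1, s.u / ν w) := by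
    rw [Pi.sub_apply]
    congr 2
    rw [hwdef]
    field_simp
  rw [hfw]
  refine hmv.trans ?_
  rw [norm_sub_rev w]
  have i5 : Real.exp (K * ‖w‖) * Real.exp (-B * (‖w‖ / 2)) ≤ Real.exp (-R / ‖q.2.z‖) := by
    rw [← Real.exp_add, Real.exp_le_exp]
    have : -R / ‖q.2.z‖ = -R * ‖w‖ := by rw [wn]; ring
    rw [this, hB]
    have := le_abs_self R
    have := norm_nonneg w
    nlinarith
  calc 2 * (C * Real.exp (2 * K) * Real.exp (K * ‖w‖)) / 1 * ‖ν w - w‖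
      ≤ 2 * (C * Real.exp (2 * K) * Real.exp (K * ‖w‖)) / 1 *
        (A * Real.exp (-B * (‖w‖ / 2))) := by gcongr
    _ = 2 * (C * Real.exp (2 * K)) * A * (Real.exp (K * ‖w‖) * Real.exp (-B * (‖w‖ / 2))) := by ring
    _ ≤ _ := by gcongr

end Extension

end HbarConn

namespace HbarConn

/-! ### The fundamental solution. -/

section Fundamental

variable {E : Type*} [NormedAddCommGroup E] [NormedSpace ℂ E] [FiniteDimensional ℂ E]
  {M : Type*} [TopologicalSpace M] [ChartedSpace E M] [IsManifold 𝓘(ℂ, E) ω M]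
  {S : Opens RealBlowup} [DualNontrivial S] {𝓔 : RankOneConnection E M S} {i j i₀ : 𝓔.ι}
  {N K : ℝ} {x₀ : M} {p : M × RealBlowup} {a e e' : M × ℂ → ℂ} {U : Opens M} {T : Opens RealBlowup}

variable (𝓔) in
/-- A bound for the growth at `p` of normalized flat coordinates, uniform in the precision. -/
def GoodBound (U : Opens M) (x₀ : M) (i₀ : 𝓔.ι) (p : M × RealBlowup) (i : 𝓔.ι) (K : ℝ) : Prop :=
  ∀ N, 1 ≤ N → ∀ e, Good 𝓔 U x₀ i₀ N p i e → Grow E K p e ∧ Grow E K p e⁻¹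

/-- Every normalized coordinate of precision at least `1` is close, to precision `1`, to a single
one `e₁`, hence has its growth; and `e₁` remains normalized at nearby points over `ħ = 0`.
Uniformity in `N` makes the limit over precisions possible. -/
theorem exists_goodBound [SimplyConnectedSpace U] (hz : p.2.z = 0) (hs : p.2 ∈ S) (hx₀ : x₀ ∈ U)
    (hi₀ : (x₀, p.2) ∈ 𝓔.dom i₀) (hx : p.1 ∈ U) (hi : p ∈ 𝓔.dom i) :
    ∃ K, 0 ≤ K ∧ ∀ᶠ q in 𝓝 p, q.2.z = 0 → GoodBound 𝓔 U x₀ i₀ q i K := by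
  obtain ⟨e₁, h₁⟩ := exists_good (i₀ := i₀) one_pos hz hs hx₀ hx hi
  obtain ⟨⟨K, hK, g1, g2⟩, -⟩ := h₁.1.unit
  have hc : ∀ᶠ q : M × RealBlowup in 𝓝 p, (x₀, q.2) ∈ 𝓔.dom i₀ :=
    (((continuous_const.prodMk continuous_snd).continuousAt (x := p)) :
      ContinuousAt (fun q : M × RealBlowup => (x₀, q.2)) p).eventually ((𝓔.dom i₀).2.mem_nhds hi₀)
  refine ⟨K, hK, ?_⟩
  filter_upwards [h₁.eventually one_pos hz hs hx₀ hi₀ hx hi, g1.eventually, g2.eventually, hc,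
    eventually_mem hs, continuous_fst.continuousAt.eventually (U.2.mem_nhds hx),
    (𝓔.dom i).2.mem_nhds hi, h₁.1.unit.eventually] with q k1 k2 k3 k4 k5 k6 k7 k8 hq N hN e he
  have hcl := (he.mono one_pos hN hq k5 hx₀ k6 k4 k7).close (k1 hq) one_pos hq k5
    (isPreconnected_of_simplyConnected U) hx₀ k6 k7
  constructor
  · refine ((NearOne.grow hcl zero_le_one).mul_le k2 (N := K) (by simp)).congr ?_
    filter_upwards [k8.2] with r hr hr0
    have := hr hr0
    simp only [Pi.mul_apply, Pi.inv_apply]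
    field_simp
  · refine ((NearOne.inv_grow hcl one_pos hq).mul_le k3 (N := K) (by simp)).congr ?_
    filter_upwards [k8.2] with r hr hr0
    have := hr hr0
    simp only [Pi.mul_apply, Pi.inv_apply]
    field_simp

theorem Good.sub_grow (h : Good 𝓔 U x₀ i₀ N p i e) (h' : Good 𝓔 U x₀ i₀ N p i e')
    (hK : GoodBound 𝓔 U x₀ i₀ p i K) (hN : 1 ≤ N)
    (hz : p.2.z = 0) (hs : p.2 ∈ S) (hU : IsPreconnected (U : Set M)) (hx₀ : x₀ ∈ U)
    (hx : p.1 ∈ U) (hi : p ∈ 𝓔.dom i) :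
    Grow E (-(N - K)) p (e - e') ∧ Grow E (-(N - K)) p (e⁻¹ - e'⁻¹) := by
  have hN0 : 0 < N := by linarith
  have hc := h.close h' hN0 hz hs hU hx₀ hx hi
  have hc' : Close E N p e⁻¹ e'⁻¹ := (NearOne.inv hc hN0 hz).congr
    (Eventually.of_forall fun q _ => by simp [mul_comm])
  exact ⟨hc.sub_grow h'.1.unit (hK N hN e' h').1 (by linarith),
    hc'.sub_grow h'.1.unit.inv (hK N hN e' h').2 (by linarith)⟩

variable (𝓔) in
/-- The property of being represented by `op e`, for `e` the normalized flat coordinates. -/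
def GoodRep (U : Opens M) (x₀ : M) (i₀ : 𝓔.ι) {W : Opens (M × RealBlowup)} (i : 𝓔.ι)
    (op : (M × ℂ → ℂ) → M × ℂ → ℂ) (a : OLam E S W) (p : M × RealBlowup) (K : ℝ) : Prop :=
  ∀ N, 1 ≤ N → ∀ e, Good 𝓔 U x₀ i₀ N p i e → Rep (N - K) p a (op e)

/-- Normalized coordinates exist at the base points only. Each is extended to a germ at the point
above, and uniqueness makes these germs compatible as required by `exists_section`. The operation
`op` treats the solution and its inverse together. -/
theorem exists_goodRep [SimplyConnectedSpace U] (hx₀ : x₀ ∈ U) (hT : T ≤ S)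
    (hi₀ : ∀ σ ∈ T, (x₀, σ) ∈ 𝓔.dom i₀) (i : 𝓔.ι) {op : (M × ℂ → ℂ) → M × ℂ → ℂ}
    (hop : op = id ∨ op = Inv.inv) :
    ∃ a : OLam E S (prodOpen U T ⊓ 𝓔.dom i), ∀ p ∈ prodOpen U T ⊓ 𝓔.dom i, p.2.z = 0 →
      ∃ K, 0 ≤ K ∧ GoodBound 𝓔 U x₀ i₀ p i K ∧ GoodRep 𝓔 U x₀ i₀ i op a p K := by
  have hU := isPreconnected_of_simplyConnected U
  set W := prodOpen U T ⊓ 𝓔.dom i with hW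
  have hmem : ∀ p ∈ W, p.1 ∈ U ∧ p.2 ∈ T ∧ p ∈ 𝓔.dom i := fun p hp => ⟨hp.1.1, hp.1.2, hp.2⟩
  have hgrow : ∀ {p N K e}, 1 ≤ N → GoodBound 𝓔 U x₀ i₀ p i K → Good 𝓔 U x₀ i₀ N p i e →
      Grow E K p (op e) := fun hN hK he => by
    rcases hop with rfl | rfl
    · exact (hK _ hN _ he).1
    · exact (hK _ hN _ he).2
  have hsub : ∀ {p N K e e'}, p ∈ W → p.2.z = 0 → 1 ≤ N → GoodBound 𝓔 U x₀ i₀ p i K →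
      Good 𝓔 U x₀ i₀ N p i e → Good 𝓔 U x₀ i₀ N p i e' →
      Grow E (-(N - K)) p (op e - op e') := fun {p N K e e'} hp hz hN hK he he' => by
    obtain ⟨m1, m2, m3⟩ := hmem p hp
    have := he.sub_grow he' hK hN hz (hT m2) hU hx₀ m1 m3
    rcases hop with rfl | rfl
    · exact this.1
    · exact this.2
  have hex : ∀ p, p ∈ W → ∃ K, 0 ≤ K ∧
      (∀ᶠ q in 𝓝 (basePt p), q.2.z = 0 → GoodBound 𝓔 U x₀ i₀ q i K) ∧
      ∃ e : ℕ → M × ℂ → ℂ, ∃ g : ℕ → M × ℂ → ℂ, ∀ n : ℕ,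
        Good 𝓔 U x₀ i₀ (n + K + 1) (basePt p) i (e n) ∧ (∃ L, Grow E L p (g n)) ∧
        Grow E (-n) (basePt p) (op (e n) - g n) := fun p hp => by
    obtain ⟨m1, m2, m3⟩ := hmem _ (basePt_mem hp)
    obtain ⟨K, hK, hev⟩ := exists_goodBound (p := basePt p) rfl (hT m2) hx₀ (hi₀ _ m2) m1 m3
    -- Multiplicative closeness to precision `N` gives additive precision `N - K`; the `1` keeps the
    -- precision at least `1`.
    have : ∀ n : ℕ, ∃ e g : M × ℂ → ℂ, Good 𝓔 U x₀ i₀ (n + K + 1) (basePt p) i e ∧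
        (∃ L, Grow E L p g) ∧ Grow E (-n) (basePt p) (op e - g) := fun n => by
      obtain ⟨e, he⟩ := exists_good (𝓔 := 𝓔) (i₀ := i₀) (p := basePt p) (i := i) (N := n + K + 1)
        (by positivity) rfl (hT m2) hx₀ m1 m3
      have h1 := hgrow (by have : (0 : ℝ) ≤ n := n.cast_nonneg
                           linarith) (hev.self_of_nhds rfl) he
      obtain ⟨g, h2, h3⟩ := h1.exists_extension n
      exact ⟨e, g, he, h2, h3⟩
    choose e g h using this
    exact ⟨K, hK, hev, e, g, h⟩
  choose! κ hκ hb e g hg using hex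
  obtain ⟨a, ha⟩ := exists_section (E := E) (S := S) (W := W) g (fun p hp _ n => (hg p hp n).2.1) (by
    intro p hp hS n
    obtain ⟨m1, m2, m3⟩ := hmem _ (basePt_mem hp)
    have e1 := (hg p hp n).1.eventually (by have := hκ p hp; positivity) rfl (hT m2) hx₀
      (hi₀ _ m2) m1 m3
    filter_upwards [(tendsto_basePt p).eventually e1, (tendsto_basePt p).eventually (hb p hp),
      (tendsto_basePt p).eventually (hg p hp n).2.2.eventually, W.2.mem_nhds hp]
      with q k1 k2 k3 k4 m hm
    obtain ⟨l1, l2, l3⟩ := hmem _ (basePt_mem k4)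
    have hnm : (n : ℝ) ≤ m := by exact_mod_cast hm
    have hn0 : (0 : ℝ) ≤ n := n.cast_nonneg
    obtain ⟨g1, -, g3⟩ := hg q k4 m
    -- Both bounds hold at the base point of `q`; the smaller one allows both coordinates to be
    -- lowered to the common precision `n + K + 1`.
    have hK : ∃ K, 0 ≤ K ∧ K ≤ κ p ∧ K ≤ κ q ∧ GoodBound 𝓔 U x₀ i₀ (basePt q) i K := by
      rcases le_total (κ p) (κ q) with h | h
      · exact ⟨κ p, hκ p hp, le_rfl, h, k2 rfl⟩
      · exact ⟨κ q, hκ q k4, h, le_rfl, (hb q k4).self_of_nhds rfl⟩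
    obtain ⟨K, hK0, hK1, hK2, hK3⟩ := hK
    have c1 := g1.mono (L := n + K + 1) (by positivity) (by linarith) rfl (hT l2) hx₀ l1
      (hi₀ _ l2) l3
    have c2 := (k1 rfl).mono (L := n + K + 1) (by positivity) (by linarith) rfl (hT l2) hx₀ l1
      (hi₀ _ l2) l3
    have c3 := (hsub (basePt_mem k4) rfl (by linarith) hK3 c1 c2).mono (L := -n) (by linarith)
    exact ((g3.mono (L := -n) (by linarith)).sub_comm.trans c3).trans k3)
  refine ⟨a, fun p hp hz => ?_⟩
  obtain ⟨m1, m2, m3⟩ := hmem p hp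
  have hbp := basePt_eq hz
  have hB := (hb p hp).self_of_nhds
  rw [hbp] at hB
  refine ⟨κ p, hκ p hp, hB hz, fun N hN e' he' => ?_⟩
  have hn : N ≤ ⌈N⌉₊ := Nat.le_ceil N
  obtain ⟨g1, -, g3⟩ := hg p hp ⌈N⌉₊
  rw [hbp] at g1 g3
  have hκp := hκ p hp
  have c1 := g1.mono (L := N) (by linarith) (by linarith) hz (hT m2) hx₀ m1 (hi₀ _ m2) m3
  have c2 := hsub hp hz hN (hB hz) c1 he'
  exact ((ha p hp (hT m2) ⌈N⌉₊).mono (by linarith)).of_grow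
    ((g3.mono (L := -(N - κ p)) (by linarith)).sub_comm.trans c2)

variable (x₀ i₀) in
/-- The coordinates `ε` of the flat section with value `1` at `x₀` in the frame `i₀`, and their
inverses `ε'`. -/
structure IsFundamental (ε : 𝓔.Sec (prodOpen U T))
    (ε' : ∀ i, OLam E S (prodOpen U T ⊓ 𝓔.dom i)) : Prop where
  bound : ∀ i, ∀ p ∈ prodOpen U T ⊓ 𝓔.dom i, p.2.z = 0 → ∃ K, 0 ≤ K ∧
    GoodBound 𝓔 U x₀ i₀ p i K ∧ GoodRep 𝓔 U x₀ i₀ i id (ε.comp i) p K ∧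
    GoodRep 𝓔 U x₀ i₀ i Inv.inv (ε' i) p K

theorem GoodBound.mono {K' : ℝ} (h : GoodBound 𝓔 U x₀ i₀ p i K) (hK : K ≤ K') :
    GoodBound 𝓔 U x₀ i₀ p i K' := fun N hN e he =>
  ⟨(h N hN e he).1.mono hK, (h N hN e he).2.mono hK⟩

theorem GoodRep.mono {K' : ℝ} {W : Opens (M × RealBlowup)} {b : OLam E S W}
    {op : (M × ℂ → ℂ) → M × ℂ → ℂ} (h : GoodRep 𝓔 U x₀ i₀ i op b p K) (hK : K ≤ K') :
    GoodRep 𝓔 U x₀ i₀ i op b p K' := fun N hN e he => (h N hN e he).mono (by linarith)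

theorem exists_isFundamental [SimplyConnectedSpace U] (hx₀ : x₀ ∈ U) (hT : T ≤ S)
    (hi₀ : ∀ σ ∈ T, (x₀, σ) ∈ 𝓔.dom i₀) :
    ∃ (ε : 𝓔.Sec (prodOpen U T)) (ε' : ∀ i, OLam E S (prodOpen U T ⊓ 𝓔.dom i)),
      IsFundamental i₀ x₀ ε ε' := by
  choose c hc using fun i => exists_goodRep (E := E) (i₀ := i₀) hx₀ hT hi₀ i (Or.inl rfl)
  choose c' hc' using fun i => exists_goodRep (E := E) (i₀ := i₀) hx₀ hT hi₀ i (Or.inr rfl)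
  refine ⟨⟨c, fun i j => eq_of_rep fun p hp hS hz R => ?_⟩, c', ⟨fun i p hp hz => ?_⟩⟩
  · obtain ⟨⟨hpU, hpT⟩, hpi, hpj⟩ := hp
    obtain ⟨Ki, hKi, -, hri⟩ := hc i p ⟨⟨hpU, hpT⟩, hpi⟩ hz
    obtain ⟨Kj, hKj, hbj, hrj⟩ := hc j p ⟨⟨hpU, hpT⟩, hpj⟩ hz
    have hR := le_abs_self R
    have hR' := abs_nonneg R
    set N := |R| + Ki + Kj + 1 with hN
    have hN1 : 1 ≤ N := by rw [hN]; linarith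
    have hN0 : 0 < N := by linarith
    obtain ⟨e, he⟩ := exists_good (𝓔 := 𝓔) (i₀ := i₀) (p := p) (i := j) hN0 hz hS hx₀ hpU hpj
    obtain ⟨a, ha⟩ := exists_rep (𝓔.g i j) ⟨hpi, hpj⟩ hS (N + 4)
    have he' := he.transition hN0 hz hS hpi hpj ha
    refine ⟨a * e, ((hri N hN1 _ he').mono (by rw [hN]; linarith)).res _, ?_⟩
    exact (ha.res _).mul ((hrj N hN1 e he).res _) (rep_g_grow hpi hpj hS hz (by linarith) ha)
      (hbj N hN1 e he).1 (by rw [hN]; linarith) (by rw [hN]; linarith) (by rw [hN]; linarith)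
  · obtain ⟨K, hK, hb, hr⟩ := hc i p hp hz
    obtain ⟨K', hK', -, hr'⟩ := hc' i p hp hz
    exact ⟨max K K', le_max_of_le_left hK, hb.mono (le_max_left _ _), hr.mono (le_max_left _ _),
      hr'.mono (le_max_right _ _)⟩

namespace IsFundamental

variable {ε : 𝓔.Sec (prodOpen U T)} {ε' : ∀ i, OLam E S (prodOpen U T ⊓ 𝓔.dom i)}

theorem exists_good_rep [SimplyConnectedSpace U] (h : IsFundamental i₀ x₀ ε ε') (hx₀ : x₀ ∈ U)
    (hT : T ≤ S) (hp : p ∈ prodOpen U T ⊓ 𝓔.dom i) (hz : p.2.z = 0) :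
    ∃ K, 0 ≤ K ∧ ∀ R, ∃ N e, R ≤ N ∧ 1 ≤ N ∧ Good 𝓔 U x₀ i₀ N p i e ∧ Grow E K p e ∧
      Grow E K p e⁻¹ ∧ Rep R p (ε.comp i) e ∧ Rep R p (ε' i) e⁻¹ := by
  obtain ⟨K, hK, hb, hr, hr'⟩ := h.bound i p hp hz
  refine ⟨K, hK, fun R => ?_⟩
  have h1 : 1 ≤ |R| + K + 1 := by have := abs_nonneg R; linarith
  have h2 := le_abs_self R
  obtain ⟨e, he⟩ := exists_good (𝓔 := 𝓔) (i₀ := i₀) (p := p) (i := i) (N := |R| + K + 1)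
    (by linarith) hz (hT hp.1.2) hx₀ hp.1.1 hp.2
  exact ⟨_, e, by linarith, h1, he, (hb _ h1 e he).1, (hb _ h1 e he).2,
    (hr _ h1 e he).mono (by linarith), (hr' _ h1 e he).mono (by linarith)⟩

theorem mul_inv [SimplyConnectedSpace U] (h : IsFundamental i₀ x₀ ε ε') (hx₀ : x₀ ∈ U)
    (hT : T ≤ S) (i : 𝓔.ι) : ε.comp i * ε' i = 1 := by
  refine eq_of_rep fun p hp hS hz R => ?_
  obtain ⟨K, hK, hR⟩ := h.exists_good_rep hx₀ hT hp hz
  have hR' := abs_nonneg R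
  have hR'' := le_abs_self R
  obtain ⟨N, e, -, -, he, g1, g2, r1, r2⟩ := hR (|R| + K)
  refine ⟨1, ?_, rep_one⟩
  refine (r1.mul r2 g1 g2 (N := R) (by linarith) (by linarith) (by linarith)).congr ?_
  filter_upwards [he.1.unit.2] with q hq hq0
  simp [hq hq0]

/-- For a flat unit the form is represented by `-ħ v(e)/e`, so with this representative the equation
holds identically. -/
theorem isSol [SimplyConnectedSpace U] (h : IsFundamental i₀ x₀ ε ε') (hx₀ : x₀ ∈ U)
    (hT : T ≤ S) : ε.IsSol := by
  intro i W' hW' v hv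
  refine eq_of_rep fun p hp hS hz R => ⟨0, ?_, rep_zero⟩
  have hp' := hW' hp
  obtain ⟨K, hK, hR⟩ := h.exists_good_rep hx₀ hT hp' hz
  have hR' := abs_nonneg R
  have hR'' := le_abs_self R
  obtain ⟨N, e, hN, hN1, he, g1, g2, r1, -⟩ := hR (|R| + K + 1)
  have d1 := (r1.res hW').vfDeriv hv hp hS (R' := |R| + K) (by linarith)
  have d2 := g1.dirDeriv (hv.near hp) (lt_add_one K)
  have m1 := (rep_hbar (S := S) (W := W') (R := |R| + K + 1) (p := p)).mul d1 Grow.hbar d2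
    (N := R) (by linarith) (by linarith) (by linarith)
  have a1 := he.1.rep W' (hW'.trans inf_le_right) v hv hp
  have a2 := a1.grow_zero_of_mem_Oce ((𝓔.form i).mem _ _ _ _) (by linarith) hp hS hz
  have m2 := a1.mul (r1.res hW') a2 g1 (N := R) (by linarith) (by linarith) (by linarith)
  refine (m1.add m2).congr ?_
  filter_upwards [he.1.unit.2] with q hq hq0
  have := hq hq0
  simp only [Pi.add_apply, Pi.mul_apply, Pi.zero_apply, logD]
  field_simp
  ring

theorem ev_eq_one [SimplyConnectedSpace U] (h : IsFundamental i₀ x₀ ε ε') (hx₀ : x₀ ∈ U)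
    (hT : T ≤ S) : ev x₀ (ε.comp i₀) = 1 := by
  refine eq_of_rep fun p hp hS hz R => ⟨1, ?_, rep_one⟩
  obtain ⟨⟨⟩, s⟩ := p
  obtain ⟨K, hK, hR⟩ := h.exists_good_rep (p := (x₀, s)) hx₀ hT hp hz
  obtain ⟨N, e, hN, hN1, he, g1, g2, r1, -⟩ := hR R
  have c := he.close_one (by linarith) hz hS hp.2
  have r2 := Rep.ev (x₀ := x₀) (p := (PUnit.unit, s)) r1
  refine r2.of_grow ?_
  have c' : Grow PUnit.{1} (-N) (PUnit.unit, s) (atPoint x₀ e - 1) := by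
    have := c
    rwa [Close, NearOne, inv_one, mul_one] at this
  exact c'.mono (by linarith)

end IsFundamental

end Fundamental

end HbarConn

namespace HbarConn

/-! ### Locality of sections and cancellation of `ħ`. -/

section Sheaf

variable {E : Type*} [NormedAddCommGroup E] [NormedSpace ℂ E] {M : Type*} [TopologicalSpace M]
  [ChartedSpace E M] {S : Opens RealBlowup} {W W' W'' : Opens (M × RealBlowup)}

theorem res_res (h : W' ≤ W) (h' : W'' ≤ W') (a : OLam E S W) :
    res h' (res h a) = res (h'.trans h) a := by
  obtain ⟨F, rfl⟩ := Ideal.Quotient.mk_surjective a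
  rfl

theorem res_self (a : OLam E S W) : res le_rfl a = a := by
  obtain ⟨F, rfl⟩ := Ideal.Quotient.mk_surjective a
  rfl

variable [DualNontrivial S]

theorem eq_of_res {a b : OLam E S W} (h : ∀ p ∈ W, p.2 ∈ S → p.2.z = 0 →
    ∃ (V : Opens (M × RealBlowup)) (hV : V ≤ W), p ∈ V ∧ res hV a = res hV b) : a = b := by
  refine eq_of_rep fun p hp hS hz R => ?_
  obtain ⟨V, hV, hpV, heq⟩ := h p hp hS hz
  obtain ⟨f, hf⟩ := exists_rep a hp hS R
  refine ⟨f, hf, (rep_res hV hpV hS).1 ?_⟩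
  rw [← heq]
  exact hf.res hV

/-- Division by `ħ` costs rate `1`, which is harmless when all precisions are available. -/
theorem hbar_mul_cancel {a : OLam E S W} (h : hbar * a = 0) : a = 0 := by
  refine eq_of_rep fun p hp hS hz R => ⟨0, ?_, rep_zero⟩
  obtain ⟨f, hf⟩ := exists_rep a hp hS (|R| + 1)
  obtain ⟨K, hK⟩ := hf.exists_grow hp hS
  have hR := le_abs_self R
  have hR' := abs_nonneg R
  have h1 := (rep_hbar (S := S) (W := W) (R := |R| + 1 + |K|) (p := p)).mul hf Grow.hbar hK
    (N := |R| + 1) (by linarith [le_abs_self K]) (by linarith) (by linarith [abs_nonneg K])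
  rw [h] at h1
  have h2 := h1.sub_grow rep_zero hp hS
  refine (hf.mono (R' := R) (by linarith)).of_grow ?_
  refine (h2.mul_le Grow.inv_hbar (N := -R) (by linarith)).congr ?_
  filter_upwards with q hq
  simp only [Pi.sub_apply, Pi.mul_apply, Pi.zero_apply, sub_zero]
  field_simp

end Sheaf

/-! ### Sections that are constant along `M`. -/

section Constant

variable {E : Type*} [NormedAddCommGroup E] [NormedSpace ℂ E] [FiniteDimensional ℂ E]
  {M : Type*} [TopologicalSpace M] [ChartedSpace E M] [IsManifold 𝓘(ℂ, E) ω M]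
  {S : Opens RealBlowup} {N R K : ℝ} {x₀ : M} {p : M × RealBlowup} {f : M × ℂ → ℂ}
  {U : Opens M} {T : Opens RealBlowup}

theorem norm_sub_le_chartBall {x : M} {r m : ℝ} {z : ℂ}
    (hr : ball (chartAt E x x) r ⊆ (chartAt E x).target) (hm : 0 ≤ m)
    (hd : ∀ y ∈ chartBall E x r, MDifferentiableAt 𝓘(ℂ, E) 𝓘(ℂ, ℂ) (fun y => f (y, z)) y)
    (hb : ∀ y ∈ chartBall E x r, ∀ k, ‖dirDeriv (basisField (E := E) x k) f (y, z)‖ ≤ m)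
    {y y' : M} (hy : y ∈ chartBall E x r) (hy' : y' ∈ chartBall E x r) :
    ‖f (y', z) - f (y, z)‖ ≤ basisConst E * m * (2 * r) := by
  set φ := chartAt E x with hφ
  set h : E → ℂ := fun w => f (φ.symm w, z) with hh
  have hmem : ∀ w ∈ ball (φ x) r, φ.symm w ∈ chartBall E x r := fun w hw =>
    ⟨φ.map_target (hr hw), by rw [φ.right_inv (hr hw)]; exact hw⟩
  have h1 : ∀ w ∈ ball (φ x) r, DifferentiableAt ℂ h w := fun w hw => by
    have hw' := hmem w hw
    have := (chart_deriv (E := E) (x₀ := x) hw'.1 (hd _ hw')).1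
    rwa [φ.right_inv (hr hw)] at this
  have h2 : ∀ w ∈ ball (φ x) r, ‖fderiv ℂ h w‖ ≤ basisConst E * m := fun w hw => by
    have hw' := hmem w hw
    refine norm_le_basisConst _ hm fun k => ?_
    have h3 := dirDeriv_coordField (E := E) hw'.1 (hd _ hw') (Module.finBasis ℂ E k)
    have h4 := hb _ hw' k
    rw [h3, ← hφ, φ.right_inv (hr hw)] at h4
    exact h4
  have hconv : Convex ℝ (ball (φ x) r) := convex_ball _ _
  have key := hconv.norm_image_sub_le_of_norm_fderiv_le (𝕜 := ℂ) h1 h2 hy.2 hy'.2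
  have i1 : φ.symm (φ y) = y := φ.left_inv hy.1
  have i2 : φ.symm (φ y') = y' := φ.left_inv hy'.1
  change ‖f (φ.symm (φ y'), z) - f (φ.symm (φ y), z)‖ ≤ _ at key
  rw [i1, i2] at key
  refine key.trans ?_
  have k1 := hy.2
  have k2 := hy'.2
  rw [mem_ball] at k1 k2
  have := basisConst_pos (E := E)
  gcongr
  rw [← dist_eq_norm]
  have := dist_triangle_right (φ y') (φ y) (φ x)
  linarith

/-- The mean value inequality on a chart ball at each fixed `ħ`. -/
theorem exists_sub_bound (hf : Grow E K p f)
    (hd : ∀ k, Grow E (-N) p (dirDeriv (basisField (E := E) p.1 k) f)) :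
    ∃ C : ℝ, 0 < C ∧ ∃ B ∈ 𝓝 p.1, ∃ T ∈ 𝓝 p.2, ∀ y ∈ B, ∀ y' ∈ B, ∀ s ∈ T, s.z ≠ 0 →
      ‖f (y', s.z) - f (y, s.z)‖ ≤ C * Real.exp (-N / ‖s.z‖) := by
  obtain ⟨C, hC, h2⟩ := exists_uniform_grow hd
  obtain ⟨r, hr, -, hball, T, hT, hpT, hVT⟩ := exists_chartBall (E := E) (inter_mem h2 hf.1) one_pos
  have hb := basisConst_pos (E := E)
  refine ⟨basisConst E * C * (2 * r), by positivity, _,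
    (isOpen_chartBall (E := E) p.1 r).mem_nhds (mem_chartBall p.1 hr), T, hT.mem_nhds hpT,
    fun y hy y' hy' s hs hz => ?_⟩
  refine (norm_sub_le_chartBall (f := f) (z := s.z) (m := C * Real.exp (-N / ‖s.z‖)) hball
    (by positivity) (fun y hy => isHolAt_slice (q := (y, s)) ((hVT y hy s hs).2 hz))
    (fun y hy k => ((hVT y hy s hs).1 hz k).2) hy hy').trans (le_of_eq (by ring))

theorem Grow.of_sub_bound {x x' : M} {s : RealBlowup} {C : ℝ} {T : Set RealBlowup} (hT : T ∈ 𝓝 s)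
    (hhol : ∀ᶠ σ in 𝓝 s, σ.z ≠ 0 → IsHolAt E f (x', σ)) (hC : 0 < C)
    (hb : ∀ σ ∈ T, σ.z ≠ 0 → ‖f (x', σ.z) - f (x, σ.z)‖ ≤ C * Real.exp (-N / ‖σ.z‖))
    (h : Grow PUnit.{1} (-N) (PUnit.unit, s) (HbarConn.atPoint x f)) :
    Grow PUnit.{1} (-N) (PUnit.unit, s) (HbarConn.atPoint x' f) := by
  obtain ⟨C', hC', h1⟩ := grow_iff.1 h
  have hc := (continuous_snd (X := PUnit.{1}) (Y := RealBlowup)).continuousAt (x := (PUnit.unit, s))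
  refine grow_iff.2 ⟨C + C', by positivity, ?_⟩
  filter_upwards [h1, hc.eventually hT, hc.eventually hhol] with q k1 k2 k3 hz
  refine ⟨MDifferentiableAt.comp (I' := 𝓘(ℂ, E).prod 𝓘(ℂ, ℂ)) (q.1, q.2.z) (g := f)
      (f := fun q : PUnit.{1} × ℂ => (x', q.2)) (k3 hz)
      (mdifferentiableAt_const.prodMk mdifferentiableAt_snd), ?_⟩
  have m1 : ‖f (x, q.2.z)‖ ≤ _ := (k1 hz).2
  have m2 := hb q.2 k2 hz
  have m3 := norm_add_le (f (x', q.2.z) - f (x, q.2.z)) (f (x, q.2.z))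
  rw [sub_add_cancel] at m3
  change ‖f (x', q.2.z)‖ ≤ _
  linarith

variable [DualNontrivial S]

/-- To each precision `N` a representative has derivatives `O(e^{-N/|ħ|})`, hence is locally
constant in `x` to that order. Vanishing to precision `N` at a point is then an open and closed
condition on the point. -/
theorem eq_zero_of_vfDeriv_eq_zero (hU : IsPreconnected (U : Set M)) (hx₀ : x₀ ∈ U)
    {w : OLam E S (prodOpen U T)} (hd : ∀ W' (h : W' ≤ prodOpen U T)
      (v : Π x : M, TangentSpace 𝓘(ℂ, E) x) (hv : HolVF v W'), vfDeriv v hv (res h w) = 0)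
    (h0 : ev x₀ w = 0) : w = 0 := by
  have key : ∀ s ∈ T, s ∈ S → ∀ N : ℝ, ∀ x ∈ U, ∃ f C, Rep N (x, s) w f ∧ 0 < C ∧
      ∃ B ∈ 𝓝 x, ∃ T' ∈ 𝓝 s, ∀ y ∈ B, ∀ y' ∈ B, ∀ σ ∈ T', σ.z ≠ 0 →
        ‖f (y', σ.z) - f (y, σ.z)‖ ≤ C * Real.exp (-N / ‖σ.z‖) := by
    intro s hsT hsS N x hx
    have hp : (x, s) ∈ prodOpen U T := ⟨hx, hsT⟩
    obtain ⟨f, hf⟩ := exists_rep w hp hsS (N + 1)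
    obtain ⟨K, hK⟩ := hf.exists_grow hp hsS
    have hp' := mem_chartPart (E := E) (p := (x, s)) hp (mem_chart_source E x)
    have h1 : ∀ k, Grow E (-N) (x, s) (dirDeriv (basisField x k) f) := fun k => by
      have := (hf.res (chartPart_le (E := E))).vfDeriv (holVF_basisField (E := E) k) hp' hsS
        (R' := N) (by linarith)
      rw [hd] at this
      simpa using this.sub_grow rep_zero hp' hsS
    obtain ⟨C, hC, h2⟩ := exists_sub_bound hK h1
    exact ⟨f, C, hf.mono (by linarith), hC, h2⟩
  have hpt : ∀ s ∈ T, s ∈ S → ∀ N : ℝ, ∀ x ∈ U, ∀ f, Rep N (x, s) w f →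
      (Rep N (PUnit.unit, s) (ev x w) 0 ↔ Grow PUnit.{1} (-N) (PUnit.unit, s) (atPoint x f)) := by
    intro s hsT hsS N x hx f hf
    have h1 := Rep.ev (x₀ := x) (p := (PUnit.unit, s)) hf
    constructor
    · intro h
      simpa using h1.sub_grow h ⟨hx, hsT⟩ hsS
    · intro h
      exact h1.of_grow (by simpa using h)
  have hzero : ∀ s ∈ T, s ∈ S → ∀ N : ℝ, ∀ x ∈ U, Rep N (PUnit.unit, s) (ev x w) 0 := by
    intro s hsT hsS N x hx
    -- The condition is phrased on the slices, where it does not involve the local representative,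
    -- so that it can be moved from one representative to the next.
    refine (hU.induction₂ (fun x y => (Rep N (PUnit.unit, s) (ev x w) 0 ↔
      Rep N (PUnit.unit, s) (ev y w) 0)) (fun x hx => ?_)
      (fun _ _ _ _ _ _ h1 h2 => h1.trans h2) (fun _ _ _ _ h1 => h1.symm) hx₀ hx).1
      (by rw [h0]; exact rep_zero)
    obtain ⟨f, C, hf, hC, B, hB, T', hT', hb⟩ := key s hsT hsS N x hx
    have hev := hf.eventually (p := (x, s)) ⟨hx, hsT⟩ hsS
    obtain ⟨K, hK⟩ := hf.exists_grow (p := (x, s)) ⟨hx, hsT⟩ hsS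
    rw [nhds_prod_eq] at hev
    have hhol : ∀ᶠ q in 𝓝 (x, s), q.2.z ≠ 0 → IsHolAt E f q := hK.1
    rw [nhds_prod_eq] at hhol
    have hy := hhol.curry
    refine Filter.Eventually.filter_mono nhdsWithin_le_nhds ?_
    filter_upwards [hev.curry, hy, hB, U.2.mem_nhds hx] with y k1 k2 k3 k4
    rw [hpt s hsT hsS N x hx f hf, hpt s hsT hsS N y k4 f k1.self_of_nhds]
    exact ⟨Grow.of_sub_bound hT' k2 hC (hb x (mem_of_mem_nhds hB) y k3),
      Grow.of_sub_bound hT' hy.self_of_nhds hC (hb y k3 x (mem_of_mem_nhds hB))⟩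
  refine eq_of_rep fun p hp hS hz R => ⟨0, ?_, rep_zero⟩
  obtain ⟨x, s⟩ := p
  obtain ⟨f, C, hf, hC, B, hB, T', hT', hb⟩ := key s hp.2 hS R x hp.1
  have h1 := (hpt s hp.2 hS R x hp.1 f hf).1 (hzero s hp.2 hS R x hp.1)
  refine hf.of_grow ?_
  rw [sub_zero]
  obtain ⟨K, hK⟩ := hf.exists_grow (p := (x, s)) hp hS
  obtain ⟨C', hC', h2⟩ := grow_iff.1 h1
  have hc : Continuous fun q : M × RealBlowup => ((PUnit.unit, q.2) : PUnit.{1} × RealBlowup) := by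
    fun_prop
  refine grow_iff.2 ⟨C + C', by positivity, ?_⟩
  filter_upwards [(hc.continuousAt (x := (x, s))).eventually h2,
    continuous_fst.continuousAt.eventually hB, continuous_snd.continuousAt.eventually hT', hK.1]
    with q k1 k2 k3 k4 hq
  refine ⟨k4 hq, ?_⟩
  have m1 : ‖f (x, q.2.z)‖ ≤ _ := (k1 hq).2
  have m2 := hb x (mem_of_mem_nhds hB) q.1 k2 q.2 k3 hq
  have m3 := norm_add_le (f (q.1, q.2.z) - f (x, q.2.z)) (f (x, q.2.z))
  rw [sub_add_cancel] at m3
  linarith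

end Constant

end HbarConn

namespace HbarConn

section Restriction

variable {E : Type*} [NormedAddCommGroup E] [NormedSpace ℂ E] [FiniteDimensional ℂ E]
  {M : Type*} [TopologicalSpace M] [ChartedSpace E M] [IsManifold 𝓘(ℂ, E) ω M]
  {S : Opens RealBlowup} {𝓔 : RankOneConnection E M S} {x₀ : M} {W W' : Opens (M × RealBlowup)}

/-- Restriction of sections. -/
noncomputable def RankOneConnection.Sec.restrict (ψ : 𝓔.Sec W) (h : W' ≤ W) : 𝓔.Sec W' where
  comp i := res (inf_le_inf_right _ h) (ψ.comp i)
  compat i j := by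
    have := congrArg (res (inf_le_inf_right (𝓔.dom i ⊓ 𝓔.dom j) h)) (ψ.compat i j)
    rw [map_mul] at this
    simp only [res_res] at this ⊢
    exact this

/-- Restriction of initial conditions. -/
noncomputable def RankOneConnection.Fibre.restrict (e : 𝓔.Fibre x₀ W) (h : W' ≤ W) :
    𝓔.Fibre x₀ W' where
  comp i := res (slice_mono x₀ (inf_le_inf_right _ h)) (e.comp i)
  compat i j := by
    have := congrArg (res (slice_mono x₀ (inf_le_inf_right (𝓔.dom i ⊓ 𝓔.dom j) h))) (e.compat i j)
    rw [map_mul] at this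
    simp only [res_res] at this ⊢
    exact this

theorem RankOneConnection.Sec.IsSol.restrict {ψ : 𝓔.Sec W} (hψ : ψ.IsSol) (h : W' ≤ W) :
    (ψ.restrict h).IsSol := by
  intro i V hV v hv
  have := hψ i V (hV.trans (inf_le_inf_right _ h)) v hv
  rwa [← res_res (inf_le_inf_right _ h) hV] at this

theorem RankOneConnection.Sec.eval_restrict (ψ : 𝓔.Sec W) (h : W' ≤ W) :
    (ψ.restrict h).eval x₀ = (ψ.eval x₀).restrict h := by
  ext i
  exact ev_res (E := E) x₀ _ _

end Restriction

/-! ### Existence and uniqueness of solutions. -/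

section Solutions

variable {E : Type*} [NormedAddCommGroup E] [NormedSpace ℂ E] [FiniteDimensional ℂ E]
  {M : Type*} [TopologicalSpace M] [ChartedSpace E M] [IsManifold 𝓘(ℂ, E) ω M]
  {S : Opens RealBlowup} [DualNontrivial S] {𝓔 : RankOneConnection E M S} {i j i₀ : 𝓔.ι}
  {x₀ : M} {p : M × RealBlowup} {U : Opens M} {T : Opens RealBlowup}
  {W W' : Opens (M × RealBlowup)}

/-- Variation of constants: `ħ v(ε w) + A ε w = ħ ε v(w)` when `ε` is a solution, and both `ε` and
`ħ` can be cancelled. -/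
theorem vfDeriv_eq_zero_of_isSol {A : OLam E S W} {ψ ε ε' w : OLam E S W}
    {v : Π x : M, TangentSpace 𝓘(ℂ, E) x} (hv : HolVF v W)
    (hψ : hbar * vfDeriv v hv ψ + A * ψ = 0) (hε : hbar * vfDeriv v hv ε + A * ε = 0)
    (hε' : ε * ε' = 1) (hw : w = ε' * ψ) : vfDeriv v hv w = 0 := by
  have h1 : ψ = ε * w := by rw [hw, ← mul_assoc, hε', one_mul]
  refine hbar_mul_cancel ?_
  have h2 := vfDeriv_mul hv ε w
  rw [← h1] at h2
  rw [h2] at hψ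
  have h3 : hbar * vfDeriv v hv w * ε = 0 := by
    rw [h1] at hψ
    linear_combination hψ - w * hε
  calc hbar * vfDeriv v hv w = hbar * vfDeriv v hv w * (ε * ε') := by rw [hε', mul_one]
    _ = hbar * vfDeriv v hv w * ε * ε' := by ring
    _ = 0 := by rw [h3, zero_mul]

theorem mul_eq_mul_of_cocycle {R : Type*} [CommRing R] {g ψ ψ' χ χ' b b' : R} (hψ : ψ = g * ψ')
    (hχ : χ = g * χ') (hb : χ * b = 1) (hb' : χ' * b' = 1) : b * ψ = b' * ψ' := by
  subst hψ hχ
  linear_combination (-b * g * ψ') * hb' + b' * ψ' * hb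

/-- Sections are multiples of a section with invertible coordinates. -/
theorem RankOneConnection.Sec.exists_scalar (χ : 𝓔.Sec W) {b : ∀ i, OLam E S (W ⊓ 𝓔.dom i)}
    (hb : ∀ i, χ.comp i * b i = 1) (ψ : 𝓔.Sec W) : ∃ a : OLam E S W,
      ∀ i, ψ.comp i = χ.comp i * res inf_le_left a ∧ res inf_le_left a = b i * ψ.comp i := by
  obtain ⟨a, ha⟩ := exists_glue (W := W) (fun i => W ⊓ 𝓔.dom i) (fun _ => inf_le_left)
    (fun p hp hS => by
      obtain ⟨i, hi⟩ := 𝓔.cover p hS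
      exact ⟨i, hp, hi⟩) (fun i => b i * ψ.comp i) fun i j => by
    have hle : (W ⊓ 𝓔.dom i) ⊓ (W ⊓ 𝓔.dom j) ≤ W ⊓ (𝓔.dom i ⊓ 𝓔.dom j) :=
      fun q hq => ⟨hq.1.1, hq.1.2, hq.2.2⟩
    have h1 := congrArg (res hle) (ψ.compat i j)
    have h2 := congrArg (res hle) (χ.compat i j)
    have h3 := congrArg (res (inf_le_left (b := W ⊓ 𝓔.dom j))) (hb i)
    have h4 := congrArg (res (inf_le_right (a := W ⊓ 𝓔.dom i))) (hb j)
    rw [map_mul] at h1 h2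
    rw [map_mul, map_one] at h3 h4
    simp only [res_res] at h1 h2
    rw [map_mul, map_mul]
    exact mul_eq_mul_of_cocycle h1 h2 h3 h4
  refine ⟨a, fun i => ⟨?_, ha i⟩⟩
  rw [ha i, ← mul_assoc, hb i, one_mul]

namespace IsFundamental

variable {ε : 𝓔.Sec (prodOpen U T)} {ε' : ∀ i, OLam E S (prodOpen U T ⊓ 𝓔.dom i)}

/-- A section is a multiple of the fundamental solution. -/
theorem exists_quotient [SimplyConnectedSpace U] (h : IsFundamental i₀ x₀ ε ε') (hx₀ : x₀ ∈ U)
    (hT : T ≤ S) (ψ : 𝓔.Sec (prodOpen U T)) : ∃ w : OLam E S (prodOpen U T),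
      ∀ i, ψ.comp i = ε.comp i * res inf_le_left w ∧ res inf_le_left w = ε' i * ψ.comp i :=
  ε.exists_scalar (h.mul_inv hx₀ hT) ψ

theorem vfDeriv_quotient [SimplyConnectedSpace U] (h : IsFundamental i₀ x₀ ε ε') (hx₀ : x₀ ∈ U)
    (hT : T ≤ S) {ψ : 𝓔.Sec (prodOpen U T)} (hψ : ψ.IsSol) {w : OLam E S (prodOpen U T)}
    (hw : ∀ i, res inf_le_left w = ε' i * ψ.comp i) (hW : W ≤ prodOpen U T)
    {v : Π x : M, TangentSpace 𝓘(ℂ, E) x} (hv : HolVF v W) : vfDeriv v hv (res hW w) = 0 := by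
  refine eq_of_res fun p hp hS hz => ?_
  obtain ⟨i, hi⟩ := 𝓔.cover p hS
  refine ⟨W ⊓ 𝓔.dom i, inf_le_left, ⟨hp, hi⟩, ?_⟩
  have hle : W ⊓ 𝓔.dom i ≤ prodOpen U T ⊓ 𝓔.dom i := inf_le_inf_right _ hW
  rw [← vfDeriv_res, map_zero]
  refine vfDeriv_eq_zero_of_isSol (hv.mono inf_le_left)
    (hψ i _ hle v (hv.mono inf_le_left)) (h.isSol hx₀ hT i _ hle v (hv.mono inf_le_left))
    (ε' := res hle (ε' i)) (by rw [← map_mul, h.mul_inv hx₀ hT, map_one]) ?_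
  have := congrArg (res hle) (hw i)
  rw [map_mul, res_res] at this
  rw [res_res, this]

end IsFundamental

/-- The quotients of the two solutions by the fundamental one are constant along `M` and agree at
`x₀`. -/
theorem isSol_unique_of_frame [SimplyConnectedSpace U] (hx₀ : x₀ ∈ U) (hT : T ≤ S)
    (hi₀ : ∀ σ ∈ T, (x₀, σ) ∈ 𝓔.dom i₀) {ψ₁ ψ₂ : 𝓔.Sec (prodOpen U T)} (h₁ : ψ₁.IsSol)
    (h₂ : ψ₂.IsSol) (h : ψ₁.eval x₀ = ψ₂.eval x₀) : ψ₁ = ψ₂ := by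
  obtain ⟨ε, ε', hε⟩ := exists_isFundamental (E := E) hx₀ hT hi₀
  obtain ⟨w₁, hw₁⟩ := hε.exists_quotient hx₀ hT ψ₁
  obtain ⟨w₂, hw₂⟩ := hε.exists_quotient hx₀ hT ψ₂
  have hw : w₁ - w₂ = 0 := by
    refine eq_zero_of_vfDeriv_eq_zero (isPreconnected_of_simplyConnected U) hx₀
      (fun W' h' v hv => ?_) ?_
    · have e1 := hε.vfDeriv_quotient hx₀ hT h₁ (fun i => (hw₁ i).2) h' hv
      have e2 := hε.vfDeriv_quotient hx₀ hT h₂ (fun i => (hw₂ i).2) h' hv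
      have e3 := vfDeriv_add hv (res h' w₁ - res h' w₂) (res h' w₂)
      rw [sub_add_cancel, e1, e2, add_zero] at e3
      rw [RingHom.map_sub, ← e3]
    · have hle : slice x₀ (prodOpen U T) ≤ slice x₀ (prodOpen U T ⊓ 𝓔.dom i₀) :=
        fun q hq => ⟨hq, hi₀ _ hq.2⟩
      -- In the frame `i₀` the fundamental solution is `1` at `x₀`, so there the quotient is the
      -- initial coordinate itself.
      have key : ∀ (w : OLam E S (prodOpen U T)) (ψ : 𝓔.Sec (prodOpen U T)),
          ψ.comp i₀ = ε.comp i₀ * res inf_le_left w → ev x₀ w = res hle ((ψ.eval x₀).comp i₀) := by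
        intro w ψ hψ
        have e1 := congrArg (ev x₀) hψ
        rw [map_mul, hε.ev_eq_one hx₀ hT, one_mul, ev_res] at e1
        have e2 := congrArg (res hle) e1
        rw [res_res, res_self] at e2
        exact e2.symm
      rw [RingHom.map_sub, key w₁ ψ₁ (hw₁ i₀).1, key w₂ ψ₂ (hw₂ i₀).1, h, sub_self]
  have hw' := sub_eq_zero.1 hw
  ext i
  rw [(hw₁ i).1, (hw₂ i).1, hw']

/-- Every direction has a neighbourhood over which a single frame is defined at `x₀`, and equality
of sections is local. -/
theorem isSol_unique [SimplyConnectedSpace U] (hx₀ : x₀ ∈ U) (hT : T ≤ S)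
    {ψ₁ ψ₂ : 𝓔.Sec (prodOpen U T)} (h₁ : ψ₁.IsSol)
    (h₂ : ψ₂.IsSol) (h : ψ₁.eval x₀ = ψ₂.eval x₀) : ψ₁ = ψ₂ := by
  ext i
  refine eq_of_res fun p hp hS hz => ?_
  obtain ⟨j, hj⟩ := 𝓔.cover (x₀, p.2) hS
  set T' : Opens RealBlowup := T ⊓ Opens.comap ⟨fun σ => (x₀, σ), by fun_prop⟩ (𝓔.dom j) with hT'
  have hle : prodOpen U T' ≤ prodOpen U T := fun q hq => ⟨hq.1, hq.2.1⟩
  have := isSol_unique_of_frame (T := T') (i₀ := j) hx₀ (inf_le_left.trans hT)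
    (fun σ hσ => hσ.2) (h₁.restrict hle) (h₂.restrict hle)
    (by rw [RankOneConnection.Sec.eval_restrict, RankOneConnection.Sec.eval_restrict, h])
  refine ⟨prodOpen U T' ⊓ 𝓔.dom i, inf_le_inf_right _ hle, ⟨⟨hp.1.1, hp.1.2, hj⟩, hp.2⟩, ?_⟩
  exact congrArg (fun ψ => ψ.comp i) this

/-- The fundamental solution is multiplied by the pullback `b` of the initial coordinate, which is
constant along `M`. The factors are kept in the conclusion because the growth of the solution is
read off from them later. -/
theorem exists_isSol_of_frame [SimplyConnectedSpace U] (hx₀ : x₀ ∈ U) (hT : T ≤ S)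
    (hi₀ : ∀ σ ∈ T, (x₀, σ) ∈ 𝓔.dom i₀) (e : 𝓔.Fibre x₀ (prodOpen U T)) :
    ∃ (ε : 𝓔.Sec (prodOpen U T)) (ε' : ∀ i, OLam E S (prodOpen U T ⊓ 𝓔.dom i))
      (b : OLam E S (prodOpen U T)) (ψ : 𝓔.Sec (prodOpen U T)), IsFundamental i₀ x₀ ε ε' ∧
      (∀ p ∈ prodOpen U T, p.2 ∈ S → ∀ R f, Rep R (PUnit.unit, p.2) (e.comp i₀) f →
        Rep R p b (ofPoint f)) ∧
      (∀ i, ψ.comp i = ε.comp i * res inf_le_left b) ∧ ψ.IsSol ∧ ψ.eval x₀ = e := by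
  obtain ⟨ε, ε', hε⟩ := exists_isFundamental (E := E) hx₀ hT hi₀
  obtain ⟨b, hb⟩ := exists_pullback (E := E) (W := prodOpen U T) (fun q hq =>
    (⟨⟨hx₀, hq.2⟩, hi₀ _ hq.2⟩ : (PUnit.unit, q.2) ∈ slice x₀ (prodOpen U T ⊓ 𝓔.dom i₀)))
    (e.comp i₀)
  have hslice : ∀ {s}, s ∈ T → (PUnit.unit, s) ∈ slice x₀ (prodOpen U T ⊓ 𝓔.dom i₀) :=
    fun hs => ⟨⟨hx₀, hs⟩, hi₀ _ hs⟩
  have hd : ∀ W (hW : W ≤ prodOpen U T) (v : Π x : M, TangentSpace 𝓘(ℂ, E) x) (hv : HolVF v W),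
      vfDeriv v hv (res hW b) = 0 := by
    intro W hW v hv
    refine eq_of_rep fun p hp hS hz R => ⟨0, ?_, rep_zero⟩
    obtain ⟨f, hf⟩ := exists_rep (e.comp i₀) (hslice (hW hp).2) hS (R + 1)
    have := ((hb p (hW hp) hS _ f hf).res hW).vfDeriv hv hp hS (R' := R) (by linarith)
    refine this.congr (Eventually.of_forall fun q _ => ?_)
    exact (dirDeriv_snd (v := v) (fun z => f (PUnit.unit, z)) _).symm
  refine ⟨ε, ε', b, ⟨fun i => ε.comp i * res inf_le_left b, fun i j => ?_⟩, hε, hb, fun i => rfl,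
    fun i W hW v hv => ?_, ?_⟩
  · rw [map_mul, map_mul, ε.compat i j, res_res, res_res, mul_assoc]
  · have h1 := hε.isSol hx₀ hT i W hW v hv
    have h2 := hd W (hW.trans inf_le_left) v hv
    simp only [OneForm.nabla] at h1 ⊢
    rw [map_mul, res_res, vfDeriv_mul, h2]
    linear_combination res (hW.trans inf_le_left) b * h1
  · ext i
    have hle : slice x₀ (prodOpen U T ⊓ 𝓔.dom i) ≤
      slice x₀ (prodOpen U T ⊓ (𝓔.dom i ⊓ 𝓔.dom i₀)) := fun q hq => ⟨hq.1, hq.2, hi₀ _ hq.1.2⟩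
    have hle' : slice x₀ (prodOpen U T) ≤ slice x₀ (prodOpen U T ⊓ 𝓔.dom i₀) :=
        fun q hq => ⟨hq, hi₀ _ hq.2⟩
    have h1 := congrArg (res hle) (e.compat i i₀)
    have h2 := congrArg (res hle) ((ε.eval x₀).compat i i₀)
    have h3 : (ε.eval x₀).comp i₀ = 1 := hε.ev_eq_one hx₀ hT
    rw [h3, map_one, mul_one] at h2
    rw [map_mul] at h1
    have h4 : ev x₀ b = res hle' (e.comp i₀) := by
      refine eq_of_rep fun p hp hS hz R => ?_
      obtain ⟨f, hf⟩ := exists_rep (e.comp i₀) (hle' hp) hS R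
      refine ⟨f, ?_, hf.res hle'⟩
      exact Rep.ev (x₀ := x₀) (p := p) (hb (sliceMap x₀ p) hp hS _ f hf)
    simp only [res_res, res_self] at h1 h2
    change ev x₀ (ε.comp i * res inf_le_left b) = _
    rw [map_mul, ev_res, h4, res_res]
    change (ε.eval x₀).comp i * _ = _
    rw [h1, h2]

/-- Solutions over small sets of directions agree on overlaps by uniqueness, and therefore glue. -/
theorem existsUnique_isSol [SimplyConnectedSpace U] (hx₀ : x₀ ∈ U) (hT : T ≤ S)
    (e : 𝓔.Fibre x₀ (prodOpen U T)) :
    ∃! ψ : 𝓔.Sec (prodOpen U T), ψ.IsSol ∧ ψ.eval x₀ = e := by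
  have key : ∀ s : T, ∃ T' : Opens RealBlowup, s.1 ∈ T' ∧ ∃ h : prodOpen U T' ≤ prodOpen U T,
      ∃ ψ : 𝓔.Sec (prodOpen U T'), ψ.IsSol ∧ ψ.eval x₀ = e.restrict h := by
    intro s
    obtain ⟨j, hj⟩ := 𝓔.cover (x₀, s.1) (hT s.2)
    set T' : Opens RealBlowup := T ⊓ Opens.comap ⟨fun σ => (x₀, σ), by fun_prop⟩ (𝓔.dom j) with hT'
    have hle : prodOpen U T' ≤ prodOpen U T := fun q hq => ⟨hq.1, hq.2.1⟩
    obtain ⟨-, -, -, ψ, -, -, -, h1, h2⟩ := exists_isSol_of_frame (T := T') (i₀ := j) hx₀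
      (inf_le_left.trans hT) (fun σ hσ => hσ.2) (e.restrict hle)
    exact ⟨T', ⟨s.2, hj⟩, hle, ψ, h1, h2⟩
  choose V hsV hVT ψ hψ heval using key
  have hglue : ∀ i, ∃ a : OLam E S (prodOpen U T ⊓ 𝓔.dom i),
      ∀ s, res (inf_le_inf_right _ (hVT s)) a = (ψ s).comp i := by
    intro i
    refine exists_glue (fun s => prodOpen U (V s) ⊓ 𝓔.dom i) (fun s => inf_le_inf_right _ (hVT s))
      (fun p hp _ => ⟨⟨p.2, hp.1.2⟩, ⟨hp.1.1, hsV _⟩, hp.2⟩) (fun s => (ψ s).comp i) fun s t => ?_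
    have l1 : prodOpen U (V s ⊓ V t) ≤ prodOpen U (V s) := fun q hq => ⟨hq.1, hq.2.1⟩
    have l2 : prodOpen U (V s ⊓ V t) ≤ prodOpen U (V t) := fun q hq => ⟨hq.1, hq.2.2⟩
    have hle : V s ⊓ V t ≤ S := fun σ hσ => hT (hVT s (show (x₀, σ) ∈ _ from ⟨hx₀, hσ.1⟩)).2
    have := isSol_unique hx₀ hle ((hψ s).restrict l1) ((hψ t).restrict l2) (by
      rw [RankOneConnection.Sec.eval_restrict, RankOneConnection.Sec.eval_restrict, heval, heval]
      ext i
      exact (res_res _ _ _).trans (res_res _ _ _).symm)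
    have h2 := congrArg (fun χ => χ.comp i) this
    have h3 : (prodOpen U (V s) ⊓ 𝓔.dom i) ⊓ (prodOpen U (V t) ⊓ 𝓔.dom i) ≤
      prodOpen U (V s ⊓ V t) ⊓ 𝓔.dom i := fun q hq => ⟨⟨hq.1.1.1, hq.1.1.2, hq.2.1.2⟩, hq.1.2⟩
    have h4 := congrArg (res h3) h2
    exact ((res_res _ _ _).symm.trans h4).trans (res_res _ _ _)
  choose a ha using hglue
  refine existsUnique_of_exists_of_unique ⟨⟨a, fun i j => ?_⟩, fun i W hW v hv => ?_, ?_⟩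
    fun ψ₁ ψ₂ h₁ h₂ => isSol_unique hx₀ hT h₁.1 h₂.1 (h₁.2.trans h₂.2.symm)
  · refine eq_of_res fun p hp hS hz => ?_
    set s : T := ⟨p.2, hp.1.2⟩
    refine ⟨prodOpen U (V s) ⊓ (𝓔.dom i ⊓ 𝓔.dom j), inf_le_inf_right _ (hVT s),
      ⟨⟨hp.1.1, hsV s⟩, hp.2⟩, ?_⟩
    have h1 := (ψ s).compat i j
    rw [← ha i s, ← ha j s] at h1
    rw [map_mul]
    simp only [res_res] at h1 ⊢
    exact h1
  · refine eq_of_res fun p hp hS hz => ?_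
    set s : T := ⟨p.2, (hW hp).1.2⟩
    have hle : W ⊓ prodOpen U (V s) ≤ prodOpen U (V s) ⊓ 𝓔.dom i :=
      fun q hq => ⟨hq.2, (hW hq.1).2⟩
    refine ⟨W ⊓ prodOpen U (V s), inf_le_left, ⟨hp, (hW hp).1.1, hsV s⟩, ?_⟩
    have h1 := hψ s i _ hle v (hv.mono inf_le_left)
    rw [← ha i s, res_res] at h1
    rw [map_zero, ← h1]
    simp only [OneForm.nabla]
    rw [RingHom.map_add, map_mul, map_mul, ← vfDeriv_res, res_res,
      ← (𝓔.form i).app_res W (hW.trans inf_le_right) _ inf_le_left v hv]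
    rfl
  · ext i
    refine eq_of_res fun p hp hS hz => ?_
    set s : T := ⟨p.2, hp.1.2⟩
    refine ⟨slice x₀ (prodOpen U (V s) ⊓ 𝓔.dom i),
      slice_mono x₀ (inf_le_inf_right _ (hVT s)), ⟨⟨hx₀, hsV s⟩, hp.2⟩, ?_⟩
    have h1 := congrArg (fun χ => χ.comp i) (heval s)
    have h2 := ev_res x₀ (inf_le_inf_right (𝓔.dom i) (hVT s)) (a i)
    rw [ha i s] at h2
    exact h2.symm.trans h1

end Solutions

end HbarConn

namespace HbarConn

/-! ### Subexponential growth from the boundary values of the connection. -/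

section Subexponential

variable {E : Type*} [NormedAddCommGroup E] [NormedSpace ℂ E] [FiniteDimensional ℂ E]
  {M : Type*} [TopologicalSpace M] [ChartedSpace E M] [IsManifold 𝓘(ℂ, E) ω M]
  {S : Opens RealBlowup} {W : Opens (M × RealBlowup)} {N K : ℝ} {x y : M} {s : RealBlowup}
  {p : M × RealBlowup} {f g F e : M × ℂ → ℂ} {α : M → ℂ} {v : Π x : M, TangentSpace 𝓘(ℂ, E) x}

/-- The function `e^{α/ħ}`. -/
noncomputable def expBase (α : M → ℂ) : M × ℂ → ℂ := fun q => Complex.exp (α q.1 / q.2)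

theorem expBase_inv : (expBase α)⁻¹ = expBase (-α) := by
  funext q
  simp only [expBase, Pi.inv_apply, Pi.neg_apply]
  rw [← Complex.exp_neg, neg_div]

theorem expBase_mul_neg : expBase α * expBase (-α) = 1 := by
  rw [← expBase_inv]
  funext q
  exact mul_inv_cancel₀ (Complex.exp_ne_zero _)

theorem isHolAt_base {q : M × RealBlowup} (hα : MDifferentiableAt 𝓘(ℂ, E) 𝓘(ℂ, ℂ) α q.1) :
    IsHolAt E (fun r => α r.1) q :=
  MDifferentiableAt.comp (I' := 𝓘(ℂ, E)) (q.1, q.2.z) (g := α) (f := Prod.fst) hα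
    mdifferentiableAt_fst

theorem isHolAt_expBase {q : M × RealBlowup} (hα : MDifferentiableAt 𝓘(ℂ, E) 𝓘(ℂ, ℂ) α q.1)
    (hz : q.2.z ≠ 0) : IsHolAt E (expBase α) q := by
  have h1 : DifferentiableAt ℂ (fun z : ℂ => z⁻¹) q.2.z := differentiableAt_inv hz
  have h2 : MDifferentiableAt (𝓘(ℂ, E).prod 𝓘(ℂ, ℂ)) 𝓘(ℂ, ℂ) (fun r : M × ℂ => r.2⁻¹)
      (q.1, q.2.z) := MDifferentiableAt.comp (I' := 𝓘(ℂ, ℂ)) (q.1, q.2.z) (g := fun z : ℂ => z⁻¹)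
    (f := Prod.snd) h1.mdifferentiableAt mdifferentiableAt_snd
  have h3 := MDifferentiableAt.mul (isHolAt_base hα) h2
  exact MDifferentiableAt.comp (I' := 𝓘(ℂ, ℂ)) (q.1, q.2.z) (g := Complex.exp)
    (f := fun r : M × ℂ => α r.1 / r.2) Complex.differentiable_exp.differentiableAt.mdifferentiableAt
    (h3.congr_of_eventuallyEq (Eventually.of_forall fun r => div_eq_mul_inv _ _))

theorem Grow.expBase (hα : ∀ᶠ x in 𝓝 p.1, MDifferentiableAt 𝓘(ℂ, E) 𝓘(ℂ, ℂ) α x) :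
    Grow E (‖α p.1‖ + 1) p (expBase α) := by
  have h1 := (continuous_fst.continuousAt (x := p)).eventually hα
  have h2 : ∀ᶠ q : M × RealBlowup in 𝓝 p, ‖α q.1‖ < ‖α p.1‖ + 1 :=
    (continuous_fst.continuousAt (x := p)).eventually
      (hα.self_of_nhds.continuousAt.norm.eventually (gt_mem_nhds (lt_add_one _)))
  refine grow_iff.2 ⟨1, one_pos, ?_⟩
  filter_upwards [h1, h2] with q k1 k2 hz
  refine ⟨isHolAt_expBase k1 hz, ?_⟩
  rw [HbarConn.expBase, Complex.norm_exp, one_mul, Real.exp_le_exp]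
  refine (Complex.re_le_norm _).trans ?_
  rw [norm_div]
  gcongr

theorem UnitGerm.expBase (hα : ∀ᶠ x in 𝓝 p.1, MDifferentiableAt 𝓘(ℂ, E) 𝓘(ℂ, ℂ) α x) :
    UnitGerm E p (expBase α) := by
  refine UnitGerm.mk' (Grow.expBase hα) (L := ‖(-α) p.1‖ + 1) ?_
    (Eventually.of_forall fun q _ => Complex.exp_ne_zero _)
  rw [expBase_inv]
  exact Grow.expBase (hα.mono fun x hx => hx.neg)

theorem dirDeriv_expBase {q : M × RealBlowup} (hα : MDifferentiableAt 𝓘(ℂ, E) 𝓘(ℂ, ℂ) α q.1) :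
    dirDeriv v (expBase α) (q.1, q.2.z) = expBase α (q.1, q.2.z) / q.2.z *
      dirDeriv v (fun r => α r.1) (q.1, q.2.z) :=
  dirDeriv_comp (F := fun w z => Complex.exp (w / z)) (F' := fun w z => Complex.exp (w / z) / z)
    (isHolAt_base hα) (by
      have := ((hasDerivAt_id (α q.1)).div_const q.2.z).cexp
      simpa [div_eq_mul_inv] using this)

variable (E) in
/-- `F` and `F⁻¹` grow subexponentially at `p`. -/
def SubExp (p : M × RealBlowup) (F : M × ℂ → ℂ) : Prop :=
  ∀ ε > 0, Grow E ε p F ∧ Grow E ε p F⁻¹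

theorem SubExp.atPoint (h : SubExp E (x, s) F) :
    SubExp PUnit.{1} (PUnit.unit, s) (atPoint x F) := fun ε hε =>
  ⟨Grow.atPoint (p := (PUnit.unit, s)) (x₀ := x) (h ε hε).1,
    Grow.atPoint (p := (PUnit.unit, s)) (x₀ := x) (h ε hε).2⟩

theorem SubExp.mul (h : SubExp E p F) (h' : SubExp E p f) : SubExp E p (F * f) := fun ε hε => by
  have h1 := h (ε / 2) (by positivity)
  have h2 := h' (ε / 2) (by positivity)
  refine ⟨h1.1.mul_le h2.1 (by linarith), ?_⟩
  rw [mul_inv]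
  exact h1.2.mul_le h2.2 (by linarith)

theorem SubExp.of_grow_zero (h : Grow E 0 p F) (h' : Grow E 0 p F⁻¹) : SubExp E p F :=
  fun _ hε => ⟨h.mono hε.le, h'.mono hε.le⟩

theorem SubExp.congr (h : SubExp E p F)
    (hfg : ∀ᶠ q in 𝓝 p, q.2.z ≠ 0 → f (q.1, q.2.z) = F (q.1, q.2.z)) : SubExp E p f :=
  fun ε hε => ⟨(h ε hε).1.congr hfg, (h ε hε).2.congr (hfg.mono fun q hq hz => by simp [hq hz])⟩

theorem NearOne.subExp (h : NearOne E N p F) (hN : 0 < N) (hz : p.2.z = 0) : SubExp E p F :=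
  SubExp.of_grow_zero (h.grow hN.le) (h.inv_grow hN hz)

/-- If `ħ dF/F` tends to zero, Gronwall with constant `ε'/|ħ|` compares the values of `F` at two
points up to `e^{ε/|ħ|}`. The ball must not depend on `ε`, which is why uniformity is obtained from
a compact ball inside the region of validity. -/
theorem exists_comparison (hF : UnitGerm E (x, s) F)
    (hd : ∀ᶠ y in 𝓝 x, ∀ k, ∀ ε > 0, ∀ᶠ q in 𝓝 (y, s), q.2.z ≠ 0 →
      ‖q.2.z * dirDeriv (basisField (E := E) x k) F (q.1, q.2.z)‖ ≤ ε * ‖F (q.1, q.2.z)‖) :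
    ∃ B : Set M, IsOpen B ∧ x ∈ B ∧ (∀ y ∈ B, UnitGerm E (y, s) F) ∧
      ∀ ε > 0, ∀ᶠ σ in 𝓝 s, σ.z ≠ 0 → ∀ y ∈ B, ∀ y' ∈ B,
        ‖F (y', σ.z)‖ ≤ Real.exp (ε / ‖σ.z‖) * ‖F (y, σ.z)‖ := by
  have : ProperSpace E := FiniteDimensional.proper ℂ E
  obtain ⟨r₀, hr₀, -, hball, T, hT, hsT, hV⟩ := exists_chartBall (E := E)
    (inter_mem (inter_mem hF.eventually hF.isHolAt)
      ((continuous_fst.continuousAt (x := (x, s))).eventually hd)) one_pos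
  set r := r₀ / 2 with hr
  have hrpos : 0 < r := by positivity
  set φ := chartAt E x with hφ
  have hcb : closedBall (φ x) r ⊆ ball (φ x) r₀ := closedBall_subset_ball (by rw [hr]; linarith)
  have hballr : ball (φ x) r ⊆ φ.target := (ball_subset_closedBall.trans hcb).trans hball
  set L := φ.symm '' closedBall (φ x) r with hL
  have hLc : IsCompact L := (isCompact_closedBall _ _).image_of_continuousOn
    (φ.continuousOn_symm.mono (hcb.trans hball))
  have hLsub : ∀ y ∈ L, y ∈ chartBall E x r₀ := by
    rintro _ ⟨w, hw, rfl⟩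
    exact ⟨φ.map_target (hball (hcb hw)), by rw [← hφ, φ.right_inv (hball (hcb hw))]; exact hcb hw⟩
  have hsubL : chartBall E x r ⊆ L := fun y hy =>
    ⟨φ y, ball_subset_closedBall hy.2, φ.left_inv hy.1⟩
  have hb := basisConst_pos (E := E)
  refine ⟨chartBall E x r, isOpen_chartBall _ _, mem_chartBall _ hrpos,
    fun y hy => (hV y (hLsub y (hsubL hy)) s hsT).1.1, fun ε hε => ?_⟩
  -- Normalizes the total Gronwall exponent over the ball to `ε/|ħ|`.
  set ε' := ε / (basisConst E * (2 * r)) with hε'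
  have hε'pos : 0 < ε' := by positivity
  have hcomp : ∀ᶠ σ in 𝓝 s, ∀ y ∈ L, ∀ k, σ.z ≠ 0 →
      ‖σ.z * dirDeriv (basisField (E := E) x k) F (y, σ.z)‖ ≤ ε' * ‖F (y, σ.z)‖ := by
    refine hLc.eventually_forall_of_forall_eventually fun y hy => ?_
    have h1 := (hV y (hLsub y hy) s hsT).2
    have h2 : ∀ᶠ q in 𝓝 (y, s), ∀ k, q.2.z ≠ 0 →
      ‖q.2.z * dirDeriv (basisField (E := E) x k) F (q.1, q.2.z)‖ ≤ ε' * ‖F (q.1, q.2.z)‖ :=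
      eventually_all.2 fun k => h1 k ε' hε'pos
    exact (continuous_swap.continuousAt (x := (s, y))).eventually h2
  filter_upwards [hcomp, hT.mem_nhds hsT] with σ h1 h2 hz y hy y' hy'
  have hzpos : 0 < ‖σ.z‖ := norm_pos_iff.2 hz
  have key := gronwall_chartBall (ρ := F) (z := σ.z) (κ := ε' / ‖σ.z‖) hballr (by positivity)
    (fun y hy => isHolAt_slice (q := (y, σ)) ((hV y (hLsub y (hsubL hy)) σ h2).1.2 hz))
    (fun y hy k => by
      have := h1 y (hsubL hy) k hz
      rw [norm_mul] at this
      rw [div_mul_eq_mul_div, le_div_iff₀ hzpos, mul_comm]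
      exact this) hy hy'
  have h3 : basisConst E * (ε' / ‖σ.z‖) * (2 * r) = ε / ‖σ.z‖ := by
    rw [hε']
    field_simp
  rw [h3] at key
  have h4 := norm_add_le (F (y', σ.z) - F (y, σ.z)) (F (y, σ.z))
  rw [sub_add_cancel] at h4
  linarith

/-- Half of `ε` is spent on the growth at `y` and half on the comparison. For the inverse the
comparison is used with the two points exchanged. -/
theorem exists_subExp_propagation (hF : UnitGerm E (x, s) F)
    (hd : ∀ᶠ y in 𝓝 x, ∀ k, ∀ ε > 0, ∀ᶠ q in 𝓝 (y, s), q.2.z ≠ 0 →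
      ‖q.2.z * dirDeriv (basisField (E := E) x k) F (q.1, q.2.z)‖ ≤ ε * ‖F (q.1, q.2.z)‖) :
    ∃ B ∈ 𝓝 x, ∀ y ∈ B, ∀ y' ∈ B, SubExp PUnit.{1} (PUnit.unit, s) (atPoint y F) →
      SubExp E (y', s) F := by
  obtain ⟨B, hB, hxB, hBF, hcmp⟩ := exists_comparison hF hd
  refine ⟨B, hB.mem_nhds hxB, fun y hy y' hy' h ε hε => ?_⟩
  obtain ⟨C, hC, h1⟩ := grow_iff.1 (h (ε / 2) (by positivity)).1
  obtain ⟨C', hC', h2⟩ := grow_iff.1 (h (ε / 2) (by positivity)).2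
  have hc : Continuous fun q : M × RealBlowup => ((PUnit.unit, q.2) : PUnit.{1} × RealBlowup) := by
    fun_prop
  have h3 := (hc.continuousAt (x := (y', s))).eventually h1
  have h4 := (hc.continuousAt (x := (y', s))).eventually h2
  have h5 := (continuous_snd.continuousAt (x := (y', s))).eventually (hcmp (ε / 2) (by positivity))
  have h6 : ∀ᶠ q : M × RealBlowup in 𝓝 (y', s), q.1 ∈ B :=
    continuous_fst.continuousAt.eventually (hB.mem_nhds hy')
  have hexp : ∀ t : ℝ, Real.exp (ε / t) = Real.exp (ε / 2 / t) * Real.exp (ε / 2 / t) := fun t => by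
    rw [← Real.exp_add]
    congr 1
    ring
  have hu := hBF y' hy'
  constructor
  · refine grow_iff.2 ⟨C, hC, ?_⟩
    filter_upwards [h3, h5, h6, hu.isHolAt] with q k1 k2 k3 k4 hz
    refine ⟨k4 hz, (k2 hz y hy q.1 k3).trans ?_⟩
    have : ‖F (y, q.2.z)‖ ≤ C * Real.exp (ε / 2 / ‖q.2.z‖) := (k1 hz).2
    rw [hexp]
    calc _ ≤ Real.exp (ε / 2 / ‖q.2.z‖) * (C * Real.exp (ε / 2 / ‖q.2.z‖)) := by gcongr
      _ = _ := by ring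
  · refine grow_iff.2 ⟨C', hC', ?_⟩
    filter_upwards [h4, h5, h6, hu.inv.isHolAt, hu.2] with q k1 k2 k3 k4 k5 hz
    refine ⟨k4 hz, ?_⟩
    have m1 : ‖F (y, q.2.z)‖⁻¹ ≤ C' * Real.exp (ε / 2 / ‖q.2.z‖) := by
      have : ‖(F (y, q.2.z))⁻¹‖ ≤ _ := (k1 hz).2
      rwa [norm_inv] at this
    have m2 := k2 hz q.1 k3 y hy
    have m3 : 0 < ‖F (q.1, q.2.z)‖ := norm_pos_iff.2 (k5 hz)
    have m4 : 0 < ‖F (y, q.2.z)‖ := by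
      have := k2 hz y hy q.1 k3
      by_contra h0
      have h0' : ‖F (y, q.2.z)‖ = 0 := le_antisymm (not_lt.1 h0) (norm_nonneg _)
      rw [h0', mul_zero] at this
      linarith
    rw [Pi.inv_apply, norm_inv, hexp]
    have m5 : ‖F (q.1, q.2.z)‖⁻¹ ≤ Real.exp (ε / 2 / ‖q.2.z‖) * ‖F (y, q.2.z)‖⁻¹ := by
      rw [inv_le_iff_one_le_mul₀ m3]
      calc (1 : ℝ) = ‖F (y, q.2.z)‖ * ‖F (y, q.2.z)‖⁻¹ := (mul_inv_cancel₀ m4.ne').symm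
        _ ≤ Real.exp (ε / 2 / ‖q.2.z‖) * ‖F (q.1, q.2.z)‖ * ‖F (y, q.2.z)‖⁻¹ := by gcongr
        _ = _ := by ring
    calc _ ≤ _ := m5
      _ ≤ Real.exp (ε / 2 / ‖q.2.z‖) * (C' * Real.exp (ε / 2 / ‖q.2.z‖)) := by gcongr
      _ = _ := by ring

theorem Grow.tendsto_zero (h : Grow E (-N) p f) (hN : 0 < N) (hz : p.2.z = 0) :
    Tendsto (fun q : M × RealBlowup => f (q.1, q.2.z)) (pnhds p) (𝓝 0) := by
  obtain ⟨C, hC, h1⟩ := grow_iff.1 h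
  have h2 := (tendsto_exp_pnhds hz (neg_neg_of_pos hN)).const_mul C
  rw [mul_zero] at h2
  exact squeeze_zero_norm' (eventually_pnhds.2 (h1.mono fun q hq hz => (hq hz).2)) h2

variable [DualNontrivial S] {A : OneForm E S W}

theorem Rep.hasBdryValue {a : OLam E S W} (h : Rep N p a f) (hN : 0 < N) (hz : p.2.z = 0) {c : ℂ}
    (hf : Tendsto (fun q : M × RealBlowup => f (q.1, q.2.z)) (pnhds p) (𝓝 c)) :
    RankOneConnection.HasBdryValue a p c := by
  obtain ⟨G, hG, h1⟩ := h
  refine ⟨G, hG, h1.mono fun D hD => ?_⟩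
  have := (hD.tendsto_zero hN hz).add hf
  rw [zero_add] at this
  exact this.congr fun q => by simp

/-- The coefficient has a representative in `A^ce`, with a continuous boundary value, and differs
from `logD e` by a decaying function. -/
theorem FlatUnit.exists_tendsto_logD (h : FlatUnit A N (y, s) e) (hN : 0 < N) (hp : (y, s) ∈ W)
    (hs : s ∈ S) (hz : s.z = 0) (hx : y ∈ (chartAt E x).source)
    (k : Fin (Module.finrank ℂ E)) :
    ∃ c : ℂ, Tendsto (fun q : M × RealBlowup => logD (basisField (E := E) x k) e (q.1, q.2.z))
      (pnhds (y, s)) (𝓝 c) := by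
  have h1 := h.coord hp hx k
  have hp' := mem_chartPart (E := E) (p := (y, s)) hp hx
  obtain ⟨f, hf, hce⟩ := exists_rep_of_mem_Oce (A.coord_mem x k) hp' hs N
  obtain ⟨-, g, hg⟩ := hce.self_of_nhds
  have h2 := ((h1.sub_grow hf hp' hs).tendsto_zero hN hz).add (hg.self_of_nhds.2 hz)
  exact ⟨_, by simpa using h2⟩

theorem FlatUnit.tendsto_logD {𝓔 : RankOneConnection E M S} {i : 𝓔.ι}
    (h : FlatUnit (𝓔.form i) N (y, s) e) (hN : 0 < N) (hp : (y, s) ∈ 𝓔.dom i)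
    (hs : s ∈ S) (hz : s.z = 0) (hx : y ∈ (chartAt E x).source)
    (hα : ∀ η ∈ 𝓔.charVariety, η.1 = y → η.2 = mfderiv 𝓘(ℂ, E) 𝓘(ℂ, ℂ) α η.1)
    (k : Fin (Module.finrank ℂ E)) :
    Tendsto (fun q : M × RealBlowup => logD (basisField (E := E) x k) e (q.1, q.2.z))
      (pnhds (y, s)) (𝓝 (dirDeriv (basisField (E := E) x k) (fun r => α r.1) (y, 0))) := by
  choose c hc using h.exists_tendsto_logD (x := x) hN hp hs hz hx
  -- The covector with the limits of the coefficients as coordinates. It is a boundary value of the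
  -- connection form, hence a point of the characteristic variety, and the hypothesis on `α`
  -- identifies it with `dα`.
  set l : TangentSpace 𝓘(ℂ, E) y →L[ℂ] ℂ := ∑ j, c j •
    ((LinearMap.toContinuousLinearMap ((Module.finBasis ℂ E).coord j) : E →L[ℂ] ℂ).comp
      (mfderiv 𝓘(ℂ, E) 𝓘(ℂ, E) (chartAt E x) y)) with hl
  have hlv : ∀ v : Π y : M, TangentSpace 𝓘(ℂ, E) y, l (v y) = ∑ j, fieldCoeff x v j y * c j := by
    intro v
    rw [hl, sum_apply]
    exact Finset.sum_congr rfl fun j _ => mul_comm _ _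
  have hmem : (⟨y, l⟩ : Σ x : M, TangentSpace 𝓘(ℂ, E) x →L[ℂ] ℂ) ∈ 𝓔.charVariety := by
    refine ⟨s, hs, hz, i, hp, fun W' hW v hv hy => ?_⟩
    have h1 := (𝓔.form i).rep_of_coord (x := x) hx hW hy hs (fun j => h.coord hp hx j) v hv
    refine h1.hasBdryValue hN hz ?_
    rw [hlv v]
    refine tendsto_finsetSum _ fun j _ => Tendsto.mul ?_ (hc j)
    have h2 : ContinuousAt (fieldCoeff x v j) y :=
      (mdifferentiableAt_fieldCoeff hx (hv (y, s) hy) j).continuousAt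
    exact (h2.comp (f := Prod.fst) (x := (y, s)) continuous_fst.continuousAt).tendsto.mono_left
      nhdsWithin_le_nhds
  have hk : c k = l (basisField (E := E) x k y) := by
    rw [hlv (basisField (E := E) x k), Finset.sum_eq_single k]
    · simp only [fieldCoeff]
      rw [mfderiv_chart_coordField hx]
      simp [constField]
    · intro j _ hj
      simp only [fieldCoeff]
      rw [mfderiv_chart_coordField hx]
      simp [constField, hj.symm]
    · simp
  have h2 : l = mfderiv 𝓘(ℂ, E) 𝓘(ℂ, ℂ) α y := hα _ hmem rfl
  have h3 := hc k
  rw [hk, h2] at h3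
  exact h3

theorem FlatUnit.eventually_dirDeriv_le {𝓔 : RankOneConnection E M S} {i : 𝓔.ι}
    (h : FlatUnit (𝓔.form i) N (y, s) e) (hN : 0 < N) (hp : (y, s) ∈ 𝓔.dom i)
    (hs : s ∈ S) (hz : s.z = 0) (hx : y ∈ (chartAt E x).source)
    (hα : ∀ η ∈ 𝓔.charVariety, η.1 = y → η.2 = mfderiv 𝓘(ℂ, E) 𝓘(ℂ, ℂ) α η.1)
    (hαy : ∀ᶠ y in 𝓝 y, MDifferentiableAt 𝓘(ℂ, E) 𝓘(ℂ, ℂ) α y)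
    (k : Fin (Module.finrank ℂ E)) {ε : ℝ} (hε : 0 < ε) :
    ∀ᶠ q in 𝓝 (y, s), q.2.z ≠ 0 →
      ‖q.2.z * dirDeriv (basisField (E := E) x k) (expBase α * e) (q.1, q.2.z)‖ ≤
        ε * ‖(expBase α * e) (q.1, q.2.z)‖ := by
  set v := basisField (E := E) x k with hv
  have h1 := h.tendsto_logD hN hp hs hz hx hα k
  have h2 : ContinuousAt (fun y' => (mfderiv 𝓘(ℂ, E) 𝓘(ℂ, ℂ) α y' (v y') : ℂ)) y :=
    (deriv_base_mdiff (mdifferentiable_coordField hx _) hαy).continuousAt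
  have h3 : Tendsto (fun q : M × RealBlowup => dirDeriv v (fun r => α r.1) (q.1, q.2.z))
      (pnhds (y, s)) (𝓝 (dirDeriv v (fun r => α r.1) (y, 0))) :=
    (h2.comp (f := Prod.fst) (x := (y, s)) continuous_fst.continuousAt).tendsto.mono_left
      nhdsWithin_le_nhds
  have h4 := (h3.sub h1).norm
  rw [sub_self, norm_zero] at h4
  have h4 := h4.eventually (gt_mem_nhds hε)
  filter_upwards [eventually_pnhds.1 h4, h.unit.isHolAt, h.unit.2,
    (continuous_fst.continuousAt (x := (y, s))).eventually hαy] with q k1 k2 k3 k4 hq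
  have m1 := dirDeriv_mul (v := v) (isHolAt_expBase k4 hq) (k2 hq)
  have m2 := k3 hq
  -- The factor `dα - logD e` tends to zero at `ħ = 0`, both terms having the same limit.
  have m3 : q.2.z * dirDeriv v (expBase α * e) (q.1, q.2.z) =
      (dirDeriv v (fun r => α r.1) (q.1, q.2.z) - logD v e (q.1, q.2.z)) *
        (expBase α * e) (q.1, q.2.z) := by
    rw [m1]
    simp only [Pi.add_apply, Pi.mul_apply, logD]
    rw [dirDeriv_expBase k4]
    field_simp
    ring
  rw [m3, norm_mul]
  gcongr
  exact (k1 hq).le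

end Subexponential

end HbarConn

namespace HbarConn

/-! ### Growth of the normalized solutions twisted by `e^{α/ħ}`. -/

section Growth

variable {E : Type*} [NormedAddCommGroup E] [NormedSpace ℂ E] [FiniteDimensional ℂ E]
  {M : Type*} [TopologicalSpace M] [ChartedSpace E M] [IsManifold 𝓘(ℂ, E) ω M]
  {S : Opens RealBlowup} [DualNontrivial S] {𝓔 : RankOneConnection E M S} {i j i₀ : 𝓔.ι}
  {N N' : ℝ} {x x₀ : M} {s : RealBlowup} {e e' : M × ℂ → ℂ} {U : Opens M} {α : M → ℂ}

/-- A change of frame multiplies by a bounded function with bounded inverse, and two normalized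
coordinates in one frame have a quotient close to `1`. -/
theorem Good.subExp_congr [SimplyConnectedSpace U] (h : Good 𝓔 U x₀ i₀ N (x, s) i e)
    (h' : Good 𝓔 U x₀ i₀ N' (x, s) j e') (hN : 1 ≤ N) (hN' : 1 ≤ N') (hz : s.z = 0) (hs : s ∈ S)
    (hx₀ : x₀ ∈ U) (hi₀ : (x₀, s) ∈ 𝓔.dom i₀) (hx : x ∈ U) (hi : (x, s) ∈ 𝓔.dom i)
    (hj : (x, s) ∈ 𝓔.dom j) (hF : SubExp E (x, s) (expBase α * e)) :
    SubExp E (x, s) (expBase α * e') := by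
  obtain ⟨a, ha⟩ := exists_rep (𝓔.g j i) ⟨hj, hi⟩ hs (1 + 4)
  have ha0 := rep_g_grow hj hi hs hz (by norm_num) ha
  have hau := rep_g_unit hj hi hs hz (by norm_num) ha
  have h1 := (h.mono one_pos hN hz hs hx₀ hx hi₀ hi).transition one_pos hz hs hj hi ha
  have h2 := (h'.mono one_pos hN' hz hs hx₀ hx hi₀ hj).close h1 one_pos hz hs
    (isPreconnected_of_simplyConnected U) hx₀ hx hj
  refine (((NearOne.subExp h2 one_pos hz).mul (SubExp.of_grow_zero ha0 hau.2)).mul hF).congr ?_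
  filter_upwards [h.1.unit.2, hau.1.2] with q k1 k2 hq
  have := k1 hq
  have := k2 hq
  simp only [Pi.mul_apply, Pi.inv_apply]
  field_simp

theorem Good.exists_subExp_propagation [SimplyConnectedSpace U] (h : Good 𝓔 U x₀ i₀ N (x, s) i e)
    (hN : 1 ≤ N) (hz : s.z = 0) (hs : s ∈ S) (hx : x ∈ U) (hi : (x, s) ∈ 𝓔.dom i)
    (hα : ∀ x ∈ U, MDifferentiableAt 𝓘(ℂ, E) 𝓘(ℂ, ℂ) α x)
    (hc : ∀ η ∈ 𝓔.charVariety, η.1 ∈ U → η.2 = mfderiv 𝓘(ℂ, E) 𝓘(ℂ, ℂ) α η.1) :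
    ∃ B ∈ 𝓝 x, ∀ y ∈ B, ∀ y' ∈ B, SubExp PUnit.{1} (PUnit.unit, s) (atPoint y (expBase α * e)) →
      SubExp E (y', s) (expBase α * e) := by
  have hαx : ∀ x ∈ U, ∀ᶠ y in 𝓝 x, MDifferentiableAt 𝓘(ℂ, E) 𝓘(ℂ, ℂ) α y := fun x hx => by
    filter_upwards [U.2.mem_nhds hx] with y hy using hα y hy
  refine HbarConn.exists_subExp_propagation ((UnitGerm.expBase (hαx x hx)).mul h.1.unit) ?_
  filter_upwards [eventually_slice (h.1.eventually hi hs),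
    eventually_slice ((𝓔.dom i).2.mem_nhds hi), U.2.mem_nhds hx,
    (chartAt E x).open_source.mem_nhds (mem_chart_source E x)] with y k1 k2 k3 k4 k ε hε
  exact k1.eventually_dirDeriv_le (by linarith) k2 hs hz k4 (fun η hη hy => hc η hη (hy ▸ k3))
    (hαx y k3) k hε

/-- At `x₀` the function is close to `1` because `α` vanishes there. Local propagation works in both
directions, so the property spreads over the connected set `U`. -/
theorem Good.subExp [SimplyConnectedSpace U] (h : Good 𝓔 U x₀ i₀ N (x, s) i e)
    (hN : 1 ≤ N) (hz : s.z = 0) (hs : s ∈ S) (hx₀ : x₀ ∈ U) (hi₀ : (x₀, s) ∈ 𝓔.dom i₀) (hx : x ∈ U)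
    (hi : (x, s) ∈ 𝓔.dom i) (hα : ∀ x ∈ U, MDifferentiableAt 𝓘(ℂ, E) 𝓘(ℂ, ℂ) α x)
    (hc : ∀ η ∈ 𝓔.charVariety, η.1 ∈ U → η.2 = mfderiv 𝓘(ℂ, E) 𝓘(ℂ, ℂ) α η.1)
    (h0 : α x₀ = 0) : SubExp E (x, s) (expBase α * e) := by
  set P : M → Prop := fun x => ∀ i e, (x, s) ∈ 𝓔.dom i → ∀ N, 1 ≤ N → Good 𝓔 U x₀ i₀ N (x, s) i e →
    SubExp E (x, s) (expBase α * e) with hP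
  have hstart : P x₀ := by
    intro i e hi N hN h
    obtain ⟨e₀, he₀⟩ := exists_good (𝓔 := 𝓔) (i₀ := i₀) (p := (x₀, s)) one_pos hz hs hx₀ hx₀ hi₀
    obtain ⟨B, hB, hBp⟩ := he₀.exists_subExp_propagation le_rfl hz hs hx₀ hi₀ hα hc
    refine he₀.subExp_congr h le_rfl hN hz hs hx₀ hi₀ hx₀ hi₀ hi
      (hBp x₀ (mem_of_mem_nhds hB) x₀ (mem_of_mem_nhds hB) ?_)
    have h1 := he₀.close_one one_pos hz hs hi₀
    rw [Close, inv_one, mul_one] at h1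
    refine (h1.subExp one_pos hz).congr (Eventually.of_forall fun q _ => ?_)
    simp [HbarConn.atPoint, expBase, h0]
  refine ((isPreconnected_of_simplyConnected U).induction₂ (fun x y => (P x ↔ P y)) (fun x hx => ?_)
    (fun _ _ _ _ _ _ h1 h2 => h1.trans h2) (fun _ _ _ _ h1 => h1.symm) hx₀ hx).1 hstart i e hi N hN h
  obtain ⟨k, hk⟩ := 𝓔.cover (x, s) hs
  obtain ⟨e₁, he₁⟩ := exists_good (𝓔 := 𝓔) (i₀ := i₀) (p := (x, s)) one_pos hz hs hx₀ hx hk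
  obtain ⟨B, hB, hBp⟩ := he₁.exists_subExp_propagation le_rfl hz hs hx hk hα hc
  refine Filter.Eventually.filter_mono nhdsWithin_le_nhds ?_
  filter_upwards [hB, eventually_slice (he₁.eventually one_pos hz hs hx₀ hi₀ hx hk),
    eventually_slice ((𝓔.dom k).2.mem_nhds hk), U.2.mem_nhds hx] with y k1 k2 k3 k4
  constructor
  · intro hPx i e hi N hN h
    exact (k2 hz).subExp_congr h le_rfl hN hz hs hx₀ hi₀ k4 k3 hi
      (hBp x (mem_of_mem_nhds hB) y k1 (hPx k e₁ hk 1 le_rfl he₁).atPoint)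
  · intro hPy i e hi N hN h
    exact he₁.subExp_congr h le_rfl hN hz hs hx₀ hi₀ hx hk hi
      (hBp y k1 x (mem_of_mem_nhds hB) (hPy k e₁ k3 1 le_rfl (k2 hz)).atPoint)

end Growth

/-! ### Criteria for membership in `O^{se,Λ0}`. -/

section SubexpSections

variable {E : Type*} [NormedAddCommGroup E] [NormedSpace ℂ E] {M : Type*} [TopologicalSpace M]
  [ChartedSpace E M] {S : Opens RealBlowup} [DualNontrivial S] {W W' : Opens (M × RealBlowup)}
  {p : M × RealBlowup} {a b c : OLam E S W} {A f : M × ℂ → ℂ} {K L : ℝ}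

theorem Rep.grow_of_mem_Ose (ha : a ∈ Ose E S W) (hf : Rep 0 p a f) (hp : p ∈ W) (hS : p.2 ∈ S)
    {ε : ℝ} (hε : 0 < ε) : Grow E ε p f := by
  obtain ⟨g, hg, hgr⟩ := mem_Ose_iff.1 ha p hp hS ε hε
  have h1 := (hf.sub_grow hg hp hS).mono (show -(0 : ℝ) ≤ ε by linarith)
  simpa using h1.add hgr

/-- Points over `ħ = 0` suffice, since the rate of a function of finite growth is detected there. -/
theorem mem_Ose_of_base (h : ∀ p ∈ W, p.2 ∈ S → p.2.z = 0 → ∀ ε > 0,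
    ∃ f, Rep 0 p a f ∧ Grow E ε p f) : a ∈ Ose E S W := by
  refine mem_Ose_iff.2 fun p hp hS ε hε => ?_
  obtain ⟨f, hf⟩ := exists_rep a hp hS 0
  obtain ⟨L, hL⟩ := hf.exists_grow hp hS
  obtain ⟨g, hg, hgr⟩ := h (basePt p) (basePt_mem hp) (base_mem hS) rfl ε hε
  refine ⟨f, hf, hL.of_basePt ?_⟩
  have h1 := ((hf.basePt hp hS).sub_grow hg (basePt_mem hp) (base_mem hS)).mono
    (show -(0 : ℝ) ≤ ε by linarith)
  simpa using h1.add hgr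

theorem mem_Ose_of_res (h : ∀ p ∈ W, p.2 ∈ S → p.2.z = 0 → ∃ (V : Opens (M × RealBlowup))
    (hV : V ≤ W), p ∈ V ∧ res hV a ∈ Ose E S V) : a ∈ Ose E S W := by
  refine mem_Ose_of_base fun p hp hS hz ε hε => ?_
  obtain ⟨V, hV, hpV, ha⟩ := h p hp hS hz
  obtain ⟨f, hf, hg⟩ := mem_Ose_iff.1 ha p hpV hS ε hε
  exact ⟨f, (rep_res hV hpV hS).1 hf, hg⟩

/-- `A` and `B` may each grow exponentially, and only `A * B` is known to be subexponential. Their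
separate rates `K` and `L` enter through the precision needed for the product. -/
theorem exists_rep_mul₃ (hA : ∀ R, Rep R p a A) (hK : 0 ≤ K) (hAK : Grow E K p A) (hL : 0 ≤ L)
    (hB : ∀ R, ∃ B, Rep R p b B ∧ Grow E L p B ∧ ∀ ε > 0, Grow E ε p (A * B))
    (hC : ∀ R, ∃ C, Rep R p c C ∧ ∀ ε > 0, Grow E ε p C) {ε : ℝ} (hε : 0 < ε) :
    ∃ f, Rep 0 p (a * (b * c)) f ∧ Grow E ε p f := by
  obtain ⟨B, hB1, hB2, hB3⟩ := hB (K + L + 1)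
  obtain ⟨C, hC1, hC2⟩ := hC (K + L + 1)
  refine ⟨A * (B * C), (hA (L + 1)).mul (hB1.mul hC1 hB2 (hC2 1 one_pos) (N := K) (by linarith)
    (by linarith) (by linarith)) hAK (hB2.mul (hC2 1 one_pos)) (by linarith) (by linarith)
    (by linarith), ?_⟩
  rw [← mul_assoc]
  exact (hB3 (ε / 2) (by positivity)).mul_le (hC2 (ε / 2) (by positivity)) (by linarith)

end SubexpSections

/-! ### The section `e^{α/ħ}`. -/

section Exponential

variable {E : Type*} [NormedAddCommGroup E] [NormedSpace ℂ E] [FiniteDimensional ℂ E]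
  {M : Type*} [TopologicalSpace M] [ChartedSpace E M] [IsManifold 𝓘(ℂ, E) ω M]
  {S : Opens RealBlowup} [DualNontrivial S] {W W' : Opens (M × RealBlowup)} {α : M → ℂ}

/-- The section `e^{α/ħ}`. -/
noncomputable def expSection (α : M → ℂ) (hα : HolOn (E := E) α W) : OLam E S W :=
  ofFun (expBase α) fun _ hp hS => (isExp_iff hS).2 ⟨_, Grow.expBase (eventually_base hα hp)⟩

theorem HolOn.neg (hα : HolOn (E := E) α W) : HolOn (E := E) (-α) W := fun q hq => (hα q hq).neg

theorem expSection_mul_neg (hα : HolOn (E := E) α W) :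
    (expSection α hα * expSection (-α) hα.neg : OLam E S W) = 1 := by
  refine eq_of_rep fun p hp hS hz R => ⟨1, ?_, rep_one⟩
  have h1 : ∀ R, Rep R p (expSection α hα : OLam E S W) (expBase α) := fun R => rep_ofFun
  have h2 : ∀ R, Rep R p (expSection (-α) hα.neg : OLam E S W) (expBase (-α)) := fun R => rep_ofFun
  have g1 := Grow.expBase (p := p) (eventually_base hα hp)
  have g2 := Grow.expBase (p := p) (eventually_base hα.neg hp)
  have hn := norm_nonneg (α p.1)
  have hn' := norm_nonneg ((-α) p.1)
  have := (h1 (|R| + (‖(-α) p.1‖ + 1))).mul (h2 (|R| + (‖α p.1‖ + 1))) g1 g2 (N := |R|) le_rfl le_rfl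
    (by linarith [abs_nonneg R])
  rw [expBase_mul_neg] at this
  exact this.mono (le_abs_self R)

theorem hbar_mul_vfDeriv_expSection (hα : HolOn (E := E) α W)
    {v : Π x : M, TangentSpace 𝓘(ℂ, E) x} (hv : HolVF v W) :
    (hbar : OLam E S W) * vfDeriv v hv (expSection α hα) =
      vfDeriv v hv (ofHol α hα) * expSection α hα := by
  refine eq_of_rep fun p hp hS hz R => ?_
  have h1 : ∀ R, Rep R p (expSection α hα : OLam E S W) (expBase α) := fun R => rep_ofFun
  have h2 : ∀ R, Rep R p (ofHol α hα : OLam E S W) (fun q => α q.1) := fun R => rep_ofHol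
  have hev := eventually_base hα hp
  have g1 := Grow.expBase (p := p) hev
  have g2 := Grow.of_base_fun (p := p) hev
  have hd1 : ∀ R, Rep R p (vfDeriv v hv (expSection α hα : OLam E S W)) (dirDeriv v (expBase α)) :=
    fun R => (h1 (R + 1)).vfDeriv hv hp hS (by linarith)
  have hd2 : ∀ R, Rep R p (vfDeriv v hv (ofHol α hα : OLam E S W)) (dirDeriv v fun q => α q.1) :=
    fun R => (h2 (R + 1)).vfDeriv hv hp hS (by linarith)
  have hg1 := g1.dirDeriv (hv.near hp) (lt_add_one _)
  have hg2 := g2.dirDeriv (hv.near hp) (lt_add_one _)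
  set K := ‖α p.1‖ + 1 with hK
  have hK0 : 0 ≤ K := by positivity
  have hR := le_abs_self R
  have hR' := abs_nonneg R
  refine ⟨(dirDeriv v fun q => α q.1) * expBase α, ?_, (hd2 (|R| + K)).mul (h1 (|R| + 1)) hg2 g1
    (by linarith) (by linarith) (by linarith)⟩
  refine ((rep_hbar (R := |R| + K + 1)).mul (hd1 |R|) Grow.hbar hg1 (N := R) (by linarith)
    (by linarith) (by linarith)).congr ?_
  filter_upwards [(continuous_fst.continuousAt (x := p)).eventually hev] with q hq hz
  simp only [Pi.mul_apply]
  rw [dirDeriv_expBase hq]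
  field_simp

end Exponential

end HbarConn

namespace HbarConn

/-! ### Generators over `O^{se,Λ0}`. -/

section LocalFrame

variable {E : Type*} [NormedAddCommGroup E] [NormedSpace ℂ E] [FiniteDimensional ℂ E]
  {M : Type*} [TopologicalSpace M] [ChartedSpace E M] [IsManifold 𝓘(ℂ, E) ω M]
  {S : Opens RealBlowup} [DualNontrivial S] {𝓔 : RankOneConnection E M S} {i i₀ : 𝓔.ι}
  {x₀ : M} {p : M × RealBlowup} {U : Opens M} {T : Opens RealBlowup} {α : M → ℂ}

theorem pullback_mul_eq_one {V : Opens (PUnit.{1} × RealBlowup)} {W : Opens (M × RealBlowup)}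
    (hV : ∀ q ∈ W, (PUnit.unit, q.2) ∈ V) {a a' : OLam PUnit.{1} S V} (haa' : a * a' = 1)
    {b b' : OLam E S W}
    (hb : ∀ p ∈ W, p.2 ∈ S → ∀ R f, Rep R (PUnit.unit, p.2) a f → Rep R p b (ofPoint f))
    (hb' : ∀ p ∈ W, p.2 ∈ S → ∀ R f, Rep R (PUnit.unit, p.2) a' f → Rep R p b' (ofPoint f)) :
    b * b' = 1 := by
  refine eq_of_rep fun p hp hS hz R => ⟨1, ?_, rep_one⟩
  obtain ⟨K, hK, h1⟩ := exists_growth a (hV p hp) hS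
  obtain ⟨K', hK', h1'⟩ := exists_growth a' (hV p hp) hS
  have hR := le_abs_self R
  have hR' := abs_nonneg R
  obtain ⟨u, hu⟩ := exists_rep a (hV p hp) hS (|R| + K + K')
  obtain ⟨u', hu'⟩ := exists_rep a' (hV p hp) hS (|R| + K + K')
  have g := h1 _ (by linarith) u hu
  have g' := h1' _ (by linarith) u' hu'
  have h2 := hu.mul hu' g g' (N := R) (by linarith) (by linarith) (by linarith)
  rw [haa'] at h2
  have h3 : Grow E (-R) p (ofPoint u * ofPoint u' - 1 : M × ℂ → ℂ) :=
    (h2.sub_grow rep_one (hV p hp) hS).ofPoint (x := p.1)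
  exact ((hb p hp hS _ u hu).mul (hb' p hp hS _ u' hu') (g.ofPoint (x := p.1))
    (g'.ofPoint (x := p.1)) (N := R) (by linarith) (by linarith) (by linarith)).of_grow h3

theorem pullback_grow {V : Opens (PUnit.{1} × RealBlowup)} {W : Opens (M × RealBlowup)}
    (hV : ∀ q ∈ W, (PUnit.unit, q.2) ∈ V) {a : OLam PUnit.{1} S V} (ha : a ∈ Ose PUnit.{1} S V)
    {b : OLam E S W}
    (hb : ∀ p ∈ W, p.2 ∈ S → ∀ R f, Rep R (PUnit.unit, p.2) a f → Rep R p b (ofPoint f))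
    (hp : p ∈ W) (hS : p.2 ∈ S) (R : ℝ) : ∃ f, Rep R p b f ∧ ∀ ε > 0, Grow E ε p f := by
  obtain ⟨u, hu⟩ := exists_rep a (hV p hp) hS (max R 0)
  refine ⟨_, (hb p hp hS _ u hu).mono (le_max_left _ _), fun ε hε => ?_⟩
  exact (Rep.grow_of_mem_Ose ha (hu.mono (le_max_right _ _)) (hV p hp) hS hε).ofPoint (x := p.1)

/-- For a solution `ψ` whose value at `x₀` is a frame, the coordinates of `e^{α/ħ} ψ` are units of the
ring of subexponential sections. -/
theorem exists_local_unit [SimplyConnectedSpace U] (hx₀ : x₀ ∈ U) (hT : T ≤ S)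
    (hα : ∀ x ∈ U, MDifferentiableAt 𝓘(ℂ, E) 𝓘(ℂ, ℂ) α x)
    (hc : ∀ η ∈ 𝓔.charVariety, η.1 ∈ U → η.2 = mfderiv 𝓘(ℂ, E) 𝓘(ℂ, ℂ) α η.1)
    (h0 : α x₀ = 0) {ψ : 𝓔.Sec (prodOpen U T)} (hψ : ψ.IsSol) (hframe : (ψ.eval x₀).IsFrame)
    (hα' : HolOn (E := E) α (prodOpen U T))
    (hp : p ∈ prodOpen U T ⊓ 𝓔.dom i) (hS : p.2 ∈ S) :
    ∃ (V : Opens (M × RealBlowup)) (hV : V ≤ prodOpen U T ⊓ 𝓔.dom i), p ∈ V ∧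
      res hV (res inf_le_left (expSection α hα') * ψ.comp i) ∈ Ose E S V ∧
      ∃ b ∈ Ose E S V, res hV (res inf_le_left (expSection α hα') * ψ.comp i) * b = 1 := by
  obtain ⟨j, hj⟩ := 𝓔.cover (x₀, p.2) hS
  obtain ⟨he, c, hc', hec⟩ := hframe j
  set T' : Opens RealBlowup := T ⊓ Opens.comap ⟨fun σ => (x₀, σ), by fun_prop⟩ (𝓔.dom j) with hT'
  have hTj : ∀ σ ∈ T', (x₀, σ) ∈ 𝓔.dom j := fun σ hσ => hσ.2
  have hTS : T' ≤ S := inf_le_left.trans hT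
  have hle : prodOpen U T' ≤ prodOpen U T := fun q hq => ⟨hq.1, hq.2.1⟩
  obtain ⟨ε, ε', b, ψ', hε, hb, hψb, hsol, heval⟩ :=
    exists_isSol_of_frame hx₀ hTS hTj ((ψ.eval x₀).restrict hle)
  have hψ' : ψ.restrict hle = ψ' := isSol_unique hx₀ hTS (hψ.restrict hle) hsol
    (by rw [heval, RankOneConnection.Sec.eval_restrict])
  have hsl : ∀ q ∈ prodOpen U T', (PUnit.unit, q.2) ∈ slice x₀ (prodOpen U T' ⊓ 𝓔.dom j) :=
    fun q hq => ⟨⟨hx₀, hq.2⟩, hTj _ hq.2⟩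
  have hsle : slice x₀ (prodOpen U T' ⊓ 𝓔.dom j) ≤ slice x₀ (prodOpen U T ⊓ 𝓔.dom j) :=
    slice_mono x₀ (inf_le_inf_right _ hle)
  obtain ⟨b', hb'⟩ := exists_pullback (E := E) (W := prodOpen U T') hsl (res hsle c)
  have hbb' : b * b' = 1 := pullback_mul_eq_one hsl (a := ((ψ.eval x₀).restrict hle).comp j)
    (a' := res hsle c) (by
      change res hsle ((ψ.eval x₀).comp j) * res hsle c = 1
      rw [← map_mul, hec, map_one]) hb hb'
  set V := prodOpen U T' ⊓ 𝓔.dom i with hV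
  have hVW : V ≤ prodOpen U T ⊓ 𝓔.dom i := inf_le_inf_right _ hle
  have hVT : V ≤ prodOpen U T' := inf_le_left
  have hVα : HolOn (E := E) α V := fun q hq => hα q.1 hq.1.1
  -- Here `e^{α/ħ}` times the fundamental coordinate is subexponential by `Good.subExp`, and `b` is
  -- because the initial value is a frame; the inverse has the corresponding three factors.
  have hres : res hVW (res inf_le_left (expSection α hα') * ψ.comp i) =
      expSection α hVα * (ε.comp i * res hVT b) := by
    have h1 := congrArg (fun χ => χ.comp i) hψ'
    rw [map_mul, ← hψb i, ← h1]
    rfl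
  have key : ∀ q ∈ V, q.2 ∈ S → q.2.z = 0 → ∃ K, 0 ≤ K ∧ ∀ R, ∃ e, Rep R q (ε.comp i) e ∧
      Rep R q (ε' i) e⁻¹ ∧ Grow E K q e ∧ Grow E K q e⁻¹ ∧ SubExp E q (expBase α * e) := by
    intro q hq hqS hz
    obtain ⟨K, hK, h1⟩ := hε.exists_good_rep hx₀ hTS hq hz
    refine ⟨K, hK, fun R => ?_⟩
    obtain ⟨N, e, -, hN, he, g1, g2, r1, r2⟩ := h1 R
    exact ⟨e, r1, r2, g1, g2, he.subExp hN hz hqS hx₀ (hTj _ hq.1.2) hq.1.1 hq.2 hα hc h0⟩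
  refine ⟨V, hVW, ⟨⟨hp.1.1, hp.1.2, hj⟩, hp.2⟩, ?_,
    expSection (-α) hVα.neg * (ε' i * res hVT b'), ?_, ?_⟩
  · rw [hres]
    refine mem_Ose_of_base fun q hq hqS hz δ hδ => ?_
    obtain ⟨K, hK, h1⟩ := key q hq hqS hz
    refine exists_rep_mul₃ (A := expBase α) (K := ‖α q.1‖ + 1) (L := K) (fun R => rep_ofFun)
      (by positivity) (Grow.expBase (eventually_base hVα hq)) hK (fun R => ?_) (fun R => ?_) hδ
    · obtain ⟨e, r1, r2, g1, g2, hs⟩ := h1 R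
      exact ⟨e, r1, g1, fun δ hδ => (hs δ hδ).1⟩
    · obtain ⟨f, hf, hf'⟩ := pullback_grow hsl (res_mem_Ose hsle he) hb (hVT hq) hqS R
      exact ⟨f, hf.res hVT, hf'⟩
  · refine mem_Ose_of_base fun q hq hqS hz δ hδ => ?_
    obtain ⟨K, hK, h1⟩ := key q hq hqS hz
    refine exists_rep_mul₃ (A := expBase (-α)) (K := ‖(-α) q.1‖ + 1) (L := K) (fun R => rep_ofFun)
      (by positivity) (Grow.expBase (eventually_base hVα.neg hq)) hK (fun R => ?_) (fun R => ?_) hδ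
    · obtain ⟨e, r1, r2, g1, g2, hs⟩ := h1 R
      refine ⟨e⁻¹, r2, g2, fun δ hδ => ?_⟩
      rw [← expBase_inv, ← mul_inv]
      exact (hs δ hδ).2
    · obtain ⟨f, hf, hf'⟩ := pullback_grow hsl (res_mem_Ose hsle hc') hb' (hVT hq) hqS R
      exact ⟨f, hf.res hVT, hf'⟩
  · rw [hres]
    have e1 := expSection_mul_neg (S := S) hVα
    have e2 := hε.mul_inv hx₀ hTS i
    have e3 := congrArg (res hVT) hbb'
    rw [map_mul, map_one] at e3
    calc _ = (expSection α hVα * expSection (-α) hVα.neg) * (ε.comp i * ε' i) *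
          (res hVT b * res hVT b') := by ring
      _ = 1 := by rw [e1, e2, e3]; ring

/-- Inverses are unique, so local ones glue. -/
theorem exists_inv_mem_Ose {W : Opens (M × RealBlowup)} {a : OLam E S W}
    (h : ∀ p ∈ W, p.2 ∈ S → ∃ (V : Opens (M × RealBlowup)) (hV : V ≤ W), p ∈ V ∧
      ∃ b ∈ Ose E S V, res hV a * b = 1) : ∃ b ∈ Ose E S W, a * b = 1 := by
  choose V hV hp b hb hab using fun p : {p : M × RealBlowup // p ∈ W ∧ p.2 ∈ S} => h p p.2.1 p.2.2
  obtain ⟨c, hc⟩ := exists_glue (W := W) V hV (fun p hpW hS => ⟨⟨p, hpW, hS⟩, hp _⟩) b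
    fun k l => by
      have h1 := congrArg (res (inf_le_left (b := V l))) (hab k)
      have h2 := congrArg (res (inf_le_right (a := V k))) (hab l)
      rw [map_mul, map_one, res_res] at h1 h2
      linear_combination (-res inf_le_left (b k)) * h2 + res inf_le_right (b l) * h1
  refine ⟨c, mem_Ose_of_res fun p hpW hS _ => ⟨_, hV ⟨p, hpW, hS⟩, hp _, ?_⟩,
    eq_of_res fun p hpW hS _ => ⟨_, hV ⟨p, hpW, hS⟩, hp _, ?_⟩⟩
  · rw [hc]
    exact hb _
  · rw [map_mul, hc, map_one]
    exact hab _

end LocalFrame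

/-! ### The isomorphism with `E^{α/ħ}`. -/

section Isomorphism

variable {E : Type*} [NormedAddCommGroup E] [NormedSpace ℂ E] [FiniteDimensional ℂ E]
  {M : Type*} [TopologicalSpace M] [ChartedSpace E M] [IsManifold 𝓘(ℂ, E) ω M]
  {S : Opens RealBlowup} {𝓔 : RankOneConnection E M S} {x₀ : M} {U : Opens M}
  {T : Opens RealBlowup} {α : M → ℂ} {W₀ W : Opens (M × RealBlowup)}

/-- Multiplication of a section by a scalar. -/
noncomputable def RankOneConnection.Sec.smul (a : OLam E S W) (ψ : 𝓔.Sec W) : 𝓔.Sec W where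
  comp i := res inf_le_left a * ψ.comp i
  compat i j := by
    rw [map_mul, map_mul, ψ.compat i j, res_res, res_res]
    ring

theorem RankOneConnection.Sec.smul_comp (a : OLam E S W) (ψ : 𝓔.Sec W) (i : 𝓔.ι) :
    (ψ.smul a).comp i = res inf_le_left a * ψ.comp i := rfl

theorem RankOneConnection.Sec.restrict_comp (χ : 𝓔.Sec W₀) (h : W ≤ W₀) (i : 𝓔.ι) :
    (χ.restrict h).comp i = res (inf_le_inf_right _ h) (χ.comp i) := rfl

theorem RankOneConnection.Sec.smul_left_injective [DualNontrivial S] (χ : 𝓔.Sec W)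
    {b : ∀ i, OLam E S (W ⊓ 𝓔.dom i)} (hb : ∀ i, χ.comp i * b i = 1) {a a' : OLam E S W}
    (h : χ.smul a = χ.smul a') : a = a' := by
  refine eq_of_res fun p hp hS _ => ?_
  obtain ⟨i, hi⟩ := 𝓔.cover p hS
  refine ⟨W ⊓ 𝓔.dom i, inf_le_left, ⟨hp, hi⟩, ?_⟩
  have h1 : res inf_le_left a * χ.comp i = res inf_le_left a' * χ.comp i :=
    congrArg (fun ψ => ψ.comp i) h
  linear_combination b i * h1 + (res inf_le_left a' - res inf_le_left a) * hb i

theorem RankOneConnection.Sec.exists_smul_eq [DualNontrivial S] (χ : 𝓔.Sec W)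
    {b : ∀ i, OLam E S (W ⊓ 𝓔.dom i)} (hb : ∀ i, χ.comp i * b i = 1)
    (hbm : ∀ i, b i ∈ Ose E S (W ⊓ 𝓔.dom i)) (ψ : 𝓔.Sec W)
    (hψ : ∀ i, ψ.comp i ∈ Ose E S (W ⊓ 𝓔.dom i)) : ∃ a ∈ Ose E S W, χ.smul a = ψ := by
  obtain ⟨a, ha⟩ := χ.exists_scalar hb ψ
  refine ⟨a, mem_Ose_of_res fun p hp hS _ => ?_, RankOneConnection.Sec.ext (funext fun i => ?_)⟩
  · obtain ⟨i, hi⟩ := 𝓔.cover p hS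
    refine ⟨W ⊓ 𝓔.dom i, inf_le_left, ⟨hp, hi⟩, ?_⟩
    rw [(ha i).2]
    exact mul_mem (hbm i) (hψ i)
  · rw [(ha i).1, smul_comp, mul_comm]

/-- If `∇ χ = dα χ`, Leibniz gives `∇ (a χ) = (ħ da + dα a) χ`, so multiplication by `χ` intertwines
the two `ħ`-connections. -/
theorem RankOneConnection.Sec.nabla_smul [DualNontrivial S] (hα : HolOn (E := E) α W)
    (χ : 𝓔.Sec W) {v : ∀ x : M, TangentSpace 𝓘(ℂ, E) x} (hv : HolVF v W) (i : 𝓔.ι)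
    (h : (𝓔.form i).nabla inf_le_right v (hv.mono inf_le_left) (χ.comp i) =
      vfDeriv v (hv.mono inf_le_left) (ofHol α (fun q hq => hα q hq.1)) * χ.comp i)
    (a : OLam E S W) :
    (χ.smul (hbar * vfDeriv v hv a + vfDeriv v hv (ofHol α hα) * a)).comp i =
      (𝓔.form i).nabla inf_le_right v (hv.mono inf_le_left) ((χ.smul a).comp i) := by
  have h2 := vfDeriv_mul (hv.mono inf_le_left) (res (inf_le_left (b := 𝓔.dom i)) a) (χ.comp i)
  have h3 := vfDeriv_res hv (inf_le_left (b := 𝓔.dom i)) a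
  have h4 := vfDeriv_res hv (inf_le_left (b := 𝓔.dom i)) (ofHol (S := S) α hα)
  have h5 : res inf_le_left (ofHol (S := S) α hα) =
    (ofHol α (fun q hq => hα q hq.1) : OLam E S (W ⊓ 𝓔.dom i)) := rfl
  have h6 : res inf_le_left (hbar : OLam E S W) = (hbar : OLam E S (W ⊓ 𝓔.dom i)) := rfl
  simp only [OneForm.nabla, smul_comp] at h ⊢
  rw [RingHom.map_add, map_mul, map_mul, h2, h3, ← h4, h5, h6]
  linear_combination (-res inf_le_left a) * h

/-- The isomorphism given by a generator `χ` with `∇ χ = dα χ`. -/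
theorem nonempty_expIso_of_generator [DualNontrivial S] (hα : HolOn (E := E) α W₀)
    (χ : 𝓔.Sec W₀) (hχ : ∀ i, χ.comp i ∈ Ose E S (W₀ ⊓ 𝓔.dom i))
    (hinv : ∀ i, ∃ b ∈ Ose E S (W₀ ⊓ 𝓔.dom i), χ.comp i * b = 1)
    (hnabla : ∀ i W (h : W ≤ W₀ ⊓ 𝓔.dom i) v (hv : HolVF v W),
      (𝓔.form i).nabla (h.trans inf_le_right) v hv (res h (χ.comp i)) =
        vfDeriv v hv (ofHol α (fun q hq => hα q (h hq).1)) * res h (χ.comp i)) :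
    Nonempty (ExpIso 𝓔 α W₀ hα) := by
  choose b hb hχb using hinv
  have hχb' : ∀ {W} (h : W ≤ W₀) i, (χ.restrict h).comp i *
      res (inf_le_inf_right (𝓔.dom i) h) (b i) = 1 := fun h i => by
    rw [RankOneConnection.Sec.restrict_comp, ← map_mul, hχb, map_one]
  refine ⟨{
    app := fun W h a => (χ.restrict h).smul a.1
    app_mem := fun W h a i => mul_mem (res_mem_Ose _ a.2) (res_mem_Ose _ (hχ i))
    injective := fun W h a a' haa' =>
      Subtype.ext ((χ.restrict h).smul_left_injective (hχb' h) haa')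
    surjective := fun W h ψ hψ => ?_
    app_res := fun W h W' h' a i => ?_
    app_add := fun W h a a' i => ?_
    app_mul := fun W h a a' i => ?_
    app_nabla := fun W h v hv a i => ?_ }⟩
  · obtain ⟨a, ha, hψ'⟩ := (χ.restrict h).exists_smul_eq (hχb' h) (fun i => res_mem_Ose _ (hb i)) ψ hψ
    exact ⟨⟨a, ha⟩, hψ'⟩
  · simp only [RankOneConnection.Sec.smul_comp, RankOneConnection.Sec.restrict_comp, map_mul,
      res_res]
  · simp only [RankOneConnection.Sec.smul_comp]
    exact (congrArg (· * _) (RingHom.map_add (res inf_le_left) a.1 a'.1)).trans (add_mul _ _ _)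
  · simp only [RankOneConnection.Sec.smul_comp]
    exact (congrArg (· * _) (RingHom.map_mul (res inf_le_left) a.1 a'.1)).trans (mul_assoc _ _ _)
  · exact (χ.restrict h).nabla_smul (fun q hq => hα q (h hq)) hv i
      (hnabla i _ (inf_le_inf_right _ h) v (hv.mono inf_le_left)) a.1

theorem hasMFDerivAt_sub_const {α : M → ℂ} {x : M} (hα : MDifferentiableAt 𝓘(ℂ, E) 𝓘(ℂ, ℂ) α x)
    (c : ℂ) : HasMFDerivAt 𝓘(ℂ, E) 𝓘(ℂ, ℂ) (fun y => α y - c) x (mfderiv 𝓘(ℂ, E) 𝓘(ℂ, ℂ) α x) := by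
  refine ⟨hα.continuousAt.sub continuousAt_const, ?_⟩
  have h := hα.hasMFDerivAt.2.sub_const c
  exact h

/-- The connection `ħ d + dα` depends only on `dα`, so the same maps serve for both functions. -/
theorem nonempty_expIso_of_sub_const [DualNontrivial S] (c : ℂ) (hα : HolOn (E := E) α W₀)
    (hα' : HolOn (E := E) (fun x => α x - c) W₀)
    (hI : Nonempty (ExpIso 𝓔 (fun x => α x - c) W₀ hα')) : Nonempty (ExpIso 𝓔 α W₀ hα) := by
  obtain ⟨I⟩ := hI
  have key : ∀ W (hW : W ≤ W₀) v (hv : HolVF v W) (a : Ose E S W),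
      nablaExp α (fun q hq => hα q (hW hq)) v hv a =
        nablaExp (fun x => α x - c) (fun q hq => hα' q (hW hq)) v hv a := by
    intro W hW v hv a
    have h1 : (vfDeriv v hv (ofHol α (fun q hq => hα q (hW hq))) : OLam E S W) =
        vfDeriv v hv (ofHol (fun x => α x - c) (fun q hq => hα' q (hW hq))) := by
      refine eq_of_rep fun p hp hS hz R => ?_
      refine ⟨_, rep_ofHol.vfDeriv hv hp hS (lt_add_one R),
        (rep_ofHol.vfDeriv hv hp hS (lt_add_one R)).congr ?_⟩
      filter_upwards [(continuous_fst.continuousAt (x := p)).eventually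
        (eventually_base (fun q hq => hα q (hW hq)) hp)] with q hq _
      exact congrArg (fun L : TangentSpace 𝓘(ℂ, E) q.1 →L[ℂ] ℂ => L (v q.1))
        (hasMFDerivAt_sub_const hq c).mfderiv.symm
    exact Subtype.ext (by simp only [nablaExp]; rw [h1])
  have hn : ∀ W h v (hv : HolVF v W) a i,
      (I.app W h (nablaExp α (fun q hq => hα q (h hq)) v hv a)).comp i =
        (𝓔.form i).nabla inf_le_right v (hv.mono inf_le_left) ((I.app W h a).comp i) := by
    intro W h v hv a i
    rw [key W h v hv a]
    exact I.app_nabla W h v hv a i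
  exact ⟨{ I with app_nabla := hn }⟩

theorem nonempty_expIso_of_subsingleton (h : ¬ DualNontrivial S) (hα : HolOn (E := E) α W₀) :
    Nonempty (ExpIso 𝓔 α W₀ hα) := by
  have := fun W : Opens (M × RealBlowup) => Subsingleton.OLam (E := E) h W
  have hsec : ∀ W, Subsingleton (𝓔.Sec W) := fun W =>
    ⟨fun ψ ψ' => RankOneConnection.Sec.ext (funext fun i => Subsingleton.elim _ _)⟩
  have hmem : ∀ (W : Opens (M × RealBlowup)) (a : OLam E S W), a ∈ Ose E S W := fun W a => by
    rw [Subsingleton.elim a 0]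
    exact zero_mem _
  exact ⟨⟨fun W _ _ => ⟨fun _ => 0, fun _ _ => Subsingleton.elim _ _⟩, fun _ _ _ _ => hmem _ _,
    fun W _ a a' _ => Subtype.ext (Subsingleton.elim _ _),
    fun W _ ψ _ => ⟨0, (hsec W).elim _ _⟩, fun _ _ _ _ _ _ => Subsingleton.elim _ _,
    fun _ _ _ _ _ => Subsingleton.elim _ _, fun _ _ _ _ _ => Subsingleton.elim _ _,
    fun _ _ _ _ _ _ => Subsingleton.elim _ _⟩⟩

/-- For the solution `ψ` with value `e` at `x₀`, the section `e^{α/ħ} ψ` is a local, hence global,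
generator, and `∇ ψ = 0` leaves only the derivative of the exponential. -/
theorem nonempty_expIso_of_isFrame [DualNontrivial S] [SimplyConnectedSpace U] (hx₀ : x₀ ∈ U)
    (hT : T ≤ S) (hα : ∀ x ∈ U, MDifferentiableAt 𝓘(ℂ, E) 𝓘(ℂ, ℂ) α x)
    (hc : ∀ η ∈ 𝓔.charVariety, η.1 ∈ U → η.2 = mfderiv 𝓘(ℂ, E) 𝓘(ℂ, ℂ) α η.1)
    {e : 𝓔.Fibre x₀ (prodOpen U T)} (he : e.IsFrame) (h0 : α x₀ = 0) :
    Nonempty (ExpIso 𝓔 α (prodOpen U T) fun q hq => hα q.1 hq.1) := by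
  have hα' : HolOn (E := E) α (prodOpen U T) := fun q hq => hα q.1 hq.1
  obtain ⟨ψ, ⟨hψ, rfl⟩, -⟩ := existsUnique_isSol hx₀ hT e
  have hloc := fun i p (hp : p ∈ prodOpen U T ⊓ 𝓔.dom i) hS =>
    exists_local_unit hx₀ hT hα hc h0 hψ he hα' hp hS
  refine nonempty_expIso_of_generator hα' (ψ.smul (expSection α hα')) (fun i => ?_) (fun i => ?_)
    fun i W h v hv => ?_
  · refine mem_Ose_of_res fun p hp hS _ => ?_
    obtain ⟨V, hV, hpV, h1, -⟩ := hloc i p hp hS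
    exact ⟨V, hV, hpV, h1⟩
  · refine exists_inv_mem_Ose fun p hp hS => ?_
    obtain ⟨V, hV, hpV, -, h1⟩ := hloc i p hp hS
    exact ⟨V, hV, hpV, h1⟩
  · have hW : HolOn (E := E) α W := fun q hq => hα' q (h hq).1
    have h1 := hψ i W h v hv
    have h2 := hbar_mul_vfDeriv_expSection (S := S) hW hv
    have h3 : res h ((ψ.smul (expSection α hα')).comp i) = expSection α hW * res h (ψ.comp i) := by
      change res h (res inf_le_left (expSection α hα') * ψ.comp i) = _
      rw [map_mul, res_res]
      rfl
    simp only [OneForm.nabla] at h1 ⊢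
    rw [h3, vfDeriv_mul]
    linear_combination expSection α hW * h1 + res h (ψ.comp i) * h2

end Isomorphism

end HbarConn

/-! ### The degenerate case and the theorem. -/

namespace HbarConn

theorem existsUnique_isSol_of_subsingleton {E : Type*} [NormedAddCommGroup E] [NormedSpace ℂ E]
    [FiniteDimensional ℂ E] {M : Type*} [TopologicalSpace M] [ChartedSpace E M]
    [IsManifold 𝓘(ℂ, E) ω M] {S : Opens RealBlowup} (h : ¬ DualNontrivial S)
    {𝓔 : RankOneConnection E M S} {x₀ : M} {W : Opens (M × RealBlowup)} (e : 𝓔.Fibre x₀ W) :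
    ∃! ψ : 𝓔.Sec W, ψ.IsSol ∧ ψ.eval x₀ = e := by
  have := fun W : Opens (M × RealBlowup) => Subsingleton.OLam (E := E) h W
  have := fun W : Opens (PUnit.{1} × RealBlowup) => Subsingleton.OLam (E := PUnit.{1}) h W
  exact ⟨⟨fun _ => 0, fun _ _ => Subsingleton.elim _ _⟩,
    ⟨fun _ _ _ _ _ => Subsingleton.elim _ _,
      RankOneConnection.Fibre.ext (funext fun _ => Subsingleton.elim _ _)⟩,
    fun _ _ => RankOneConnection.Sec.ext (funext fun _ => Subsingleton.elim _ _)⟩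

end HbarConn

theorem mainTheorem7 {E : Type*} [NormedAddCommGroup E] [NormedSpace ℂ E] [FiniteDimensional ℂ E]
    {M : Type*} [TopologicalSpace M] [T2Space M] [ChartedSpace E M] [IsManifold 𝓘(ℂ, E) ω M]
    (S : Opens HbarConn.RealBlowup) (𝓔 : HbarConn.RankOneConnection E M S)
    (U : Opens M) [SimplyConnectedSpace U] :
    (∀ S' : Opens HbarConn.RealBlowup, S' ≤ S → ∀ x₀ ∈ U, ∀ e : 𝓔.Fibre x₀ (HbarConn.prodOpen U S'),
      ∃! ψ : 𝓔.Sec (HbarConn.prodOpen U S'), ψ.IsSol ∧ ψ.eval x₀ = e) ∧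
    (∀ α : M → ℂ, ∀ hα : ∀ x ∈ U, MDifferentiableAt 𝓘(ℂ, E) 𝓘(ℂ, ℂ) α x,
      (∀ η ∈ 𝓔.charVariety, η.1 ∈ U → η.2 = mfderiv 𝓘(ℂ, E) 𝓘(ℂ, ℂ) α η.1) →
      ∀ S' : Opens HbarConn.RealBlowup, S' ≤ S → ∀ x₀ ∈ U,
        (∃ e : 𝓔.Fibre x₀ (HbarConn.prodOpen U S'), e.IsFrame) →
        Nonempty (HbarConn.ExpIso 𝓔 α (HbarConn.prodOpen U S') fun q hq => hα q.1 hq.1)) := by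
  -- Without a nonzero element in the polar dual all rings `O^Λ` are zero and everything holds
  -- trivially.
  by_cases hD : HbarConn.DualNontrivial S
  · refine ⟨fun S' hS' x₀ hx₀ e => HbarConn.existsUnique_isSol hx₀ hS' e,
      fun α hα hc S' hS' x₀ hx₀ ⟨e, he⟩ => ?_⟩
    -- Subtracting `α x₀` makes the primitive vanish at the base point without changing `dα`;
    -- otherwise `e^{α/ħ}` would not be subexponential at `x₀`.
    have hd : ∀ x ∈ U, HasMFDerivAt 𝓘(ℂ, E) 𝓘(ℂ, ℂ) (fun y => α y - α x₀) x
        (mfderiv 𝓘(ℂ, E) 𝓘(ℂ, ℂ) α x) := fun x hx =>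
      HbarConn.hasMFDerivAt_sub_const (hα x hx) (α x₀)
    exact HbarConn.nonempty_expIso_of_sub_const (α x₀) _ _
      (HbarConn.nonempty_expIso_of_isFrame hx₀ hS' (fun x hx => (hd x hx).mdifferentiableAt)
        (fun η hη hηU => (hc η hη hηU).trans (hd η.1 hηU).mfderiv.symm) he (sub_self _))
  · exact ⟨fun _ _ _ _ e => HbarConn.existsUnique_isSol_of_subsingleton hD e,
      fun _ _ _ _ _ _ _ _ => HbarConn.nonempty_expIso_of_subsingleton hD _⟩
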